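/- Notation. Identify $\mathbb R^2$ with $\mathbb C$, write $e(x)=(\cos x,\sin x)$, $e^\perp(x)=(-\sin x,\cos x)$, and $\frac{1}{2\pi}\int_0^{2\pi}$ for means. Let $1<\alpha<2$, $N\ge 1$, $k\ge 3$, $b_1,\dots,b_N>0$, $C_\alpha=\frac{\Gamma(\alpha/2)}{2^{1-\alpha}\Gamma(1-\alpha/2)}$, $\widehat C_\alpha=\alpha C_\alpha$. For $\lambda=(w_{1},\dots,w_{N},\gamma_1,\dots,\gamma_N,\Omega,U)\in\mathbb R^{3N+2}$ with $w_i\in\mathbb R^2$, $\gamma_i,\Omega,U\in\mathbb R$, let $$\mathcal P_i^\alpha(\lambda)=\Omega w_i+(U,0)-\frac{\widehat C_\alpha}{2}\sum_{j\ne i}\gamma_j\frac{w_i-w_j}{|w_i-w_j|^{\alpha+2}}\in\mathbb R^2 .$$ Let $\lambda^*$ satisfy $\mathcal P^\alpha(\lambda^*)=0$, with distinct $w_i$, all $\gamma_i\neq 0$, and $\Omega\ne0$ or $U\neq0$. Assume $\lambda^*$ is non-degenerate: after a reordering of the components, $\lambda=(\lambda_1,\lambda_2)$ with $\lambda_1\in\mathbb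 R^{2N-1}$ and $\operatorname{codim}\operatorname{ran}D_{\lambda_1}\mathcal P^\alpha(\lambda^*)=1$ in $\mathbb R^{2N}$. Let $X^{k+\alpha-1}$ be the space of $f=\sum_{n\ge2}(a_n\cos nx+d_n\sin nx)\in H^k(\mathbb T)$ with finite norm $$\|f\|_{H^k}+\Big\|\int_0^{2\pi}\frac{\partial^kf(\cdot-y)-\partial^kf(\cdot)}{|\sin(y/2)|^\alpha}\,dy\Big\|_{L^2},$$ where the integral denotes the operator multiplying $\cos nx$ and $\sin nx$ (in the expansion of $\partial^k f$) by $-\int_0^{2\pi}(1-\cos ny)|\sin(y/2)|^{-\alpha}dy$. Let $\mathcal B_X$ be the open unit ball of $(X^{k+\alpha-1})^N$. For $f=(f_1,\dots,f_N)$ put $R_i(x)=1+\varepsilon|\varepsilon|^\alpha b_i^{1+\alpha}f_i(x)$, $z_i(x)=w_i+\varepsilon b_iR_i(x)e(x)$, and $$n_{ij}(x,y)=\big(R_i(x)R_j(y)+R_i'(x)R_j'(y)\big)\sin(x-y)+\big(R_i(x)R_j'(y)-R_i'(x)R_j(y)\big)\cos(x-y).$$ For $\varepsilon\neq0$ let $\mathcal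 F_i^\alpha(\varepsilon,f,\lambda)(x)$ be $$\Omega\big[\varepsilon b_iR_iR_i'+w_i\cdot(R_ie)'\big](x)+(U,0)\cdot(R_ie)'(x) +\frac{C_\alpha\gamma_i}{\varepsilon|\varepsilon|^\alpha b_i^{1+\alpha}}\frac1{2\pi}\int_0^{2\pi}\frac{n_{ii}(x,y)\,dy}{\big((R_i(x)-R_i(y))^2+4R_i(x)R_i(y)\sin^2\frac{x-y}2\big)^{\alpha/2}} +\sum_{j\ne i}\frac{C_\alpha\gamma_j}{\varepsilon b_j}\frac1{2\pi}\int_0^{2\pi}\frac{n_{ij}(x,y)\,dy}{|z_i(x)-z_j(y)|^\alpha}.$$ Its continuous extension to $\varepsilon=0$ is $$\mathcal F_i^\alpha(0,f,\lambda)(x)=\mathcal P_i^\alpha(\lambda)\cdot e^\perp(x)+\frac{C_\alpha\gamma_i}{2\pi}\int_0^{2\pi}\frac{(1-\frac\alpha2)f_i(x-y)\sin y-(f_i'(x)-f_i'(x-y))\cos y}{(4\sin^2\frac y2)^{\alpha/2}}\,dy .$$ Theorem. (i) There are $\varepsilon_1>0$ and a $C^1$ function $(f,\lambda_1):(-\varepsilon_1,\varepsilon_1)\to\mathcal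 B_X\times\mathbb R^{2N-1}$ with $(f,\lambda_1)(0)=(0,\lambda_1^*)$ and $$\mathcal F^\alpha\big(\varepsilon,f(\varepsilon),\lambda_1(\varepsilon),\lambda_2^*\big)=0\qquad\text{for }|\varepsilon|<\varepsilon_1 .$$ It is unique: every $C^1$ function with these properties on an interval $(-\delta,\delta)$, $0<\delta\le\varepsilon_1$, is its restriction. Moreover $\lambda_1(\varepsilon)=\lambda_1^*+O(\varepsilon)$ and, in the norm of $(X^{k+\alpha-1})^N$ as $\varepsilon\to0$, $$f_i(\varepsilon,x)=\varepsilon\, b_i\,\frac{\Xi_\alpha}{4}\sum_{j\neq i}\frac{\gamma_j}{\gamma_i}\,\frac{\operatorname{Re}\big(\overline{(w_j-w_i)^2}\,e^{2ix}\big)}{|w_j-w_i|^{\alpha+4}}+o(\varepsilon),\qquad \Xi_\alpha=\frac{(\alpha+2)\,\Gamma(1-\frac\alpha2)\,\Gamma(3-\frac\alpha2)}{\Gamma(2-\alpha)},$$ where $w_j,\gamma_j$ are the components of $\lambda^*$ and the squares $(w_j-w_i)^2$ are squares of complex numbers. (ii) For all $\varepsilon\in(-\varepsilon_1,\varepsilon_1)\setminus\{0\}$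 the functions $R_i$ are positive, the closed domains $\overline{\mathcal O_i^\varepsilon}=\{r\,e(x):0\le r\le R_i(x)\}$, bounded by the curves $R_ie$, are strictly convex, and the $N$ patches $w_i(\varepsilon)+\varepsilon b_i\overline{\mathcal O_i^\varepsilon}$ are pairwise disjoint. -/

import Mathlib

open Set Filter Topology Asymptotics

namespace GSQG

noncomputable section

/-! The plane `ℝ²` is identified with `ℂ`, so that `(cos x, sin x)` is `exp (i x)`, the
counterclockwise rotation by `π / 2` is multiplication by `i`, the vector `(U, 0)` is the real
number `U`, and the Euclidean inner product is `inner ℝ`. -/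

/-! ### Constants -/

/-- `C_α = Γ(α/2) / (2^(1-α) Γ((2-α)/2))`, the constant of the kernel
`K_α(x) = C_α / (2 π |x|^α)`. -/
def kernelConst (α : ℝ) : ℝ :=
  Real.Gamma (α / 2) / ((2 : ℝ) ^ (1 - α) * Real.Gamma ((2 - α) / 2))

/-- `Ξ_α = (α+2) Γ(1-α/2) Γ(3-α/2) / Γ(2-α)`. -/
def profileConst (α : ℝ) : ℝ :=
  (α + 2) * Real.Gamma (1 - α / 2) * Real.Gamma (3 - α / 2) / Real.Gamma (2 - α)

/-! ### The parameters of the point vortex problem -/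

/-- The names of the `3 N + 2` real components of
`λ = (w_11, …, w_N1, w_12, …, w_N2, γ_1, …, γ_N, Ω, U)`. -/
inductive Component (N : ℕ) : Type
  | posX (i : Fin N) : Component N
  | posY (i : Fin N) : Component N
  | strength (i : Fin N) : Component N
  | angularVelocity : Component N
  | speed : Component N

/-- A parameter vector `λ`. -/
abbrev Params (N : ℕ) : Type := Component N → ℝ

/-- The position `w_i` of the `i`-th vortex. -/
def Params.pos {N : ℕ} (lam : Params N) (i : Fin N) : ℂ :=
  ⟨lam (Component.posX i), lam (Component.posY i)⟩

/-- The strength `γ_i`; the circulation of the `i`-th vortex is `π γ_i`. -/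
def Params.strength {N : ℕ} (lam : Params N) (i : Fin N) : ℝ := lam (Component.strength i)

/-- The angular velocity `Ω`. -/
def Params.angularVelocity {N : ℕ} (lam : Params N) : ℝ := lam Component.angularVelocity

/-- The scalar speed `U`. -/
def Params.speed {N : ℕ} (lam : Params N) : ℝ := lam Component.speed

/-- A splitting `λ = (λ₁, λ₂)` after a reordering of the components is a set `S` of components,
those which make up `λ₁`. This is the sub-vector `λ₁` of `λ`. -/
def Params.first {N : ℕ} (lam : Params N) (S : Finset (Component N)) : S → ℝ :=
  fun c => lam c

open Classical in
/-- The parameter vector `(μ, λ₂)`: the components in `S` are given by `μ`, the others by `λ`. -/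
def Params.replace {N : ℕ} (lam : Params N) (S : Finset (Component N)) (μ : S → ℝ) : Params N :=
  fun c => if h : c ∈ S then μ ⟨c, h⟩ else lam c

/-- `P_i^α(λ) = Ω w_i + U - (α C_α / 2) ∑_{j ≠ i} γ_j (w_i - w_j) / |w_i - w_j|^(α+2)`,
with `U` standing for the vector `(U, 0)`. -/
def pointVortexMap {N : ℕ} (α : ℝ) (lam : Params N) (i : Fin N) : ℂ :=
  (lam.angularVelocity : ℂ) * lam.pos i + (lam.speed : ℂ)
    - ((α * kernelConst α / 2 : ℝ) : ℂ) *
      ∑ j ∈ Finset.univ.erase i,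
        ((lam.strength j / ‖lam.pos i - lam.pos j‖ ^ (α + 2) : ℝ) : ℂ) * (lam.pos i - lam.pos j)

/-- `λ` is a solution of the `N`-vortex problem: `N` vortices with distinct positions and non-zero
strengths, and `P^α(λ) = 0`. -/
structure IsVortexEquilibrium {N : ℕ} (α : ℝ) (lam : Params N) : Prop where
  pos_injective : Function.Injective lam.pos
  strength_ne_zero : ∀ i, lam.strength i ≠ 0
  map_eq_zero : ∀ i, pointVortexMap α lam i = 0

/-- Non-degeneracy of a rotating or traveling solution for the splitting `λ = (λ₁, λ₂)` given by
`S`: `λ₁` has `2 N - 1` components, and the range of `D_{λ₁} P^α(λ)` has codimension one in the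
real vector space `(ℝ²)^N`. -/
structure IsNondegenerate {N : ℕ} (α : ℝ) (lam : Params N) (S : Finset (Component N)) : Prop where
  card_eq : S.card + 1 = 2 * N
  codim_range_eq_one :
    Module.finrank ℝ ((Fin N → ℂ) ⧸
      (fderiv ℝ (fun μ : S → ℝ => pointVortexMap α (lam.replace S μ)) (lam.first S)).range) = 1

/-! ### The function space `X^{k+α-1}`

A function `f(x) = ∑_{n ≥ 2} (a_n cos (n x) + d_n sin (n x))` is given by its Fourier
coefficients, written as `c n = a_n + i d_n`. The `H^k` norm is
`(∑ (1+n²)^k |c n|²)^(1/2)`, and since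
`∫_0^{2π} (cos (n (x - y)) - cos (n x)) / |sin (y/2)|^α dy = - β_n cos (n x)`
with `β_n = ∫_0^{2π} (1 - cos (n y)) / |sin (y/2)|^α dy`, and likewise for the sine, the norm in
`L²(0, 2π)`, for the measure `dx / π`, of
`∫_0^{2π} (∂^k f (x - y) - ∂^k f (x)) / |sin (y/2)|^α dy` is `(∑ (n^k β_n)² |c n|²)^(1/2)`. -/

/-- `β_n = ∫_0^{2π} (1 - cos (n y)) / |sin (y/2)|^α dy`. -/
def singularSymbol (α : ℝ) (n : ℕ) : ℝ :=
  ∫ y in (0 : ℝ)..(2 * Real.pi), (1 - Real.cos (n * y)) / |Real.sin (y / 2)| ^ α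

/-- The weight of the `n`-th Fourier coefficient in the `H^k` norm. -/
def sobolevWeight (k n : ℕ) : ℝ := Real.sqrt ((1 + (n : ℝ) ^ 2) ^ k)

/-- The weight of the `n`-th Fourier coefficient in the singular integral seminorm. -/
def singularWeight (k : ℕ) (α : ℝ) (n : ℕ) : ℝ := (n : ℝ) ^ k * singularSymbol α n

/-- The sequences of Fourier coefficients of the elements of `X^{k+α-1}`. -/
def coeffSubmodule (k : ℕ) (α : ℝ) : Submodule ℝ (ℕ → ℂ) where
  carrier := {c | c 0 = 0 ∧ c 1 = 0 ∧ Memℓp (fun n => sobolevWeight k n • c n) 2 ∧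
    Memℓp (fun n => singularWeight k α n • c n) 2}
  zero_mem' := by
    refine ⟨rfl, rfl, ?_, ?_⟩
    · convert (zero_memℓp : Memℓp (0 : ℕ → ℂ) 2) using 1
      funext n; simp
    · convert (zero_memℓp : Memℓp (0 : ℕ → ℂ) 2) using 1
      funext n; simp
  add_mem' := by
    rintro c d ⟨hc0, hc1, hc2, hc3⟩ ⟨hd0, hd1, hd2, hd3⟩
    refine ⟨by simp [hc0, hd0], by simp [hc1, hd1], ?_, ?_⟩
    · convert hc2.add hd2 using 1
      funext n; exact smul_add _ _ _
    · convert hc3.add hd3 using 1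
      funext n; exact smul_add _ _ _
  smul_mem' := by
    rintro r c ⟨hc0, hc1, hc2, hc3⟩
    refine ⟨by simp [hc0], by simp [hc1], ?_, ?_⟩
    · convert hc2.const_smul r using 1
      funext n; exact smul_comm (sobolevWeight k n) r (c n)
    · convert hc3.const_smul r using 1
      funext n; exact smul_comm (singularWeight k α n) r (c n)

/-- The space `X^{k+α-1}`. -/
def XSpace (k : ℕ) (α : ℝ) : Type := coeffSubmodule k α

namespace XSpace

instance (k : ℕ) (α : ℝ) : AddCommGroup (XSpace k α) :=
  inferInstanceAs (AddCommGroup (coeffSubmodule k α))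

instance (k : ℕ) (α : ℝ) : Module ℝ (XSpace k α) :=
  inferInstanceAs (Module ℝ (coeffSubmodule k α))

/-- The Fourier coefficients `c n = a_n + i d_n`. -/
def coeff {k : ℕ} {α : ℝ} (f : XSpace k α) : ℕ → ℂ := f.1

/-- The two weighted sequences of Fourier coefficients, as elements of `ℓ²`. -/
def toWeighted (k : ℕ) (α : ℝ) :
    XSpace k α →ₗ[ℝ] WithLp 1 (lp (fun _ : ℕ => ℂ) 2 × lp (fun _ : ℕ => ℂ) 2) where
  toFun f := WithLp.toLp 1
    (⟨fun n => sobolevWeight k n • f.coeff n, f.2.2.2.1⟩,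
      ⟨fun n => singularWeight k α n • f.coeff n, f.2.2.2.2⟩)
  map_add' f g := by
    apply (WithLp.equiv 1 _).injective
    refine Prod.ext (lp.ext ?_) (lp.ext ?_)
    · funext n; exact smul_add (sobolevWeight k n) (f.coeff n) (g.coeff n)
    · funext n; exact smul_add (singularWeight k α n) (f.coeff n) (g.coeff n)
  map_smul' r f := by
    apply (WithLp.equiv 1 _).injective
    refine Prod.ext (lp.ext ?_) (lp.ext ?_)
    · funext n; exact smul_comm (sobolevWeight k n) r (f.coeff n)
    · funext n; exact smul_comm (singularWeight k α n) r (f.coeff n)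

theorem toWeighted_injective (k : ℕ) (α : ℝ) : Function.Injective (toWeighted k α) := by
  intro f g h
  have h1 := congrArg (fun z => (WithLp.ofLp z).1) h
  apply Subtype.ext
  funext n
  have h2 : sobolevWeight k n • f.coeff n = sobolevWeight k n • g.coeff n :=
    congrFun (congrArg Subtype.val h1) n
  have h3 : sobolevWeight k n ≠ 0 := by unfold sobolevWeight; positivity
  exact smul_right_injective ℂ h3 h2

/-- The norm of `X^{k+α-1}` is the sum of the `H^k` norm and the `L²` norm of the singular
integral. -/
instance (k : ℕ) (α : ℝ) : NormedAddCommGroup (XSpace k α) :=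
  NormedAddCommGroup.induced (XSpace k α) _ (toWeighted k α) (toWeighted_injective k α)

instance (k : ℕ) (α : ℝ) : NormedSpace ℝ (XSpace k α) :=
  NormedSpace.induced ℝ (XSpace k α) _ (toWeighted k α)

theorem norm_eq {k : ℕ} {α : ℝ} (f : XSpace k α) :
    ‖f‖ = Real.sqrt (∑' n : ℕ, (1 + (n : ℝ) ^ 2) ^ k * ‖f.coeff n‖ ^ 2) +
      Real.sqrt (∑' n : ℕ, ((n : ℝ) ^ k * singularSymbol α n) ^ 2 * ‖f.coeff n‖ ^ 2) := by
  have h0 : ‖f‖ = ‖toWeighted k α f‖ := rfl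
  rw [h0, WithLp.prod_norm_eq_of_L1, lp.norm_eq_tsum_rpow (by norm_num),
    lp.norm_eq_tsum_rpow (by norm_num), Real.sqrt_eq_rpow, Real.sqrt_eq_rpow]
  have e1 : ∀ n, ‖(toWeighted k α f).fst n‖ ^ (2 : ENNReal).toReal
      = (1 + (n : ℝ) ^ 2) ^ k * ‖f.coeff n‖ ^ 2 := by
    intro n
    have : (toWeighted k α f).fst n = sobolevWeight k n • f.coeff n := rfl
    rw [this, norm_smul, ENNReal.toReal_ofNat, Real.rpow_two, mul_pow, Real.norm_eq_abs, sq_abs,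
      sobolevWeight, Real.sq_sqrt (by positivity)]
  have e2 : ∀ n, ‖(toWeighted k α f).snd n‖ ^ (2 : ENNReal).toReal
      = ((n : ℝ) ^ k * singularSymbol α n) ^ 2 * ‖f.coeff n‖ ^ 2 := by
    intro n
    have : (toWeighted k α f).snd n = singularWeight k α n • f.coeff n := rfl
    rw [this, norm_smul, ENNReal.toReal_ofNat, Real.rpow_two, mul_pow, Real.norm_eq_abs, sq_abs,
      singularWeight]
  simp only [e1, e2]
  norm_num

/-- The function `f(x) = ∑ (a_n cos (n x) + d_n sin (n x))`. -/
def eval {k : ℕ} {α : ℝ} (f : XSpace k α) (x : ℝ) : ℝ :=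
  ∑' n : ℕ, ((f.coeff n).re * Real.cos (n * x) + (f.coeff n).im * Real.sin (n * x))

instance (k : ℕ) (α : ℝ) : CoeFun (XSpace k α) (fun _ => ℝ → ℝ) := ⟨eval⟩

end XSpace

/-! ### The patches and the functional -/

/-- The mean value `(1 / 2π) ∫_0^{2π} g(y) dy`. -/
def mean (g : ℝ → ℝ) : ℝ := (1 / (2 * Real.pi)) * ∫ y in (0 : ℝ)..(2 * Real.pi), g y

/-- The unit vector `(cos x, sin x)`. -/
def unitVec (x : ℝ) : ℂ := ⟨Real.cos x, Real.sin x⟩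

/-- `R(x) = 1 + ε |ε|^α b^(1+α) f(x)`. -/
def radius (α b ε : ℝ) (f : ℝ → ℝ) (x : ℝ) : ℝ := 1 + ε * |ε| ^ α * b ^ (1 + α) * f x

/-- The closed region `{r (cos x, sin x) : 0 ≤ r ≤ R(x)}`, whose boundary is the polar curve
`x ↦ R(x) (cos x, sin x)` if `R` is positive, continuous and `2π`-periodic. -/
def polarRegion (R : ℝ → ℝ) : Set ℂ :=
  {z | ∃ x r : ℝ, 0 ≤ r ∧ r ≤ R x ∧ z = (r : ℂ) * unitVec x}

/-- The closed patch `ε b O + w`. -/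
def patch (b ε : ℝ) (w : ℂ) (O : Set ℂ) : Set ℂ := (fun z => w + ((ε * b : ℝ) : ℂ) * z) '' O

/-- `(R S + R' S') sin (x - y) + (R S' - R' S) cos (x - y)`, where `R`, `R'` are taken at `x` and
`S`, `S'` at `y`. -/
def crossTerm (R S : ℝ → ℝ) (x y : ℝ) : ℝ :=
  (R x * S y + deriv R x * deriv S y) * Real.sin (x - y)
    + (R x * deriv S y - deriv R x * S y) * Real.cos (x - y)

section Functional

variable {N : ℕ} (α : ℝ) (b : Fin N → ℝ) (ε : ℝ) (f : Fin N → ℝ → ℝ) (lam : Params N)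
  (i : Fin N) (x : ℝ)

/-- The contribution of the rigid motion:
`Ω (ε b R R' + w · (R (cos, sin))') + (U, 0) · (R (cos, sin))'`. -/
def rigidTerm : ℝ :=
  let R := radius α (b i) ε (f i)
  let τ : ℂ := ((deriv R x : ℝ) : ℂ) * unitVec x + (R x : ℂ) * (Complex.I * unitVec x)
  lam.angularVelocity * (ε * b i * R x * deriv R x + inner ℝ (lam.pos i) τ)
    + inner ℝ (lam.speed : ℂ) τ

/-- The contribution of the `i`-th patch to the velocity on its own boundary. -/
def selfTerm : ℝ :=
  let R := radius α (b i) ε (f i)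
  kernelConst α * lam.strength i / (ε * |ε| ^ α * b i ^ (1 + α)) *
    mean fun y => crossTerm R R x y /
      ((R x - R y) ^ 2 + 4 * R x * R y * Real.sin ((x - y) / 2) ^ 2) ^ (α / 2)

/-- The contribution of the other patches to the velocity on the boundary of the `i`-th patch. -/
def interactionTerm : ℝ :=
  let R := fun j => radius α (b j) ε (f j)
  ∑ j ∈ Finset.univ.erase i,
    kernelConst α * lam.strength j / (ε * b j) *
      mean fun y => crossTerm (R i) (R j) x y /
        ‖(lam.pos i + ((ε * b i * R i x : ℝ) : ℂ) * unitVec x)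
          - (lam.pos j + ((ε * b j * R j y : ℝ) : ℂ) * unitVec y)‖ ^ α

/-- The continuous extension of the functional to `ε = 0`:
`P_i^α(λ) · (-sin x, cos x)` plus the linearization at the unit disc, applied to `f_i`. -/
def limitTerm : ℝ :=
  inner ℝ (pointVortexMap α lam i) (Complex.I * unitVec x)
    + kernelConst α * lam.strength i *
      ((1 - α / 2) * mean (fun y =>
          f i (x - y) * Real.sin y / (4 * Real.sin (y / 2) ^ 2) ^ (α / 2))
        - mean (fun y =>
          (deriv (f i) x - deriv (f i) (x - y)) * Real.cos y
            / (4 * Real.sin (y / 2) ^ 2) ^ (α / 2)))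

/-- The functional `F_i^α(ε, f, λ)(x)`. For `ε ≠ 0`, `F_i^α = 0` is the contour dynamics equation
saying that the boundary of the `i`-th patch is stationary in the frame moving with the velocity
`z ↦ i (Ω z + U)`; at `ε = 0` the functional is extended by continuity. -/
def contourFunctional : ℝ :=
  if ε = 0 then limitTerm α f lam i x
  else rigidTerm α b ε f lam i x + selfTerm α b ε f lam i x + interactionTerm α b ε f lam i x

end Functional

/-! ### Solution branches -/

/-- `(f, μ) : (-δ, δ) → B_X × ℝ^S` is a `C¹` curve issuing from `(0, λ₁)` with
`F^α(ε, f(ε), μ(ε), λ₂) = 0`. Here `B_X` is the open unit ball of `(X^{k+α-1})^N`. -/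
structure IsSolutionBranch {N : ℕ} {k : ℕ} (α : ℝ) (b : Fin N → ℝ) (lam : Params N)
    (S : Finset (Component N)) (δ : ℝ) (f : ℝ → Fin N → XSpace k α) (μ : ℝ → S → ℝ) : Prop where
  contDiffOn : ContDiffOn ℝ 1 (fun ε => (f ε, μ ε)) (Ioo (-δ) δ)
  mem_ball : ∀ ε ∈ Ioo (-δ) δ, ‖f ε‖ < 1
  profile_zero : f 0 = 0
  param_zero : μ 0 = lam.first S
  functional_eq_zero : ∀ ε ∈ Ioo (-δ) δ, ∀ (i : Fin N) (x : ℝ),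
    contourFunctional α b ε (fun j => f ε j) (lam.replace S (μ ε)) i x = 0

/-- The first order profile: with the squares taken in `ℂ`,
`(Ξ_α / 4) b_i ∑_{j ≠ i} (γ_j / γ_i) Re (conj ((w_j - w_i)²) exp (2 i x)) / |w_j - w_i|^(α+4)`. -/
def firstOrderProfile {N : ℕ} (α : ℝ) (b : Fin N → ℝ) (lam : Params N) (i : Fin N) (x : ℝ) : ℝ :=
  profileConst α / 4 * b i * ∑ j ∈ Finset.univ.erase i,
    lam.strength j / lam.strength i *
      ((starRingEnd ℂ ((lam.pos j - lam.pos i) ^ 2) * unitVec x ^ 2).re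
        / ‖lam.pos j - lam.pos i‖ ^ (α + 4))

end

end GSQG

/-! Decoupling at `ε = 0`. There the functional splits by Fourier modes. Its first mode is the point
vortex map `pointVortexMap`. On the modes `n ≥ 2` it is linear in the profiles and diagonal, with
symbol `linSymbol α n`, which is bounded below by a positive multiple of `n ^ α` (`le_linSymbol`);
`exists_equiv_diagLin` inverts it. The mean value vanishes for every `ε ≠ 0`
(`integral_contourFunctional`), so it imposes no condition. Only the first mode obstructs the
implicit function theorem: the derivative of the vortex map in `λ₁` is injective, but its range
misses one dimension.

The multiplier. An extra real unknown `t` times a fixed vector `v` outside that range is added to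
the first mode (`systemMap`), and the implicit function theorem gives a curve on which the
functional of patch `i` equals `-t ⟨v_i, i e(x)⟩`. Take `v_i = γ_i i (Ω w_i + U)`. It is orthogonal
to the range because `∑ ⟨P_i(λ), γ_i i (Ω w_i + U)⟩ = 0` holds identically in `λ`
(`sum_inner_pointVortexMap`). The patches obey a matching law: with `E(z) = Ω |z|² / 2 + U z₁`, the
sum over `i` of `(γ_i / b_i) ∫ E F_i`, with `E` taken along the boundary of patch `i`, is zero for
all profiles, since the interaction kernels times energy differences are divergences on the torus
(`sum_integral_energy_contourFunctional`). Inserting the curve gives `t` times a pairing that tends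
to `∑ γ_i² |Ω w_i + U|² / 2`, so `t = 0` unless all velocities vanish. In that case there is at most
one vortex, and the disc is an exact solution for every `ε`.

The function spaces. The implicit function theorem is not applied in `X^{k+α-1}` but in weighted
`ℓ¹` spaces of Fourier coefficients. Targets lie in the Wiener algebra with weight `(1 + |n|)^m`,
profiles carry the weight `n^α (1 + n)^m`, and the diagonal operator is an isomorphism between them.
In a Banach algebra the negative power of the distance is a convergent power series, so smoothness
needs no estimates of nonlinear integral operators. The apparent poles at `ε = 0` go away because
the leading kernels have mean zero and the remainder is written with `powQuot`, the function `((1 +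
u)^a - 1) / u`.

Existence is run with `m = k`, where profiles embed into `X^{k+α-1}` (`toX`). Uniqueness is run with
`m = 0`, where `X^{k+α-1}` embeds into the profiles because `α < 2` and `3 ≤ k` (`ofX`).
Connectedness extends local uniqueness to whole intervals.

The expansion comes from differentiating the equation along the curve at `ε = 0`. The first
derivative in `ε` of the interaction of two discs is a pure second mode
(`hasDerivAt_pairMap_circle`), and dividing by `linSymbol α 2 = α (α + 2) / Ξ_α` gives the profile.
Since the perturbation of each disc is small in `C²`, the curvature is positive, which gives strict
convexity; the patches have size `O(ε)`, which gives disjointness. -/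

namespace GSQG
noncomputable section

/-! ### Weighted Wiener algebras -/

/-- The weight `(1 + |n|)^m`. -/
def wienerWeight (m : ℕ) (n : ℤ) : ℝ := (1 + |(n : ℝ)|) ^ m

theorem one_le_wienerWeight (m : ℕ) (n : ℤ) : 1 ≤ wienerWeight m n :=
  one_le_pow₀ (by linarith [abs_nonneg (n : ℝ)])

theorem wienerWeight_pos (m : ℕ) (n : ℤ) : 0 < wienerWeight m n :=
  lt_of_lt_of_le one_pos (one_le_wienerWeight m n)

/-- Because `1 + |k + l| ≤ (1 + |k|) (1 + |l|)`. This submultiplicativity is what makes `Wiener m`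
closed under convolution, with a submultiplicative norm. -/
theorem wienerWeight_add_le (m : ℕ) (k l : ℤ) :
    wienerWeight m (k + l) ≤ wienerWeight m k * wienerWeight m l := by
  unfold wienerWeight
  rw [← mul_pow]
  refine pow_le_pow_left₀ (by positivity) ?_ m
  push_cast
  nlinarith [abs_add_le (k : ℝ) l, abs_nonneg (k : ℝ), abs_nonneg (l : ℝ),
    mul_nonneg (abs_nonneg (k : ℝ)) (abs_nonneg (l : ℝ))]

/-- The sequences of Fourier coefficients which are summable with the weight `(1 + |n|)^m`. -/
def wienerSubmodule (m : ℕ) : Submodule ℝ (ℤ → ℂ) where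
  carrier := {c | Summable fun n => wienerWeight m n * ‖c n‖}
  zero_mem' := by simp
  add_mem' := by
    intro c d hc hd
    refine Summable.of_nonneg_of_le (fun n => by have := wienerWeight_pos m n; positivity)
      (fun n => ?_) (Summable.add hc hd)
    rw [← mul_add]
    exact mul_le_mul_of_nonneg_left (norm_add_le _ _) (wienerWeight_pos m n).le
  smul_mem' := by
    intro r c hc
    refine (Summable.mul_left |r| hc).congr fun n => ?_
    simp only [Pi.smul_apply, norm_smul, Real.norm_eq_abs]; ring

/-- The weighted Wiener algebra of the functions `∑ c_n exp (i n x)` with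
`∑ (1 + |n|)^m |c_n| < ∞`. -/
def Wiener (m : ℕ) : Type := wienerSubmodule m

namespace Wiener

variable {m : ℕ}

instance : AddCommGroup (Wiener m) := inferInstanceAs (AddCommGroup (wienerSubmodule m))

instance : Module ℝ (Wiener m) := inferInstanceAs (Module ℝ (wienerSubmodule m))

/-- The Fourier coefficients. -/
def coeff (c : Wiener m) : ℤ → ℂ := c.1

@[ext] theorem ext {c d : Wiener m} (h : ∀ n, c.coeff n = d.coeff n) : c = d :=
  Subtype.ext (funext h)

@[simp] theorem coeff_zero (n : ℤ) : (0 : Wiener m).coeff n = 0 := rfl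
@[simp] theorem coeff_add (c d : Wiener m) (n : ℤ) : (c + d).coeff n = c.coeff n + d.coeff n := rfl
@[simp] theorem coeff_sub (c d : Wiener m) (n : ℤ) : (c - d).coeff n = c.coeff n - d.coeff n := rfl
@[simp] theorem coeff_neg (c : Wiener m) (n : ℤ) : (-c).coeff n = -c.coeff n := rfl
@[simp] theorem coeff_smul (r : ℝ) (c : Wiener m) (n : ℤ) : (r • c).coeff n = r • c.coeff n := rfl

theorem summable (c : Wiener m) : Summable fun n => wienerWeight m n * ‖c.coeff n‖ := c.2

/-- The element with given coefficients. -/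
def mk (c : ℤ → ℂ) (h : Summable fun n => wienerWeight m n * ‖c n‖) : Wiener m := ⟨c, h⟩

@[simp] theorem coeff_mk (c : ℤ → ℂ) (h : Summable fun n => wienerWeight m n * ‖c n‖) (n : ℤ) :
    (mk c h).coeff n = c n := rfl

/-- The weighted coefficients. -/
def toLp (m : ℕ) : Wiener m →ₗ[ℝ] lp (fun _ : ℤ => ℂ) 1 where
  toFun c := ⟨fun n => wienerWeight m n • c.coeff n, by
    refine memℓp_gen ?_
    refine c.summable.congr fun n => ?_
    simp [abs_of_pos (wienerWeight_pos m n)]⟩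
  map_add' c d := by
    refine lp.ext (funext fun n => ?_)
    exact smul_add (wienerWeight m n) (c.coeff n) (d.coeff n)
  map_smul' r c := by
    refine lp.ext (funext fun n => ?_)
    exact smul_comm (wienerWeight m n) r (c.coeff n)

theorem toLp_apply (c : Wiener m) (n : ℤ) : toLp m c n = wienerWeight m n • c.coeff n := rfl

theorem toLp_injective : Function.Injective (toLp m) := by
  intro c d h
  ext n
  have := congrArg (fun z : lp (fun _ : ℤ => ℂ) 1 => z n) h
  exact smul_right_injective ℂ (wienerWeight_pos m n).ne' this

theorem toLp_surjective : Function.Surjective (toLp m) := by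
  intro d
  have hd := (lp.memℓp d).summable (by norm_num)
  refine ⟨mk (fun n => (wienerWeight m n)⁻¹ • d n) ?_, ?_⟩
  · refine hd.congr fun n => ?_
    have := wienerWeight_pos m n
    simp [abs_of_pos this]
    field_simp
  · refine lp.ext (funext fun n => ?_)
    rw [toLp_apply, coeff_mk, smul_smul, mul_inv_cancel₀ (wienerWeight_pos m n).ne', one_smul]

instance : NormedAddCommGroup (Wiener m) :=
  NormedAddCommGroup.induced (Wiener m) _ (toLp m) toLp_injective

instance : NormedSpace ℝ (Wiener m) := NormedSpace.induced ℝ (Wiener m) _ (toLp m)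

theorem norm_def (c : Wiener m) : ‖c‖ = ∑' n, wienerWeight m n * ‖c.coeff n‖ := by
  have h0 : ‖c‖ = ‖toLp m c‖ := rfl
  rw [h0, lp.norm_eq_tsum_rpow (by norm_num)]
  simp [toLp_apply, abs_of_pos (wienerWeight_pos m _)]

instance : CompleteSpace (Wiener m) := by
  have hi : Isometry (toLp m) := AddMonoidHomClass.isometry_of_norm _ fun _ => rfl
  exact (completeSpace_congr (e := Equiv.ofBijective _ ⟨toLp_injective, toLp_surjective⟩)
    hi.isUniformEmbedding).2 inferInstance

theorem norm_coeff_le (c : Wiener m) (n : ℤ) : wienerWeight m n * ‖c.coeff n‖ ≤ ‖c‖ := by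
  rw [norm_def]
  exact c.summable.le_tsum n fun j _ => by have := wienerWeight_pos m j; positivity

theorem summable_norm (c : Wiener m) : Summable fun n => ‖c.coeff n‖ :=
  Summable.of_nonneg_of_le (fun _ => norm_nonneg _)
    (fun n => le_mul_of_one_le_left (norm_nonneg _) (one_le_wienerWeight m n)) c.summable

/-- The value `∑ c_n exp (i n x)`. -/
def value (c : Wiener m) (x : ℝ) : ℂ := ∑' n : ℤ, c.coeff n * Complex.exp (Complex.I * n * x)

theorem norm_exp_I (n : ℤ) (x : ℝ) : ‖Complex.exp (Complex.I * n * x)‖ = 1 := by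
  rw [Complex.norm_exp]; simp

theorem norm_exp_neg_I (n : ℤ) (x : ℝ) : ‖Complex.exp (-(Complex.I * n * x))‖ = 1 := by
  rw [Complex.norm_exp]; simp

theorem summable_value (c : Wiener m) (x : ℝ) :
    Summable fun n : ℤ => c.coeff n * Complex.exp (Complex.I * n * x) := by
  refine Summable.of_norm (c.summable_norm.congr fun n => ?_)
  rw [norm_mul, norm_exp_I, mul_one]

theorem norm_value_le (c : Wiener m) (x : ℝ) : ‖c.value x‖ ≤ ‖c‖ := by
  rw [norm_def]
  refine (norm_tsum_le_tsum_norm (c.summable_value x).norm).trans ?_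
  refine Summable.tsum_le_tsum (fun n => ?_) (c.summable_value x).norm c.summable
  rw [norm_mul, norm_exp_I, mul_one]
  exact le_mul_of_one_le_left (norm_nonneg _) (one_le_wienerWeight m n)

theorem exp_orthogonal (n k : ℤ) :
    ∫ x in (0 : ℝ)..(2 * Real.pi),
      Complex.exp (Complex.I * n * x) * Complex.exp (-(Complex.I * k * x)) =
      if n = k then 2 * Real.pi else 0 := by
  split_ifs with h
  · subst h
    simp [← Complex.exp_add]
  · have h1 : (Complex.I * ((n : ℂ) - k)) ≠ 0 :=
      mul_ne_zero Complex.I_ne_zero (sub_ne_zero.2 (by exact_mod_cast h))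
    have h2 : ∀ x : ℝ, Complex.exp (Complex.I * n * x) * Complex.exp (-(Complex.I * k * x)) =
        Complex.exp (Complex.I * ((n : ℂ) - k) * x) := fun x => by
      rw [← Complex.exp_add]; ring_nf
    simp_rw [h2]
    rw [integral_exp_mul_complex h1]
    have h3 : Complex.exp (Complex.I * ((n : ℂ) - k) * (2 * Real.pi : ℝ)) = 1 := by
      rw [Complex.exp_eq_one_iff]
      exact ⟨n - k, by push_cast; ring⟩
    rw [h3]; simp

theorem integral_value_mul_exp (c : Wiener m) (k : ℤ) :
    ∫ x in (0 : ℝ)..(2 * Real.pi), c.value x * Complex.exp (-(Complex.I * k * x)) =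
      2 * Real.pi * c.coeff k := by
  have h := intervalIntegral.hasSum_intervalIntegral_of_summable_norm (a := 0) (b := 2 * Real.pi)
    (f := fun n : ℤ => (⟨fun x : ℝ => c.coeff n * Complex.exp (Complex.I * n * x) *
      Complex.exp (-(Complex.I * k * x)), by fun_prop⟩ : C(ℝ, ℂ))) (by
      refine Summable.of_nonneg_of_le (fun _ => norm_nonneg _) (fun n => ?_) c.summable_norm
      refine (ContinuousMap.norm_le _ (norm_nonneg _)).2 fun x => ?_
      simp only [ContinuousMap.restrict_apply, ContinuousMap.coe_mk, norm_mul, norm_exp_I,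
        norm_exp_neg_I, mul_one, le_refl])
  have h1 : ∀ x : ℝ, c.value x * Complex.exp (-(Complex.I * k * x)) = ∑' n : ℤ,
      c.coeff n * Complex.exp (Complex.I * n * x) * Complex.exp (-(Complex.I * k * x)) :=
    fun x => tsum_mul_right.symm
  simp_rw [h1]
  refine h.tsum_eq.symm.trans ?_
  simp only [ContinuousMap.coe_mk, mul_assoc, intervalIntegral.integral_const_mul]
  have h2 := exp_orthogonal
  simp only [mul_assoc] at h2
  simp only [h2]
  rw [tsum_eq_single k]
  · simp; ring
  · intro n hn; simp [hn]

/-- The coefficients are recovered from the values by `integral_value_mul_exp`. From here on the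
ring axioms and most identities in `Wiener m` are checked point by point. -/
theorem value_injective {c d : Wiener m} (h : ∀ x, c.value x = d.value x) : c = d := by
  ext n
  have h1 := integral_value_mul_exp c n
  simp_rw [h, integral_value_mul_exp d n] at h1
  have : (2 * Real.pi : ℂ) ≠ 0 := by simp [Real.pi_ne_zero]
  exact (mul_left_cancel₀ this h1).symm

@[simp] theorem value_zero (x : ℝ) : (0 : Wiener m).value x = 0 := by simp [value]

theorem value_add (c d : Wiener m) (x : ℝ) : (c + d).value x = c.value x + d.value x := by
  simp only [value, coeff_add, add_mul]
  exact (c.summable_value x).tsum_add (d.summable_value x)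

theorem value_smul (r : ℝ) (c : Wiener m) (x : ℝ) : (r • c).value x = r * c.value x := by
  simp only [value, coeff_smul, Complex.real_smul, mul_assoc]
  exact tsum_mul_left

/-- The coordinates `(n, k) ↦ (k, n - k)`. -/
def convEquiv : ℤ × ℤ ≃ ℤ × ℤ where
  toFun p := (p.2, p.1 - p.2)
  invFun q := (q.1 + q.2, q.1)
  left_inv p := by simp
  right_inv q := by simp

/-- The reindexing `(n, k) ↦ (k, n - k)` turns the double series into a product of two summable
ones, up to the submultiplicativity of the weight. -/
theorem summable_conv (c d : Wiener m) : Summable fun p : ℤ × ℤ =>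
    wienerWeight m p.1 * (‖c.coeff p.2‖ * ‖d.coeff (p.1 - p.2)‖) := by
  have h := c.summable.mul_of_nonneg d.summable
    (fun n => by have := wienerWeight_pos m n; simp; positivity)
    (fun n => by have := wienerWeight_pos m n; simp; positivity)
  rw [← convEquiv.summable_iff] at h
  refine Summable.of_nonneg_of_le (fun p => by have := wienerWeight_pos m p.1; positivity)
    (fun p => ?_) h
  simp only [Function.comp, convEquiv, Equiv.coe_fn_mk]
  have := wienerWeight_add_le m p.2 (p.1 - p.2)
  rw [add_sub_cancel] at this
  calc _ ≤ (wienerWeight m p.2 * wienerWeight m (p.1 - p.2)) *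
        (‖c.coeff p.2‖ * ‖d.coeff (p.1 - p.2)‖) := by gcongr
    _ = _ := by ring

theorem summable_conv_fiber (c d : Wiener m) (n : ℤ) :
    Summable fun k => ‖c.coeff k‖ * ‖d.coeff (n - k)‖ := by
  have h := (summable_conv c d).prod_factor n
  exact (summable_mul_left_iff (wienerWeight_pos m n).ne').1 h

theorem conv_le (c d : Wiener m) (n : ℤ) :
    wienerWeight m n * ‖∑' k, c.coeff k * d.coeff (n - k)‖ ≤
      ∑' k, wienerWeight m n * (‖c.coeff k‖ * ‖d.coeff (n - k)‖) := by
  rw [tsum_mul_left]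
  refine mul_le_mul_of_nonneg_left ?_ (wienerWeight_pos m n).le
  refine (norm_tsum_le_tsum_norm ?_).trans (le_of_eq ?_)
  · exact (summable_conv_fiber c d n).congr fun k => (norm_mul _ _).symm
  · simp

instance : Mul (Wiener m) := ⟨fun c d => mk (fun n => ∑' k, c.coeff k * d.coeff (n - k)) <| by
  refine Summable.of_nonneg_of_le (fun n => by have := wienerWeight_pos m n; positivity)
    (conv_le c d) (summable_conv c d).prod⟩

theorem coeff_mul (c d : Wiener m) (n : ℤ) :
    (c * d).coeff n = ∑' k, c.coeff k * d.coeff (n - k) := rfl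

theorem norm_mul_le' (c d : Wiener m) : ‖c * d‖ ≤ ‖c‖ * ‖d‖ := by
  have h := c.summable.mul_of_nonneg d.summable
    (fun n => by have := wienerWeight_pos m n; simp; positivity)
    (fun n => by have := wienerWeight_pos m n; simp; positivity)
  have h' := h
  rw [← convEquiv.summable_iff] at h'
  calc ‖c * d‖ ≤ ∑' n, ∑' k, wienerWeight m n * (‖c.coeff k‖ * ‖d.coeff (n - k)‖) := by
        rw [norm_def]
        exact (c * d).summable.tsum_le_tsum (conv_le c d) (summable_conv c d).prod
    _ = ∑' p : ℤ × ℤ, wienerWeight m p.1 * (‖c.coeff p.2‖ * ‖d.coeff (p.1 - p.2)‖) :=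
        ((summable_conv c d).tsum_prod).symm
    _ ≤ ∑' p : ℤ × ℤ, (wienerWeight m (convEquiv p).1 * ‖c.coeff (convEquiv p).1‖) *
          (wienerWeight m (convEquiv p).2 * ‖d.coeff (convEquiv p).2‖) := by
        refine (summable_conv c d).tsum_le_tsum (fun p => ?_) h'
        simp only [convEquiv, Equiv.coe_fn_mk]
        have := wienerWeight_add_le m p.2 (p.1 - p.2)
        rw [add_sub_cancel] at this
        calc _ ≤ (wienerWeight m p.2 * wienerWeight m (p.1 - p.2)) *
              (‖c.coeff p.2‖ * ‖d.coeff (p.1 - p.2)‖) := by gcongr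
          _ = _ := by ring
    _ = ∑' p : ℤ × ℤ, (wienerWeight m p.1 * ‖c.coeff p.1‖) *
          (wienerWeight m p.2 * ‖d.coeff p.2‖) :=
        convEquiv.tsum_eq fun p : ℤ × ℤ => (wienerWeight m p.1 * ‖c.coeff p.1‖) *
          (wienerWeight m p.2 * ‖d.coeff p.2‖)
    _ = ‖c‖ * ‖d‖ := by
        rw [norm_def, norm_def]
        exact (c.summable.tsum_mul_tsum d.summable h).symm

theorem value_mul (c d : Wiener m) (x : ℝ) : (c * d).value x = c.value x * d.value x := by
  have hc := (c.summable_value x).norm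
  have hd := (d.summable_value x).norm
  have h := summable_mul_of_summable_norm hc hd
  have h' := h
  rw [← convEquiv.summable_iff] at h'
  have e : ∀ p : ℤ × ℤ, (c.coeff (convEquiv p).1 * Complex.exp (Complex.I * (convEquiv p).1 * x)) *
      (d.coeff (convEquiv p).2 * Complex.exp (Complex.I * (convEquiv p).2 * x)) =
      c.coeff p.2 * d.coeff (p.1 - p.2) * Complex.exp (Complex.I * p.1 * x) := by
    intro p
    have : Complex.exp (Complex.I * p.1 * x) = Complex.exp (Complex.I * p.2 * x) *
        Complex.exp (Complex.I * ((p.1 - p.2 : ℤ) : ℂ) * x) := by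
      rw [← Complex.exp_add]; push_cast; ring_nf
    rw [this]; simp only [convEquiv, Equiv.coe_fn_mk]; ring
  calc (c * d).value x = ∑' n, ∑' k, c.coeff k * d.coeff (n - k) *
        Complex.exp (Complex.I * n * x) := by
        simp only [value, coeff_mul, tsum_mul_right]
    _ = ∑' p : ℤ × ℤ, c.coeff p.2 * d.coeff (p.1 - p.2) * Complex.exp (Complex.I * p.1 * x) :=
        ((h'.congr e).tsum_prod).symm
    _ = _ := by
        rw [← tsum_congr e, convEquiv.tsum_eq (fun p : ℤ × ℤ =>
          (c.coeff p.1 * Complex.exp (Complex.I * p.1 * x)) *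
          (d.coeff p.2 * Complex.exp (Complex.I * p.2 * x)))]
        exact (tsum_mul_tsum_of_summable_norm hc hd).symm

theorem summable_single (n : ℤ) (z : ℂ) :
    Summable fun k => wienerWeight m k * ‖(Pi.single n z : ℤ → ℂ) k‖ := by
  refine summable_of_ne_finset_zero (s := {n}) fun k hk => ?_
  have : k ≠ n := by simpa using hk
  simp [this]

/-- The function `z exp (i n x)`. -/
def single (n : ℤ) (z : ℂ) : Wiener m := mk (Pi.single n z) (summable_single n z)

theorem coeff_single (n : ℤ) (z : ℂ) (k : ℤ) :
    (single n z : Wiener m).coeff k = if k = n then z else 0 := by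
  rw [single, coeff_mk, Pi.single_apply]

theorem value_single (n : ℤ) (z : ℂ) (x : ℝ) :
    (single n z : Wiener m).value x = z * Complex.exp (Complex.I * n * x) := by
  rw [value, tsum_eq_single n]
  · simp [coeff_single]
  · intro k hk; simp [coeff_single, hk]

theorem norm_single (n : ℤ) (z : ℂ) : ‖(single n z : Wiener m)‖ = wienerWeight m n * ‖z‖ := by
  rw [norm_def, tsum_eq_single n]
  · simp [coeff_single]
  · intro k hk; simp [coeff_single, hk]

instance : One (Wiener m) := ⟨single 0 1⟩

@[simp] theorem value_one (x : ℝ) : (1 : Wiener m).value x = 1 := by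
  have : (1 : Wiener m) = single 0 1 := rfl
  rw [this, value_single]; simp

instance : CommRing (Wiener m) :=
  { (inferInstance : AddCommGroup (Wiener m)) with
    mul := (· * ·)
    one := 1
    mul_assoc := fun a b c => value_injective fun x => by simp only [value_mul]; ring
    mul_comm := fun a b => value_injective fun x => by simp only [value_mul]; ring
    one_mul := fun a => value_injective fun x => by simp only [value_mul, value_one, one_mul]
    mul_one := fun a => value_injective fun x => by simp only [value_mul, value_one, mul_one]
    left_distrib := fun a b c => value_injective fun x => by
      simp only [value_mul, value_add, mul_add]
    right_distrib := fun a b c => value_injective fun x => by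
      simp only [value_mul, value_add, add_mul]
    zero_mul := fun a => value_injective fun x => by simp only [value_mul, value_zero, zero_mul]
    mul_zero := fun a => value_injective fun x => by simp only [value_mul, value_zero, mul_zero] }

instance : NormedCommRing (Wiener m) :=
  { (inferInstance : NormedAddCommGroup (Wiener m)), (inferInstance : CommRing (Wiener m)) with
    norm_mul_le := norm_mul_le' }

instance : Algebra ℝ (Wiener m) :=
  Algebra.ofModule
    (fun r a b => value_injective fun x => by simp only [value_mul, value_smul, mul_assoc])
    (fun r a b => value_injective fun x => by simp only [value_mul, value_smul]; ring)

instance : NormedAlgebra ℝ (Wiener m) :=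
  { (inferInstance : Algebra ℝ (Wiener m)) with
    norm_smul_le := fun r x => (norm_smul r x).le }

instance : NormOneClass (Wiener m) := ⟨by
  have : (1 : Wiener m) = single 0 1 := rfl
  rw [this, norm_single]; simp [wienerWeight]⟩

/-- Evaluation at a point, as an algebra homomorphism. -/
def evalAlgHom (x : ℝ) : Wiener m →ₐ[ℝ] ℂ :=
  AlgHom.ofLinearMap
    { toFun := fun c => c.value x, map_add' := fun c d => value_add c d x,
      map_smul' := fun r c => by simp [value_smul] }
    (value_one x) (fun c d => value_mul c d x)

/-- Evaluation at a point, as a continuous linear map. -/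
def evalCLM (x : ℝ) : Wiener m →L[ℝ] ℂ :=
  (evalAlgHom x).toLinearMap.mkContinuous 1 fun c => by
    rw [one_mul]; exact norm_value_le c x

@[simp] theorem evalCLM_apply (x : ℝ) (c : Wiener m) : evalCLM x c = c.value x := rfl

theorem value_sub (c d : Wiener m) (x : ℝ) : (c - d).value x = c.value x - d.value x :=
  map_sub (evalCLM x) c d

/-- The `n`-th Fourier coefficient as a continuous linear map. -/
def coeffCLM (n : ℤ) : Wiener m →L[ℝ] ℂ :=
  LinearMap.mkContinuous
    (⟨⟨fun c => c.coeff n, fun _ _ => rfl⟩, fun _ _ => rfl⟩ : Wiener m →ₗ[ℝ] ℂ) 1 fun c => by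
      rw [one_mul]
      exact (le_mul_of_one_le_left (norm_nonneg _) (one_le_wienerWeight m n)).trans
        (norm_coeff_le c n)

@[simp] theorem coeffCLM_apply (n : ℤ) (c : Wiener m) : coeffCLM n c = c.coeff n := rfl

end Wiener
end
end GSQG

namespace GSQG
noncomputable section

open scoped BoundedContinuousFunction

/-! ### Profiles and multipliers -/

/-- The space of the unknown profiles, given by their weighted Fourier coefficients. -/
abbrev Profile : Type := lp (fun _ : ℕ => ℂ) 1

/-- The weight `n^α (1 + n)^m`. -/
def profileWeight (α : ℝ) (m n : ℕ) : ℝ := (n : ℝ) ^ α * (1 + (n : ℝ)) ^ m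

theorem profileWeight_pos (α : ℝ) (m : ℕ) {n : ℕ} (hn : n ≠ 0) : 0 < profileWeight α m n := by
  have : (0 : ℝ) < n := by positivity
  unfold profileWeight; positivity

theorem profileWeight_nonneg (α : ℝ) (m n : ℕ) : 0 ≤ profileWeight α m n := by
  unfold profileWeight; positivity

namespace Profile

variable {α : ℝ} {m : ℕ}

/-- The coefficients `a_n + i d_n` of the profile. -/
def realCoeff (α : ℝ) (m : ℕ) (a : Profile) (n : ℕ) : ℂ :=
  if n < 2 then 0 else (profileWeight α m n)⁻¹ • a (n - 2)

/-- The coefficients of `exp (i n x)`. -/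
def expCoeff (α : ℝ) (m : ℕ) (a : Profile) (n : ℤ) : ℂ :=
  if 0 < n then (starRingEnd ℂ (realCoeff α m a n.natAbs)) / 2 else realCoeff α m a n.natAbs / 2

theorem realCoeff_add (a b : Profile) (n : ℕ) :
    realCoeff α m (a + b) n = realCoeff α m a n + realCoeff α m b n := by
  unfold realCoeff; split_ifs
  · simp
  · exact smul_add _ _ _

theorem realCoeff_smul (r : ℝ) (a : Profile) (n : ℕ) :
    realCoeff α m (r • a) n = r • realCoeff α m a n := by
  unfold realCoeff; split_ifs
  · simp
  · exact smul_comm (profileWeight α m n)⁻¹ r (a (n - 2))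

theorem expCoeff_add (a b : Profile) (n : ℤ) :
    expCoeff α m (a + b) n = expCoeff α m a n + expCoeff α m b n := by
  unfold expCoeff; split_ifs <;> simp only [realCoeff_add, map_add] <;> ring

theorem expCoeff_smul (r : ℝ) (a : Profile) (n : ℤ) :
    expCoeff α m (r • a) n = r • expCoeff α m a n := by
  unfold expCoeff; split_ifs <;>
    simp only [realCoeff_smul, Complex.real_smul, map_mul, Complex.conj_ofReal] <;> ring

theorem norm_expCoeff (a : Profile) (n : ℤ) :
    ‖expCoeff α m a n‖ = ‖realCoeff α m a n.natAbs‖ / 2 := by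
  unfold expCoeff; split_ifs <;> simp

theorem expCoeff_neg (a : Profile) (n : ℤ) :
    expCoeff α m a (-n) = starRingEnd ℂ (expCoeff α m a n) := by
  rcases lt_trichotomy n 0 with h | h | h
  · simp [expCoeff, h, h.le.not_gt, Complex.conj_ofNat]
  · subst h; simp [expCoeff, realCoeff]
  · simp [expCoeff, h, h.le.not_gt, Complex.conj_ofNat]

theorem expCoeff_of_natAbs_lt (a : Profile) {n : ℤ} (hn : n.natAbs < 2) :
    expCoeff α m a n = 0 := by
  simp [expCoeff, realCoeff, hn]

/-- The sequence `a` starts at the mode `n = 2`, hence the shift by two. With it the norm of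
`Profile` is exactly the weighted `ℓ¹` norm of the Fourier coefficients. -/
theorem hasSum_realCoeff (a : Profile) :
    HasSum (fun n => profileWeight α m n * ‖realCoeff α m a n‖) ‖a‖ := by
  have h := (lp.hasSum_norm (p := 1) (by norm_num) a)
  rw [← hasSum_nat_add_iff' 2]
  simp only [ENNReal.toReal_one, Real.rpow_one] at h
  have e0 : ∑ i ∈ Finset.range 2, profileWeight α m i * ‖realCoeff α m a i‖ = 0 :=
    Finset.sum_eq_zero fun i hi => by simp [realCoeff, Finset.mem_range.1 hi]
  rw [e0, sub_zero]
  refine h.congr_fun fun n => ?_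
  have := profileWeight_pos α m (n := n + 2) (by omega)
  simp [realCoeff, abs_of_pos this, mul_inv_cancel_left₀ this.ne']

/-- Each real mode splits into two exponential modes of half its size, so the sum over `ℤ` is again
`‖a‖`. The term `n = 0`, which both halves of the sum contain, is zero. -/
theorem hasSum_expCoeff (a : Profile) :
    HasSum (fun n : ℤ => profileWeight α m n.natAbs * ‖expCoeff α m a n‖) ‖a‖ := by
  have h := hasSum_realCoeff (α := α) (m := m) a
  have h2 := (h.div_const 2)
  have e : (fun n : ℕ => profileWeight α m n * ‖realCoeff α m a n‖ / 2) =
      fun n : ℕ => profileWeight α m (n : ℤ).natAbs * ‖expCoeff α m a (n : ℤ)‖ := by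
    funext n; rw [norm_expCoeff]; simp; ring
  have e' : (fun n : ℕ => profileWeight α m n * ‖realCoeff α m a n‖ / 2) =
      fun n : ℕ => profileWeight α m (-(n : ℤ)).natAbs * ‖expCoeff α m a (-(n : ℤ))‖ := by
    funext n; rw [norm_expCoeff]; simp; ring
  have h3 := HasSum.of_nat_of_neg (f := fun n : ℤ => profileWeight α m n.natAbs *
    ‖expCoeff α m a n‖) (e ▸ h2) (e' ▸ h2)
  rwa [expCoeff_of_natAbs_lt a (by simp), norm_zero, mul_zero, sub_zero, add_halves] at h3

theorem summable_multiplier {κ : ℤ → ℂ} {m' : ℕ} {C : ℝ}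
    (h : ∀ n : ℤ, 2 ≤ n.natAbs → ‖κ n‖ * wienerWeight m' n ≤ C * profileWeight α m n.natAbs)
    (a : Profile) (n : ℤ) :
    wienerWeight m' n * ‖κ n * expCoeff α m a n‖ ≤
      C * (profileWeight α m n.natAbs * ‖expCoeff α m a n‖) := by
  by_cases hn : 2 ≤ n.natAbs
  · rw [norm_mul]
    nlinarith [mul_le_mul_of_nonneg_right (h n hn) (norm_nonneg (expCoeff α m a n))]
  · rw [expCoeff_of_natAbs_lt a (by omega)]; simp

/-- The Fourier multiplier with symbol `κ`, from profiles to the Wiener algebra. -/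
def multiplier (α : ℝ) (m m' : ℕ) (κ : ℤ → ℂ) (C : ℝ)
    (h : ∀ n : ℤ, 2 ≤ n.natAbs → ‖κ n‖ * wienerWeight m' n ≤ C * profileWeight α m n.natAbs) :
    Profile →L[ℝ] Wiener m' :=
  LinearMap.mkContinuous
    (⟨⟨fun a => Wiener.mk (fun n => κ n * expCoeff α m a n)
        (Summable.of_nonneg_of_le (fun n => by have := wienerWeight_pos m' n; positivity)
          (summable_multiplier h a) ((hasSum_expCoeff a).summable.mul_left C)),
      fun a b => by
        ext n; simp only [Wiener.coeff_mk, Wiener.coeff_add, expCoeff_add]; ring⟩,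
      fun r a => by
        ext n
        simp only [Wiener.coeff_mk, Wiener.coeff_smul, expCoeff_smul, Complex.real_smul,
          RingHom.id_apply]
        ring⟩ : Profile →ₗ[ℝ] Wiener m') C fun a => by
      rw [Wiener.norm_def, ← (hasSum_expCoeff (α := α) (m := m) a).tsum_eq, ← tsum_mul_left]
      exact Summable.tsum_le_tsum (summable_multiplier h a) (Wiener.summable _)
        ((hasSum_expCoeff a).summable.mul_left C)

@[simp] theorem coeff_multiplier {κ : ℤ → ℂ} {m' : ℕ} {C : ℝ}
    (h : ∀ n : ℤ, 2 ≤ n.natAbs → ‖κ n‖ * wienerWeight m' n ≤ C * profileWeight α m n.natAbs)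
    (a : Profile) (n : ℤ) :
    (multiplier α m m' κ C h a).coeff n = κ n * expCoeff α m a n := rfl

theorem wienerWeight_eq_natAbs (m : ℕ) (n : ℤ) :
    wienerWeight m n = (1 + (n.natAbs : ℝ)) ^ m := by
  unfold wienerWeight; rw [Nat.cast_natAbs]; simp

theorem natAbs_le_rpow (hα : 1 ≤ α) (n : ℕ) : (n : ℝ) ≤ (n : ℝ) ^ α := by
  rcases Nat.eq_zero_or_pos n with h | h
  · subst h; rw [Nat.cast_zero, Real.zero_rpow (by linarith)]
  · exact Real.self_le_rpow_of_one_le (by exact_mod_cast h) hα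

theorem toFun_bound (hα : 1 ≤ α) (n : ℤ) (hn : 2 ≤ n.natAbs) :
    ‖(1 : ℂ)‖ * wienerWeight m n ≤ 1 * profileWeight α m n.natAbs := by
  rw [wienerWeight_eq_natAbs, norm_one, one_mul, one_mul]
  refine le_mul_of_one_le_left (by positivity) ((natAbs_le_rpow hα _).trans' ?_)
  exact_mod_cast (by omega : 1 ≤ n.natAbs)

theorem norm_I_mul_int (n : ℤ) : ‖Complex.I * n‖ = n.natAbs := by
  simp [Nat.cast_natAbs]

theorem toDeriv_bound (hα : 1 ≤ α) (n : ℤ) (_ : 2 ≤ n.natAbs) :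
    ‖Complex.I * n‖ * wienerWeight m n ≤ 1 * profileWeight α m n.natAbs := by
  rw [wienerWeight_eq_natAbs, one_mul, norm_I_mul_int]
  exact mul_le_mul_of_nonneg_right (natAbs_le_rpow hα _) (by positivity)

/-- One factor `n` is absorbed by `n ^ α` and the other by `(1 + n) ^ m`, which is where `1 ≤ m`
enters. Second derivatives are needed only as bounded functions, for the curvature and for the
energy law, so `Wiener 0` suffices as target. -/
theorem toSecond_bound (hα : 1 ≤ α) (hm : 1 ≤ m) (n : ℤ) (_ : 2 ≤ n.natAbs) :
    ‖(Complex.I * n) ^ 2‖ * wienerWeight 0 n ≤ 1 * profileWeight α m n.natAbs := by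
  rw [wienerWeight_eq_natAbs, one_mul, norm_pow, norm_I_mul_int, pow_zero, mul_one, sq]
  refine mul_le_mul (natAbs_le_rpow hα _) ?_ (by positivity) (by positivity)
  refine le_trans ?_ (le_self_pow₀ (by linarith [Nat.cast_nonneg (α := ℝ) n.natAbs]) (by omega))
  linarith

/-- The profile as an element of the Wiener algebra. -/
def fn (hα : 1 ≤ α) (m : ℕ) : Profile →L[ℝ] Wiener m :=
  multiplier α m m (fun _ => 1) 1 (toFun_bound hα)

/-- The derivative of the profile. -/
def dfn (hα : 1 ≤ α) (m : ℕ) : Profile →L[ℝ] Wiener m :=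
  multiplier α m m (fun n => Complex.I * n) 1 (toDeriv_bound hα)

/-- The second derivative of the profile. -/
def ddfn (hα : 1 ≤ α) (hm : 1 ≤ m) : Profile →L[ℝ] Wiener 0 :=
  multiplier α m 0 (fun n => (Complex.I * n) ^ 2) 1 (toSecond_bound hα hm)

@[simp] theorem coeff_fn (hα : 1 ≤ α) (a : Profile) (n : ℤ) :
    (fn hα m a).coeff n = expCoeff α m a n := by simp [fn]

@[simp] theorem coeff_dfn (hα : 1 ≤ α) (a : Profile) (n : ℤ) :
    (dfn hα m a).coeff n = Complex.I * n * expCoeff α m a n := by simp [dfn]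

@[simp] theorem coeff_ddfn (hα : 1 ≤ α) (hm : 1 ≤ m) (a : Profile) (n : ℤ) :
    (ddfn hα hm a).coeff n = (Complex.I * n) ^ 2 * expCoeff α m a n := by simp [ddfn]

end Profile

/-! ### Real-valued elements, derivatives and periodicity -/

namespace Wiener

variable {m : ℕ}

theorem value_conj_of_coeff_neg {c : Wiener m}
    (h : ∀ n, c.coeff (-n) = starRingEnd ℂ (c.coeff n)) (x : ℝ) :
    starRingEnd ℂ (c.value x) = c.value x := by
  unfold value
  rw [Complex.conj_tsum, ← (Equiv.neg ℤ).tsum_eq]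
  refine tsum_congr fun n => ?_
  rw [Equiv.neg_apply, map_mul, ← Complex.exp_conj, h]
  simp

theorem coeff_neg_of_value_conj {c : Wiener m}
    (h : ∀ x, starRingEnd ℂ (c.value x) = c.value x) (n : ℤ) :
    c.coeff (-n) = starRingEnd ℂ (c.coeff n) := by
  have h1 := integral_value_mul_exp c n
  have h2 := integral_value_mul_exp c (-n)
  have h3 := congrArg (starRingEnd ℂ) h1
  rw [← intervalIntegral.intervalIntegral_conj] at h3
  have e : ∀ x : ℝ, starRingEnd ℂ (c.value x * Complex.exp (-(Complex.I * n * x))) =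
      c.value x * Complex.exp (-(Complex.I * ((-n : ℤ) : ℂ) * x)) := by
    intro x
    rw [map_mul, h, ← Complex.exp_conj]; simp
  simp_rw [e, h2] at h3
  simp only [map_mul, Complex.conj_ofReal, Complex.conj_ofNat] at h3
  have : (2 * Real.pi : ℂ) ≠ 0 := by simp [Real.pi_ne_zero]
  exact mul_left_cancel₀ this h3

theorem hasDerivAt_value {m' : ℕ} {c : Wiener m} {d : Wiener m'}
    (h : ∀ n, d.coeff n = Complex.I * n * c.coeff n) (x : ℝ) :
    HasDerivAt c.value (d.value x) x := by
  have key := hasDerivAt_tsum (u := fun n => ‖d.coeff n‖)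
    (g := fun (n : ℤ) (y : ℝ) => c.coeff n * Complex.exp (Complex.I * n * y))
    (g' := fun (n : ℤ) (y : ℝ) => d.coeff n * Complex.exp (Complex.I * n * y))
    d.summable_norm (fun n y => ?_) (fun n y => ?_) (c.summable_value 0) x
  · exact key
  · have h1 : HasDerivAt (fun y : ℝ => Complex.I * n * (y : ℂ)) (Complex.I * n) y := by
      simpa using (Complex.ofRealCLM.hasDerivAt (x := y)).const_mul (Complex.I * n)
    exact (h1.cexp.const_mul (c.coeff n)).congr_deriv (by rw [h]; ring)
  · rw [norm_mul, norm_exp_I, mul_one]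

theorem continuous_value (c : Wiener m) : Continuous c.value := by
  refine continuous_tsum (u := fun n => ‖c.coeff n‖) (fun n => by fun_prop) c.summable_norm
    fun n x => ?_
  rw [norm_mul, norm_exp_I, mul_one]

theorem value_periodic (c : Wiener m) : Function.Periodic c.value (2 * Real.pi) := by
  intro x
  unfold value
  refine tsum_congr fun n => ?_
  congr 1
  rw [Complex.exp_eq_exp_iff_exists_int]
  exact ⟨n, by push_cast; ring⟩

end Wiener
end
end GSQG

namespace GSQG
noncomputable section

/-! ### The kernel `(2 sin (τ / 2))^(-α)` -/

/-- The kernel `(4 sin² (τ / 2))^(-α/2)`. -/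
def kern (α τ : ℝ) : ℝ := ((4 * Real.sin (τ / 2) ^ 2) ^ (α / 2))⁻¹

theorem sin_half_pos {τ : ℝ} (h : τ ∈ Ioo 0 (2 * Real.pi)) : 0 < Real.sin (τ / 2) :=
  Real.sin_pos_of_pos_of_lt_pi (by linarith [h.1]) (by linarith [h.2])

theorem kern_eq {α τ : ℝ} (h : τ ∈ Ioo 0 (2 * Real.pi)) :
    kern α τ = (2 * Real.sin (τ / 2)) ^ (-α) := by
  have := sin_half_pos h
  rw [kern, show 4 * Real.sin (τ / 2) ^ 2 = (2 * Real.sin (τ / 2)) ^ (2 : ℝ) by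
    rw [Real.rpow_two]; ring, ← Real.rpow_mul (by positivity), Real.rpow_neg (by positivity)]
  congr 2; ring

theorem kern_nonneg (α τ : ℝ) : 0 ≤ kern α τ := by unfold kern; positivity

theorem measurable_kern (α : ℝ) : Measurable (kern α) := by unfold kern; fun_prop

theorem kern_symm (α τ : ℝ) : kern α (2 * Real.pi - τ) = kern α τ := by
  unfold kern
  rw [show (2 * Real.pi - τ) / 2 = Real.pi - τ / 2 by ring, Real.sin_pi_sub]

theorem two_mul_sin_half_mul_kern {α τ : ℝ} (h : τ ∈ Ioo 0 (2 * Real.pi)) :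
    2 * Real.sin (τ / 2) * kern α τ = (2 * Real.sin (τ / 2)) ^ (1 - α) := by
  have := sin_half_pos h
  rw [kern_eq h, sub_eq_add_neg, Real.rpow_add (by positivity), Real.rpow_one]

/-- Induction by the addition formula. At `x = τ / 2` it compares the mode `n` of a difference `f(x)
- f(x - τ)` with that of the derivative, times `2 sin (τ / 2)`. -/
theorem abs_sin_nat_mul_le (n : ℕ) (x : ℝ) : |Real.sin (n * x)| ≤ n * |Real.sin x| := by
  induction n with
  | zero => simp
  | succ n ih =>
    have e : ((n + 1 : ℕ) : ℝ) * x = n * x + x := by push_cast; ring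
    rw [e, Real.sin_add]
    refine (abs_add_le _ _).trans ?_
    rw [abs_mul, abs_mul]
    push_cast
    nlinarith [Real.abs_cos_le_one x, Real.abs_cos_le_one (n * x), abs_nonneg (Real.sin x),
      abs_nonneg (Real.sin (n * x))]

/-- A bounded measurable function is interval integrable. -/

theorem intervalIntegrable_two_sin_rpow {p : ℝ} (hp : -1 < p) (hp0 : p ≤ 0) :
    IntervalIntegrable (fun τ => (2 * Real.sin (τ / 2)) ^ p) MeasureTheory.volume
      0 (2 * Real.pi) := by
  have h1 : IntervalIntegrable (fun τ : ℝ => (2 / Real.pi) ^ p * τ ^ p) MeasureTheory.volume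
      0 Real.pi := (intervalIntegral.intervalIntegrable_rpow' hp).const_mul _
  have h2 : IntervalIntegrable (fun τ => (2 * Real.sin (τ / 2)) ^ p) MeasureTheory.volume
      0 Real.pi := by
    refine h1.mono_fun (Measurable.aestronglyMeasurable (by fun_prop)) ?_
    filter_upwards [MeasureTheory.ae_restrict_mem measurableSet_uIoc] with τ hτ
    rw [uIoc_of_le Real.pi_pos.le] at hτ
    -- Jordan's inequality gives `2 sin (τ / 2) ≥ (2 / π) τ`, and the non-positive power reverses
    -- it.
    have h3 := Real.mul_le_sin (x := τ / 2) (by linarith [hτ.1]) (by linarith [hτ.2])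
    have h4 : 0 < 2 / Real.pi * τ := mul_pos (by positivity) hτ.1
    have h5 : 2 / Real.pi * τ ≤ 2 * Real.sin (τ / 2) := by linarith
    rw [← Real.mul_rpow (by positivity) hτ.1.le, Real.norm_eq_abs, Real.norm_eq_abs,
      abs_of_nonneg (Real.rpow_nonneg h4.le _), abs_of_nonneg (Real.rpow_nonneg (by linarith) _)]
    exact Real.rpow_le_rpow_of_nonpos h4 h5 hp0
  -- The half `[π, 2π]` follows by the reflection `τ ↦ 2π - τ`.
  have h3 := (h2.comp_sub_left (2 * Real.pi)).symm
  have e : ∀ τ : ℝ, (2 * Real.sin ((2 * Real.pi - τ) / 2)) ^ p = (2 * Real.sin (τ / 2)) ^ p := by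
    intro τ
    rw [show (2 * Real.pi - τ) / 2 = Real.pi - τ / 2 by ring, Real.sin_pi_sub]
  simp only [e] at h3
  rw [show 2 * Real.pi - Real.pi = Real.pi by ring, sub_zero] at h3
  exact h2.trans h3

theorem intervalIntegrable_of_le_rpow {g : ℝ → ℝ} (hg : Measurable g) {C p : ℝ} (hp : -1 < p)
    (hp0 : p ≤ 0) (h : ∀ τ ∈ Ioo 0 (2 * Real.pi), |g τ| ≤ C * (2 * Real.sin (τ / 2)) ^ p) :
    IntervalIntegrable g MeasureTheory.volume 0 (2 * Real.pi) := by
  have h1 := ((intervalIntegrable_two_sin_rpow hp hp0).const_mul C)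
  rw [intervalIntegrable_iff_integrableOn_Ioo_of_le (by positivity)] at h1 ⊢
  refine h1.mono' hg.aestronglyMeasurable ?_
  filter_upwards [MeasureTheory.ae_restrict_mem measurableSet_Ioo] with τ hτ
  exact h τ hτ

theorem abs_sin_le_two_mul_sin_half {τ : ℝ} (h : τ ∈ Ioo 0 (2 * Real.pi)) :
    |Real.sin τ| ≤ 2 * Real.sin (τ / 2) := by
  have := sin_half_pos h
  have e : Real.sin τ = 2 * Real.sin (τ / 2) * Real.cos (τ / 2) := by
    rw [← Real.sin_two_mul]; ring_nf
  rw [e, abs_mul, abs_of_pos (by positivity)]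
  exact mul_le_of_le_one_right (by positivity) (Real.abs_cos_le_one _)

variable {α : ℝ}

/-- For `α > 1` the kernel itself is not integrable. The sine vanishes at both ends of the period
and lowers the order of the singularity to `α - 1 < 1`. -/
theorem intervalIntegrable_sin_mul_kern (hα : α ∈ Ioo (1 : ℝ) 2) :
    IntervalIntegrable (fun τ => Real.sin τ * kern α τ) MeasureTheory.volume
      0 (2 * Real.pi) := by
  refine intervalIntegrable_of_le_rpow (C := 1) (p := 1 - α)
    ((by fun_prop : Measurable Real.sin).mul (measurable_kern α)) (by linarith [hα.2])
    (by linarith [hα.1]) fun τ hτ => ?_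
  rw [one_mul, ← two_mul_sin_half_mul_kern hτ, abs_mul, abs_of_nonneg (kern_nonneg α τ)]
  exact mul_le_mul_of_nonneg_right (abs_sin_le_two_mul_sin_half hτ) (kern_nonneg α τ)

theorem integral_eq_zero_of_odd {g : ℝ → ℝ} (h : ∀ τ, g (2 * Real.pi - τ) = -g τ) :
    ∫ τ in (0 : ℝ)..(2 * Real.pi), g τ = 0 := by
  have h1 := intervalIntegral.integral_comp_sub_left (a := 0) (b := 2 * Real.pi) g (2 * Real.pi)
  simp only [h, sub_self, sub_zero, intervalIntegral.integral_neg] at h1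
  linarith

theorem integral_sin_mul_kern (α : ℝ) :
    ∫ τ in (0 : ℝ)..(2 * Real.pi), Real.sin τ * kern α τ = 0 := by
  refine integral_eq_zero_of_odd fun τ => ?_
  rw [kern_symm, Real.sin_two_pi_sub]; ring

theorem abs_sin_half_mul_kern_le (n : ℕ) {τ : ℝ} (h : τ ∈ Ioo 0 (2 * Real.pi)) :
    |2 * |Real.sin (n * τ / 2)| * kern α τ| ≤ n * (2 * Real.sin (τ / 2)) ^ (1 - α) := by
  have h1 := abs_sin_nat_mul_le n (τ / 2)
  rw [abs_of_pos (sin_half_pos h), ← mul_div_assoc] at h1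
  rw [abs_of_nonneg (mul_nonneg (by positivity) (kern_nonneg α τ)),
    ← two_mul_sin_half_mul_kern h, ← mul_assoc]
  exact mul_le_mul_of_nonneg_right (by linarith) (kern_nonneg α τ)

theorem intervalIntegrable_abs_sin_mul_kern (hα : α ∈ Ioo (1 : ℝ) 2) (n : ℕ) :
    IntervalIntegrable (fun τ => 2 * |Real.sin (n * τ / 2)| * kern α τ) MeasureTheory.volume
      0 (2 * Real.pi) := by
  refine intervalIntegrable_of_le_rpow (C := n) (p := 1 - α)
    ((by fun_prop : Measurable fun τ : ℝ => 2 * |Real.sin (n * τ / 2)|).mul (measurable_kern α))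
    (by linarith [hα.2]) (by linarith [hα.1]) fun τ hτ => abs_sin_half_mul_kern_le n hτ

theorem kern_le {τ : ℝ} (h0 : 0 < τ) (h1 : τ ≤ Real.pi) (hα : 0 < α) :
    kern α τ ≤ (2 / Real.pi) ^ (-α) * τ ^ (-α) := by
  have h3 := Real.mul_le_sin (x := τ / 2) (by linarith) (by linarith)
  have h4 : 0 < 2 / Real.pi * τ := mul_pos (by positivity) h0
  rw [← Real.mul_rpow (by positivity) h0.le, kern_eq ⟨h0, by linarith [Real.pi_pos]⟩]
  exact Real.rpow_le_rpow_of_nonpos h4 (by linarith) (by linarith)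

/-- The half period is split at `τ = 1 / n`. Below, `|sin (n τ / 2)| ≤ n τ / 2` and `τ ^ (1 - α)` is
integrable because `α < 2`; above, `|sin| ≤ 1` and the integral of `τ ^ (-α)` is dominated by its
lower end because `α > 1`. Both pieces are of order `n ^ (α - 1)`. Together with the factor `n` of a
derivative this explains the exponent in `profileWeight`. -/
theorem integral_abs_sin_mul_kern_le (hα : α ∈ Ioo (1 : ℝ) 2) : ∃ C, 0 ≤ C ∧ ∀ n : ℕ, n ≠ 0 →
    ∫ τ in (0 : ℝ)..(2 * Real.pi), 2 * |Real.sin (n * τ / 2)| * kern α τ ≤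
      C * (n : ℝ) ^ (α - 1) := by
  obtain ⟨hα1, hα2⟩ := hα
  set A : ℝ := (2 / Real.pi) ^ (-α) with hA
  have hA0 : 0 ≤ A := by positivity
  refine ⟨2 * (A / (2 - α) + 2 * A / (α - 1)), ?_, fun n hn => ?_⟩
  · have : 0 < 2 - α := by linarith
    have : 0 < α - 1 := by linarith
    positivity
  have hn0 : (0 : ℝ) < n := by positivity
  have hn1 : (1 : ℝ) ≤ n := by exact_mod_cast Nat.one_le_iff_ne_zero.2 hn
  have hle : (1 / (n : ℝ)) ≤ Real.pi := by
    have : 1 / (n : ℝ) ≤ 1 := by rw [div_le_one hn0]; exact hn1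
    linarith [Real.pi_gt_three]
  have hpos : 0 < 1 / (n : ℝ) := by positivity
  set g : ℝ → ℝ := fun τ => 2 * |Real.sin (n * τ / 2)| * kern α τ with hg
  have hI := intervalIntegrable_abs_sin_mul_kern ⟨hα1, hα2⟩ n
  have hsub : ∀ {c d : ℝ}, 0 ≤ c → c ≤ d → d ≤ 2 * Real.pi →
      IntervalIntegrable g MeasureTheory.volume c d := by
    intro c d h1 h2 h3
    refine hI.mono_set ?_
    rw [uIcc_of_le h2, uIcc_of_le (by positivity)]
    exact Icc_subset_Icc h1 h3
  have hpi := Real.pi_pos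
  -- Under `τ ↦ 2π - τ` the sine of `n τ / 2` changes at most by a sign, so its absolute value is
  -- symmetric and the two halves of the period contribute equally.
  have hsymm : ∫ τ in Real.pi..(2 * Real.pi), g τ = ∫ τ in (0 : ℝ)..Real.pi, g τ := by
    have h1 := intervalIntegral.integral_comp_sub_left (a := 0) (b := Real.pi) g (2 * Real.pi)
    rw [show 2 * Real.pi - Real.pi = Real.pi by ring, sub_zero] at h1
    rw [← h1]
    congr 1
    funext τ
    simp only [hg, kern_symm]
    congr 2
    rw [show (n : ℝ) * (2 * Real.pi - τ) / 2 = n * Real.pi - n * τ / 2 by ring, Real.sin_sub,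
      Real.sin_nat_mul_pi, zero_mul, zero_sub, abs_neg, abs_mul]
    rw [Real.abs_cos_eq_sqrt_one_sub_sin_sq, Real.sin_nat_mul_pi]; simp
  have hfirst : ∫ τ in (0 : ℝ)..(1 / n), g τ ≤ A / (2 - α) * (n : ℝ) ^ (α - 1) := by
    have hi : IntervalIntegrable (fun τ : ℝ => A * n * τ ^ (1 - α)) MeasureTheory.volume
        0 (1 / n) :=
      (intervalIntegral.intervalIntegrable_rpow' (by linarith)).const_mul _
    calc _ ≤ ∫ τ in (0 : ℝ)..(1 / n), A * n * τ ^ (1 - α) := by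
          refine intervalIntegral.integral_mono_on_of_le_Ioo hpos.le
            (hsub le_rfl hpos.le (by linarith)) hi fun τ hτ => ?_
          have h1 : |Real.sin (n * τ / 2)| ≤ n * τ / 2 := by
            refine Real.abs_sin_le_abs.trans (le_of_eq (abs_of_nonneg ?_))
            have := hτ.1; positivity
          have h2 := kern_le (α := α) hτ.1 (by linarith [hτ.2]) (by linarith)
          have h3 : τ ^ (1 - α) = τ * τ ^ (-α) := by
            rw [sub_eq_add_neg, Real.rpow_add hτ.1, Real.rpow_one]
          have := hτ.1
          calc g τ ≤ (n * τ) * (A * τ ^ (-α)) :=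
                mul_le_mul (by linarith) h2 (kern_nonneg _ _) (by positivity)
            _ = _ := by rw [h3]; ring
      _ = _ := by
          rw [intervalIntegral.integral_const_mul, integral_rpow (Or.inl (by linarith)),
            Real.zero_rpow (by linarith), one_div, Real.inv_rpow hn0.le, ← Real.rpow_neg hn0.le,
            show -(1 - α + 1) = (α - 1) - 1 by ring, Real.rpow_sub_one hn0.ne',
            show 1 - α + 1 = 2 - α by ring]
          field_simp
          ring
  have hsecond : ∫ τ in (1 / (n : ℝ))..Real.pi, g τ ≤ 2 * A / (α - 1) * (n : ℝ) ^ (α - 1) := by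
    have h0 : (0 : ℝ) ∉ uIcc (1 / (n : ℝ)) Real.pi := by
      rw [uIcc_of_le hle]; exact fun h => absurd h.1 (not_le.2 hpos)
    have hi : IntervalIntegrable (fun τ : ℝ => 2 * A * τ ^ (-α)) MeasureTheory.volume
        (1 / n) Real.pi :=
      (intervalIntegral.intervalIntegrable_rpow (Or.inr h0)).const_mul _
    calc _ ≤ ∫ τ in (1 / (n : ℝ))..Real.pi, 2 * A * τ ^ (-α) := by
          refine intervalIntegral.integral_mono_on_of_le_Ioo hle
            (hsub hpos.le hle (by linarith)) hi fun τ hτ => ?_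
          have hτ0 : 0 < τ := hpos.trans hτ.1
          have h2 := kern_le (α := α) hτ0 hτ.2.le (by linarith)
          calc g τ ≤ 2 * (A * τ ^ (-α)) :=
                mul_le_mul (by linarith [Real.abs_sin_le_one (n * τ / 2)]) h2
                  (kern_nonneg _ _) (by positivity)
            _ = _ := by ring
      _ ≤ _ := by
          rw [intervalIntegral.integral_const_mul, integral_rpow (Or.inr ⟨by linarith, h0⟩),
            one_div, Real.inv_rpow hn0.le, ← Real.rpow_neg hn0.le,
            show -(-α + 1) = α - 1 by ring, show -α + 1 = -(α - 1) by ring, div_neg, ← neg_div,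
            neg_sub, mul_div_assoc', mul_comm (2 * A / (α - 1)), mul_div_assoc']
          have : 0 < α - 1 := by linarith
          have h3 : 0 ≤ Real.pi ^ (-(α - 1)) := by positivity
          refine div_le_div_of_nonneg_right ?_ this.le
          nlinarith
  have h1 := intervalIntegral.integral_add_adjacent_intervals
    (hsub le_rfl hpos.le (by linarith)) (hsub hpos.le hle (by linarith))
  have h2 := intervalIntegral.integral_add_adjacent_intervals
    (hsub le_rfl hpi.le (by linarith)) (hsub hpi.le (by linarith) le_rfl)
  have : ∫ τ in (0 : ℝ)..(2 * Real.pi), g τ ≤ 2 * (A / (2 - α) * (n : ℝ) ^ (α - 1) +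
      2 * A / (α - 1) * (n : ℝ) ^ (α - 1)) := by linarith
  refine this.trans (le_of_eq (by ring))

/-! ### The symbol of the linearized operator -/

variable {α : ℝ}

/-- `∫ sin ((n + 1/2) y) (2 sin (y/2))^(1-α) dy`. -/
def sineMoment (α : ℝ) (n : ℕ) : ℝ :=
  ∫ y in (0 : ℝ)..(2 * Real.pi), Real.sin ((n + 1 / 2) * y) * (2 * Real.sin (y / 2)) ^ (1 - α)

/-- `∫ (1 - cos (n y)) (2 sin (y/2))^(-α) dy`. -/
def cosSymbol (α : ℝ) (n : ℕ) : ℝ :=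
  ∫ y in (0 : ℝ)..(2 * Real.pi), (1 - Real.cos (n * y)) * kern α y

theorem one_sub_cos_eq (n : ℕ) (y : ℝ) :
    1 - Real.cos (n * y) = 2 * Real.sin (n * y / 2) ^ 2 := by
  rw [show (n : ℝ) * y = 2 * (n * y / 2) by ring, Real.cos_two_mul, Real.cos_sq']; ring_nf

theorem abs_one_sub_cos_mul_kern_le (n : ℕ) (y : ℝ) :
    |(1 - Real.cos (n * y)) * kern α y| ≤ 2 * |Real.sin (n * y / 2)| * kern α y := by
  rw [abs_mul, abs_of_nonneg (kern_nonneg α y), one_sub_cos_eq, abs_mul, abs_two, abs_pow]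
  refine mul_le_mul_of_nonneg_right ?_ (kern_nonneg α y)
  nlinarith [abs_nonneg (Real.sin (n * y / 2)), Real.abs_sin_le_one (n * y / 2)]

theorem measurable_cos_kern (n : ℕ) :
    Measurable fun y : ℝ => (1 - Real.cos (n * y)) * kern α y :=
  (by fun_prop : Measurable fun y : ℝ => 1 - Real.cos (n * y)).mul (measurable_kern α)

theorem intervalIntegrable_cos_kern (hα : α ∈ Ioo (1 : ℝ) 2) (n : ℕ) :
    IntervalIntegrable (fun y => (1 - Real.cos (n * y)) * kern α y) MeasureTheory.volume
      0 (2 * Real.pi) := by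
  refine (intervalIntegrable_abs_sin_mul_kern hα n).mono_fun
    (measurable_cos_kern n).aestronglyMeasurable (Eventually.of_forall fun y => ?_)
  exact (abs_one_sub_cos_mul_kern_le n y).trans (le_abs_self _)

theorem cosSymbol_nonneg (α : ℝ) (n : ℕ) : 0 ≤ cosSymbol α n :=
  intervalIntegral.integral_nonneg (by positivity) fun y _ =>
    mul_nonneg (by linarith [Real.cos_le_one (n * y)]) (kern_nonneg α y)

theorem cosSymbol_zero (α : ℝ) : cosSymbol α 0 = 0 := by simp [cosSymbol]

theorem cosSymbol_le (hα : α ∈ Ioo (1 : ℝ) 2) : ∃ C, 0 ≤ C ∧ ∀ n : ℕ, n ≠ 0 →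
    cosSymbol α n ≤ C * (n : ℝ) ^ (α - 1) := by
  obtain ⟨C, hC, h⟩ := integral_abs_sin_mul_kern_le hα
  refine ⟨C, hC, fun n hn => le_trans ?_ (h n hn)⟩
  exact intervalIntegral.integral_mono_on (by positivity) (intervalIntegrable_cos_kern hα n)
    (intervalIntegrable_abs_sin_mul_kern hα n)
    fun y _ => (le_abs_self _).trans (abs_one_sub_cos_mul_kern_le n y)

/-- By `cos (n y) - cos ((n + 1) y) = 2 sin ((n + 1/2) y) sin (y / 2)`; the factor `2 sin (y / 2)`
raises the exponent of the kernel to `1 - α`. -/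
theorem cosSymbol_succ_sub (hα : α ∈ Ioo (1 : ℝ) 2) (n : ℕ) :
    cosSymbol α (n + 1) - cosSymbol α n = sineMoment α n := by
  unfold cosSymbol sineMoment
  rw [← intervalIntegral.integral_sub (intervalIntegrable_cos_kern hα _)
    (intervalIntegrable_cos_kern hα _)]
  refine intervalIntegral.integral_congr_Ioo_of_le (by positivity) fun y hy => ?_
  rw [← two_mul_sin_half_mul_kern hy]
  have h1 := Real.cos_sub_cos (n * y) (((n + 1 : ℕ) : ℝ) * y)
  rw [show ((n : ℝ) * y + ((n + 1 : ℕ) : ℝ) * y) / 2 = (n + 1 / 2) * y by push_cast; ring,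
    show ((n : ℝ) * y - ((n + 1 : ℕ) : ℝ) * y) / 2 = -(y / 2) by push_cast; ring,
    Real.sin_neg] at h1
  linear_combination (kern α y) * h1

theorem intervalIntegrable_sine (hα : α ∈ Ioo (1 : ℝ) 2) (a : ℝ) :
    IntervalIntegrable (fun y => Real.sin (a * y) * (2 * Real.sin (y / 2)) ^ (1 - α))
      MeasureTheory.volume 0 (2 * Real.pi) := by
  refine intervalIntegrable_of_le_rpow (C := 1) (p := 1 - α) (by fun_prop) (by linarith [hα.2])
    (by linarith [hα.1]) fun τ hτ => ?_
  have : 0 ≤ (2 * Real.sin (τ / 2)) ^ (1 - α) := by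
    have := sin_half_pos hτ; positivity
  rw [abs_mul, abs_of_nonneg this]
  exact mul_le_mul_of_nonneg_right (Real.abs_sin_le_one _) this

/-- The derivative of `sin ((n + 1) y) (2 sin (y / 2)) ^ (2 - α)` is integrated over the period. The
boundary terms vanish because `α < 2`, and the half-angle addition formulas express the derivative
by the two neighbouring integrands. -/
theorem sineMoment_recurrence (hα : α ∈ Ioo (1 : ℝ) 2) (n : ℕ) :
    ((n : ℝ) + 2 - α / 2) * sineMoment α (n + 1) = (n + α / 2) * sineMoment α n := by
  have hp : 0 < 2 - α := by linarith [hα.2]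
  set F : ℝ → ℝ := fun y => Real.sin ((n + 1 : ℝ) * y) * (2 * Real.sin (y / 2)) ^ (2 - α) with hF
  set G : ℝ → ℝ := fun y =>
    (n + 2 - α / 2) * (Real.sin (((n + 1 : ℕ) + 1 / 2) * y) * (2 * Real.sin (y / 2)) ^ (1 - α)) -
      (n + α / 2) * (Real.sin ((n + 1 / 2) * y) * (2 * Real.sin (y / 2)) ^ (1 - α)) with hG
  have hcont : Continuous F := by
    refine Continuous.mul (by fun_prop) ?_
    exact (by fun_prop : Continuous fun y : ℝ => 2 * Real.sin (y / 2)).rpow_const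
      fun _ => Or.inr hp.le
  have hd : ∀ y ∈ Ioo 0 (2 * Real.pi), HasDerivAt F (G y) y := by
    intro y hy
    have hs := sin_half_pos hy
    have h1 : HasDerivAt (fun y : ℝ => Real.sin ((n + 1 : ℝ) * y))
        (Real.cos ((n + 1 : ℝ) * y) * (n + 1)) y := by
      simpa using ((hasDerivAt_id y).const_mul ((n : ℝ) + 1)).sin
    have h2 : HasDerivAt (fun y : ℝ => 2 * Real.sin (y / 2)) (Real.cos (y / 2)) y := by
      have := (((hasDerivAt_id y).div_const 2).sin).const_mul 2
      refine this.congr_deriv ?_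
      simp; ring
    have h3 := h2.rpow_const (p := 2 - α) (Or.inl (by positivity))
    refine (h1.mul h3).congr_deriv ?_
    have e1 : (2 * Real.sin (y / 2)) ^ (2 - α) =
        2 * Real.sin (y / 2) * (2 * Real.sin (y / 2)) ^ (1 - α) := by
      rw [show 2 - α = 1 + (1 - α) by ring, Real.rpow_add (by positivity), Real.rpow_one]
    have e2 : Real.sin (((n + 1 : ℕ) + 1 / 2) * y) =
        Real.sin ((n + 1) * y) * Real.cos (y / 2) + Real.cos ((n + 1) * y) * Real.sin (y / 2) := by
      rw [← Real.sin_add]; push_cast; ring_nf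
    have e3 : Real.sin ((n + 1 / 2) * y) =
        Real.sin ((n + 1) * y) * Real.cos (y / 2) - Real.cos ((n + 1) * y) * Real.sin (y / 2) := by
      rw [← Real.sin_sub]; ring_nf
    simp only [hG, e2, e3, e1, show 2 - α - 1 = 1 - α by ring]
    ring
  have hi1 := (intervalIntegrable_sine hα ((n + 1 : ℕ) + 1 / 2)).const_mul (n + 2 - α / 2)
  have hi2 := (intervalIntegrable_sine hα (n + 1 / 2)).const_mul (n + α / 2)
  have key := intervalIntegral.integral_eq_sub_of_hasDerivAt_of_le (by positivity)
    hcont.continuousOn hd (hi1.sub hi2)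
  have e0 : F (2 * Real.pi) - F 0 = 0 := by
    simp only [hF]
    rw [show 2 * Real.pi / 2 = Real.pi by ring]
    simp [Real.zero_rpow hp.ne']
  rw [e0, intervalIntegral.integral_sub hi1 hi2, intervalIntegral.integral_const_mul,
    intervalIntegral.integral_const_mul] at key
  unfold sineMoment
  linarith

/-- `∫ sin^p` over a half period, through the Beta function. -/
theorem integral_sin_rpow {p : ℝ} (hp : 0 < p) :
    ∫ θ in (0 : ℝ)..Real.pi, Real.sin θ ^ p =
      2 ^ p * (Real.Gamma ((p + 1) / 2) ^ 2 / Real.Gamma (p + 1)) := by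
  have hq : 0 < (p + 1) / 2 := by linarith
  set g : ℝ → ℝ := fun x => (x * (1 - x)) ^ ((p + 1) / 2 - 1) with hg
  have hbeta : ∀ x ∈ Ioo (0 : ℝ) 1,
      (x : ℂ) ^ (((p + 1) / 2 : ℝ) - 1 : ℂ) * (1 - (x : ℂ)) ^ (((p + 1) / 2 : ℝ) - 1 : ℂ) =
        ((g x : ℝ) : ℂ) := by
    intro x hx
    have h1 : (1 - (x : ℂ)) = ((1 - x : ℝ) : ℂ) := by push_cast; ring
    have h2 : (((p + 1) / 2 : ℝ) - 1 : ℂ) = (((p + 1) / 2 - 1 : ℝ) : ℂ) := by push_cast; ring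
    rw [h1, h2, ← Complex.ofReal_cpow hx.1.le, ← Complex.ofReal_cpow (by linarith [hx.2]),
      ← Complex.ofReal_mul, ← Real.mul_rpow hx.1.le (by linarith [hx.2])]
  have hconv := Complex.betaIntegral_convergent (u := ((p + 1) / 2 : ℝ)) (v := ((p + 1) / 2 : ℝ))
    (by simpa using hq) (by simpa using hq)
  have hint : MeasureTheory.IntegrableOn g (Icc 0 1) := by
    rw [intervalIntegrable_iff_integrableOn_Ioo_of_le zero_le_one] at hconv
    rw [integrableOn_Icc_iff_integrableOn_Ioo]
    have := hconv.re
    refine this.congr ?_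
    filter_upwards [MeasureTheory.ae_restrict_mem measurableSet_Ioo] with x hx
    rw [hbeta x hx]; simp
  have hG : ∫ x in (0 : ℝ)..1, g x = Real.Gamma ((p + 1) / 2) ^ 2 / Real.Gamma (p + 1) := by
    have h1 := Complex.betaIntegral_eq_Gamma_mul_div ((p + 1) / 2 : ℝ) ((p + 1) / 2 : ℝ)
      (by simpa using hq) (by simpa using hq)
    have h2 : Complex.betaIntegral ((p + 1) / 2 : ℝ) ((p + 1) / 2 : ℝ) =
        ((∫ x in (0 : ℝ)..1, g x : ℝ) : ℂ) := by
      rw [Complex.betaIntegral, ← intervalIntegral.integral_ofReal]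
      exact intervalIntegral.integral_congr_Ioo_of_le zero_le_one fun x hx => hbeta x hx
    rw [h2, ← Complex.ofReal_add, add_halves, Complex.Gamma_ofReal, Complex.Gamma_ofReal] at h1
    rw [sq]
    exact_mod_cast h1
  -- The substitution `x = (1 - cos θ) / 2` gives `x (1 - x) = (sin θ / 2)²` and `dx = (sin θ / 2)
  -- dθ`, so the Beta integral with both arguments `(p + 1) / 2` becomes a multiple of `∫ sin^p`.
  set f : ℝ → ℝ := fun θ => (1 - Real.cos θ) / 2 with hf
  have himg : f '' uIcc 0 Real.pi ⊆ Icc 0 1 := by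
    rintro _ ⟨θ, -, rfl⟩
    exact ⟨by simp only [hf]; linarith [Real.cos_le_one θ],
      by simp only [hf]; linarith [Real.neg_one_le_cos θ]⟩
  have hprod : ∀ θ ∈ Ioo (0 : ℝ) Real.pi,
      (g ∘ f) θ * (Real.sin θ / 2) = 2 ^ (-p) * Real.sin θ ^ p := by
    intro θ hθ
    have hs := Real.sin_pos_of_pos_of_lt_pi hθ.1 hθ.2
    have e1 : f θ * (1 - f θ) = (Real.sin θ / 2) ^ (2 : ℝ) := by
      rw [Real.rpow_two, div_pow, Real.sin_sq]; simp only [hf]; ring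
    have e2 : (g ∘ f) θ = (Real.sin θ / 2) ^ (p - 1) := by
      simp only [Function.comp, hg, e1]
      rw [← Real.rpow_mul (by positivity)]; ring_nf
    rw [e2, Real.rpow_sub_one (by positivity), div_mul_cancel₀ _ (by positivity),
      Real.div_rpow hs.le two_pos.le, Real.rpow_neg two_pos.le]
    ring
  have hcont : Continuous fun θ : ℝ => 2 ^ (-p) * Real.sin θ ^ p :=
    continuous_const.mul (Real.continuous_sin.rpow_const fun _ => Or.inr hp.le)
  have key := intervalIntegral.integral_comp_mul_deriv''' (a := 0) (b := Real.pi) (f := f)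
    (f' := fun θ => Real.sin θ / 2) (g := g) (by fun_prop)
    (fun θ _ => by
      have := ((Real.hasDerivAt_cos θ).const_sub 1).div_const 2
      exact (this.congr_deriv (by ring)).hasDerivWithinAt)
    (by
      rintro _ ⟨θ, hθ, rfl⟩
      rw [min_eq_left Real.pi_pos.le, max_eq_right Real.pi_pos.le] at hθ
      have hs := Real.sin_pos_of_pos_of_lt_pi hθ.1 hθ.2
      refine ContinuousAt.continuousWithinAt ?_
      refine ContinuousAt.rpow_const (by fun_prop) (Or.inl ?_)
      have : f θ * (1 - f θ) = (Real.sin θ / 2) ^ 2 := by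
        rw [div_pow, Real.sin_sq]; simp only [hf]; ring
      rw [this]; positivity)
    (hint.mono_set himg)
    (by
      rw [uIcc_of_le Real.pi_pos.le, integrableOn_Icc_iff_integrableOn_Ioo]
      refine ((hcont.integrableOn_Icc (a := 0) (b := Real.pi)).mono_set
        Ioo_subset_Icc_self).congr ?_
      filter_upwards [MeasureTheory.ae_restrict_mem measurableSet_Ioo] with θ hθ
      exact (hprod θ hθ).symm)
  rw [intervalIntegral.integral_congr_Ioo_of_le Real.pi_pos.le hprod,
    intervalIntegral.integral_const_mul] at key
  simp only [hf, Real.cos_zero, Real.cos_pi] at key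
  norm_num at key
  rw [hG] at key
  rw [← key, ← mul_assoc, ← Real.rpow_add two_pos]; simp

theorem sineMoment_zero (hα : α ∈ Ioo (1 : ℝ) 2) :
    sineMoment α 0 = Real.pi * Real.Gamma (3 - α) / Real.Gamma (2 - α / 2) ^ 2 := by
  have h0 : sineMoment α 0 = ∫ θ in (0 : ℝ)..Real.pi, 2 ^ (2 - α) * Real.sin θ ^ (2 - α) := by
    have h1 := intervalIntegral.integral_comp_div (a := 0) (b := 2 * Real.pi)
      (fun θ => 2 ^ (2 - α) * Real.sin θ ^ (2 - α)) (c := 2) two_ne_zero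
    rw [zero_div, show 2 * Real.pi / 2 = Real.pi by ring, smul_eq_mul] at h1
    have h2 : sineMoment α 0 = (1 / 2) *
        ∫ y in (0 : ℝ)..(2 * Real.pi), 2 ^ (2 - α) * Real.sin (y / 2) ^ (2 - α) := by
      unfold sineMoment
      rw [← intervalIntegral.integral_const_mul]
      refine intervalIntegral.integral_congr_Ioo_of_le (by positivity) fun y hy => ?_
      have hs := sin_half_pos hy
      rw [← Real.mul_rpow (by norm_num) hs.le, show 2 - α = 1 + (1 - α) by ring,
        Real.rpow_add (by positivity), Real.rpow_one]
      rw [show ((0 : ℕ) + 1 / 2 : ℝ) * y = y / 2 by push_cast; ring]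
      ring_nf
    rw [h2, h1]; ring
  have hp : 0 < 2 - α := by linarith [hα.2]
  rw [h0, intervalIntegral.integral_const_mul, integral_sin_rpow hp]
  -- Legendre's duplication formula at `(3 - α) / 2` trades `Γ((3 - α) / 2)` for `Γ(2 - α / 2)`.
  have hd := Real.Gamma_mul_Gamma_add_half ((3 - α) / 2)
  rw [show (3 - α) / 2 + 1 / 2 = 2 - α / 2 by ring, show 2 * ((3 - α) / 2) = 3 - α by ring] at hd
  rw [show 2 - α + 1 = 3 - α by ring]
  have g1 : 0 < Real.Gamma (3 - α) := Real.Gamma_pos_of_pos (by linarith)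
  have g2 : 0 < Real.Gamma (2 - α / 2) := Real.Gamma_pos_of_pos (by linarith)
  rw [← mul_assoc, ← Real.rpow_add two_pos, mul_div_assoc', div_eq_div_iff g1.ne' (by positivity)]
  have hpi : Real.pi = Real.sqrt Real.pi ^ 2 := (Real.sq_sqrt Real.pi_pos.le).symm
  have h2 : (2 : ℝ) ^ (2 - α + (2 - α)) * ((2 : ℝ) ^ (1 - (3 - α))) ^ 2 = 1 := by
    rw [← Real.rpow_natCast, ← Real.rpow_mul two_pos.le, ← Real.rpow_add two_pos]
    norm_num
    ring_nf
    simp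
  calc _ = 2 ^ (2 - α + (2 - α)) *
        (Real.Gamma ((3 - α) / 2) * Real.Gamma (2 - α / 2)) ^ 2 := by ring
    _ = ((2 : ℝ) ^ (2 - α + (2 - α)) * ((2 : ℝ) ^ (1 - (3 - α))) ^ 2) *
        (Real.Gamma (3 - α) ^ 2 * Real.sqrt Real.pi ^ 2) := by rw [hd]; ring
    _ = _ := by rw [h2, ← hpi]; ring

/-- The initial value is a quotient of positive Gamma values, and both coefficients of the
recurrence are positive for `0 < α < 2`. -/
theorem sineMoment_pos (hα : α ∈ Ioo (1 : ℝ) 2) (n : ℕ) : 0 < sineMoment α n := by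
  induction n with
  | zero =>
    rw [sineMoment_zero hα]
    have g1 : 0 < Real.Gamma (3 - α) := Real.Gamma_pos_of_pos (by linarith [hα.2])
    have g2 : 0 < Real.Gamma (2 - α / 2) := Real.Gamma_pos_of_pos (by linarith [hα.2])
    positivity
  | succ n ih =>
    have h := sineMoment_recurrence hα n
    have h1 : 0 < (n : ℝ) + 2 - α / 2 := by linarith [hα.2, (Nat.cast_nonneg n : (0 : ℝ) ≤ n)]
    have h2 : 0 < ((n : ℝ) + α / 2) * sineMoment α n := by
      have := hα.1; positivity
    rw [← h] at h2
    exact (mul_pos_iff_of_pos_left h1).1 h2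

/-- The increments are the positive numbers `sineMoment α n`. This monotonicity is what keeps
`linSymbol α n` positive for `n ≥ 2`. -/
theorem cosSymbol_strictMono (hα : α ∈ Ioo (1 : ℝ) 2) : StrictMono (cosSymbol α) :=
  strictMono_nat_of_lt_succ fun n => by
    linarith [cosSymbol_succ_sub hα n, sineMoment_pos hα n]

/-- On `[0, π / n]` one has `1 - cos (n τ) ≥ 2 (n τ)² / π²` and the kernel is at least `τ ^ (-α)`.
Integrating over this interval alone already gives the order `n ^ (α - 1)`, with the constant
stated. -/
theorem le_cosSymbol (hα : α ∈ Ioo (1 : ℝ) 2) : ∃ c, 0 < c ∧ ∀ n : ℕ, n ≠ 0 →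
    c * (n : ℝ) ^ (α - 1) ≤ cosSymbol α n := by
  obtain ⟨hα1, hα2⟩ := hα
  have h3 : 0 < 3 - α := by linarith
  have hpi := Real.pi_pos
  refine ⟨2 / Real.pi ^ 2 * Real.pi ^ (3 - α) / (3 - α), by positivity, fun n hn => ?_⟩
  have hn0 : (0 : ℝ) < n := by positivity
  have hn1 : (1 : ℝ) ≤ n := by exact_mod_cast Nat.one_le_iff_ne_zero.2 hn
  have hle : Real.pi / n ≤ 2 * Real.pi := by
    rw [div_le_iff₀ hn0]; nlinarith
  have hpos : 0 < Real.pi / n := by positivity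
  have hi : IntervalIntegrable (fun τ : ℝ => 2 / Real.pi ^ 2 * (n : ℝ) ^ 2 * τ ^ (2 - α))
      MeasureTheory.volume 0 (Real.pi / n) :=
    (intervalIntegral.intervalIntegrable_rpow' (by linarith)).const_mul _
  have hI := intervalIntegrable_cos_kern ⟨hα1, hα2⟩ n
  calc _ = ∫ τ in (0 : ℝ)..(Real.pi / n), 2 / Real.pi ^ 2 * (n : ℝ) ^ 2 * τ ^ (2 - α) := by
        rw [intervalIntegral.integral_const_mul, integral_rpow (Or.inl (by linarith)),
          Real.zero_rpow (by linarith), show 2 - α + 1 = 3 - α by ring,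
          Real.div_rpow hpi.le hn0.le]
        have e : (n : ℝ) ^ (3 - α) * (n : ℝ) ^ (α - 1) = (n : ℝ) ^ 2 := by
          rw [← Real.rpow_add hn0, show 3 - α + (α - 1) = 2 by ring, Real.rpow_two]
        have : (n : ℝ) ^ (3 - α) ≠ 0 := by positivity
        rw [← e]
        field_simp
        ring
    _ ≤ ∫ τ in (0 : ℝ)..(Real.pi / n), (1 - Real.cos (n * τ)) * kern α τ := by
        refine intervalIntegral.integral_mono_on_of_le_Ioo hpos.le hi (hI.mono_set ?_)
          fun τ hτ => ?_
        · rw [uIcc_of_le hpos.le, uIcc_of_le (by positivity)]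
          exact Icc_subset_Icc le_rfl hle
        · have hτ0 := hτ.1
          have hnt : (n : ℝ) * τ < Real.pi := by
            have := hτ.2; rw [lt_div_iff₀ hn0] at this; linarith
          have h1 := Real.cos_le_one_sub_mul_cos_sq (x := n * τ)
            (by rw [abs_of_pos (by positivity)]; exact hnt.le)
          have hτ' : τ ∈ Ioo 0 (2 * Real.pi) := ⟨hτ0, hτ.2.trans_le hle⟩
          have h2 : τ ^ (-α) ≤ kern α τ := by
            rw [kern_eq hτ']
            refine Real.rpow_le_rpow_of_nonpos (by have := sin_half_pos hτ'; positivity) ?_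
              (by linarith)
            linarith [Real.sin_lt (x := τ / 2) (by linarith)]
          calc _ = (2 / Real.pi ^ 2 * (n * τ) ^ 2) * τ ^ (-α) := by
                rw [show 2 - α = 2 + (-α) by ring, Real.rpow_add hτ0, Real.rpow_two]; ring
            _ ≤ _ := mul_le_mul (by linarith) h2 (by positivity)
                (by linarith [Real.cos_le_one (n * τ)])
    _ ≤ cosSymbol α n := by
        refine intervalIntegral.integral_mono_interval le_rfl hpos.le hle ?_ hI
        exact Eventually.of_forall fun τ =>
          mul_nonneg (by linarith [Real.cos_le_one (n * τ)]) (kern_nonneg α τ)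

/-- The symbol of the linearization at the unit disc: `cos (n x) ↦ ℓ_n sin (n x)`. -/
def linSymbol (α : ℝ) (n : ℕ) : ℝ :=
  (1 / (2 * Real.pi)) *
    ((1 - α / 2) * ∫ y in (0 : ℝ)..(2 * Real.pi), Real.sin (n * y) * (Real.sin y * kern α y)) +
  (1 / (2 * Real.pi)) *
    (n * ∫ y in (0 : ℝ)..(2 * Real.pi), (1 - Real.cos (n * y)) * Real.cos y * kern α y)

/-- The product-to-sum formulas turn `sin (n y) sin y` and `cos (n y) cos y` into cosines of the
neighbouring modes. They are arranged so that only the convergent combinations `1 - cos` meet the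
kernel. -/
theorem linSymbol_succ (hα : α ∈ Ioo (1 : ℝ) 2) (n : ℕ) :
    linSymbol α (n + 1) = (1 / (2 * Real.pi)) *
      ((1 - α / 2) / 2 * (cosSymbol α (n + 2) - cosSymbol α n) +
        (n + 1) * ((cosSymbol α (n + 2) + cosSymbol α n) / 2 - cosSymbol α 1)) := by
  have h0 := intervalIntegrable_cos_kern hα n
  have h1 := intervalIntegrable_cos_kern hα 1
  have h2 := intervalIntegrable_cos_kern hα (n + 2)
  have e1 : ∫ y in (0 : ℝ)..(2 * Real.pi),
      Real.sin ((n + 1 : ℕ) * y) * (Real.sin y * kern α y) =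
      1 / 2 * (cosSymbol α (n + 2) - cosSymbol α n) := by
    unfold cosSymbol
    rw [← intervalIntegral.integral_sub h2 h0, ← intervalIntegral.integral_const_mul]
    congr 1; funext y
    rw [show ((n + 2 : ℕ) : ℝ) * y = (n + 1 : ℕ) * y + y by push_cast; ring,
      show (n : ℝ) * y = (n + 1 : ℕ) * y - y by push_cast; ring, Real.cos_add, Real.cos_sub]
    ring
  have e2 : ∫ y in (0 : ℝ)..(2 * Real.pi),
      (1 - Real.cos ((n + 1 : ℕ) * y)) * Real.cos y * kern α y =
      1 / 2 * (cosSymbol α (n + 2) + cosSymbol α n) - cosSymbol α 1 := by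
    unfold cosSymbol
    rw [← intervalIntegral.integral_add h2 h0, ← intervalIntegral.integral_const_mul,
      ← intervalIntegral.integral_sub ((h2.add h0).const_mul _) h1]
    congr 1; funext y
    rw [show ((n + 2 : ℕ) : ℝ) * y = (n + 1 : ℕ) * y + y by push_cast; ring,
      show (n : ℝ) * y = (n + 1 : ℕ) * y - y by push_cast; ring, Real.cos_add, Real.cos_sub,
      Nat.cast_one, one_mul]
    ring
  unfold linSymbol
  rw [e1, e2]; push_cast; ring

/-- By monotonicity of `cosSymbol` the first term of `linSymbol_succ` is non-negative, and the
second is at least `n (cosSymbol α (n + 1) - cosSymbol α 1) / 2`. The bound makes the linearization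
elliptic of order exactly `α`. The mode `n = 1`, which belongs to translations, is excluded because
the symbol vanishes there. -/
theorem le_linSymbol (hα : α ∈ Ioo (1 : ℝ) 2) : ∃ c, 0 < c ∧ ∀ n : ℕ, 2 ≤ n →
    c * (n : ℝ) ^ α ≤ linSymbol α n := by
  obtain ⟨c, hc, h⟩ := le_cosSymbol hα
  have hm := cosSymbol_strictMono hα
  have hc01 : cosSymbol α 1 < cosSymbol α 2 := hm (by norm_num)
  have hc1 : 0 < cosSymbol α 1 := by
    have := hm (by norm_num : 0 < 1); rwa [cosSymbol_zero] at this
  -- Chosen so that `cosSymbol α 1 = K (cosSymbol α 2 - cosSymbol α 1)`. Subtracting `cosSymbol α 1`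
  -- from a later value then costs at most the factor `K + 1`.
  set K : ℝ := cosSymbol α 1 / (cosSymbol α 2 - cosSymbol α 1) with hK
  have hK0 : 0 < K := div_pos hc1 (by linarith)
  refine ⟨1 / (2 * Real.pi) * (c / (2 * (K + 1))), by positivity, fun n hn => ?_⟩
  obtain ⟨n, rfl⟩ : ∃ j, n = j + 1 := ⟨n - 1, by omega⟩
  rw [linSymbol_succ hα, mul_assoc]
  refine mul_le_mul_of_nonneg_left ?_ (by positivity)
  have h0 : cosSymbol α n < cosSymbol α (n + 2) := hm (by omega)
  have h1 : cosSymbol α 1 ≤ cosSymbol α n := hm.monotone (by omega)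
  have h2 : cosSymbol α 2 ≤ cosSymbol α (n + 2) := hm.monotone (by omega)
  have h3 : cosSymbol α (n + 1) ≤ cosSymbol α (n + 2) := hm.monotone (by omega)
  have h4 := h (n + 1) (by omega)
  have h5 : cosSymbol α (n + 2) ≤ (K + 1) * (cosSymbol α (n + 2) - cosSymbol α 1) := by
    have : cosSymbol α 1 = K * (cosSymbol α 2 - cosSymbol α 1) := by
      rw [hK, div_mul_cancel₀]; linarith
    nlinarith
  have hn0 : (0 : ℝ) < ((n + 1 : ℕ) : ℝ) := by positivity
  have h6 : (((n + 1 : ℕ) : ℝ)) ^ α = (n + 1 : ℕ) * ((n + 1 : ℕ) : ℝ) ^ (α - 1) := by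
    rw [Real.rpow_sub_one hn0.ne']; field_simp
  have h7 : 0 ≤ (1 - α / 2) / 2 * (cosSymbol α (n + 2) - cosSymbol α n) :=
    mul_nonneg (by linarith [hα.2]) (by linarith)
  have h8 : c / (2 * (K + 1)) * ((n + 1 : ℕ) : ℝ) ^ (α - 1) ≤
      (cosSymbol α (n + 2) - cosSymbol α 1) / 2 := by
    rw [div_mul_eq_mul_div, div_le_iff₀ (by positivity)]
    nlinarith
  rw [h6]
  have h9 : c / (2 * (K + 1)) * (((n + 1 : ℕ) : ℝ) * ((n + 1 : ℕ) : ℝ) ^ (α - 1)) ≤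
      ((n + 1 : ℕ) : ℝ) * ((cosSymbol α (n + 2) - cosSymbol α 1) / 2) := by
    calc _ = ((n + 1 : ℕ) : ℝ) * (c / (2 * (K + 1)) * ((n + 1 : ℕ) : ℝ) ^ (α - 1)) := by ring
      _ ≤ _ := mul_le_mul_of_nonneg_left h8 hn0.le
  push_cast at h9 ⊢
  nlinarith [hn0]

/-- The symbol at `n = 2` involves only `sineMoment α 1` and `sineMoment α 2`, which the recurrence
reduces to `sineMoment α 0`. The rest is the functional equation of the Gamma function. This
identity is the source of `Ξ_α` in the first order profile. -/
theorem linSymbol_two (hα : α ∈ Ioo (1 : ℝ) 2) :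
    profileConst α * linSymbol α 2 = α * (α + 2) := by
  have r0 := sineMoment_recurrence hα 0
  have r1 := sineMoment_recurrence hα 1
  have d1 := cosSymbol_succ_sub hα 1
  have d2 := cosSymbol_succ_sub hα 2
  have hl := linSymbol_succ hα 1
  norm_num at r0 r1 d1 d2 hl
  have hs : cosSymbol α 3 = sineMoment α 1 + sineMoment α 2 + cosSymbol α 1 := by linarith
  rw [hs] at hl
  have h4 : (0 : ℝ) < 4 - α := by linarith [hα.2]
  have h6 : (0 : ℝ) < 6 - α := by linarith [hα.2]
  have s1 : sineMoment α 1 = α * sineMoment α 0 / (4 - α) := by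
    rw [eq_div_iff h4.ne']; linarith
  have s2 : sineMoment α 2 = (2 + α) * sineMoment α 1 / (6 - α) := by
    rw [eq_div_iff h6.ne']; linarith
  have g0 : 0 < Real.Gamma (3 - α) := Real.Gamma_pos_of_pos (by linarith [hα.2])
  have g2 : 0 < Real.Gamma (2 - α / 2) := Real.Gamma_pos_of_pos (by linarith [hα.2])
  have g3 : 0 < Real.Gamma (2 - α) := Real.Gamma_pos_of_pos (by linarith [hα.2])
  have hα2 : 2 - α ≠ 0 := by linarith [hα.2]
  have k1 : Real.Gamma (3 - α / 2) = (2 - α / 2) * Real.Gamma (2 - α / 2) := by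
    rw [← Real.Gamma_add_one (by linarith [hα.2])]; ring_nf
  have k2 : Real.Gamma (2 - α / 2) = (1 - α / 2) * Real.Gamma (1 - α / 2) := by
    rw [← Real.Gamma_add_one (by linarith [hα.2])]; ring_nf
  have k3 : Real.Gamma (3 - α) = (2 - α) * Real.Gamma (2 - α) := by
    rw [← Real.Gamma_add_one hα2]; ring_nf
  have k4 : Real.Gamma (1 - α / 2) = 2 * Real.Gamma (2 - α / 2) / (2 - α) := by
    rw [k2]; field_simp
  have hl' : linSymbol α 2 =
      α * Real.Gamma (3 - α) / ((4 - α) * Real.Gamma (2 - α / 2) ^ 2) := by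
    rw [hl, s2, s1, sineMoment_zero hα]
    have h4' := h4.ne'
    have h6' := h6.ne'
    have := Real.pi_pos.ne'
    field_simp
    ring
  rw [hl', profileConst, k4, k1, k3]
  have h4' := h4.ne'
  clear k1 k2 k3 k4
  generalize Real.Gamma (2 - α / 2) = A at *
  generalize Real.Gamma (2 - α) = B at *
  field_simp
  ring

/-! ### Powers in commutative Banach algebras -/

section PowQuot

variable (𝔸 : Type*) [NormedCommRing 𝔸] [NormedAlgebra ℝ 𝔸]

/-- The power series of `((1 + u)^a - 1) / u`. -/
def powQuotSeries (a : ℝ) : FormalMultilinearSeries ℝ 𝔸 𝔸 :=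
  FormalMultilinearSeries.ofScalars 𝔸 fun n => Ring.choose a (n + 1)

variable {𝔸}

/-- The function `((1 + u)^a - 1) / u`, extended analytically. -/
def powQuot (a : ℝ) (u : 𝔸) : 𝔸 := (powQuotSeries 𝔸 a).sum u

variable [NormOneClass 𝔸]

/-- The coefficients are those of the binomial series shifted by one place, and the shift changes
the bound of the terms only by the factor `1 / r`. -/
theorem one_le_radius_powQuotSeries (a : ℝ) : 1 ≤ (powQuotSeries 𝔸 a).radius := by
  refine ENNReal.le_of_forall_nnreal_lt fun r hr => ?_
  rcases eq_or_ne r 0 with h0 | h0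
  · subst h0; simp
  have h1 : (r : ENNReal) < (binomialSeries ℝ a).radius :=
    hr.trans_le (binomialSeries_radius_ge_one (𝕂 := ℝ) (𝔸 := ℝ))
  obtain ⟨C, hC, h⟩ := (binomialSeries ℝ a).norm_mul_pow_le_of_lt_radius h1
  refine FormalMultilinearSeries.le_radius_of_bound _ (C / r) fun n => ?_
  have h2 := h (n + 1)
  rw [binomialSeries, FormalMultilinearSeries.ofScalars_norm] at h2
  rw [powQuotSeries, FormalMultilinearSeries.ofScalars_norm]
  have hr0 : (0 : ℝ) < r := by positivity
  rw [le_div_iff₀ hr0, mul_assoc, ← pow_succ]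
  exact h2

variable [CompleteSpace 𝔸]

theorem hasFPowerSeriesOnBall_powQuot (a : ℝ) :
    HasFPowerSeriesOnBall (powQuot a : 𝔸 → 𝔸) (powQuotSeries 𝔸 a) 0
      (powQuotSeries 𝔸 a).radius :=
  (powQuotSeries 𝔸 a).hasFPowerSeriesOnBall
    (lt_of_lt_of_le one_pos (one_le_radius_powQuotSeries a))

theorem mem_eball_of_norm_lt_one {a : ℝ} {u : 𝔸} (hu : ‖u‖ < 1) :
    u ∈ Metric.eball (0 : 𝔸) (powQuotSeries 𝔸 a).radius := by
  rw [Metric.mem_eball, edist_zero_right]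
  refine lt_of_lt_of_le ?_ (one_le_radius_powQuotSeries a)
  rw [← ofReal_norm]
  exact ENNReal.ofReal_lt_one.2 hu

theorem contDiffAt_powQuot {n : WithTop ℕ∞} (a : ℝ) {u : 𝔸} (hu : ‖u‖ < 1) :
    ContDiffAt ℝ n (powQuot a : 𝔸 → 𝔸) u :=
  ((hasFPowerSeriesOnBall_powQuot a).analyticAt_of_mem (mem_eball_of_norm_lt_one hu)).contDiffAt

theorem hasSum_powQuot (a : ℝ) {u : 𝔸} (hu : ‖u‖ < 1) :
    HasSum (fun n => Ring.choose a (n + 1) • u ^ n) (powQuot a u) := by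
  have h := (hasFPowerSeriesOnBall_powQuot (𝔸 := 𝔸) a).hasSum (mem_eball_of_norm_lt_one hu)
  simpa [powQuotSeries, FormalMultilinearSeries.ofScalars_apply_eq] using h

theorem powQuot_zero (a : ℝ) : powQuot a (0 : 𝔸) = a • 1 := by
  have h := hasSum_powQuot a (u := (0 : 𝔸)) (by simp)
  rw [← h.tsum_eq, tsum_eq_single 0]
  · simp
  · intro n hn; simp [hn]

theorem choose_two (a : ℝ) : Ring.choose a 2 = a * (a - 1) / 2 := by
  have h := Ring.choose_smul_choose a (n := 2) (k := 1) (by norm_num)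
  rw [Nat.choose_one_right, nsmul_eq_mul, Ring.choose_one_right, Nat.cast_one,
    Ring.choose_one_right] at h
  push_cast at h
  linarith

theorem hasFDerivAt_powQuot_zero (a : ℝ) :
    HasFDerivAt (powQuot a : 𝔸 → 𝔸) ((a * (a - 1) / 2) • ContinuousLinearMap.id ℝ 𝔸) 0 := by
  have h := (hasFPowerSeriesOnBall_powQuot (𝔸 := 𝔸) a).hasFPowerSeriesAt.hasFDerivAt
  refine h.congr_fderiv ?_
  ext u
  simp [powQuotSeries, FormalMultilinearSeries.ofScalars, choose_two,
    continuousMultilinearCurryFin1]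

/-- A continuous character maps a convergent power series to the series of the image. Combined with
`one_add_mul_powQuot`, it identifies powers formed in the algebra with ordinary real powers of the
values. -/
theorem map_powQuot (a : ℝ) (χ : 𝔸 →ₐ[ℝ] ℂ) (hχ : Continuous χ) {u : 𝔸} (hu : ‖u‖ < 1)
    {t : ℝ} (ht : χ u = t) (ht1 : |t| < 1) : χ (powQuot a u) = ((powQuot a t : ℝ) : ℂ) := by
  have h1 := (hasSum_powQuot a hu).map χ hχ
  have h2 := Complex.hasSum_ofReal.2 (hasSum_powQuot a (u := t) (by simpa using ht1))
  refine h1.unique (h2.congr_fun fun n => ?_)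
  simp only [Function.comp, map_smul, map_pow, ht, smul_eq_mul, Complex.real_smul]
  push_cast; ring

theorem one_add_mul_powQuot (a : ℝ) {t : ℝ} (ht1 : |t| < 1) :
    1 + t * powQuot a t = (1 + t) ^ a := by
  have h1 := (hasSum_powQuot a (u := t) (by simpa using ht1)).mul_left t
  have h3 := (Real.one_add_rpow_hasFPowerSeriesOnBall_zero (a := a)).hasSum (y := t) (by
    rw [Metric.mem_eball, edist_zero_right, ← ofReal_norm]
    exact ENNReal.ofReal_lt_one.2 ht1)
  rw [zero_add, ← hasSum_nat_add_iff' 1] at h3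
  have h4 := h1.unique (h3.congr_fun fun n => by
    simp only [binomialSeries, FormalMultilinearSeries.ofScalars_apply_eq, smul_eq_mul]; ring)
  rw [h4]
  simp [binomialSeries]

end PowQuot

end
end GSQG

namespace GSQG
noncomputable section

open scoped BoundedContinuousFunction

/-! ### Families depending on an angle -/

/-- The angles in `(0, 2π)`. -/
abbrev Angle : Type := Ioo (0 : ℝ) (2 * Real.pi)

instance : Nonempty Angle := ⟨⟨Real.pi, Real.pi_pos, by linarith [Real.pi_pos]⟩⟩

instance : MeasureTheory.MeasureSpace Angle := MeasureTheory.Measure.Subtype.measureSpace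

namespace Wiener

variable {m : ℕ}

/-- Translation of functions: `(shift τ c)(x) = c(x - τ)`. -/
def shift (τ : ℝ) (c : Wiener m) : Wiener m :=
  mk (fun n => Complex.exp (-(Complex.I * n * τ)) * c.coeff n) <| by
    refine c.summable.congr fun n => ?_
    rw [norm_mul, norm_exp_neg_I, one_mul]

@[simp] theorem coeff_shift (τ : ℝ) (c : Wiener m) (n : ℤ) :
    (shift τ c).coeff n = Complex.exp (-(Complex.I * n * τ)) * c.coeff n := rfl

theorem norm_shift (τ : ℝ) (c : Wiener m) : ‖shift τ c‖ = ‖c‖ := by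
  rw [norm_def, norm_def]
  refine tsum_congr fun n => ?_
  rw [coeff_shift, norm_mul, norm_exp_neg_I, one_mul]

theorem value_shift (τ : ℝ) (c : Wiener m) (x : ℝ) : (shift τ c).value x = c.value (x - τ) := by
  unfold value
  refine tsum_congr fun n => ?_
  rw [coeff_shift, mul_comm (Complex.exp _), mul_assoc, ← Complex.exp_add]
  push_cast; ring_nf

/-- Each mode depends continuously on `τ`, and twice the weighted coefficients dominate the series.
The translates of a function thus form a bounded continuous family. -/
theorem continuous_shift (c : Wiener m) : Continuous fun τ => shift τ c := by
  rw [continuous_iff_continuousAt]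
  intro τ₀
  rw [ContinuousAt, tendsto_iff_norm_sub_tendsto_zero]
  simp_rw [norm_def, coeff_sub, coeff_shift, ← sub_mul, norm_mul]
  have h0 : (0 : ℝ) = ∑' _ : ℤ, (0 : ℝ) := by simp
  rw [h0]
  refine tendsto_tsum_of_dominated_convergence (c.summable.mul_left 2) (fun n => ?_)
    (Eventually.of_forall fun τ n => ?_)
  · have : Continuous fun τ : ℝ => wienerWeight m n * (‖Complex.exp (-(Complex.I * n * τ)) -
        Complex.exp (-(Complex.I * n * τ₀))‖ * ‖c.coeff n‖) := by fun_prop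
    have h := this.tendsto τ₀
    simpa using h
  · have h1 : ‖Complex.exp (-(Complex.I * n * τ)) - Complex.exp (-(Complex.I * n * τ₀))‖ ≤ 2 := by
      refine (norm_sub_le _ _).trans (le_of_eq ?_)
      rw [norm_exp_neg_I, norm_exp_neg_I]; norm_num
    have := wienerWeight_pos m n
    rw [Real.norm_of_nonneg (by positivity)]
    calc _ ≤ wienerWeight m n * (2 * ‖c.coeff n‖) := by gcongr
      _ = _ := by ring

theorem norm_one_sub_exp (n : ℤ) (τ : ℝ) :
    ‖1 - Complex.exp (-(Complex.I * n * τ))‖ = 2 * |Real.sin (n.natAbs * τ / 2)| := by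
  have e : (1 : ℂ) - Complex.exp (-(Complex.I * n * τ)) =
      Complex.exp (-(Complex.I * n * (τ / 2 : ℝ))) * (2 * Complex.I * Real.sin (n * τ / 2)) := by
    rw [Complex.ofReal_sin, Complex.sin]
    have h1 : Complex.exp (-(Complex.I * n * (τ / 2 : ℝ))) *
        Complex.exp (-((n * τ / 2 : ℝ) : ℂ) * Complex.I) =
        Complex.exp (-(Complex.I * n * τ)) := by
      rw [← Complex.exp_add]; push_cast; ring_nf
    have h2 : Complex.exp (-(Complex.I * n * (τ / 2 : ℝ))) *
        Complex.exp (((n * τ / 2 : ℝ) : ℂ) * Complex.I) = 1 := by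
      rw [← Complex.exp_add]; push_cast; ring_nf; simp
    have h3 : Complex.I * Complex.I = -1 := Complex.I_mul_I
    linear_combination (-1 : ℂ) * h2 + h1 + (Complex.exp (-(Complex.I * n * (τ / 2 : ℝ))) *
        Complex.exp (-((n * τ / 2 : ℝ) : ℂ) * Complex.I) - Complex.exp (-(Complex.I * n * (τ / 2 : ℝ))) *
        Complex.exp (((n * τ / 2 : ℝ) : ℂ) * Complex.I)) * (-h3)
  rw [e, norm_mul, norm_exp_neg_I, one_mul, norm_mul, norm_mul, Complex.norm_I, mul_one,
    Complex.norm_real, Real.norm_eq_abs, Nat.cast_natAbs]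
  congr 1
  · simp
  · rcases abs_cases (n : ℝ) with h | h
    · push_cast; rw [h.1]
    · push_cast; rw [h.1, ← abs_neg, ← Real.sin_neg]; ring_nf

theorem norm_sub_shift (τ : ℝ) (c : Wiener m) :
    ‖c - shift τ c‖ = ∑' n : ℤ, wienerWeight m n *
      (2 * |Real.sin (n.natAbs * τ / 2)| * ‖c.coeff n‖) := by
  rw [norm_def]
  refine tsum_congr fun n => ?_
  rw [coeff_sub, coeff_shift, ← norm_one_sub_exp, ← norm_mul, sub_mul, one_mul]

/-- Families of elements of the Wiener algebra indexed by an angle. -/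
abbrev Family (m : ℕ) : Type := Angle →ᵇ Wiener m

/-- Evaluation of a family at an angle and at a point. -/
def evalFamily (τ : Angle) (x : ℝ) : Family m →ₐ[ℝ] ℂ :=
  (evalAlgHom x).comp
    { toFun := fun h => h τ, map_one' := rfl, map_mul' := fun _ _ => rfl, map_zero' := rfl,
      map_add' := fun _ _ => rfl, commutes' := fun _ => rfl }

@[simp] theorem evalFamily_apply (τ : Angle) (x : ℝ) (h : Family m) :
    evalFamily τ x h = (h τ).value x := rfl

theorem norm_evalFamily_le (τ : Angle) (x : ℝ) (h : Family m) : ‖evalFamily τ x h‖ ≤ ‖h‖ :=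
  (norm_value_le _ x).trans (h.norm_coe_le_norm τ)

theorem continuous_evalFamily (τ : Angle) (x : ℝ) :
    Continuous (evalFamily τ x : Family m → ℂ) :=
  ((evalFamily τ x).toLinearMap.mkContinuous 1 fun h => by
    rw [one_mul]; exact norm_evalFamily_le τ x h).continuous

/-- Constant families. -/
def constFamily (m : ℕ) : Wiener m →L[ℝ] Family m :=
  LinearMap.mkContinuous
    ⟨⟨fun c => BoundedContinuousFunction.const _ c, fun _ _ => rfl⟩, fun _ _ => rfl⟩ 1 fun c => by
    rw [one_mul]
    exact (BoundedContinuousFunction.norm_le (norm_nonneg c)).2 fun _ => le_rfl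

@[simp] theorem constFamily_apply (c : Wiener m) (τ : Angle) : constFamily m c τ = c := rfl

/-- The family of the translates of a function. -/
def shiftFamily (m : ℕ) : Wiener m →L[ℝ] Family m :=
  LinearMap.mkContinuous
    ⟨⟨fun c => BoundedContinuousFunction.ofNormedAddCommGroup (fun τ : Angle => shift (τ : ℝ) c)
        ((continuous_shift c).comp continuous_subtype_val) ‖c‖ fun τ => (norm_shift _ c).le,
      fun c d => by
        ext τ n
        simp [mul_add]⟩,
      fun r c => by
        ext τ n
        simp [mul_left_comm]⟩ 1 fun c => by
    rw [one_mul]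
    exact (BoundedContinuousFunction.norm_le (norm_nonneg c)).2 fun τ => (norm_shift _ c).le

@[simp] theorem shiftFamily_apply (c : Wiener m) (τ : Angle) :
    shiftFamily m c τ = shift (τ : ℝ) c := rfl

/-- Scalar families. -/
def scalarFamily (m : ℕ) (g : ℝ → ℝ) (hg : Continuous g) (C : ℝ) (hC : ∀ y, |g y| ≤ C) :
    Family m :=
  BoundedContinuousFunction.ofNormedAddCommGroup (fun τ : Angle => g τ • (1 : Wiener m))
    ((hg.comp continuous_subtype_val).smul continuous_const) C fun τ => by
      rw [norm_smul, norm_one, mul_one]; exact hC τ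

@[simp] theorem scalarFamily_apply (g : ℝ → ℝ) (hg : Continuous g) (C : ℝ) (hC : ∀ y, |g y| ≤ C)
    (τ : Angle) : scalarFamily m g hg C hC τ = g τ • (1 : Wiener m) := rfl

/-- The real part of the values of a function, as a scalar family. -/
def valueFamily (m : ℕ) : Wiener m →L[ℝ] Family m :=
  LinearMap.mkContinuous
    ⟨⟨fun c => scalarFamily m (fun y => (c.value y).re)
        (Complex.continuous_re.comp c.continuous_value) ‖c‖
        fun y => (Complex.abs_re_le_norm _).trans (norm_value_le c y),
      fun c d => by
        ext1 τ
        simp [value_add, add_smul]⟩,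
      fun r c => by
        ext1 τ
        simp [value_smul, mul_smul]⟩ 1 fun c => by
    rw [one_mul]
    refine (BoundedContinuousFunction.norm_le (norm_nonneg c)).2 fun τ => ?_
    change ‖(c.value τ).re • (1 : Wiener m)‖ ≤ ‖c‖
    rw [norm_smul, norm_one, mul_one]
    exact (Complex.abs_re_le_norm _).trans (norm_value_le c τ)

@[simp] theorem valueFamily_apply (c : Wiener m) (τ : Angle) :
    valueFamily m c τ = (c.value τ).re • (1 : Wiener m) := rfl

/-- The mean over the angle with an integrable weight. -/
theorem integrable_smul_family {k : ℝ → ℝ}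
    (hk : IntervalIntegrable k MeasureTheory.volume 0 (2 * Real.pi)) (h : Family m) :
    MeasureTheory.Integrable fun τ : Angle => k τ • h τ := by
  have hk' : MeasureTheory.Integrable fun τ : Angle => k τ := by
    rw [intervalIntegrable_iff_integrableOn_Ioo_of_le (by positivity)] at hk
    exact (MeasureTheory.integrableOn_iff_comap_subtypeVal measurableSet_Ioo).1 hk
  refine (hk'.norm.mul_const ‖h‖).mono'
    (hk'.aestronglyMeasurable.smul h.continuous.aestronglyMeasurable)
    (Eventually.of_forall fun τ => ?_)
  rw [norm_smul]
  exact mul_le_mul_of_nonneg_left (h.norm_coe_le_norm τ) (norm_nonneg _)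

theorem angle_integral {E : Type*} [NormedAddCommGroup E] [NormedSpace ℝ E] (g : ℝ → E) :
    ∫ τ : Angle, g τ = ∫ τ in (0 : ℝ)..(2 * Real.pi), g τ := by
  rw [intervalIntegral.integral_of_le (by positivity), MeasureTheory.integral_Ioc_eq_integral_Ioo]
  exact MeasureTheory.integral_subtype measurableSet_Ioo g

/-- The weighted mean `(1 / 2π) ∫ k(τ) h(τ) dτ`. -/
def meanFamily (m : ℕ) (k : ℝ → ℝ)
    (hk : IntervalIntegrable k MeasureTheory.volume 0 (2 * Real.pi)) : Family m →L[ℝ] Wiener m :=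
  LinearMap.mkContinuous
    ⟨⟨fun h => (1 / (2 * Real.pi)) • ∫ τ : Angle, k τ • h τ, fun h h' => by
        simp only [BoundedContinuousFunction.coe_add, Pi.add_apply, smul_add]
        rw [MeasureTheory.integral_add (integrable_smul_family hk h)
          (integrable_smul_family hk h'), smul_add]⟩,
      fun r h => by
        simp only [BoundedContinuousFunction.coe_smul, smul_comm _ r, RingHom.id_apply]
        rw [MeasureTheory.integral_smul, smul_comm]⟩
    ((1 / (2 * Real.pi)) * ∫ τ : Angle, ‖k τ‖) fun h => by
    change ‖(1 / (2 * Real.pi)) • ∫ τ : Angle, k τ • h τ‖ ≤ _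
    rw [norm_smul, Real.norm_of_nonneg (by positivity), mul_assoc]
    refine mul_le_mul_of_nonneg_left ?_ (by positivity)
    rw [← MeasureTheory.integral_mul_const]
    refine (MeasureTheory.norm_integral_le_integral_norm _).trans ?_
    have hk' : MeasureTheory.Integrable fun τ : Angle => k τ := by
      rw [intervalIntegrable_iff_integrableOn_Ioo_of_le (by positivity)] at hk
      exact (MeasureTheory.integrableOn_iff_comap_subtypeVal measurableSet_Ioo).1 hk
    refine MeasureTheory.integral_mono (integrable_smul_family hk h).norm
      (hk'.norm.mul_const ‖h‖) fun τ => ?_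
    simp only [norm_smul]
    exact mul_le_mul_of_nonneg_left (h.norm_coe_le_norm τ) (norm_nonneg _)

/-- The Bochner integral in `Wiener m` commutes with evaluation at `x`, which is continuous and
linear. The value of the operator is therefore the ordinary mean of the values. -/
theorem value_meanFamily {k : ℝ → ℝ}
    (hk : IntervalIntegrable k MeasureTheory.volume 0 (2 * Real.pi)) (h : Family m) (x : ℝ)
    (g : ℝ → ℝ) (hg : ∀ τ : Angle, (h τ).value x = (g τ : ℂ)) :
    (meanFamily m k hk h).value x = ((mean fun τ => k τ * g τ : ℝ) : ℂ) := by
  have e : meanFamily m k hk h = (1 / (2 * Real.pi)) • ∫ τ : Angle, k τ • h τ := rfl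
  rw [e, value_smul, mean]
  have h1 := (evalCLM (m := m) x).integral_comp_comm (integrable_smul_family hk h)
  simp only [evalCLM_apply, value_smul, hg] at h1
  rw [← h1, angle_integral (fun τ => (k τ : ℂ) * (g τ : ℂ))]
  push_cast
  rw [← intervalIntegral.integral_ofReal]
  push_cast
  rfl

end Wiener
end
end GSQG

namespace GSQG
noncomputable section

open scoped BoundedContinuousFunction
open Wiener

/-! ### Difference quotients and the singular integral operator -/

namespace Profile

variable {α : ℝ} {m : ℕ}

/-- Mode by mode, `|sin (n τ / 2)| ≤ n sin (τ / 2)`. It bounds the difference quotients uniformly up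
to the ends of the period, so that they form an element of `Family m`. -/
theorem norm_fn_sub_shift_le (hα : 1 ≤ α) (a : Profile) (τ : Angle) :
    ‖fn hα m a - shift (τ : ℝ) (fn hα m a)‖ ≤ 2 * Real.sin ((τ : ℝ) / 2) * ‖dfn hα m a‖ := by
  rw [norm_sub_shift, norm_def, ← tsum_mul_left]
  have hs := sin_half_pos τ.2
  have hle : ∀ n : ℤ, wienerWeight m n *
      (2 * |Real.sin (n.natAbs * (τ : ℝ) / 2)| * ‖(fn hα m a).coeff n‖) ≤
      2 * Real.sin ((τ : ℝ) / 2) * (wienerWeight m n * ‖(dfn hα m a).coeff n‖) := by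
    intro n
    have h1 := abs_sin_nat_mul_le n.natAbs ((τ : ℝ) / 2)
    rw [abs_of_pos hs, ← mul_div_assoc] at h1
    rw [coeff_fn, coeff_dfn, norm_mul, norm_I_mul_int]
    have := wienerWeight_pos m n
    calc _ ≤ wienerWeight m n * (2 * (n.natAbs * Real.sin ((τ : ℝ) / 2)) * ‖expCoeff α m a n‖) := by
          gcongr
      _ = _ := by ring
  have hsum := (dfn hα m a).summable.mul_left (2 * Real.sin ((τ : ℝ) / 2))
  exact Summable.tsum_le_tsum hle (Summable.of_nonneg_of_le (fun n => by
    have := wienerWeight_pos m n; positivity) hle hsum) hsum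

/-- The difference quotients `(f(x) - f(x - τ)) / (2 sin (τ / 2))`. -/
def diffQuot (hα : 1 ≤ α) (m : ℕ) : Profile →L[ℝ] Family m :=
  LinearMap.mkContinuous
    ⟨⟨fun a => BoundedContinuousFunction.ofNormedAddCommGroup
        (fun τ : Angle => (2 * Real.sin ((τ : ℝ) / 2))⁻¹ •
          (fn hα m a - shift (τ : ℝ) (fn hα m a)))
        (by
          refine Continuous.smul (Continuous.inv₀ (f := fun τ : Angle => 2 * Real.sin ((τ : ℝ) / 2))
            (by fun_prop) fun τ => ?_)
            (continuous_const.sub ((continuous_shift _).comp continuous_subtype_val))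
          have := sin_half_pos τ.2; positivity)
        ‖dfn hα m a‖ fun τ => by
          have hs := sin_half_pos τ.2
          rw [norm_smul, norm_inv, Real.norm_of_nonneg (by positivity),
            inv_mul_le_iff₀ (by positivity)]
          exact norm_fn_sub_shift_le hα a τ,
      fun a b => by
        ext τ n
        simp
        ring⟩,
      fun r a => by
        ext τ n
        simp
        ring⟩ ‖dfn hα m‖ fun a =>
    (BoundedContinuousFunction.norm_le (by positivity)).2 fun τ => by
      have hs := sin_half_pos τ.2
      change ‖(2 * Real.sin ((τ : ℝ) / 2))⁻¹ • (fn hα m a - shift (τ : ℝ) (fn hα m a))‖ ≤ _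
      rw [norm_smul, norm_inv, Real.norm_of_nonneg (by positivity),
        inv_mul_le_iff₀ (by positivity)]
      exact (norm_fn_sub_shift_le hα a τ).trans
        (mul_le_mul_of_nonneg_left ((dfn hα m).le_opNorm a) (by positivity))

theorem diffQuot_apply (hα : 1 ≤ α) (a : Profile) (τ : Angle) :
    diffQuot hα m a τ = (2 * Real.sin ((τ : ℝ) / 2))⁻¹ •
      (fn hα m a - shift (τ : ℝ) (fn hα m a)) := rfl

/-- A non-negative series of integrable functions with summable integrals is integrable. -/
theorem integrable_tsum_of_nonneg {X ι : Type*} [MeasurableSpace X] {μ : MeasureTheory.Measure X}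
    [Countable ι] {F : ι → X → ℝ} (hF : ∀ i x, 0 ≤ F i x)
    (hi : ∀ i, MeasureTheory.Integrable (F i) μ) (hs : ∀ x, Summable fun i => F i x)
    {G : ι → ℝ} (hG : Summable G) (hle : ∀ i, ∫ x, F i x ∂μ ≤ G i)
    (hm : MeasureTheory.AEStronglyMeasurable (fun x => ∑' i, F i x) μ) :
    MeasureTheory.Integrable (fun x => ∑' i, F i x) μ ∧
      ∫ x, ∑' i, F i x ∂μ ≤ ∑' i, G i := by
  have h0 : ∀ i, 0 ≤ ∫ x, F i x ∂μ := fun i => MeasureTheory.integral_nonneg (hF i)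
  have hsum : Summable fun i => ∫ x, F i x ∂μ := Summable.of_nonneg_of_le h0 hle hG
  have hsum' : Summable fun i => ∫ x, ‖F i x‖ ∂μ := by
    refine hsum.congr fun i => ?_
    refine MeasureTheory.integral_congr_ae (Eventually.of_forall fun x => ?_)
    exact (Real.norm_of_nonneg (hF i x)).symm
  have hval := MeasureTheory.integral_tsum_of_summable_integral_norm hi hsum'
  refine ⟨⟨hm, ?_⟩, ?_⟩
  · rw [MeasureTheory.hasFiniteIntegral_iff_ofReal
      (Eventually.of_forall fun x => tsum_nonneg fun i => hF i x)]
    calc ∫⁻ x, ENNReal.ofReal (∑' i, F i x) ∂μ = ∫⁻ x, ∑' i, ENNReal.ofReal (F i x) ∂μ := by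
          refine MeasureTheory.lintegral_congr fun x => ?_
          exact ENNReal.ofReal_tsum_of_nonneg (fun i => hF i x) (hs x)
      _ = ∑' i, ∫⁻ x, ENNReal.ofReal (F i x) ∂μ :=
          MeasureTheory.lintegral_tsum fun i => (hi i).aemeasurable.ennreal_ofReal
      _ = ∑' i, ENNReal.ofReal (∫ x, F i x ∂μ) := by
          refine tsum_congr fun i => ?_
          rw [MeasureTheory.ofReal_integral_eq_lintegral_ofReal (hi i)
            (Eventually.of_forall (hF i))]
      _ = ENNReal.ofReal (∑' i, ∫ x, F i x ∂μ) := (ENNReal.ofReal_tsum_of_nonneg h0 hsum).symm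
      _ < ⊤ := ENNReal.ofReal_lt_top
  · rw [← hval]
    exact hsum.tsum_le_tsum hle hG

/-- The series over the modes is integrated term by term: the mode `n` contributes its coefficient
times `(1 + n)^m n` times at most `C n ^ (α - 1)`, which is `C` times its weight `profileWeight α m
n`. This is where the factor `n ^ α` of the weight of `Profile` is used in full. -/
theorem integrable_kern_mul_norm (hα : α ∈ Ioo (1 : ℝ) 2) (m : ℕ) : ∃ C, 0 ≤ C ∧
    ∀ a : Profile,
      MeasureTheory.Integrable (fun τ : Angle => kern α τ *
        ‖dfn hα.1.le m a - shift (τ : ℝ) (dfn hα.1.le m a)‖) ∧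
      ∫ τ : Angle, kern α τ * ‖dfn hα.1.le m a - shift (τ : ℝ) (dfn hα.1.le m a)‖ ≤
        C * ‖a‖ := by
  obtain ⟨C, hC, h⟩ := integral_abs_sin_mul_kern_le hα
  refine ⟨C, hC, fun a => ?_⟩
  set F : ℤ → Angle → ℝ := fun n τ => wienerWeight m n * ‖(dfn hα.1.le m a).coeff n‖ *
    (2 * |Real.sin (n.natAbs * (τ : ℝ) / 2)| * kern α τ) with hF
  have e : ∀ τ : Angle, kern α τ * ‖dfn hα.1.le m a - shift (τ : ℝ) (dfn hα.1.le m a)‖ =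
      ∑' n, F n τ := by
    intro τ
    rw [norm_sub_shift, ← tsum_mul_left]
    refine tsum_congr fun n => ?_
    simp only [hF]; ring
  rw [show (fun τ : Angle => kern α τ *
    ‖dfn hα.1.le m a - shift (τ : ℝ) (dfn hα.1.le m a)‖) = fun τ => ∑' n, F n τ from funext e]
  have hint : ∀ n : ℕ, MeasureTheory.Integrable fun τ : Angle =>
      2 * |Real.sin (n * (τ : ℝ) / 2)| * kern α τ := by
    intro n
    have := intervalIntegrable_abs_sin_mul_kern hα n
    rw [intervalIntegrable_iff_integrableOn_Ioo_of_le (by positivity)] at this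
    exact (MeasureTheory.integrableOn_iff_comap_subtypeVal measurableSet_Ioo).1 this
  have hb := (hasSum_expCoeff (α := α) (m := m) a).mul_left C
  rw [← hb.tsum_eq]
  refine integrable_tsum_of_nonneg (fun n τ => ?_) (fun n => (hint _).const_mul _) (fun τ => ?_)
    hb.summable (fun n => ?_) ?_
  · have := wienerWeight_pos m n
    have := kern_nonneg α τ
    positivity
  · refine Summable.of_nonneg_of_le (fun n => ?_) (fun n => ?_)
      ((dfn hα.1.le m a).summable.mul_right (2 * kern α τ))
    · have := wienerWeight_pos m n
      have := kern_nonneg α τ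
      positivity
    · have := wienerWeight_pos m n
      refine mul_le_mul_of_nonneg_left ?_ (by positivity)
      refine mul_le_mul_of_nonneg_right ?_ (kern_nonneg α τ)
      linarith [Real.abs_sin_le_one (n.natAbs * (τ : ℝ) / 2)]
  · rw [MeasureTheory.integral_const_mul,
      angle_integral fun τ => 2 * |Real.sin (n.natAbs * τ / 2)| * kern α τ]
    by_cases hn : n.natAbs = 0
    · have : n = 0 := by omega
      subst this
      simp only [coeff_dfn, Int.cast_zero, mul_zero, zero_mul, norm_zero]
      have := profileWeight_nonneg α m (0 : ℤ).natAbs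
      positivity
    · have hn0 : (0 : ℝ) < n.natAbs := by positivity
      have hw := wienerWeight_pos m n
      calc _ ≤ wienerWeight m n * ‖(dfn hα.1.le m a).coeff n‖ *
            (C * (n.natAbs : ℝ) ^ (α - 1)) := by
            exact mul_le_mul_of_nonneg_left (h _ hn) (by positivity)
        _ = _ := by
            rw [coeff_dfn, norm_mul, norm_I_mul_int, profileWeight, wienerWeight_eq_natAbs,
              Real.rpow_sub_one hn0.ne']
            field_simp
  · refine Measurable.aestronglyMeasurable ?_
    rw [← show (fun τ : Angle => kern α τ *
      ‖dfn hα.1.le m a - shift (τ : ℝ) (dfn hα.1.le m a)‖) = fun τ => ∑' n, F n τ from funext e]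
    refine ((measurable_kern α).comp measurable_subtype_coe).mul ?_
    exact (continuous_const.sub
      ((continuous_shift _).comp continuous_subtype_val)).norm.measurable

theorem integrable_singular (hα : α ∈ Ioo (1 : ℝ) 2) (a : Profile) (h : Family m) :
    MeasureTheory.Integrable fun τ : Angle => (Real.cos τ * kern α τ) •
      ((dfn hα.1.le m a - shift (τ : ℝ) (dfn hα.1.le m a)) * h τ) := by
  obtain ⟨C, -, hC⟩ := integrable_kern_mul_norm hα m
  refine ((hC a).1.mul_const ‖h‖).mono' ?_ (Eventually.of_forall fun τ => ?_)
  · refine MeasureTheory.AEStronglyMeasurable.smul (𝕜 := ℝ) ?_ ?_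
    · refine Measurable.aestronglyMeasurable ?_
      exact ((by fun_prop : Measurable Real.cos).mul (measurable_kern α)).comp
        measurable_subtype_coe
    · exact ((continuous_const.sub ((continuous_shift _).comp continuous_subtype_val)).mul
        h.continuous).aestronglyMeasurable
  · rw [norm_smul, norm_mul, Real.norm_eq_abs, Real.norm_of_nonneg (kern_nonneg α τ)]
    have h1 := norm_mul_le (dfn hα.1.le m a - shift (τ : ℝ) (dfn hα.1.le m a)) (h τ)
    have h2 := h.norm_coe_le_norm τ
    have h3 := kern_nonneg α τ
    calc _ ≤ 1 * kern α τ * (‖dfn hα.1.le m a - shift (τ : ℝ) (dfn hα.1.le m a)‖ * ‖h‖) := by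
          gcongr
          · exact Real.abs_cos_le_one _
          · exact h1.trans (by gcongr)
      _ = _ := by ring

/-- The bilinear singular integral
`(1 / 2π) ∫ (f'(x) - f'(x - τ)) h(τ) cos τ (2 sin (τ/2))^(-α) dτ`. -/
def singularMean (hα : α ∈ Ioo (1 : ℝ) 2) (m : ℕ) : Profile →L[ℝ] Family m →L[ℝ] Wiener m :=
  LinearMap.mkContinuousOfExistsBound₂
    (LinearMap.mk₂ ℝ (fun a h => (1 / (2 * Real.pi)) • ∫ τ : Angle, (Real.cos τ * kern α τ) •
        ((dfn hα.1.le m a - shift (τ : ℝ) (dfn hα.1.le m a)) * h τ))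
      (fun a b h => by
        rw [← smul_add, ← MeasureTheory.integral_add (integrable_singular hα a h)
          (integrable_singular hα b h)]
        congr 2; funext τ
        rw [← smul_add, ← add_mul, map_add]
        congr 2
        ext n; simp; ring)
      (fun r a h => by
        rw [smul_comm r (1 / (2 * Real.pi)), ← MeasureTheory.integral_smul r]
        congr 2; funext τ
        rw [smul_comm r (Real.cos τ * kern α τ), ← smul_mul_assoc r, map_smul]
        congr 2
        ext n; simp; ring)
      (fun a h h' => by
        rw [← smul_add, ← MeasureTheory.integral_add (integrable_singular hα a h)
          (integrable_singular hα a h')]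
        congr 2; funext τ
        rw [← smul_add, ← mul_add]; rfl)
      (fun r a h => by
        rw [smul_comm r (1 / (2 * Real.pi)), ← MeasureTheory.integral_smul r]
        congr 2; funext τ
        rw [smul_comm r (Real.cos τ * kern α τ), ← mul_smul_comm r]; rfl))
    (by
      obtain ⟨C, hC0, hC⟩ := integrable_kern_mul_norm hα m
      refine ⟨1 / (2 * Real.pi) * C, fun a h => ?_⟩
      rw [LinearMap.mk₂_apply, norm_smul, Real.norm_of_nonneg (by positivity), mul_assoc, mul_assoc]
      refine mul_le_mul_of_nonneg_left ?_ (by positivity)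
      rw [← mul_assoc]
      refine le_trans ?_ (mul_le_mul_of_nonneg_right (hC a).2 (norm_nonneg h))
      rw [← MeasureTheory.integral_mul_const]
      refine MeasureTheory.norm_integral_le_of_norm_le ((hC a).1.mul_const ‖h‖)
        (Eventually.of_forall fun τ => ?_)
      rw [norm_smul, norm_mul, Real.norm_eq_abs, Real.norm_of_nonneg (kern_nonneg α τ)]
      have h1 := norm_mul_le (dfn hα.1.le m a - shift (τ : ℝ) (dfn hα.1.le m a)) (h τ)
      have h2 := h.norm_coe_le_norm τ
      have h3 := kern_nonneg α τ
      calc _ ≤ 1 * kern α τ * (‖dfn hα.1.le m a - shift (τ : ℝ) (dfn hα.1.le m a)‖ * ‖h‖) := by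
            gcongr
            · exact Real.abs_cos_le_one _
            · exact h1.trans (by gcongr)
        _ = _ := by ring)

theorem singularMean_apply (hα : α ∈ Ioo (1 : ℝ) 2) (a : Profile) (h : Family m) :
    singularMean hα m a h = (1 / (2 * Real.pi)) • ∫ τ : Angle, (Real.cos τ * kern α τ) •
        ((dfn hα.1.le m a - shift (τ : ℝ) (dfn hα.1.le m a)) * h τ) := rfl

/-! ### The real functions attached to a profile -/

/-- The profile as a real function. -/
def fnR (α : ℝ) (m : ℕ) (a : Profile) (x : ℝ) : ℝ :=
  ∑' n : ℕ, ((realCoeff α m a n).re * Real.cos (n * x) + (realCoeff α m a n).im * Real.sin (n * x))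

theorem value_fn (hα : 1 ≤ α) (a : Profile) (x : ℝ) :
    ((fn hα m a).value x) = ((fnR α m a x : ℝ) : ℂ) := by
  have h1 := (fn hα m a).summable_value x
  have h2 : Summable fun n : ℕ => (fn hα m a).coeff (n : ℤ) *
      Complex.exp (Complex.I * (n : ℤ) * x) := h1.comp_injective Nat.cast_injective
  have h3 : Summable fun n : ℕ => (fn hα m a).coeff (-(n : ℤ)) *
      Complex.exp (Complex.I * (-(n : ℤ) : ℤ) * x) :=
    h1.comp_injective (neg_injective.comp Nat.cast_injective)
  have h4 := HasSum.of_nat_of_neg (f := fun n : ℤ => (fn hα m a).coeff n *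
      Complex.exp (Complex.I * n * x)) h2.hasSum h3.hasSum
  unfold value
  rw [h4.tsum_eq, ← h2.tsum_add h3, fnR, Complex.ofReal_tsum]
  have h0 : (fn hα m a).coeff 0 = 0 := by
    rw [coeff_fn, expCoeff_of_natAbs_lt a (by simp)]
  rw [h0, zero_mul, sub_zero]
  refine tsum_congr fun n => ?_
  rcases Nat.eq_zero_or_pos n with hn | hn
  · subst hn
    simp [expCoeff, realCoeff]
  · have e1 : expCoeff α m a (n : ℤ) = starRingEnd ℂ (realCoeff α m a n) / 2 := by
      simp [expCoeff, hn]
    have e2 : expCoeff α m a (-(n : ℤ)) = realCoeff α m a n / 2 := by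
      simp [expCoeff]
    rw [coeff_fn, coeff_fn, e1, e2]
    set c := realCoeff α m a n
    have e3 : Complex.exp (Complex.I * (n : ℤ) * x) =
        Complex.cos (n * x) + Complex.sin (n * x) * Complex.I := by
      rw [← Complex.exp_mul_I]; push_cast; ring_nf
    have e4 : Complex.exp (Complex.I * (-(n : ℤ) : ℤ) * x) =
        Complex.cos (n * x) - Complex.sin (n * x) * Complex.I := by
      rw [← Complex.cos_neg, ← neg_neg (Complex.sin (n * x)), ← Complex.sin_neg, neg_mul,
        sub_neg_eq_add, ← Complex.exp_mul_I]
      push_cast; ring_nf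
    rw [e3, e4]
    push_cast
    have e5 : starRingEnd ℂ c = c.re - c.im * Complex.I := by
      apply Complex.ext <;> simp
    rw [e5]
    nth_rewrite 3 [← Complex.re_add_im c]
    linear_combination (-(c.im : ℂ) * Complex.sin (n * x)) * Complex.I_sq

theorem conj_dfn_value (hα : 1 ≤ α) (a : Profile) (x : ℝ) :
    starRingEnd ℂ ((dfn hα m a).value x) = (dfn hα m a).value x :=
  value_conj_of_coeff_neg (fun n => by simp [expCoeff_neg]) x

theorem hasDerivAt_fnR (hα : 1 ≤ α) (a : Profile) (x : ℝ) :
    HasDerivAt (fnR α m a) ((dfn hα m a).value x).re x := by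
  have h1 := hasDerivAt_value (c := fn hα m a) (d := dfn hα m a) (by simp) x
  have h2 := Complex.reCLM.hasFDerivAt.comp_hasDerivAt x h1
  have e : Complex.reCLM ∘ (fn hα m a).value = fnR α m a := by
    funext y
    simp [value_fn hα a y]
  rwa [e] at h2

theorem value_dfn (hα : 1 ≤ α) (a : Profile) (x : ℝ) :
    (dfn hα m a).value x = ((deriv (fnR α m a) x : ℝ) : ℂ) := by
  rw [(hasDerivAt_fnR hα a x).deriv]
  exact (Complex.conj_eq_iff_re.1 (conj_dfn_value hα a x)).symm

theorem hasDerivAt_deriv_fnR (hα : 1 ≤ α) (hm : 1 ≤ m) (a : Profile) (x : ℝ) :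
    HasDerivAt (deriv (fnR α m a)) ((ddfn hα hm a).value x).re x := by
  have h1 := hasDerivAt_value (c := dfn hα m a) (d := ddfn hα hm a) (fun n => by simp; ring) x
  have h2 := Complex.reCLM.hasFDerivAt.comp_hasDerivAt x h1
  have e : Complex.reCLM ∘ (dfn hα m a).value = deriv (fnR α m a) := by
    funext y
    simp [value_dfn hα a y]
  rwa [e] at h2

theorem fnR_periodic (hα : 1 ≤ α) (a : Profile) : Function.Periodic (fnR α m a) (2 * Real.pi) := by
  intro x
  have h := value_periodic (fn hα m a) x
  rw [value_fn, value_fn] at h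
  exact_mod_cast h

theorem deriv_fnR_periodic (hα : 1 ≤ α) (a : Profile) :
    Function.Periodic (deriv (fnR α m a)) (2 * Real.pi) := by
  intro x
  have h := value_periodic (dfn hα m a) x
  rw [value_dfn, value_dfn] at h
  exact_mod_cast h

theorem continuous_deriv_fnR (hα : 1 ≤ α) (a : Profile) : Continuous (deriv (fnR α m a)) := by
  have h := Complex.continuous_re.comp (dfn hα m a).continuous_value
  refine h.congr fun x => ?_
  simp [value_dfn hα a x]

theorem continuous_fnR (hα : 1 ≤ α) (a : Profile) : Continuous (fnR α m a) :=
  continuous_iff_continuousAt.2 fun x => (hasDerivAt_fnR hα a x).continuousAt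

/-- The value of the singular integral in terms of the real functions. -/
theorem value_singularMean (hα : α ∈ Ioo (1 : ℝ) 2) (a : Profile) (h : Family m) (x : ℝ)
    (g : ℝ → ℝ) (hg : ∀ τ : Angle, (h τ).value x = (g τ : ℂ)) :
    (singularMean hα m a h).value x = ((mean fun τ => Real.cos τ * kern α τ *
      ((deriv (fnR α m a) x - deriv (fnR α m a) (x - τ)) * g τ) : ℝ) : ℂ) := by
  rw [singularMean_apply, value_smul, mean]
  have h1 := (evalCLM (m := m) x).integral_comp_comm (integrable_singular hα a h)
  simp only [evalCLM_apply, value_smul, value_mul, value_sub, value_shift, hg, value_dfn] at h1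
  rw [← h1, angle_integral (fun τ => ((Real.cos τ * kern α τ : ℝ) : ℂ) *
    (((deriv (fnR α m a) x : ℝ) - (deriv (fnR α m a) (x - τ) : ℝ)) * (g τ : ℂ)))]
  push_cast
  rw [← intervalIntegral.integral_ofReal]
  push_cast
  rfl

theorem intervalIntegrable_singular (hα : α ∈ Ioo (1 : ℝ) 2) (a : Profile) (h : Family m) (x : ℝ)
    (g : ℝ → ℝ) (hg : ∀ τ : Angle, (h τ).value x = (g τ : ℂ)) :
    IntervalIntegrable (fun τ => Real.cos τ * kern α τ *
      ((deriv (fnR α m a) x - deriv (fnR α m a) (x - τ)) * g τ)) MeasureTheory.volume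
      0 (2 * Real.pi) := by
  rw [intervalIntegrable_iff_integrableOn_Ioo_of_le (by positivity)]
  refine (MeasureTheory.integrableOn_iff_comap_subtypeVal measurableSet_Ioo).2 ?_
  have h1 := ((evalCLM (m := m) x).integrable_comp (integrable_singular hα a h)).re
  refine h1.congr (Eventually.of_forall fun τ => ?_)
  simp only [evalCLM_apply, value_smul, value_mul, value_sub, value_shift, hg, value_dfn]
  norm_cast

end Profile

theorem Wiener.intervalIntegrable_mean {m : ℕ} {k : ℝ → ℝ}
    (hk : IntervalIntegrable k MeasureTheory.volume 0 (2 * Real.pi)) (h : Family m) (x : ℝ)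
    (g : ℝ → ℝ) (hg : ∀ τ : Angle, (h τ).value x = (g τ : ℂ)) :
    IntervalIntegrable (fun τ => k τ * g τ) MeasureTheory.volume 0 (2 * Real.pi) := by
  rw [intervalIntegrable_iff_integrableOn_Ioo_of_le (by positivity)]
  refine (MeasureTheory.integrableOn_iff_comap_subtypeVal measurableSet_Ioo).2 ?_
  have h1 := ((evalCLM (m := m) x).integrable_comp (integrable_smul_family hk h)).re
  refine h1.congr (Eventually.of_forall fun τ => ?_)
  simp only [evalCLM_apply, value_smul, hg]
  norm_cast

end
end GSQG

namespace GSQG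
noncomputable section

open scoped BoundedContinuousFunction
open Wiener Profile

/-! ### The self-interaction -/

theorem mean_add {g h : ℝ → ℝ} (hg : IntervalIntegrable g MeasureTheory.volume 0 (2 * Real.pi))
    (hh : IntervalIntegrable h MeasureTheory.volume 0 (2 * Real.pi)) :
    mean (fun y => g y + h y) = mean g + mean h := by
  unfold mean; rw [intervalIntegral.integral_add hg hh]; ring

theorem mean_const_mul (c : ℝ) (g : ℝ → ℝ) : mean (fun y => c * g y) = c * mean g := by
  unfold mean; rw [intervalIntegral.integral_const_mul]; ring

theorem mean_congr {g h : ℝ → ℝ} (H : ∀ y ∈ Ioo 0 (2 * Real.pi), g y = h y) : mean g = mean h := by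
  unfold mean
  rw [intervalIntegral.integral_congr_Ioo_of_le (by positivity) H]

/-- The mean over a period after the substitution `y = x - τ`. -/
theorem mean_comp_sub {g : ℝ → ℝ} (hg : Function.Periodic g (2 * Real.pi)) (x : ℝ) :
    mean (fun τ => g (x - τ)) = mean g := by
  unfold mean
  rw [intervalIntegral.integral_comp_sub_left g x, sub_zero]
  have := hg.intervalIntegral_add_eq (x - 2 * Real.pi) 0
  rw [sub_add_cancel, zero_add] at this
  rw [this]

theorem intervalIntegrable_cos_sin_half_kern {α : ℝ} (hα : α ∈ Ioo (1 : ℝ) 2) :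
    IntervalIntegrable (fun τ => Real.cos τ * kern α τ * (2 * Real.sin (τ / 2)))
      MeasureTheory.volume 0 (2 * Real.pi) := by
  refine intervalIntegrable_of_le_rpow (C := 1) (p := 1 - α)
    (((by fun_prop : Measurable Real.cos).mul (measurable_kern α)).mul (by fun_prop))
    (by linarith [hα.2]) (by linarith [hα.1]) fun τ hτ => ?_
  have hs := sin_half_pos hτ
  rw [one_mul, ← two_mul_sin_half_mul_kern hτ, abs_mul, abs_mul,
    abs_of_nonneg (kern_nonneg α τ), abs_of_pos (by positivity : 0 < 2 * Real.sin (τ / 2))]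
  have := kern_nonneg α τ
  calc _ ≤ 1 * kern α τ * (2 * Real.sin (τ / 2)) := by
        gcongr; exact Real.abs_cos_le_one τ
    _ = _ := by ring

section Self

variable {α : ℝ} (hα : α ∈ Ioo (1 : ℝ) 2) (m : ℕ)

/-- The relative perturbation of the squared distance of two points of the boundary. -/
def selfPert (s : ℝ) (a : Profile) : Family m :=
  constFamily m (fn hα.1.le m a) + shiftFamily m (fn hα.1.le m a) +
    s • (constFamily m (fn hα.1.le m a) * shiftFamily m (fn hα.1.le m a) +
      diffQuot hα.1.le m a ^ 2)

/-- The family `((1 + s v)^(-α/2) - 1) / (s v)`. -/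
def selfQuot (s : ℝ) (a : Profile) : Family m := powQuot (-α / 2) (s • selfPert hα m s a)

/-- The family `(1 + s v)^(-α/2)`. -/
def selfPow (s : ℝ) (a : Profile) : Family m :=
  1 + s • (selfPert hα m s a * selfQuot hα m s a)

/-- The self-interaction divided by the size `s` of the perturbation. -/
def selfMap (s : ℝ) (a : Profile) : Wiener m :=
  meanFamily m _ (intervalIntegrable_sin_mul_kern hα)
      (selfPert hα m s a * selfQuot hα m s a +
        (constFamily m (fn hα.1.le m a) + shiftFamily m (fn hα.1.le m a) +
          s • (constFamily m (fn hα.1.le m a) * shiftFamily m (fn hα.1.le m a)) +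
          s • (constFamily m (dfn hα.1.le m a) * shiftFamily m (dfn hα.1.le m a))) *
        selfPow hα m s a) +
    singularMean hα m a (-selfPow hα m s a -
      s • (constFamily m (fn hα.1.le m a) * selfPow hα m s a)) +
    s • meanFamily m _ (intervalIntegrable_cos_sin_half_kern hα)
      (constFamily m (dfn hα.1.le m a) * diffQuot hα.1.le m a * selfPow hα m s a)

theorem contDiff_constFamily_fn {n : WithTop ℕ∞} :
    ContDiff ℝ n fun p : ℝ × Profile => constFamily m (fn hα.1.le m p.2) :=
  (constFamily m).contDiff.comp ((fn hα.1.le m).contDiff.comp contDiff_snd)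

theorem contDiff_shiftFamily_fn {n : WithTop ℕ∞} :
    ContDiff ℝ n fun p : ℝ × Profile => shiftFamily m (fn hα.1.le m p.2) :=
  (shiftFamily m).contDiff.comp ((fn hα.1.le m).contDiff.comp contDiff_snd)

theorem contDiff_constFamily_dfn {n : WithTop ℕ∞} :
    ContDiff ℝ n fun p : ℝ × Profile => constFamily m (dfn hα.1.le m p.2) :=
  (constFamily m).contDiff.comp ((dfn hα.1.le m).contDiff.comp contDiff_snd)

theorem contDiff_shiftFamily_dfn {n : WithTop ℕ∞} :
    ContDiff ℝ n fun p : ℝ × Profile => shiftFamily m (dfn hα.1.le m p.2) :=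
  (shiftFamily m).contDiff.comp ((dfn hα.1.le m).contDiff.comp contDiff_snd)

theorem contDiff_diffQuot {n : WithTop ℕ∞} :
    ContDiff ℝ n fun p : ℝ × Profile => diffQuot hα.1.le m p.2 :=
  (diffQuot hα.1.le m).contDiff.comp contDiff_snd

theorem contDiff_selfPert {n : WithTop ℕ∞} :
    ContDiff ℝ n fun p : ℝ × Profile => selfPert hα m p.1 p.2 :=
  ((contDiff_constFamily_fn hα m).add (contDiff_shiftFamily_fn hα m)).add
    (contDiff_fst.smul (((contDiff_constFamily_fn hα m).mul (contDiff_shiftFamily_fn hα m)).add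
      ((contDiff_diffQuot hα m).pow 2)))

theorem contDiffAt_selfQuot {n : WithTop ℕ∞} {p : ℝ × Profile}
    (hp : ‖p.1 • selfPert hα m p.1 p.2‖ < 1) :
    ContDiffAt ℝ n (fun p : ℝ × Profile => selfQuot hα m p.1 p.2) p :=
  (contDiffAt_powQuot (-α / 2) hp).comp p
    ((contDiff_fst.smul (contDiff_selfPert hα m)).contDiffAt)

theorem contDiffAt_selfPow {n : WithTop ℕ∞} {p : ℝ × Profile}
    (hp : ‖p.1 • selfPert hα m p.1 p.2‖ < 1) :
    ContDiffAt ℝ n (fun p : ℝ × Profile => selfPow hα m p.1 p.2) p :=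
  contDiffAt_const.add (contDiffAt_fst.smul
    ((contDiff_selfPert hα m).contDiffAt.mul (contDiffAt_selfQuot hα m hp)))

/-- Everything is built from bounded linear and bilinear maps of the profile and from `powQuot`,
which is analytic on the unit ball of the Banach algebra of families. The hypothesis keeps its
argument inside that ball. -/
theorem contDiffAt_selfMap {n : WithTop ℕ∞} {p : ℝ × Profile}
    (hp : ‖p.1 • selfPert hα m p.1 p.2‖ < 1) :
    ContDiffAt ℝ n (fun p : ℝ × Profile => selfMap hα m p.1 p.2) p := by
  have h1 := (contDiff_selfPert hα m (n := n)).contDiffAt (x := p)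
  have h2 := contDiffAt_selfQuot hα m (n := n) hp
  have h3 := contDiffAt_selfPow hα m (n := n) hp
  have c1 := (contDiff_constFamily_fn hα m (n := n)).contDiffAt (x := p)
  have c2 := (contDiff_shiftFamily_fn hα m (n := n)).contDiffAt (x := p)
  have c3 := (contDiff_constFamily_dfn hα m (n := n)).contDiffAt (x := p)
  have c4 := (contDiff_shiftFamily_dfn hα m (n := n)).contDiffAt (x := p)
  have c5 := (contDiff_diffQuot hα m (n := n)).contDiffAt (x := p)
  refine (ContDiffAt.add ?_ ?_).add ?_
  · exact (meanFamily m _ (intervalIntegrable_sin_mul_kern hα)).contDiff.contDiffAt.comp p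
      ((h1.mul h2).add ((((c1.add c2).add (contDiffAt_fst.smul (c1.mul c2))).add
        (contDiffAt_fst.smul (c3.mul c4))).mul h3))
  · exact ((singularMean hα m).contDiff.comp contDiff_snd).contDiffAt.clm_apply
      (h3.neg.sub (contDiffAt_fst.smul (c1.mul h3)))
  · exact contDiffAt_fst.smul ((meanFamily m _
      (intervalIntegrable_cos_sin_half_kern hα)).contDiff.contDiffAt.comp p ((c3.mul c5).mul h3))

/-- The real counterpart of `selfPert`. -/
def selfPertR (α : ℝ) (m : ℕ) (s : ℝ) (a : Profile) (x τ : ℝ) : ℝ :=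
  fnR α m a x + fnR α m a (x - τ) + s * (fnR α m a x * fnR α m a (x - τ) +
    ((2 * Real.sin (τ / 2))⁻¹ * (fnR α m a x - fnR α m a (x - τ))) ^ 2)

theorem eval_constFamily (c : Wiener m) (τ : Angle) (x : ℝ) :
    evalFamily τ x (constFamily m c) = c.value x := rfl

theorem eval_shiftFamily (c : Wiener m) (τ : Angle) (x : ℝ) :
    evalFamily τ x (shiftFamily m c) = c.value (x - τ) := value_shift _ _ _

theorem eval_diffQuot (a : Profile) (τ : Angle) (x : ℝ) :
    evalFamily τ x (diffQuot hα.1.le m a) = (((2 * Real.sin ((τ : ℝ) / 2))⁻¹ *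
      (fnR α m a x - fnR α m a (x - τ)) : ℝ) : ℂ) := by
  rw [evalFamily_apply, diffQuot_apply, value_smul, value_sub, value_shift, value_fn, value_fn]
  push_cast; ring

theorem eval_selfPert (s : ℝ) (a : Profile) (τ : Angle) (x : ℝ) :
    evalFamily τ x (selfPert hα m s a) = (selfPertR α m s a x τ : ℂ) := by
  unfold selfPert selfPertR
  simp only [map_add, map_smul, map_mul, map_pow, eval_constFamily, eval_shiftFamily,
    eval_diffQuot hα m, value_fn, Complex.real_smul]
  push_cast; ring

theorem eval_smul_selfPert (s : ℝ) (a : Profile) (τ : Angle) (x : ℝ) :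
    evalFamily τ x (s • selfPert hα m s a) = ((s * selfPertR α m s a x τ : ℝ) : ℂ) := by
  rw [map_smul, eval_selfPert, Complex.real_smul]; push_cast; ring

theorem abs_selfPertR_lt {s : ℝ} {a : Profile} (hp : ‖s • selfPert hα m s a‖ < 1) (τ : Angle)
    (x : ℝ) : |s * selfPertR α m s a x τ| < 1 := by
  have h := norm_evalFamily_le τ x (s • selfPert hα m s a)
  rw [eval_smul_selfPert, Complex.norm_real] at h
  exact lt_of_le_of_lt h hp

theorem eval_selfQuot {s : ℝ} {a : Profile} (hp : ‖s • selfPert hα m s a‖ < 1) (τ : Angle)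
    (x : ℝ) : evalFamily τ x (selfQuot hα m s a) =
      ((powQuot (-α / 2) (s * selfPertR α m s a x τ) : ℝ) : ℂ) :=
  map_powQuot _ _ (continuous_evalFamily τ x) hp (eval_smul_selfPert hα m s a τ x)
    (abs_selfPertR_lt hα m hp τ x)

theorem eval_selfPow {s : ℝ} {a : Profile} (hp : ‖s • selfPert hα m s a‖ < 1) (τ : Angle)
    (x : ℝ) : evalFamily τ x (selfPow hα m s a) =
      (((1 + s * selfPertR α m s a x τ) ^ (-α / 2) : ℝ) : ℂ) := by
  rw [← one_add_mul_powQuot _ (abs_selfPertR_lt hα m hp τ x)]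
  unfold selfPow
  simp only [map_add, map_one, map_smul, map_mul, eval_selfPert, eval_selfQuot hα m hp,
    Complex.real_smul]
  push_cast; ring

/-- The values of `selfMap`, as means of real functions. -/
theorem value_selfMap {s : ℝ} {a : Profile} (hp : ‖s • selfPert hα m s a‖ < 1) (x : ℝ) :
    ∃ g₁ g₂ g₃ : ℝ → ℝ,
      IntervalIntegrable g₁ MeasureTheory.volume 0 (2 * Real.pi) ∧
      IntervalIntegrable g₂ MeasureTheory.volume 0 (2 * Real.pi) ∧
      IntervalIntegrable g₃ MeasureTheory.volume 0 (2 * Real.pi) ∧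
      (selfMap hα m s a).value x = ((mean g₁ + mean g₂ + s * mean g₃ : ℝ) : ℂ) ∧
      ∀ τ ∈ Ioo 0 (2 * Real.pi),
        let F := fnR α m a x
        let G := fnR α m a (x - τ)
        let F' := deriv (fnR α m a) x
        let G' := deriv (fnR α m a) (x - τ)
        let v := selfPertR α m s a x τ
        let P := (1 + s * v) ^ (-α / 2)
        g₁ τ = Real.sin τ * kern α τ * (v * powQuot (-α / 2) (s * v) +
          (F + G + s * (F * G) + s * (F' * G')) * P) ∧
        g₂ τ = Real.cos τ * kern α τ * ((F' - G') * (-P - s * (F * P))) ∧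
        g₃ τ = Real.cos τ * kern α τ * (F' * (F - G) * P) := by
  set f := fnR α m a with hf
  set v : ℝ → ℝ := selfPertR α m s a x with hv
  set P : ℝ → ℝ := fun τ => (1 + s * v τ) ^ (-α / 2) with hP
  have e1 : ∀ τ : Angle, evalFamily τ x (selfPert hα m s a * selfQuot hα m s a +
        (constFamily m (fn hα.1.le m a) + shiftFamily m (fn hα.1.le m a) +
          s • (constFamily m (fn hα.1.le m a) * shiftFamily m (fn hα.1.le m a)) +
          s • (constFamily m (dfn hα.1.le m a) * shiftFamily m (dfn hα.1.le m a))) *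
        selfPow hα m s a) = ((v τ * powQuot (-α / 2) (s * v τ) +
          (f x + f (x - τ) + s * (f x * f (x - τ)) + s * (deriv f x * deriv f (x - τ))) * P τ :
          ℝ) : ℂ) := by
    intro τ
    simp only [map_add, map_smul, map_mul, eval_constFamily, eval_shiftFamily, eval_selfPert,
      eval_selfQuot hα m hp, eval_selfPow hα m hp, value_fn, value_dfn, Complex.real_smul]
    push_cast; rfl
  have e2 : ∀ τ : Angle, evalFamily τ x (-selfPow hα m s a -
      s • (constFamily m (fn hα.1.le m a) * selfPow hα m s a)) =
      ((-P τ - s * (f x * P τ) : ℝ) : ℂ) := by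
    intro τ
    simp only [map_sub, map_neg, map_smul, map_mul, eval_constFamily,
      eval_selfPow hα m hp, value_fn, Complex.real_smul]
    push_cast; rfl
  have e3 : ∀ τ : Angle, evalFamily τ x (constFamily m (dfn hα.1.le m a) *
      diffQuot hα.1.le m a * selfPow hα m s a) =
      ((deriv f x * ((2 * Real.sin ((τ : ℝ) / 2))⁻¹ * (f x - f (x - τ))) * P τ : ℝ) : ℂ) := by
    intro τ
    simp only [map_mul, eval_constFamily, eval_diffQuot hα m,
      eval_selfPow hα m hp, value_dfn]
    push_cast; rfl
  simp only [evalFamily_apply] at e1 e2 e3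
  set p₁ : ℝ → ℝ := fun τ => v τ * powQuot (-α / 2) (s * v τ) +
    (f x + f (x - τ) + s * (f x * f (x - τ)) + s * (deriv f x * deriv f (x - τ))) * P τ with hp₁
  set p₂ : ℝ → ℝ := fun τ => -P τ - s * (f x * P τ) with hp₂
  set p₃ : ℝ → ℝ := fun τ =>
    deriv f x * ((2 * Real.sin (τ / 2))⁻¹ * (f x - f (x - τ))) * P τ with hp₃
  refine ⟨_, _, _, intervalIntegrable_mean (intervalIntegrable_sin_mul_kern hα) _ x p₁ e1,
    intervalIntegrable_singular hα a _ x p₂ e2,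
    intervalIntegrable_mean (intervalIntegrable_cos_sin_half_kern hα) _ x p₃ e3,
    ?_, fun τ hτ => ⟨rfl, rfl, ?_⟩⟩
  · unfold selfMap
    rw [value_add, value_add, value_smul, value_meanFamily _ _ x p₁ e1,
      value_singularMean hα a _ x p₂ e2, value_meanFamily _ _ x p₃ e3]
    push_cast; rfl
  · have hs := (sin_half_pos hτ).ne'
    change Real.cos τ * kern α τ * (2 * Real.sin (τ / 2)) *
      (deriv f x * ((2 * Real.sin (τ / 2))⁻¹ * (f x - f (x - τ))) * P τ) =
      Real.cos τ * kern α τ * (deriv f x * (f x - f (x - τ)) * P τ)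
    field_simp

theorem crossTerm_periodic {R S : ℝ → ℝ} (hS : Function.Periodic S (2 * Real.pi))
    (hS' : Function.Periodic (deriv S) (2 * Real.pi)) (x : ℝ) :
    Function.Periodic (crossTerm R S x) (2 * Real.pi) := by
  intro y
  have e1 : Real.sin (x - (y + 2 * Real.pi)) = Real.sin (x - y) := by
    rw [← sub_sub, Real.sin_sub_two_pi]
  have e2 : Real.cos (x - (y + 2 * Real.pi)) = Real.cos (x - y) := by
    rw [← sub_sub, Real.cos_sub_two_pi]
  simp only [crossTerm, e1, e2, hS y, hS' y]

/-- After the substitution `y = x - τ` the squared chord is `4 sin² (τ / 2) (1 + s v)`, so the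
kernel is `kern α τ` times `(1 + s v) ^ (-α / 2)`. The term of order zero in `s` is `sin τ * kern α
τ`, which is odd about `π` and has mean zero. Hence the integral is divisible by `s`, which
compensates the factor `1 / (ε |ε|^α b^(1+α))` of the functional. -/
theorem mean_selfTerm {s : ℝ} {a : Profile} (hp : ‖s • selfPert hα m s a‖ < 1) (x : ℝ)
    {R : ℝ → ℝ} (hR : ∀ x, R x = 1 + s * fnR α m a x) :
    (((mean fun y => crossTerm R R x y /
      ((R x - R y) ^ 2 + 4 * R x * R y * Real.sin ((x - y) / 2) ^ 2) ^ (α / 2)) : ℝ) : ℂ) =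
      s * (selfMap hα m s a).value x := by
  obtain ⟨g₁, g₂, g₃, i1, i2, i3, hval, hg⟩ := value_selfMap hα m hp x
  have hR' : ∀ x, deriv R x = s * deriv (fnR α m a) x := by
    intro x
    have : R = fun x => 1 + s * fnR α m a x := funext hR
    rw [this]
    exact (((hasDerivAt_fnR hα.1.le a x).const_mul s).const_add 1).deriv.trans
      (by rw [(hasDerivAt_fnR hα.1.le a x).deriv])
  have hper : Function.Periodic R (2 * Real.pi) := fun x => by
    rw [hR, hR, fnR_periodic hα.1.le a x]
  have hper' : Function.Periodic (deriv R) (2 * Real.pi) := fun x => by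
    rw [hR', hR', deriv_fnR_periodic hα.1.le a x]
  have hperiod : Function.Periodic (fun y => crossTerm R R x y /
      ((R x - R y) ^ 2 + 4 * R x * R y * Real.sin ((x - y) / 2) ^ 2) ^ (α / 2))
      (2 * Real.pi) := by
    intro y
    have e : Real.sin ((x - (y + 2 * Real.pi)) / 2) ^ 2 = Real.sin ((x - y) / 2) ^ 2 := by
      rw [show (x - (y + 2 * Real.pi)) / 2 = (x - y) / 2 - Real.pi by ring, Real.sin_sub_pi, neg_sq]
    simp only [crossTerm_periodic hper hper' x y, hper y, e]
  rw [hval, ← mean_comp_sub hperiod x]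
  norm_cast
  have e : ∀ τ ∈ Ioo 0 (2 * Real.pi), crossTerm R R x (x - τ) /
      ((R x - R (x - τ)) ^ 2 + 4 * R x * R (x - τ) * Real.sin ((x - (x - τ)) / 2) ^ 2) ^ (α / 2) =
      Real.sin τ * kern α τ + (s * g₁ τ + (s * g₂ τ + s ^ 2 * g₃ τ)) := by
    intro τ hτ
    obtain ⟨h1, h2, h3⟩ := hg τ hτ
    have hsin := sin_half_pos hτ
    have ht := abs_selfPertR_lt hα m hp ⟨τ, hτ⟩ x
    have hone := one_add_mul_powQuot (-α / 2) ht
    simp only at hone ht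
    have hpos : 0 < 1 + s * selfPertR α m s a x τ := by linarith [(abs_lt.1 ht).1]
    have hD : (R x - R (x - τ)) ^ 2 + 4 * R x * R (x - τ) * Real.sin ((x - (x - τ)) / 2) ^ 2 =
        (4 * Real.sin (τ / 2) ^ 2) * (1 + s * selfPertR α m s a x τ) := by
      have hs' := hsin.ne'
      rw [sub_sub_cancel, hR, hR, selfPertR, mul_pow, inv_pow]
      field_simp
      ring
    have hdiv : (((4 * Real.sin (τ / 2) ^ 2) * (1 + s * selfPertR α m s a x τ)) ^ (α / 2))⁻¹ =
        kern α τ * (1 + s * selfPertR α m s a x τ) ^ (-α / 2) := by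
      rw [Real.mul_rpow (by positivity) hpos.le, mul_inv, ← Real.rpow_neg hpos.le, kern, neg_div]
    rw [hD, div_eq_mul_inv, hdiv, h1, h2, h3, crossTerm, hR', hR', sub_sub_cancel, hR, hR]
    -- The only use of the power identity: the unperturbed part of the sine term is split as `1 + s
    -- v * powQuot`, whose `1` is the odd kernel.
    linear_combination (-Real.sin τ * kern α τ) * hone
  rw [mean_congr e, mean_add (intervalIntegrable_sin_mul_kern hα)
    ((i1.const_mul s).add ((i2.const_mul s).add (i3.const_mul (s ^ 2)))),
    mean_add (i1.const_mul s) ((i2.const_mul s).add (i3.const_mul (s ^ 2))),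
    mean_add (i2.const_mul s) (i3.const_mul (s ^ 2)), mean_const_mul, mean_const_mul,
    mean_const_mul]
  have h0 : mean (fun τ => Real.sin τ * kern α τ) = 0 := by
    rw [mean, integral_sin_mul_kern, mul_zero]
  rw [h0]; ring

/-- At `s = 0` the function `powQuot` is the constant `-α / 2`, whence the coefficient `1 - α / 2`.
The part with `f(x)` multiplies a kernel of mean zero and drops out, leaving only `f(x - y)`. -/
theorem value_selfMap_zero (a : Profile) (x : ℝ) :
    (selfMap hα m 0 a).value x = (((1 - α / 2) * mean (fun y =>
          fnR α m a (x - y) * Real.sin y / (4 * Real.sin (y / 2) ^ 2) ^ (α / 2))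
        - mean (fun y =>
          (deriv (fnR α m a) x - deriv (fnR α m a) (x - y)) * Real.cos y
            / (4 * Real.sin (y / 2) ^ 2) ^ (α / 2)) : ℝ) : ℂ) := by
  obtain ⟨g₁, g₂, g₃, i1, i2, i3, hval, hg⟩ := value_selfMap hα m (s := 0) (a := a) (by simp) x
  rw [hval]
  congr 1
  have hcont : Continuous fun y => fnR α m a (x - y) :=
    (continuous_fnR hα.1.le a).comp (by fun_prop)
  have i4 : IntervalIntegrable (fun y => fnR α m a (x - y) * Real.sin y /
      (4 * Real.sin (y / 2) ^ 2) ^ (α / 2)) MeasureTheory.volume 0 (2 * Real.pi) := by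
    refine ((intervalIntegrable_sin_mul_kern hα).continuousOn_mul hcont.continuousOn).congr ?_
    intro y _
    simp only [kern, div_eq_mul_inv, mul_assoc]
  have e1 : mean g₁ = (1 - α / 2) * mean (fun y =>
      fnR α m a (x - y) * Real.sin y / (4 * Real.sin (y / 2) ^ 2) ^ (α / 2)) := by
    have : mean g₁ = mean (fun y => (1 - α / 2) * fnR α m a x * (Real.sin y * kern α y) +
        (1 - α / 2) * (fnR α m a (x - y) * Real.sin y /
          (4 * Real.sin (y / 2) ^ 2) ^ (α / 2))) := by
      refine mean_congr fun y hy => ?_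
      rw [(hg y hy).1]
      simp only [selfPertR, zero_mul, add_zero, Real.one_rpow, powQuot_zero, smul_eq_mul, kern,
        div_eq_mul_inv]
      ring
    rw [this, mean_add ((intervalIntegrable_sin_mul_kern hα).const_mul _) (i4.const_mul _),
      mean_const_mul, mean_const_mul]
    have h0 : mean (fun τ => Real.sin τ * kern α τ) = 0 := by
      rw [mean, integral_sin_mul_kern, mul_zero]
    rw [h0]; ring
  have e2 : mean g₂ = -mean (fun y =>
          (deriv (fnR α m a) x - deriv (fnR α m a) (x - y)) * Real.cos y
            / (4 * Real.sin (y / 2) ^ 2) ^ (α / 2)) := by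
    rw [← neg_one_mul, ← mean_const_mul]
    refine mean_congr fun y hy => ?_
    rw [(hg y hy).2.1]
    simp only [zero_mul, add_zero, Real.one_rpow, kern, div_eq_mul_inv]
    ring
  rw [e1, e2]; ring

end Self

/-! ### The symbol of the linearized self-interaction -/

namespace Wiener

variable {m : ℕ}

theorem coeff_meanFamily {k : ℝ → ℝ}
    (hk : IntervalIntegrable k MeasureTheory.volume 0 (2 * Real.pi)) (h : Family m) (n : ℤ)
    (g : ℝ → ℂ) (hg : ∀ τ : Angle, (h τ).coeff n = g τ) :
    (meanFamily m k hk h).coeff n =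
      ((1 / (2 * Real.pi) : ℝ) : ℂ) * ∫ τ in (0 : ℝ)..(2 * Real.pi), (k τ : ℂ) * g τ := by
  have e : meanFamily m k hk h = (1 / (2 * Real.pi)) • ∫ τ : Angle, k τ • h τ := rfl
  have h1 := (coeffCLM (m := m) n).integral_comp_comm (integrable_smul_family hk h)
  simp only [coeffCLM_apply, coeff_smul, hg, Complex.real_smul] at h1
  rw [e, coeff_smul, Complex.real_smul, ← h1, angle_integral (fun τ => (k τ : ℂ) * g τ)]

end Wiener

variable {α : ℝ} (hα : α ∈ Ioo (1 : ℝ) 2) (m : ℕ)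

theorem coeff_singularMean_one (a : Profile) (n : ℤ) :
    (singularMean hα m a 1).coeff n =
      ((1 / (2 * Real.pi) : ℝ) : ℂ) * ∫ τ in (0 : ℝ)..(2 * Real.pi),
        ((Real.cos τ * kern α τ : ℝ) : ℂ) * ((1 - Complex.exp (-(Complex.I * n * τ))) *
          (Complex.I * n * expCoeff α m a n)) := by
  have h1 := (coeffCLM (m := m) n).integral_comp_comm (integrable_singular hα a 1)
  have e : ∀ τ : Angle, coeffCLM (m := m) n ((Real.cos τ * kern α τ) •
      ((dfn hα.1.le m a - shift (τ : ℝ) (dfn hα.1.le m a)) * (1 : Family m) τ)) =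
      ((Real.cos τ * kern α τ : ℝ) : ℂ) * ((1 - Complex.exp (-(Complex.I * n * τ))) *
          (Complex.I * n * expCoeff α m a n)) := by
    intro τ
    rw [show (1 : Family m) τ = 1 from rfl, mul_one, coeffCLM_apply, coeff_smul, coeff_sub,
      coeff_shift, coeff_dfn, Complex.real_smul]
    ring
  simp only [e] at h1
  rw [singularMean_apply, coeff_smul, Complex.real_smul]
  rw [coeffCLM_apply] at h1
  rw [← h1, angle_integral (fun τ : ℝ => ((Real.cos τ * kern α τ : ℝ) : ℂ) *
    ((1 - Complex.exp (-(Complex.I * n * τ))) * (Complex.I * n * expCoeff α m a n)))]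

theorem intervalIntegrable_ofReal {g : ℝ → ℝ} {c d : ℝ}
    (h : IntervalIntegrable g MeasureTheory.volume c d) :
    IntervalIntegrable (fun τ => (g τ : ℂ)) MeasureTheory.volume c d :=
  ⟨h.1.ofReal, h.2.ofReal⟩

theorem exp_neg_nat (n : ℕ) (τ : ℝ) : Complex.exp (-(Complex.I * (n : ℤ) * τ)) =
    ((Real.cos (n * τ) : ℝ) : ℂ) - Complex.I * (Real.sin (n * τ) : ℝ) := by
  rw [show -(Complex.I * (n : ℤ) * τ) = (-((n * τ : ℝ) : ℂ)) * Complex.I by push_cast; ring,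
    Complex.exp_mul_I, Complex.cos_neg, Complex.sin_neg]
  push_cast; ring

theorem cos_nat_two_pi_sub (n : ℕ) (τ : ℝ) :
    Real.cos (n * (2 * Real.pi - τ)) = Real.cos (n * τ) := by
  rw [mul_sub, Real.cos_nat_mul_two_pi_sub]

theorem sin_nat_two_pi_sub (n : ℕ) (τ : ℝ) :
    Real.sin (n * (2 * Real.pi - τ)) = -Real.sin (n * τ) := by
  rw [mul_sub, Real.sin_nat_mul_two_pi_sub]

/-- The weight `sin τ * kern α τ` is odd under `τ ↦ 2π - τ`, so only the sine part of the
exponential survives. In `integral_cos_kern_mul_exp` the weight is even and only the cosine part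
survives. -/
theorem integral_sin_kern_mul_exp {α : ℝ} (hα : α ∈ Ioo (1 : ℝ) 2) (n : ℕ) :
    ∫ τ in (0 : ℝ)..(2 * Real.pi), ((Real.sin τ * kern α τ : ℝ) : ℂ) *
      (1 + Complex.exp (-(Complex.I * (n : ℤ) * τ))) =
      -Complex.I * ((∫ τ in (0 : ℝ)..(2 * Real.pi),
        Real.sin (n * τ) * (Real.sin τ * kern α τ) : ℝ) : ℂ) := by
  have h0 := intervalIntegrable_sin_mul_kern hα
  have i1 : IntervalIntegrable (fun τ => (1 + Real.cos (n * τ)) * (Real.sin τ * kern α τ))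
    MeasureTheory.volume 0 (2 * Real.pi) :=
    h0.continuousOn_mul (g := fun τ => 1 + Real.cos (n * τ)) (by fun_prop)
  have i2 : IntervalIntegrable (fun τ => Real.sin (n * τ) * (Real.sin τ * kern α τ))
    MeasureTheory.volume 0 (2 * Real.pi) :=
    h0.continuousOn_mul (g := fun τ => Real.sin (n * τ)) (by fun_prop)
  have hz : ∫ τ in (0 : ℝ)..(2 * Real.pi), (1 + Real.cos (n * τ)) * (Real.sin τ * kern α τ) = 0 :=
    integral_eq_zero_of_odd fun τ => by
      rw [cos_nat_two_pi_sub, kern_symm, Real.sin_two_pi_sub]; ring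
  calc _ = ∫ τ in (0 : ℝ)..(2 * Real.pi),
        ((((1 + Real.cos (n * τ)) * (Real.sin τ * kern α τ) : ℝ) : ℂ) +
          -Complex.I * ((Real.sin (n * τ) * (Real.sin τ * kern α τ) : ℝ) : ℂ)) := by
        congr 1; funext τ
        rw [exp_neg_nat]; push_cast; ring
    _ = _ := by
        rw [intervalIntegral.integral_add (intervalIntegrable_ofReal i1)
          ((intervalIntegrable_ofReal i2).const_mul _),
          intervalIntegral.integral_const_mul, intervalIntegral.integral_ofReal,
          intervalIntegral.integral_ofReal, hz, Complex.ofReal_zero, zero_add]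

theorem integral_cos_kern_mul_exp {α : ℝ} (hα : α ∈ Ioo (1 : ℝ) 2) (n : ℕ) :
    ∫ τ in (0 : ℝ)..(2 * Real.pi), ((Real.cos τ * kern α τ : ℝ) : ℂ) *
      (1 - Complex.exp (-(Complex.I * (n : ℤ) * τ))) =
      ((∫ τ in (0 : ℝ)..(2 * Real.pi),
        (1 - Real.cos (n * τ)) * Real.cos τ * kern α τ : ℝ) : ℂ) := by
  have i1 : IntervalIntegrable (fun τ => (1 - Real.cos (n * τ)) * Real.cos τ * kern α τ)
      MeasureTheory.volume 0 (2 * Real.pi) :=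
    ((intervalIntegrable_cos_kern hα n).continuousOn_mul (g := Real.cos) (by fun_prop)).congr
      fun τ _ => by ring
  have i2 : IntervalIntegrable (fun τ => Real.sin (n * τ) * (Real.cos τ * kern α τ))
      MeasureTheory.volume 0 (2 * Real.pi) := by
    refine (intervalIntegrable_abs_sin_mul_kern hα (2 * n)).mono_fun
      ((by fun_prop : Measurable fun τ : ℝ => Real.sin (n * τ)).mul
        ((by fun_prop : Measurable Real.cos).mul (measurable_kern α))).aestronglyMeasurable
      (Eventually.of_forall fun τ => ?_)
    have hk := kern_nonneg α τ
    simp only [Real.norm_eq_abs]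
    rw [show ((2 * n : ℕ) : ℝ) * τ / 2 = n * τ by push_cast; ring, abs_mul, abs_mul, abs_mul,
      abs_mul, abs_two, abs_abs, abs_of_nonneg hk]
    have hc := Real.abs_cos_le_one τ
    calc |Real.sin (n * τ)| * (|Real.cos τ| * kern α τ) ≤
          |Real.sin (n * τ)| * (2 * kern α τ) := by gcongr; linarith
      _ = _ := by ring
  have hz : ∫ τ in (0 : ℝ)..(2 * Real.pi), Real.sin (n * τ) * (Real.cos τ * kern α τ) = 0 :=
    integral_eq_zero_of_odd fun τ => by
      rw [sin_nat_two_pi_sub, kern_symm, Real.cos_two_pi_sub]; ring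
  calc _ = ∫ τ in (0 : ℝ)..(2 * Real.pi),
        ((((1 - Real.cos (n * τ)) * Real.cos τ * kern α τ : ℝ) : ℂ) +
          Complex.I * ((Real.sin (n * τ) * (Real.cos τ * kern α τ) : ℝ) : ℂ)) := by
        congr 1; funext τ
        rw [exp_neg_nat]; push_cast; ring
    _ = _ := by
        rw [intervalIntegral.integral_add (intervalIntegrable_ofReal i1)
          ((intervalIntegrable_ofReal i2).const_mul _),
          intervalIntegral.integral_const_mul, intervalIntegral.integral_ofReal,
          intervalIntegral.integral_ofReal, hz, Complex.ofReal_zero, mul_zero, add_zero]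

theorem selfMap_zero (a : Profile) : selfMap hα m 0 a =
    (1 - α / 2) • meanFamily m _ (intervalIntegrable_sin_mul_kern hα)
      (constFamily m (fn hα.1.le m a) + shiftFamily m (fn hα.1.le m a)) -
    singularMean hα m a 1 := by
  simp only [selfMap, selfPert, selfQuot, selfPow, zero_smul, add_zero, powQuot_zero, sub_zero,
    map_neg, mul_one]
  rw [mul_smul_comm, mul_one, map_add, map_smul, ← sub_eq_add_neg, sub_left_inj]
  module

/-- The linearization acts on Fourier coefficients as a multiplier. -/
theorem coeff_selfMap_zero (a : Profile) (n : ℕ) : (selfMap hα m 0 a).coeff n =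
    -Complex.I * linSymbol α n * expCoeff α m a n := by
  rw [selfMap_zero, coeff_sub, coeff_smul, coeff_singularMean_one,
    coeff_meanFamily _ _ _ (fun τ => (1 + Complex.exp (-(Complex.I * (n : ℤ) * τ))) *
      expCoeff α m a n) fun τ => ?_]
  · simp only [← mul_assoc]
    rw [intervalIntegral.integral_mul_const, intervalIntegral.integral_mul_const,
      intervalIntegral.integral_mul_const, intervalIntegral.integral_mul_const,
      integral_sin_kern_mul_exp hα, integral_cos_kern_mul_exp hα, linSymbol, Complex.real_smul]
    push_cast
    ring
  · rw [BoundedContinuousFunction.add_apply, constFamily_apply, shiftFamily_apply, coeff_add,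
      coeff_shift, coeff_fn]
    ring

/-! ### The interaction of two patches -/

section Trig

variable (m : ℕ)

/-- The cosine as an element of the Wiener algebra. -/
def cosElt : Wiener m := single 1 (1 / 2) + single (-1) (1 / 2)

/-- The sine as an element of the Wiener algebra. -/
def sinElt : Wiener m := single 1 (-Complex.I / 2) + single (-1) (Complex.I / 2)

theorem exp_I_one (x : ℝ) : Complex.exp (Complex.I * (1 : ℤ) * x) =
    (Real.cos x : ℝ) + Complex.I * (Real.sin x : ℝ) := by
  rw [Int.cast_one, mul_one, mul_comm, Complex.exp_mul_I]
  push_cast; ring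

theorem exp_I_neg_one (x : ℝ) : Complex.exp (Complex.I * (-1 : ℤ) * x) =
    (Real.cos x : ℝ) - Complex.I * (Real.sin x : ℝ) := by
  rw [show Complex.I * ((-1 : ℤ) : ℂ) * x = (-(x : ℂ)) * Complex.I by push_cast; ring,
    Complex.exp_mul_I, Complex.cos_neg, Complex.sin_neg]
  push_cast; ring

theorem value_cosElt (x : ℝ) : (cosElt m).value x = (Real.cos x : ℝ) := by
  rw [cosElt, value_add, value_single, value_single, exp_I_one, exp_I_neg_one]; ring

theorem value_sinElt (x : ℝ) : (sinElt m).value x = (Real.sin x : ℝ) := by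
  rw [sinElt, value_add, value_single, value_single, exp_I_one, exp_I_neg_one]
  linear_combination (-(Real.sin x : ℂ)) * Complex.I_sq

end Trig

/-- A closed curve, given by its position and velocity `(x, y, x', y')`. -/
abbrev Loop (m : ℕ) : Type := Wiener m × Wiener m × Wiener m × Wiener m

section Loop

variable {α : ℝ} (hα : α ∈ Ioo (1 : ℝ) 2) (m : ℕ)

/-- The polar curve `(1 + s f) (cos, sin)`. -/
def loop (s : ℝ) (a : Profile) : Loop m :=
  ((1 + s • fn hα.1.le m a) * cosElt m, (1 + s • fn hα.1.le m a) * sinElt m,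
    s • dfn hα.1.le m a * cosElt m - (1 + s • fn hα.1.le m a) * sinElt m,
    s • dfn hα.1.le m a * sinElt m + (1 + s • fn hα.1.le m a) * cosElt m)

theorem contDiff_radiusElt {n : WithTop ℕ∞} :
    ContDiff ℝ n fun p : ℝ × Profile => 1 + p.1 • fn hα.1.le m p.2 :=
  contDiff_const.add (contDiff_fst.smul ((fn hα.1.le m).contDiff.comp contDiff_snd))

theorem contDiff_smul_dfn {n : WithTop ℕ∞} :
    ContDiff ℝ n fun p : ℝ × Profile => p.1 • dfn hα.1.le m p.2 :=
  contDiff_fst.smul ((dfn hα.1.le m).contDiff.comp contDiff_snd)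

theorem contDiff_loop {n : WithTop ℕ∞} :
    ContDiff ℝ n fun p : ℝ × Profile => loop hα m p.1 p.2 := by
  have h1 := contDiff_radiusElt hα m (n := n)
  have h2 := contDiff_smul_dfn hα m (n := n)
  exact (h1.mul contDiff_const).prodMk ((h1.mul contDiff_const).prodMk
    (((h2.mul contDiff_const).sub (h1.mul contDiff_const)).prodMk
      ((h2.mul contDiff_const).add (h1.mul contDiff_const))))

/-- The real radius `1 + s f`. -/
def radR (α : ℝ) (m : ℕ) (s : ℝ) (a : Profile) (x : ℝ) : ℝ := 1 + s * fnR α m a x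

theorem hasDerivAt_radR {α : ℝ} (hα : α ∈ Ioo (1 : ℝ) 2) (m : ℕ) (s : ℝ) (a : Profile) (x : ℝ) :
    HasDerivAt (radR α m s a) (s * deriv (fnR α m a) x) x := by
  have h := (hasDerivAt_fnR (m := m) hα.1.le a x)
  rw [h.deriv]
  exact (h.const_mul s).const_add 1

theorem deriv_radR {α : ℝ} (hα : α ∈ Ioo (1 : ℝ) 2) (m : ℕ) (s : ℝ) (a : Profile) (x : ℝ) :
    deriv (radR α m s a) x = s * deriv (fnR α m a) x := (hasDerivAt_radR hα m s a x).deriv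

theorem value_loop (s : ℝ) (a : Profile) (x : ℝ) :
    (loop hα m s a).1.value x = ((radR α m s a x * Real.cos x : ℝ) : ℂ) ∧
    (loop hα m s a).2.1.value x = ((radR α m s a x * Real.sin x : ℝ) : ℂ) ∧
    (loop hα m s a).2.2.1.value x =
      ((deriv (radR α m s a) x * Real.cos x - radR α m s a x * Real.sin x : ℝ) : ℂ) ∧
    (loop hα m s a).2.2.2.value x =
      ((deriv (radR α m s a) x * Real.sin x + radR α m s a x * Real.cos x : ℝ) : ℂ) := by
  have h1 : (1 + s • fn hα.1.le m a).value x = ((radR α m s a x : ℝ) : ℂ) := by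
    rw [value_add, value_one, value_smul, value_fn, radR]; push_cast; ring
  have h2 : (s • dfn hα.1.le m a).value x = ((deriv (radR α m s a) x : ℝ) : ℂ) := by
    rw [value_smul, value_dfn, deriv_radR hα]; push_cast; ring
  simp only [loop, value_mul, value_sub, value_add (_ * _), h1, h2, value_cosElt, value_sinElt]
  push_cast
  exact ⟨rfl, rfl, rfl, rfl⟩

theorem radR_periodic {α : ℝ} (hα : α ∈ Ioo (1 : ℝ) 2) (m : ℕ) (s : ℝ) (a : Profile) : Function.Periodic (radR α m s a) (2 * Real.pi) :=
  fun x => by rw [radR, radR, fnR_periodic hα.1.le a x]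

/-- The integrands are derivatives of the coordinates of a closed curve. This removes the term of
order zero in `ε` from the interaction of two patches. -/
theorem mean_velocity_eq_zero {α : ℝ} (hα : α ∈ Ioo (1 : ℝ) 2) (m : ℕ) (s : ℝ) (a : Profile) :
    mean (fun y => deriv (radR α m s a) y * Real.cos y - radR α m s a y * Real.sin y) = 0 ∧
    mean (fun y => deriv (radR α m s a) y * Real.sin y + radR α m s a y * Real.cos y) = 0 := by
  have hc : Continuous (radR α m s a) :=
    continuous_iff_continuousAt.2 fun x => (hasDerivAt_radR hα m s a x).continuousAt
  have hc' : Continuous (deriv (radR α m s a)) := by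
    have : Continuous fun x => s * deriv (fnR α m a) x :=
      continuous_const.mul (continuous_deriv_fnR hα.1.le a)
    exact this.congr fun x => (deriv_radR hα m s a x).symm
  have hd : ∀ y, HasDerivAt (radR α m s a) (deriv (radR α m s a) y) y := fun y => by
    rw [deriv_radR hα]; exact hasDerivAt_radR hα m s a y
  have hp : radR α m s a (2 * Real.pi) = radR α m s a 0 := by
    simpa using radR_periodic hα m s a 0
  unfold mean
  constructor
  · rw [intervalIntegral.integral_eq_sub_of_hasDerivAt
      (f := fun y => radR α m s a y * Real.cos y)
      (fun y _ => ((hd y).mul (Real.hasDerivAt_cos y)).congr_deriv (by ring))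
      (Continuous.intervalIntegrable (by fun_prop) _ _)]
    simp [hp]
  · rw [intervalIntegral.integral_eq_sub_of_hasDerivAt
      (f := fun y => radR α m s a y * Real.sin y)
      (fun y _ => ((hd y).mul (Real.hasDerivAt_sin y)).congr_deriv (by ring))
      (Continuous.intervalIntegrable (by fun_prop) _ _)]
    simp

/-- The right side is minus the cross product of the velocities of the two polar curves. In this
form the dependence on `x` and on `y` separates, which the means and the conservation laws rely on.
-/
theorem crossTerm_eq (R S : ℝ → ℝ) (x y : ℝ) : crossTerm R S x y =
    (deriv R x * Real.sin x + R x * Real.cos x) * (deriv S y * Real.cos y - S y * Real.sin y) -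
    (deriv R x * Real.cos x - R x * Real.sin x) *
      (deriv S y * Real.sin y + S y * Real.cos y) := by
  rw [crossTerm, Real.sin_sub, Real.cos_sub]; ring

end Loop

section Pair

variable {m : ℕ}

theorem intervalIntegrable_one :
    IntervalIntegrable (fun _ : ℝ => (1 : ℝ)) MeasureTheory.volume 0 (2 * Real.pi) :=
  continuous_const.intervalIntegrable _ _

/-- The cross product of the velocities. -/
def pairCross (P Q : Loop m) : Family m :=
  constFamily m P.2.2.2 * valueFamily m Q.2.2.1 - constFamily m P.2.2.1 * valueFamily m Q.2.2.2

/-- `(|d + ε h|² - |d|²) / ε`, where `h = b z - b' ζ`. -/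
def pairPert (b b' ε : ℝ) (d : ℂ) (P Q : Loop m) : Family m :=
  (2 * d.re) • (b • constFamily m P.1 - b' • valueFamily m Q.1) +
    (2 * d.im) • (b • constFamily m P.2.1 - b' • valueFamily m Q.2.1) +
    ε • ((b • constFamily m P.1 - b' • valueFamily m Q.1) ^ 2 +
      (b • constFamily m P.2.1 - b' • valueFamily m Q.2.1) ^ 2)

/-- The mean of the interaction kernel over the second curve, divided by `ε`. -/
def pairMap (α b b' ε : ℝ) (d : ℂ) (P Q : Loop m) : Wiener m :=
  (d.re ^ 2 + d.im ^ 2) ^ (-α / 2 - 1) • meanFamily m (fun _ => 1) intervalIntegrable_one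
    (pairCross P Q * (pairPert b b' ε d P Q *
      powQuot (-α / 2) ((ε / (d.re ^ 2 + d.im ^ 2)) • pairPert b b' ε d P Q)))

/-- The domain on which the interaction is smooth. -/
def PairSmall (b b' ε : ℝ) (d : ℂ) (P Q : Loop m) : Prop :=
  d ≠ 0 ∧ ‖(ε / (d.re ^ 2 + d.im ^ 2)) • pairPert b b' ε d P Q‖ < 1

theorem re_sq_add_im_sq_pos {d : ℂ} (hd : d ≠ 0) : 0 < d.re ^ 2 + d.im ^ 2 := by
  have := Complex.normSq_pos.2 hd
  rw [Complex.normSq_apply] at this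
  nlinarith

section ContDiff

variable {E : Type*} [NormedAddCommGroup E] [NormedSpace ℝ E] {n : WithTop ℕ∞} {q : E}

theorem contDiffAt_pairPert {b b' : ℝ} {ε : E → ℝ} {d : E → ℂ} {P Q : E → Loop m}
    (hε : ContDiffAt ℝ n ε q) (hd : ContDiffAt ℝ n d q) (hP : ContDiffAt ℝ n P q)
    (hQ : ContDiffAt ℝ n Q q) :
    ContDiffAt ℝ n (fun q => pairPert b b' (ε q) (d q) (P q) (Q q)) q := by
  have p1 : ContDiffAt ℝ n (fun q => constFamily m (P q).1) q :=
    (constFamily m).contDiff.contDiffAt.comp q hP.fst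
  have p2 : ContDiffAt ℝ n (fun q => constFamily m (P q).2.1) q :=
    (constFamily m).contDiff.contDiffAt.comp q hP.snd.fst
  have q1 : ContDiffAt ℝ n (fun q => valueFamily m (Q q).1) q :=
    (valueFamily m).contDiff.contDiffAt.comp q hQ.fst
  have q2 : ContDiffAt ℝ n (fun q => valueFamily m (Q q).2.1) q :=
    (valueFamily m).contDiff.contDiffAt.comp q hQ.snd.fst
  have dr : ContDiffAt ℝ n (fun q => (d q).re) q := Complex.reCLM.contDiff.contDiffAt.comp q hd
  have di : ContDiffAt ℝ n (fun q => (d q).im) q := Complex.imCLM.contDiff.contDiffAt.comp q hd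
  have h1 := (p1.const_smul b).sub (q1.const_smul b')
  have h2 := (p2.const_smul b).sub (q2.const_smul b')
  exact (((contDiffAt_const.mul dr).smul h1).add ((contDiffAt_const.mul di).smul h2)).add
    (hε.smul ((h1.pow 2).add (h2.pow 2)))

theorem contDiffAt_pairMap {α b b' : ℝ} {ε : E → ℝ} {d : E → ℂ} {P Q : E → Loop m}
    (hε : ContDiffAt ℝ n ε q) (hd : ContDiffAt ℝ n d q) (hP : ContDiffAt ℝ n P q)
    (hQ : ContDiffAt ℝ n Q q) (hs : PairSmall b b' (ε q) (d q) (P q) (Q q)) :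
    ContDiffAt ℝ n (fun q => pairMap α b b' (ε q) (d q) (P q) (Q q)) q := by
  have p1 : ContDiffAt ℝ n (fun q => constFamily m (P q).2.2.2) q :=
    (constFamily m).contDiff.contDiffAt.comp q hP.snd.snd.snd
  have p2 : ContDiffAt ℝ n (fun q => constFamily m (P q).2.2.1) q :=
    (constFamily m).contDiff.contDiffAt.comp q hP.snd.snd.fst
  have q1 : ContDiffAt ℝ n (fun q => valueFamily m (Q q).2.2.1) q :=
    (valueFamily m).contDiff.contDiffAt.comp q hQ.snd.snd.fst
  have q2 : ContDiffAt ℝ n (fun q => valueFamily m (Q q).2.2.2) q :=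
    (valueFamily m).contDiff.contDiffAt.comp q hQ.snd.snd.snd
  have dr : ContDiffAt ℝ n (fun q => (d q).re) q := Complex.reCLM.contDiff.contDiffAt.comp q hd
  have di : ContDiffAt ℝ n (fun q => (d q).im) q := Complex.imCLM.contDiff.contDiffAt.comp q hd
  have hρ := (dr.pow 2).add (di.pow 2)
  have hρ0 := (re_sq_add_im_sq_pos hs.1).ne'
  have hp := contDiffAt_pairPert (b := b) (b' := b') hε hd hP hQ
  have hw : ContDiffAt ℝ n (fun q => powQuot (-α / 2) ((ε q / ((d q).re ^ 2 + (d q).im ^ 2)) •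
      pairPert b b' (ε q) (d q) (P q) (Q q))) q :=
    (contDiffAt_powQuot (-α / 2) hs.2).comp q ((hε.div hρ hρ0).smul hp)
  exact (hρ.rpow_const_of_ne hρ0).smul ((meanFamily m (fun _ => 1)
    intervalIntegrable_one).contDiff.contDiffAt.comp q
      (((p1.mul q1).sub (p2.mul q2)).mul (hp.mul hw)))

end ContDiff

theorem eval_valueFamily (c : Wiener m) (τ : Angle) (x : ℝ) :
    evalFamily τ x (valueFamily m c) = ((c.value τ).re : ℂ) := by
  rw [evalFamily_apply, valueFamily_apply, value_smul, value_one, mul_one]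

variable {α : ℝ} (hα : α ∈ Ioo (1 : ℝ) 2)

/-- The real counterpart of `pairPert`. -/
def pairPertR (b b' ε : ℝ) (d : ℂ) (R S : ℝ → ℝ) (x y : ℝ) : ℝ :=
  2 * d.re * (b * (R x * Real.cos x) - b' * (S y * Real.cos y)) +
    2 * d.im * (b * (R x * Real.sin x) - b' * (S y * Real.sin y)) +
    ε * ((b * (R x * Real.cos x) - b' * (S y * Real.cos y)) ^ 2 +
      (b * (R x * Real.sin x) - b' * (S y * Real.sin y)) ^ 2)

theorem eval_pairPert (b b' ε : ℝ) (d : ℂ) (s s' : ℝ) (a a' : Profile) (τ : Angle) (x : ℝ) :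
    evalFamily τ x (pairPert b b' ε d (loop hα m s a) (loop hα m s' a')) =
      ((pairPertR b b' ε d (radR α m s a) (radR α m s' a') x τ : ℝ) : ℂ) := by
  unfold pairPert pairPertR
  obtain ⟨h1, h2, -, -⟩ := value_loop hα m s a x
  obtain ⟨k1, k2, -, -⟩ := value_loop hα m s' a' τ
  simp only [map_add, map_sub, map_smul, map_pow, eval_constFamily, eval_valueFamily, h1, h2, k1,
    k2, Complex.real_smul, Complex.ofReal_re]
  push_cast; ring

theorem eval_pairCross (s s' : ℝ) (a a' : Profile) (τ : Angle) (x : ℝ) :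
    evalFamily τ x (pairCross (loop hα m s a) (loop hα m s' a')) =
      ((crossTerm (radR α m s a) (radR α m s' a') x τ : ℝ) : ℂ) := by
  rw [crossTerm_eq]
  unfold pairCross
  obtain ⟨-, -, h1, h2⟩ := value_loop hα m s a x
  obtain ⟨-, -, k1, k2⟩ := value_loop hα m s' a' τ
  simp only [map_sub, map_mul, eval_constFamily, eval_valueFamily, h1, h2, k1,
    k2, Complex.ofReal_re]
  push_cast; ring

theorem value_pairMap {b b' ε : ℝ} {d : ℂ} {s s' : ℝ} {a a' : Profile}
    (hs : PairSmall b b' ε d (loop hα m s a) (loop hα m s' a')) (x : ℝ) :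
    let p := pairPertR b b' ε d (radR α m s a) (radR α m s' a') x
    let ρ := d.re ^ 2 + d.im ^ 2
    let g := fun y => crossTerm (radR α m s a) (radR α m s' a') x y *
      (p y * powQuot (-α / 2) (ε / ρ * p y))
    IntervalIntegrable g MeasureTheory.volume 0 (2 * Real.pi) ∧
    (∀ y ∈ Ioo 0 (2 * Real.pi), |ε / ρ * p y| < 1) ∧
    (pairMap α b b' ε d (loop hα m s a) (loop hα m s' a')).value x =
      ((ρ ^ (-α / 2 - 1) * mean g : ℝ) : ℂ) := by
  intro p ρ g
  have hev : ∀ τ : Angle, evalFamily τ x ((ε / ρ) • pairPert b b' ε d (loop hα m s a)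
      (loop hα m s' a')) = ((ε / ρ * p τ : ℝ) : ℂ) := by
    intro τ
    rw [map_smul, eval_pairPert, Complex.real_smul, ← Complex.ofReal_mul]
  have hlt : ∀ τ : Angle, |ε / ρ * p τ| < 1 := by
    intro τ
    have h := norm_evalFamily_le τ x ((ε / ρ) • pairPert b b' ε d (loop hα m s a)
      (loop hα m s' a'))
    rw [hev, Complex.norm_real] at h
    exact lt_of_le_of_lt h hs.2
  have he : ∀ τ : Angle, evalFamily τ x (pairCross (loop hα m s a) (loop hα m s' a') *
      (pairPert b b' ε d (loop hα m s a) (loop hα m s' a') *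
        powQuot (-α / 2) ((ε / ρ) • pairPert b b' ε d (loop hα m s a) (loop hα m s' a')))) =
      ((g τ : ℝ) : ℂ) := by
    intro τ
    rw [map_mul, map_mul, eval_pairCross, eval_pairPert,
      map_powQuot _ _ (continuous_evalFamily τ x) hs.2 (hev τ) (hlt τ)]
    simp only [g, p, Complex.ofReal_mul]
  simp only [evalFamily_apply] at he
  refine ⟨?_, fun y hy => hlt ⟨y, hy⟩, ?_⟩
  · exact (intervalIntegrable_mean intervalIntegrable_one _ x g he).congr
      fun y _ => one_mul (g y)
  · rw [pairMap, value_smul, value_meanFamily _ _ x g he]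
    simp only [one_mul]
    push_cast; rfl

theorem norm_sub_sq_eq (b b' ε : ℝ) (w w' : ℂ) (R S : ℝ → ℝ) (x y : ℝ) :
    ‖(w + ((ε * b * R x : ℝ) : ℂ) * unitVec x) - (w' + ((ε * b' * S y : ℝ) : ℂ) * unitVec y)‖ ^ 2 =
      (w - w').re ^ 2 + (w - w').im ^ 2 + ε * pairPertR b b' ε (w - w') R S x y := by
  rw [← Complex.normSq_eq_norm_sq, Complex.normSq_apply, pairPertR]
  simp only [unitVec, Complex.sub_re, Complex.add_re, Complex.mul_re, Complex.ofReal_re,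
    Complex.ofReal_im, Complex.sub_im, Complex.add_im, Complex.mul_im, zero_mul, sub_zero, add_zero]
  ring

/-- The interaction integral in terms of `pairMap`. -/
theorem mean_interaction {b b' ε : ℝ} {w w' : ℂ} {s s' : ℝ} {a a' : Profile}
    (hs : PairSmall b b' ε (w - w') (loop hα m s a) (loop hα m s' a')) (x : ℝ) :
    ((mean fun y => crossTerm (radR α m s a) (radR α m s' a') x y /
      ‖(w + ((ε * b * radR α m s a x : ℝ) : ℂ) * unitVec x) -
        (w' + ((ε * b' * radR α m s' a' y : ℝ) : ℂ) * unitVec y)‖ ^ α : ℝ) : ℂ) =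
      ε * (pairMap α b b' ε (w - w') (loop hα m s a) (loop hα m s' a')).value x := by
  obtain ⟨hi, hlt, hval⟩ := value_pairMap hα hs x
  set d := w - w' with hd
  set ρ := d.re ^ 2 + d.im ^ 2 with hρ
  have hρ0 : 0 < ρ := re_sq_add_im_sq_pos hs.1
  set p := pairPertR b b' ε d (radR α m s a) (radR α m s' a') x with hp
  rw [hval]
  norm_cast
  have e : ∀ y ∈ Ioo 0 (2 * Real.pi), crossTerm (radR α m s a) (radR α m s' a') x y /
      ‖(w + ((ε * b * radR α m s a x : ℝ) : ℂ) * unitVec x) -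
        (w' + ((ε * b' * radR α m s' a' y : ℝ) : ℂ) * unitVec y)‖ ^ α =
      ρ ^ (-α / 2) * crossTerm (radR α m s a) (radR α m s' a') x y +
        ε * ρ ^ (-α / 2 - 1) * (crossTerm (radR α m s a) (radR α m s' a') x y *
      (p y * powQuot (-α / 2) (ε / ρ * p y))) := by
    intro y hy
    have ht := hlt y hy
    have hone := one_add_mul_powQuot (-α / 2) ht
    have hpos : 0 < 1 + ε / ρ * p y := by linarith [(abs_lt.1 ht).1]
    set z := (w + ((ε * b * radR α m s a x : ℝ) : ℂ) * unitVec x) -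
        (w' + ((ε * b' * radR α m s' a' y : ℝ) : ℂ) * unitVec y) with hz
    have hn : ‖z‖ ^ 2 = ρ * (1 + ε / ρ * p y) := by
      rw [hz, norm_sub_sq_eq]
      field_simp
      rfl
    have hpow : (‖z‖ ^ α)⁻¹ = ρ ^ (-α / 2) * (1 + ε / ρ * p y) ^ (-α / 2) := by
      rw [← Real.mul_rpow hρ0.le hpos.le, ← hn, ← Real.rpow_natCast, ← Real.rpow_mul (norm_nonneg z),
        ← Real.rpow_neg (norm_nonneg z)]
      congr 1; push_cast; ring
    rw [div_eq_mul_inv, hpow, ← hone, Real.rpow_sub_one hρ0.ne']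
    field_simp
  have hcross : ∀ y, crossTerm (radR α m s a) (radR α m s' a') x y =
      (deriv (radR α m s a) x * Real.sin x + radR α m s a x * Real.cos x) *
        (deriv (radR α m s' a') y * Real.cos y - radR α m s' a' y * Real.sin y) +
      -(deriv (radR α m s a) x * Real.cos x - radR α m s a x * Real.sin x) *
        (deriv (radR α m s' a') y * Real.sin y + radR α m s' a' y * Real.cos y) := by
    intro y; rw [crossTerm_eq]; ring
  have hc : Continuous (radR α m s' a') :=
    continuous_iff_continuousAt.2 fun x => (hasDerivAt_radR hα m s' a' x).continuousAt
  have hc' : Continuous (deriv (radR α m s' a')) := by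
    have : Continuous fun x => s' * deriv (fnR α m a') x :=
      continuous_const.mul (continuous_deriv_fnR hα.1.le a')
    exact this.congr fun x => (deriv_radR hα m s' a' x).symm
  -- The leading part of the kernel is a constant times `crossTerm`, which has mean zero in `y`
  -- because the second curve is closed. The whole integral is therefore `ε` times a regular term.
  have hm0 : mean (crossTerm (radR α m s a) (radR α m s' a') x) = 0 := by
    rw [show crossTerm (radR α m s a) (radR α m s' a') x = _ from funext hcross,
      mean_add (Continuous.intervalIntegrable (by fun_prop) _ _)
        (Continuous.intervalIntegrable (by fun_prop) _ _), mean_const_mul, mean_const_mul,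
      (mean_velocity_eq_zero hα m s' a').1, (mean_velocity_eq_zero hα m s' a').2]
    ring
  have hci : IntervalIntegrable (crossTerm (radR α m s a) (radR α m s' a') x)
      MeasureTheory.volume 0 (2 * Real.pi) := by
    rw [show crossTerm (radR α m s a) (radR α m s' a') x = _ from funext hcross]
    exact Continuous.intervalIntegrable (by fun_prop) _ _
  rw [mean_congr e, mean_add (hci.const_mul _) (hi.const_mul _), mean_const_mul, mean_const_mul,
    hm0]
  ring

end Pair

/-! ### The full functional -/

/-- The size `ε |ε|^α b^(1+α)` of the perturbation of the disc. -/
def coreSize (α b ε : ℝ) : ℝ := ε * |ε| ^ α * b ^ (1 + α)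

@[simp] theorem coreSize_zero (α b : ℝ) : coreSize α b 0 = 0 := by simp [coreSize]

theorem coreSize_ne_zero {α b ε : ℝ} (hb : 0 < b) (hε : ε ≠ 0) : coreSize α b ε ≠ 0 := by
  have : 0 < |ε| := abs_pos.2 hε
  unfold coreSize; positivity

/-- The factor `|ε|^α` is `C¹` because `α > 1`. The self-interaction and the interaction are smooth
in the size of the perturbation, so this factor is what limits the regularity in `ε`. -/
theorem contDiff_coreSize {α : ℝ} (hα : α ∈ Ioo (1 : ℝ) 2) (b : ℝ) :
    ContDiff ℝ 1 (coreSize α b) :=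
  (contDiff_id.mul (contDiff_norm_rpow (E := ℝ) hα.1)).mul contDiff_const

theorem radius_eq_radR (α b ε : ℝ) (m : ℕ) (a : Profile) :
    radius α b ε (fnR α m a) = radR α m (coreSize α b ε) a := rfl

section Total

variable {α : ℝ} (hα : α ∈ Ioo (1 : ℝ) 2) (m : ℕ)

/-- The rigid motion in terms of `b`, `ε`, `w`, `Ω`, `U` and the curve. -/
def rigidMap (b ε : ℝ) (w : ℂ) (Ω U : ℝ) (s : ℝ) (a : Profile) : Wiener m :=
  (Ω * ε * b) • ((1 + s • fn hα.1.le m a) * (s • dfn hα.1.le m a)) +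
    (Ω * w.re + U) • (loop hα m s a).2.2.1 + (Ω * w.im) • (loop hα m s a).2.2.2

variable {N : ℕ} (b : Fin N → ℝ)

/-- The functional with values in the Wiener algebra. -/
def totalMap (ε : ℝ) (a : Fin N → Profile) (l : Params N) (i : Fin N) : Wiener m :=
  rigidMap hα m (b i) ε (l.pos i) l.angularVelocity l.speed (coreSize α (b i) ε) (a i) +
    (kernelConst α * l.strength i) • selfMap hα m (coreSize α (b i) ε) (a i) +
    ∑ j ∈ Finset.univ.erase i, (kernelConst α * l.strength j / b j) •
      pairMap α (b i) (b j) ε (l.pos i - l.pos j) (loop hα m (coreSize α (b i) ε) (a i))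
        (loop hα m (coreSize α (b j) ε) (a j))

/-- The domain of `totalMap`. -/
def TotalSmall (ε : ℝ) (a : Fin N → Profile) (l : Params N) : Prop :=
  ∀ i, ‖coreSize α (b i) ε • selfPert hα m (coreSize α (b i) ε) (a i)‖ < 1 ∧
    ∀ j, j ≠ i → PairSmall (b i) (b j) ε (l.pos i - l.pos j)
      (loop hα m (coreSize α (b i) ε) (a i)) (loop hα m (coreSize α (b j) ε) (a j))

section ContDiff

variable {E : Type*} [NormedAddCommGroup E] [NormedSpace ℝ E] {q : E}

theorem contDiffAt_pos {n : WithTop ℕ∞} {l : E → Params N}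
    (hl : ∀ c, ContDiffAt ℝ n (fun q => l q c) q) (i : Fin N) :
    ContDiffAt ℝ n (fun q => (l q).pos i) q := by
  have h : (fun q => (l q).pos i) = fun q => ((l q (Component.posX i) : ℝ) : ℂ) +
      ((l q (Component.posY i) : ℝ) : ℂ) * Complex.I := by
    funext q
    apply Complex.ext <;> simp [Params.pos]
  rw [h]
  exact (Complex.ofRealCLM.contDiff.contDiffAt.comp q (hl _)).add
    ((Complex.ofRealCLM.contDiff.contDiffAt.comp q (hl _)).mul contDiffAt_const)

theorem contDiffAt_loop {ε : E → ℝ} {a : E → Fin N → Profile} (hε : ContDiffAt ℝ 1 ε q)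
    (ha : ContDiffAt ℝ 1 a q) (i : Fin N) :
    ContDiffAt ℝ 1 (fun q => loop hα m (coreSize α (b i) (ε q)) (a q i)) q :=
  (contDiff_loop hα m).contDiffAt.comp (f := fun q => (coreSize α (b i) (ε q), a q i)) q
    (((contDiff_coreSize hα (b i)).contDiffAt.comp q hε).prodMk (contDiffAt_pi.1 ha i))

theorem contDiffAt_rigidMap {b : ℝ} {ε s Ω U : E → ℝ} {w : E → ℂ} {a : E → Profile}
    (hε : ContDiffAt ℝ 1 ε q) (hw : ContDiffAt ℝ 1 w q) (hΩ : ContDiffAt ℝ 1 Ω q)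
    (hU : ContDiffAt ℝ 1 U q) (hs : ContDiffAt ℝ 1 s q) (ha : ContDiffAt ℝ 1 a q) :
    ContDiffAt ℝ 1 (fun q => rigidMap hα m b (ε q) (w q) (Ω q) (U q) (s q) (a q)) q := by
  have hp : ContDiffAt ℝ 1 (fun q => (s q, a q)) q := hs.prodMk ha
  have h1 : ContDiffAt ℝ 1 (fun q => 1 + s q • fn hα.1.le m (a q)) q :=
    (contDiff_radiusElt hα m).contDiffAt.comp (f := fun q => (s q, a q)) q hp
  have h2 : ContDiffAt ℝ 1 (fun q => s q • dfn hα.1.le m (a q)) q :=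
    (contDiff_smul_dfn hα m).contDiffAt.comp (f := fun q => (s q, a q)) q hp
  have h3 : ContDiffAt ℝ 1 (fun q => loop hα m (s q) (a q)) q :=
    (contDiff_loop hα m).contDiffAt.comp (f := fun q => (s q, a q)) q hp
  have dr : ContDiffAt ℝ 1 (fun q => (w q).re) q := Complex.reCLM.contDiff.contDiffAt.comp q hw
  have di : ContDiffAt ℝ 1 (fun q => (w q).im) q := Complex.imCLM.contDiff.contDiffAt.comp q hw
  have k1 : ContDiffAt ℝ 1 (fun q => (Ω q * ε q * b) •
      ((1 + s q • fn hα.1.le m (a q)) * (s q • dfn hα.1.le m (a q)))) q :=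
    ((hΩ.mul hε).mul contDiffAt_const).smul (h1.mul h2)
  have k2 : ContDiffAt ℝ 1 (fun q => (Ω q * (w q).re + U q) •
      (loop hα m (s q) (a q)).2.2.1) q := ((hΩ.mul dr).add hU).smul h3.snd.snd.fst
  have k3 : ContDiffAt ℝ 1 (fun q => (Ω q * (w q).im) •
      (loop hα m (s q) (a q)).2.2.2) q := (hΩ.mul di).smul h3.snd.snd.snd
  exact (k1.add k2).add k3

theorem contDiffAt_totalMap {ε : E → ℝ} {a : E → Fin N → Profile} {l : E → Params N}
    (hε : ContDiffAt ℝ 1 ε q) (ha : ContDiffAt ℝ 1 a q)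
    (hl : ∀ c, ContDiffAt ℝ 1 (fun q => l q c) q) (hs : TotalSmall hα m b (ε q) (a q) (l q))
    (i : Fin N) :
    ContDiffAt ℝ 1 (fun q => totalMap hα m b (ε q) (a q) (l q) i) q := by
  have hsz : ContDiffAt ℝ 1 (fun q => coreSize α (b i) (ε q)) q :=
    (contDiff_coreSize hα (b i)).contDiffAt.comp q hε
  have hai : ContDiffAt ℝ 1 (fun q => a q i) q := contDiffAt_pi.1 ha i
  have hp : ContDiffAt ℝ 1 (fun q => (coreSize α (b i) (ε q), a q i)) q := hsz.prodMk hai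
  have hpos := contDiffAt_pos hl
  have hloop := contDiffAt_loop hα m b hε ha
  have hγ : ∀ j, ContDiffAt ℝ 1 (fun q => (l q).strength j) q := fun j => hl _
  have hΩ : ContDiffAt ℝ 1 (fun q => (l q).angularVelocity) q := hl Component.angularVelocity
  have hU : ContDiffAt ℝ 1 (fun q => (l q).speed) q := hl Component.speed
  have k1 : ContDiffAt ℝ 1 (fun q => rigidMap hα m (b i) (ε q) ((l q).pos i)
      (l q).angularVelocity (l q).speed (coreSize α (b i) (ε q)) (a q i)) q :=
    contDiffAt_rigidMap hα m (b := b i) hε (hpos i) hΩ hU hsz hai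
  have k2 : ContDiffAt ℝ 1 (fun q => (kernelConst α * (l q).strength i) •
      selfMap hα m (coreSize α (b i) (ε q)) (a q i)) q := by
    have h := (contDiffAt_selfMap hα m (n := 1)
      (p := (coreSize α (b i) (ε q), a q i)) (hs i).1).comp
      (f := fun q => (coreSize α (b i) (ε q), a q i)) q hp
    exact (contDiffAt_const.mul (hγ i)).smul h
  have k3 : ContDiffAt ℝ 1 (fun q => ∑ j ∈ Finset.univ.erase i,
      (kernelConst α * (l q).strength j / b j) • pairMap α (b i) (b j) (ε q)
        ((l q).pos i - (l q).pos j) (loop hα m (coreSize α (b i) (ε q)) (a q i))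
        (loop hα m (coreSize α (b j) (ε q)) (a q j))) q := by
    refine ContDiffAt.sum fun j hj => ?_
    have h : ContDiffAt ℝ 1 (fun q => pairMap α (b i) (b j) (ε q)
        ((l q).pos i - (l q).pos j) (loop hα m (coreSize α (b i) (ε q)) (a q i))
        (loop hα m (coreSize α (b j) (ε q)) (a q j))) q :=
      contDiffAt_pairMap hε ((hpos i).sub (hpos j)) (hloop i) (hloop j)
        ((hs i).2 j (Finset.ne_of_mem_erase hj))
    exact ((contDiffAt_const.mul (hγ j)).div_const _).smul h
  exact (k1.add k2).add k3

theorem eventually_totalSmall {ε : E → ℝ} {a : E → Fin N → Profile} {l : E → Params N}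
    (hε : ContDiffAt ℝ 1 ε q) (ha : ContDiffAt ℝ 1 a q)
    (hl : ∀ c, ContDiffAt ℝ 1 (fun q => l q c) q) (hs : TotalSmall hα m b (ε q) (a q) (l q)) :
    ∀ᶠ q in 𝓝 q, TotalSmall hα m b (ε q) (a q) (l q) := by
  have hpos := contDiffAt_pos hl
  have hloop := contDiffAt_loop hα m b hε ha
  refine eventually_all.2 fun i => ?_
  have hsz : ContDiffAt ℝ 1 (fun q => coreSize α (b i) (ε q)) q :=
    (contDiff_coreSize hα (b i)).contDiffAt.comp q hε
  have hai : ContDiffAt ℝ 1 (fun q => a q i) q := contDiffAt_pi.1 ha i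
  have hp : ContDiffAt ℝ 1 (fun q => (coreSize α (b i) (ε q), a q i)) q := hsz.prodMk hai
  refine Eventually.and ?_ (eventually_all.2 fun j => ?_)
  · have h1 : ContDiffAt ℝ 1 (fun q => coreSize α (b i) (ε q) •
        selfPert hα m (coreSize α (b i) (ε q)) (a q i)) q :=
      hsz.smul ((contDiff_selfPert hα m).contDiffAt.comp
        (f := fun q => (coreSize α (b i) (ε q), a q i)) q hp)
    exact h1.continuousAt.norm.eventually_lt continuousAt_const (hs i).1
  · by_cases hj : j = i
    · exact Eventually.of_forall fun q h => absurd hj h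
    · have hd := (hpos i).sub (hpos j)
      have hs' := (hs i).2 j hj
      have dr : ContDiffAt ℝ 1 (fun q => ((l q).pos i - (l q).pos j).re) q :=
        Complex.reCLM.contDiff.contDiffAt.comp q hd
      have di : ContDiffAt ℝ 1 (fun q => ((l q).pos i - (l q).pos j).im) q :=
        Complex.imCLM.contDiff.contDiffAt.comp q hd
      have hρ := (dr.pow 2).add (di.pow 2)
      have hρ0 := (re_sq_add_im_sq_pos hs'.1).ne'
      have h1 := (hε.div hρ hρ0).smul
        (contDiffAt_pairPert (b := b i) (b' := b j) hε hd (hloop i) (hloop j))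
      filter_upwards [h1.continuousAt.norm.eventually_lt continuousAt_const hs'.2,
        hd.continuousAt.eventually_ne hs'.1] with q h2 h3 _ using ⟨h3, h2⟩

end ContDiff

/-- At `ε = 0` both smallness conditions are empty for profiles of any size, and only the
distinctness of the positions remains. By `eventually_totalSmall` the conditions persist nearby. -/
theorem totalSmall_zero (a : Fin N → Profile) {l : Params N} (hl : Function.Injective l.pos) :
    TotalSmall hα m b 0 a l := fun i =>
  ⟨by simp, fun j hj => ⟨sub_ne_zero.2 fun h => hj (hl h).symm, by simp⟩⟩

theorem value_rigidMap (ε : ℝ) (l : Params N) (i : Fin N) (a : Profile) (x : ℝ) :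
    (rigidMap hα m (b i) ε (l.pos i) l.angularVelocity l.speed (coreSize α (b i) ε) a).value x =
      ((let R := radR α m (coreSize α (b i) ε) a
        let τ : ℂ := ((deriv R x : ℝ) : ℂ) * unitVec x + (R x : ℂ) * (Complex.I * unitVec x)
        l.angularVelocity * (ε * b i * R x * deriv R x + inner ℝ (l.pos i) τ)
          + inner ℝ (l.speed : ℂ) τ : ℝ) : ℂ) := by
  obtain ⟨-, -, h3, h4⟩ := value_loop hα m (coreSize α (b i) ε) a x
  have h1 : (1 + coreSize α (b i) ε • fn hα.1.le m a).value x =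
      ((radR α m (coreSize α (b i) ε) a x : ℝ) : ℂ) := by
    rw [value_add, value_one, value_smul, value_fn, radR]; push_cast; ring
  have h2 : (coreSize α (b i) ε • dfn hα.1.le m a).value x =
      ((deriv (radR α m (coreSize α (b i) ε) a) x : ℝ) : ℂ) := by
    rw [value_smul, value_dfn, deriv_radR hα]; push_cast; ring
  rw [rigidMap, value_add, value_add, value_smul, value_smul, value_smul, value_mul, h1, h2, h3, h4]
  norm_cast
  simp only [Complex.inner, Complex.mul_re, Complex.add_re, Complex.add_im, Complex.mul_im,
    Complex.conj_re, Complex.conj_im, Complex.ofReal_re, Complex.ofReal_im, Complex.I_re,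
    Complex.I_im, unitVec]
  ring

variable {b}

/-- The values of `totalMap` for `ε ≠ 0`. -/
theorem value_totalMap (hb : ∀ i, 0 < b i) {ε : ℝ} (hε : ε ≠ 0) {a : Fin N → Profile}
    {l : Params N} (hs : TotalSmall hα m b ε a l) (i : Fin N) (x : ℝ) :
    (totalMap hα m b ε a l i).value x =
      ((contourFunctional α b ε (fun j => fnR α m (a j)) l i x : ℝ) : ℂ) := by
  rw [contourFunctional, if_neg hε, totalMap, value_add, value_add, value_rigidMap, value_smul]
  have hself : ((kernelConst α * l.strength i : ℝ) : ℂ) *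
      (selfMap hα m (coreSize α (b i) ε) (a i)).value x =
      ((selfTerm α b ε (fun j => fnR α m (a j)) l i x : ℝ) : ℂ) := by
    have h := mean_selfTerm hα m (hs i).1 x (R := radR α m (coreSize α (b i) ε) (a i))
      fun _ => rfl
    have hc := coreSize_ne_zero (α := α) (hb i) hε
    have hc' : ((coreSize α (b i) ε : ℝ) : ℂ) ≠ 0 := by exact_mod_cast hc
    simp only [selfTerm, radius_eq_radR]
    rw [Complex.ofReal_mul (kernelConst α * l.strength i / _), h, show ε * |ε| ^ α * b i ^ (1 + α) = coreSize α (b i) ε from rfl,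
      Complex.ofReal_div]
    field_simp
  have hint : (∑ j ∈ Finset.univ.erase i, (kernelConst α * l.strength j / b j) •
      pairMap α (b i) (b j) ε (l.pos i - l.pos j) (loop hα m (coreSize α (b i) ε) (a i))
        (loop hα m (coreSize α (b j) ε) (a j))).value x =
      ((interactionTerm α b ε (fun j => fnR α m (a j)) l i x : ℝ) : ℂ) := by
    rw [← evalCLM_apply, map_sum]
    simp only [interactionTerm, radius_eq_radR]
    rw [Complex.ofReal_sum]
    refine Finset.sum_congr rfl fun j hj => ?_
    rw [evalCLM_apply, value_smul, Complex.ofReal_mul,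
      mean_interaction hα ((hs i).2 j (Finset.ne_of_mem_erase hj)) x]
    have hbj : ((b j : ℝ) : ℂ) ≠ 0 := by exact_mod_cast (hb j).ne'
    have hε' : (ε : ℂ) ≠ 0 := by exact_mod_cast hε
    push_cast
    field_simp
  rw [hself, hint]
  push_cast [rigidTerm, radius_eq_radR]
  rfl

end Total

/-- The mean of a trigonometric polynomial of degree three. -/
theorem mean_trig (c₀ c₁ s₁ c₂ s₂ c₃ s₃ : ℝ) :
    mean (fun y => c₀ + c₁ * Real.cos y + s₁ * Real.sin y + c₂ * Real.cos (2 * y) +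
      s₂ * Real.sin (2 * y) + c₃ * Real.cos (3 * y) + s₃ * Real.sin (3 * y)) = c₀ := by
  have hc : ∀ (k : ℝ) (y : ℝ), HasDerivAt (fun y => Real.cos (k * y)) (-(k * Real.sin (k * y))) y :=
    fun k y => (((hasDerivAt_id y).const_mul k).cos).congr_deriv (by simp; ring)
  have hs : ∀ (k : ℝ) (y : ℝ), HasDerivAt (fun y => Real.sin (k * y)) (k * Real.cos (k * y)) y :=
    fun k y => (((hasDerivAt_id y).const_mul k).sin).congr_deriv (by simp; ring)
  have hd : ∀ y ∈ uIcc (0 : ℝ) (2 * Real.pi), HasDerivAt (fun y => c₀ * y + c₁ * Real.sin y -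
      s₁ * Real.cos y + c₂ / 2 * Real.sin (2 * y) - s₂ / 2 * Real.cos (2 * y) +
      c₃ / 3 * Real.sin (3 * y) - s₃ / 3 * Real.cos (3 * y))
      (c₀ + c₁ * Real.cos y + s₁ * Real.sin y + c₂ * Real.cos (2 * y) +
      s₂ * Real.sin (2 * y) + c₃ * Real.cos (3 * y) + s₃ * Real.sin (3 * y)) y := by
    intro y _
    refine ((((((((hasDerivAt_id y).const_mul c₀).add ((Real.hasDerivAt_sin y).const_mul c₁)).sub
      ((Real.hasDerivAt_cos y).const_mul s₁)).add ((hs 2 y).const_mul (c₂ / 2))).sub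
      ((hc 2 y).const_mul (s₂ / 2))).add ((hs 3 y).const_mul (c₃ / 3))).sub
      ((hc 3 y).const_mul (s₃ / 3))).congr_deriv ?_
    ring
  unfold mean
  rw [intervalIntegral.integral_eq_sub_of_hasDerivAt hd
    (Continuous.intervalIntegrable (by fun_prop) _ _)]
  have h2 := Real.cos_nat_mul_two_pi 2
  have h3 := Real.cos_nat_mul_two_pi 3
  have k2 : Real.sin (2 * (2 * Real.pi)) = 0 := by
    have := Real.sin_nat_mul_pi 4
    rw [← this]; congr 1; push_cast; ring
  have k3 : Real.sin (3 * (2 * Real.pi)) = 0 := by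
    have := Real.sin_nat_mul_pi 6
    rw [← this]; congr 1; push_cast; ring
  push_cast at h2 h3
  rw [h2, h3, k2, k3]
  simp
  field_simp

/-! ### The functional at `ε = 0` -/

section Limit

variable {α : ℝ} (hα : α ∈ Ioo (1 : ℝ) 2) (m : ℕ)

theorem radR_zero (a : Profile) : radR α m 0 a = fun _ => 1 := by
  funext x; simp [radR]

theorem crossTerm_one (x y : ℝ) : crossTerm (fun _ => 1) (fun _ => 1) x y = Real.sin (x - y) := by
  simp [crossTerm]

/-- With `powQuot` constant and both curves unit circles, the integrand is a trigonometric
polynomial in `y`, and its mean is its constant term. -/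
theorem value_pairMap_zero {b b' : ℝ} {d : ℂ} (hd : d ≠ 0) (a a' : Profile) (x : ℝ) :
    (pairMap α b b' 0 d (loop hα m 0 a) (loop hα m 0 a')).value x =
      ((-α / 2 * b' * (d.re ^ 2 + d.im ^ 2) ^ (-α / 2 - 1) *
        (d.im * Real.cos x - d.re * Real.sin x) : ℝ) : ℂ) := by
  obtain ⟨-, -, h⟩ := value_pairMap (b := b) (b' := b') hα (m := m) (s := 0) (s' := 0) (a := a)
    (a' := a') (ε := 0) ⟨hd, by simp⟩ x
  rw [h]
  congr 1
  simp only [radR_zero, crossTerm_one, pairPertR, zero_div, zero_mul, add_zero, powQuot_zero,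
    smul_eq_mul, mul_one, one_mul]
  have e : (fun y => Real.sin (x - y) * ((2 * d.re * (b * Real.cos x - b' * Real.cos y) +
      2 * d.im * (b * Real.sin x - b' * Real.sin y)) * (-α / 2))) =
      fun y => (-α / 2 * b' * (d.im * Real.cos x - d.re * Real.sin x)) +
        (-α / 2 * (2 * b * (d.re * Real.cos x + d.im * Real.sin x) * Real.sin x)) * Real.cos y +
        (α / 2 * (2 * b * (d.re * Real.cos x + d.im * Real.sin x) * Real.cos x)) * Real.sin y +
        (α / 2 * b' * (d.re * Real.sin x + d.im * Real.cos x)) * Real.cos (2 * y) +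
        (α / 2 * b' * (d.im * Real.sin x - d.re * Real.cos x)) * Real.sin (2 * y) +
        0 * Real.cos (3 * y) + 0 * Real.sin (3 * y) := by
    funext y
    rw [Real.sin_sub, Real.cos_two_mul, Real.sin_two_mul]
    linear_combination (-α * b' * d.im * Real.cos x) * Real.sin_sq_add_cos_sq y
  rw [e, mean_trig]
  ring

variable {N : ℕ} {b : Fin N → ℝ}

theorem re_sq_add_im_sq_rpow {d : ℂ} (p : ℝ) :
    (d.re ^ 2 + d.im ^ 2) ^ p = ‖d‖ ^ (2 * p) := by
  have : d.re ^ 2 + d.im ^ 2 = ‖d‖ ^ 2 := by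
    rw [← Complex.normSq_eq_norm_sq, Complex.normSq_apply]; ring
  rw [this, ← Real.rpow_natCast, ← Real.rpow_mul (norm_nonneg d)]
  norm_num

theorem inner_pointVortexMap (l : Params N) (i : Fin N) (x : ℝ) :
    inner ℝ (pointVortexMap α l i) (Complex.I * unitVec x) =
      -(l.angularVelocity * (l.pos i).re + l.speed) * Real.sin x +
      l.angularVelocity * (l.pos i).im * Real.cos x +
      ∑ j ∈ Finset.univ.erase i, (-(α * kernelConst α / 2)) * l.strength j *
        ((l.pos i - l.pos j).re ^ 2 + (l.pos i - l.pos j).im ^ 2) ^ (-α / 2 - 1) *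
        ((l.pos i - l.pos j).im * Real.cos x - (l.pos i - l.pos j).re * Real.sin x) := by
  have hs : ∀ j, ((l.pos i - l.pos j).re ^ 2 + (l.pos i - l.pos j).im ^ 2) ^ (-α / 2 - 1) =
      (‖l.pos i - l.pos j‖ ^ (α + 2))⁻¹ := by
    intro j
    rw [re_sq_add_im_sq_rpow, ← Real.rpow_neg (norm_nonneg _)]
    ring_nf
  simp only [hs]
  simp only [pointVortexMap, Complex.inner, Complex.mul_re, Complex.mul_im, Complex.conj_re,
    Complex.conj_im, Complex.I_re, Complex.I_im, unitVec, Complex.sub_re, Complex.sub_im,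
    Complex.add_re, Complex.add_im, Complex.ofReal_re, Complex.ofReal_im, Complex.re_sum,
    Complex.im_sum, zero_mul, sub_zero, add_zero, one_mul, zero_add, zero_sub]
  have e : ∑ j ∈ Finset.univ.erase i, -(α * kernelConst α / 2) * l.strength j *
      (‖l.pos i - l.pos j‖ ^ (α + 2))⁻¹ * (((l.pos i).im - (l.pos j).im) * Real.cos x -
        ((l.pos i).re - (l.pos j).re) * Real.sin x) =
      α * kernelConst α / 2 * Real.sin x * (∑ j ∈ Finset.univ.erase i,
        l.strength j / ‖l.pos i - l.pos j‖ ^ (α + 2) * ((l.pos i).re - (l.pos j).re)) -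
      α * kernelConst α / 2 * Real.cos x * ∑ j ∈ Finset.univ.erase i,
        l.strength j / ‖l.pos i - l.pos j‖ ^ (α + 2) * ((l.pos i).im - (l.pos j).im) := by
    rw [Finset.mul_sum, Finset.mul_sum, ← Finset.sum_sub_distrib]
    refine Finset.sum_congr rfl fun j _ => ?_
    rw [div_eq_mul_inv]; ring
  rw [e]
  ring

/-- The values of `totalMap` for `ε = 0`. -/
theorem value_totalMap_zero (hb : ∀ i, 0 < b i) (a : Fin N → Profile)
    {l : Params N} (hl : Function.Injective l.pos) (i : Fin N) (x : ℝ) :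
    (totalMap hα m b 0 a l i).value x = ((inner ℝ (pointVortexMap α l i) (Complex.I * unitVec x) +
      0 : ℝ) : ℂ) + ((kernelConst α * l.strength i : ℝ) : ℂ) * (selfMap hα m 0 (a i)).value x := by
  rw [totalMap, value_add, value_add, value_rigidMap, value_smul, ← evalCLM_apply x (∑ j ∈ _, _),
    map_sum]
  simp only [coreSize_zero, evalCLM_apply, value_smul, radR_zero]
  have e : ∀ j ∈ Finset.univ.erase i, ((kernelConst α * l.strength j / b j : ℝ) : ℂ) *
      (pairMap α (b i) (b j) 0 (l.pos i - l.pos j) (loop hα m 0 (a i))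
        (loop hα m 0 (a j))).value x = (((-(α * kernelConst α / 2)) * l.strength j *
        ((l.pos i - l.pos j).re ^ 2 + (l.pos i - l.pos j).im ^ 2) ^ (-α / 2 - 1) *
        ((l.pos i - l.pos j).im * Real.cos x - (l.pos i - l.pos j).re * Real.sin x) : ℝ) : ℂ) := by
    intro j hj
    have hd : l.pos i - l.pos j ≠ 0 :=
      sub_ne_zero.2 fun h => Finset.ne_of_mem_erase hj (hl h).symm
    rw [value_pairMap_zero hα m hd, ← Complex.ofReal_mul]
    congr 1
    have := (hb j).ne'
    field_simp
  rw [Finset.sum_congr rfl e, inner_pointVortexMap, ← Complex.ofReal_sum]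
  simp only [deriv_const, Complex.inner, Complex.mul_re, Complex.add_re, Complex.add_im,
    Complex.mul_im, Complex.conj_re, Complex.conj_im, Complex.ofReal_re, Complex.ofReal_im,
    Complex.I_re, Complex.I_im, unitVec]
  push_cast
  ring

theorem value_totalMap_zero' (hb : ∀ i, 0 < b i) (a : Fin N → Profile)
    {l : Params N} (hl : Function.Injective l.pos) (i : Fin N) (x : ℝ) :
    (totalMap hα m b 0 a l i).value x =
      ((contourFunctional α b 0 (fun j => fnR α m (a j)) l i x : ℝ) : ℂ) := by
  rw [value_totalMap_zero hα m hb a hl, contourFunctional, if_pos rfl, limitTerm,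
    value_selfMap_zero]
  push_cast; ring

end Limit

/-! ### The system for the implicit function theorem -/

section Modes

variable {m : ℕ}

theorem summable_highModes (c : Wiener m) :
    Summable fun k : ℕ => ‖starRingEnd ℂ (2 * Complex.I * (1 + (k + 2 : ℕ) : ℂ) ^ m *
      c.coeff ((k + 2 : ℕ) : ℤ))‖ := by
  have h : Function.Injective fun k : ℕ => ((k + 2 : ℕ) : ℤ) := fun k l h => by simpa using h
  refine ((c.summable.comp_injective h).mul_left 2).congr fun k => ?_
  simp only [Function.comp, wienerWeight_eq_natAbs, Int.natAbs_natCast]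
  rw [RCLike.norm_conj, norm_mul, norm_mul, norm_mul, norm_pow, Complex.norm_I, mul_one,
    Complex.norm_two, show (1 + ((k + 2 : ℕ) : ℂ)) = ((1 + ((k + 2 : ℕ) : ℝ) : ℝ) : ℂ) by push_cast; ring,
    Complex.norm_real, Real.norm_of_nonneg (by positivity), mul_assoc]

/-- The Fourier modes of order at least two, suitably normalized. -/
def highModes (m : ℕ) : Wiener m →L[ℝ] Profile :=
  LinearMap.mkContinuous
    ⟨⟨fun c => ⟨fun k : ℕ => starRingEnd ℂ (2 * Complex.I * (1 + (k + 2 : ℕ) : ℂ) ^ m *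
        c.coeff ((k + 2 : ℕ) : ℤ)), memℓp_gen (by simpa using summable_highModes c)⟩,
      fun c d => by
        ext k
        change starRingEnd ℂ _ = starRingEnd ℂ _ + starRingEnd ℂ _
        rw [coeff_add, mul_add, map_add]⟩,
      fun r c => by
        ext k
        change starRingEnd ℂ _ = r • starRingEnd ℂ _
        rw [coeff_smul, Complex.real_smul, Complex.real_smul, mul_left_comm, map_mul,
          Complex.conj_ofReal]⟩ 2 fun c => by
    have h : Function.Injective fun k : ℕ => ((k + 2 : ℕ) : ℤ) := fun k l h => by simpa using h
    rw [lp.norm_eq_tsum_rpow (by norm_num), norm_def, ← tsum_mul_left]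
    simp only [ENNReal.toReal_one, Real.rpow_one, ne_eq, one_ne_zero, not_false_eq_true, div_self]
    refine (Summable.tsum_le_tsum_of_inj (fun k : ℕ => ((k + 2 : ℕ) : ℤ)) h (fun n _ => ?_)
      (fun k => ?_) (summable_highModes c) (c.summable.mul_left 2))
    · have := wienerWeight_pos m n
      positivity
    · change ‖starRingEnd ℂ _‖ ≤ _
      simp only [wienerWeight_eq_natAbs, Int.natAbs_natCast]
      rw [RCLike.norm_conj, norm_mul, norm_mul, norm_mul, norm_pow, Complex.norm_I, mul_one,
        Complex.norm_two,
        show (1 + ((k + 2 : ℕ) : ℂ)) = ((1 + ((k + 2 : ℕ) : ℝ) : ℝ) : ℂ) by push_cast; ring,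
        Complex.norm_real, Real.norm_of_nonneg (by positivity), mul_assoc]

theorem highModes_apply (c : Wiener m) (k : ℕ) : highModes m c k =
    starRingEnd ℂ (2 * Complex.I * (1 + (k + 2 : ℕ) : ℂ) ^ m * c.coeff ((k + 2 : ℕ) : ℤ)) := rfl

/-- The first Fourier mode, normalized to be `q` for the function `⟨q, i exp (i x)⟩`. -/
def firstMode (m : ℕ) : Wiener m →L[ℝ] ℂ :=
  ((2 * Complex.I) • (Complex.conjCLE : ℂ →L[ℝ] ℂ)).comp (coeffCLM 1)

theorem firstMode_apply (c : Wiener m) :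
    firstMode m c = 2 * Complex.I * starRingEnd ℂ (c.coeff 1) := rfl

/-- The function `⟨q, i exp (i x)⟩`. -/
def perpElt (m : ℕ) (q : ℂ) : Wiener m := (-q.re) • sinElt m + q.im • cosElt m

theorem value_perpElt (q : ℂ) (x : ℝ) :
    (perpElt m q).value x = ((inner ℝ q (Complex.I * unitVec x) : ℝ) : ℂ) := by
  rw [perpElt, value_add, value_smul, value_smul, value_sinElt, value_cosElt]
  norm_cast
  simp [Complex.inner, unitVec]
  ring

theorem coeff_perpElt_one (q : ℂ) : (perpElt m q).coeff 1 =
    (q.im + Complex.I * q.re) / 2 := by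
  simp [perpElt, sinElt, cosElt, coeff_single]; ring

theorem coeff_perpElt_nat (q : ℂ) {n : ℕ} (hn : n ≠ 1) : (perpElt m q).coeff n = 0 := by
  have h1 : (n : ℤ) ≠ 1 := by exact_mod_cast hn
  have h2 : (n : ℤ) ≠ -1 := by omega
  simp [perpElt, sinElt, cosElt, coeff_single, h1, h2]

theorem firstMode_perpElt (q : ℂ) : firstMode m (perpElt m q) = q := by
  rw [firstMode_apply, coeff_perpElt_one]
  have h2 : starRingEnd ℂ 2 = 2 := map_ofNat _ 2
  apply Complex.ext <;> simp [h2] <;> ring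

theorem highModes_perpElt (q : ℂ) : highModes m (perpElt m q) = 0 := by
  ext k
  rw [highModes_apply, coeff_perpElt_nat q (by omega)]
  simp

/-- A real element of the Wiener algebra with vanishing mean and modes of order at least two. -/
theorem eq_perpElt_of_highModes {c : Wiener m} (h0 : c.coeff 0 = 0) (h2 : highModes m c = 0)
    (hc : ∀ n, c.coeff (-n) = starRingEnd ℂ (c.coeff n)) : c = perpElt m (firstMode m c) := by
  have hq : ∀ n, (perpElt m (firstMode m c)).coeff (-n) =
      starRingEnd ℂ ((perpElt m (firstMode m c)).coeff n) :=
    coeff_neg_of_value_conj fun x => by rw [value_perpElt, Complex.conj_ofReal]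
  have key : ∀ n : ℕ, c.coeff n = (perpElt m (firstMode m c)).coeff n := by
    intro n
    rcases n with _ | _ | k
    · rw [coeff_perpElt_nat _ (by norm_num)]; exact h0
    · have h1 : ((0 + 1 : ℕ) : ℤ) = 1 := rfl
      rw [h1, coeff_perpElt_one, firstMode_apply]
      apply Complex.ext <;> simp
    · rw [coeff_perpElt_nat _ (by omega)]
      have h := congrArg (fun a : Profile => a k) h2
      simp only [highModes_apply] at h
      have h' := (map_eq_zero (starRingEnd ℂ)).1 h
      have hk : (1 + ((k + 2 : ℕ) : ℂ)) ^ m ≠ 0 := by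
        refine pow_ne_zero _ ?_
        exact_mod_cast (by omega : 1 + (k + 2) ≠ 0)
      have h3 : (2 * Complex.I : ℂ) ≠ 0 := by simp
      exact (mul_eq_zero.1 h').resolve_left (mul_ne_zero h3 hk)
  ext n
  obtain ⟨k, rfl | rfl⟩ := n.eq_nat_or_neg
  · exact key k
  · rw [hc, hq, key]

end Modes

/-! ### Invertibility of the linearization on the modes of order at least two -/

section Diagonal

variable {α : ℝ} (hα : α ∈ Ioo (1 : ℝ) 2) (m : ℕ)

/-- The linearized self-interaction. -/
def selfLin : Profile →L[ℝ] Wiener m :=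
  (1 - α / 2) • (meanFamily m _ (intervalIntegrable_sin_mul_kern hα)).comp
    ((constFamily m).comp (fn hα.1.le m) + (shiftFamily m).comp (fn hα.1.le m)) -
  (singularMean hα m).flip 1

theorem selfLin_apply (a : Profile) : selfLin hα m a = selfMap hα m 0 a := by
  rw [selfMap_zero]; rfl

/-- The linearized self-interaction on the modes of order at least two. -/
def diagLin : Profile →L[ℝ] Profile := (highModes m).comp (selfLin hα m)

/-- The normalizations of `highModes` and of `Profile` are matched so that the weights `(1 + n) ^ m`
cancel. What is left is `linSymbol α n / n ^ α`, which is bounded away from zero by `le_linSymbol`.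
-/
theorem diagLin_apply (a : Profile) (k : ℕ) :
    diagLin hα m a k = (linSymbol α (k + 2) * (((k + 2 : ℕ) : ℝ) ^ α)⁻¹) • a k := by
  have hw : ((1 : ℝ) + (k + 2 : ℕ)) ^ m ≠ 0 := by positivity
  have hw' : ((1 : ℂ) + (k + 2 : ℕ)) ^ m ≠ 0 := by
    rw [show (1 + ((k + 2 : ℕ) : ℂ)) = ((1 + ((k + 2 : ℕ) : ℝ) : ℝ) : ℂ) by push_cast; ring]
    exact_mod_cast hw
  have h : diagLin hα m a k = highModes m (selfMap hα m 0 a) k := by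
    rw [← selfLin_apply]; rfl
  rw [h, highModes_apply, coeff_selfMap_zero]
  have e : expCoeff α m a ((k + 2 : ℕ) : ℤ) =
      starRingEnd ℂ ((profileWeight α m (k + 2))⁻¹ • a k) / 2 := by
    have : (0 : ℤ) < ((k + 2 : ℕ) : ℤ) := by positivity
    rw [expCoeff, if_pos this, Int.natAbs_natCast, realCoeff, if_neg (by omega)]
    rfl
  rw [e, profileWeight, Complex.real_smul, Complex.real_smul]
  simp only [map_mul, map_div₀, Complex.conj_conj, Complex.conj_ofReal, map_neg, Complex.conj_I,
    map_pow, map_add, map_one, map_natCast, Complex.conj_ofNat]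
  push_cast
  push_cast at hw'
  rw [mul_inv]
  field_simp
  linear_combination (-(linSymbol α (k + 2) : ℂ) * a k *
    (((k + 2 : ℝ) ^ α : ℝ) : ℂ)⁻¹) * Complex.I_sq

/-- Multiplication of the coefficients by a bounded sequence. -/
def diagonal (r : ℕ → ℝ) (C : ℝ) (h : ∀ k, |r k| ≤ C) : Profile →L[ℝ] Profile :=
  LinearMap.mkContinuous
    ⟨⟨fun a => ⟨fun k => r k • a k, memℓp_gen (by
        have ha := (lp.memℓp a).summable (by norm_num)
        simp only [ENNReal.toReal_one, Real.rpow_one] at ha ⊢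
        refine Summable.of_nonneg_of_le (fun k => norm_nonneg _) (fun k => ?_) (ha.mul_left C)
        rw [norm_smul]
        exact mul_le_mul_of_nonneg_right (h k) (norm_nonneg _))⟩,
      fun a b => by ext k; exact smul_add (r k) (a k) (b k)⟩,
      fun s a => by ext k; exact smul_comm (r k) s (a k)⟩ C fun a => by
    have ha := (lp.memℓp a).summable (by norm_num)
    rw [lp.norm_eq_tsum_rpow (by norm_num), lp.norm_eq_tsum_rpow (by norm_num)]
    simp only [ENNReal.toReal_one, Real.rpow_one, ne_eq, one_ne_zero, not_false_eq_true, div_self]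
      at ha ⊢
    rw [← tsum_mul_left]
    have hle : ∀ k, ‖r k • a k‖ ≤ C * ‖a k‖ := fun k => by
      rw [norm_smul]
      exact mul_le_mul_of_nonneg_right (h k) (norm_nonneg _)
    exact Summable.tsum_le_tsum hle
      (Summable.of_nonneg_of_le (fun k => norm_nonneg _) hle (ha.mul_left C)) (ha.mul_left C)

theorem diagonal_apply (r : ℕ → ℝ) (C : ℝ) (h : ∀ k, |r k| ≤ C) (a : Profile) (k : ℕ) :
    diagonal r C h a k = r k • a k := rfl

theorem linSymbol_pos (hα : α ∈ Ioo (1 : ℝ) 2) (k : ℕ) : 0 < linSymbol α (k + 2) := by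
  obtain ⟨c, hc, h⟩ := le_linSymbol hα
  refine lt_of_lt_of_le ?_ (h (k + 2) (by omega))
  positivity

/-- The linearized self-interaction is invertible on the modes of order at least two. -/
theorem exists_equiv_diagLin : ∃ e : Profile ≃L[ℝ] Profile,
    (e : Profile →L[ℝ] Profile) = diagLin hα m := by
  obtain ⟨c, hc, h⟩ := le_linSymbol hα
  have hb : ∀ k : ℕ, |((k + 2 : ℕ) : ℝ) ^ α / linSymbol α (k + 2)| ≤ c⁻¹ := by
    intro k
    have h1 := h (k + 2) (by omega)
    have h2 := linSymbol_pos hα k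
    rw [abs_of_nonneg (by positivity), div_le_iff₀ h2, inv_mul_eq_div, le_div_iff₀ hc]
    linarith
  refine ⟨ContinuousLinearEquiv.equivOfInverse (diagLin hα m) (diagonal _ _ hb)
    (fun a => ?_) (fun a => ?_), rfl⟩
  · ext k
    have h2 := (linSymbol_pos hα k).ne'
    have h3 : ((k + 2 : ℕ) : ℝ) ^ α ≠ 0 := by positivity
    rw [diagonal_apply, diagLin_apply, smul_smul]
    rw [show ((k + 2 : ℕ) : ℝ) ^ α / linSymbol α (k + 2) *
      (linSymbol α (k + 2) * (((k + 2 : ℕ) : ℝ) ^ α)⁻¹) = 1 by field_simp, one_smul]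
  · ext k
    have h2 := (linSymbol_pos hα k).ne'
    have h3 : ((k + 2 : ℕ) : ℝ) ^ α ≠ 0 := by positivity
    rw [diagLin_apply, diagonal_apply, smul_smul]
    rw [show (linSymbol α (k + 2) * (((k + 2 : ℕ) : ℝ) ^ α)⁻¹) *
      (((k + 2 : ℕ) : ℝ) ^ α / linSymbol α (k + 2)) = 1 by field_simp, one_smul]

variable {N : ℕ} {b : Fin N → ℝ}

/-- At `ε = 0` the patches act on each other only through `pointVortexMap`, which sits in the first
mode, and each profile enters linearly in its own equation. This decoupling makes the derivative of
`systemMap` block diagonal. -/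
theorem totalMap_zero (hb : ∀ i, 0 < b i) (a : Fin N → Profile)
    {l : Params N} (hl : Function.Injective l.pos) (i : Fin N) :
    totalMap hα m b 0 a l i =
      perpElt m (pointVortexMap α l i) + (kernelConst α * l.strength i) • selfLin hα m (a i) :=
  value_injective fun x => by
    rw [value_totalMap_zero hα m hb a hl, value_add, value_smul, value_perpElt, selfLin_apply,
      add_zero]

theorem highModes_totalMap_zero (hb : ∀ i, 0 < b i) (a : Fin N → Profile)
    {l : Params N} (hl : Function.Injective l.pos) (i : Fin N) :
    highModes m (totalMap hα m b 0 a l i) =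
      (kernelConst α * l.strength i) • diagLin hα m (a i) := by
  rw [totalMap_zero hα m hb a hl, map_add, highModes_perpElt, zero_add, map_smul]; rfl

theorem firstMode_totalMap_zero (hb : ∀ i, 0 < b i) (a : Fin N → Profile)
    {l : Params N} (hl : Function.Injective l.pos) (i : Fin N) :
    firstMode m (totalMap hα m b 0 a l i) = pointVortexMap α l i := by
  have h : (selfLin hα m (a i)).coeff 1 = 0 := by
    have := coeff_selfMap_zero hα m (a i) 1
    rw [expCoeff_of_natAbs_lt _ (by norm_num), mul_zero] at this
    rw [selfLin_apply]; exact_mod_cast this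
  rw [totalMap_zero hα m hb a hl, map_add, firstMode_perpElt, map_smul, firstMode_apply, h]
  simp

end Diagonal

/-! ### Solving the system -/

theorem Params.replace_first {N : ℕ} (lam : Params N) (S : Finset (Component N)) :
    lam.replace S (lam.first S) = lam := by
  funext c; by_cases h : c ∈ S <;> simp [Params.replace, Params.first, h]

theorem Params.contDiff_replace {N : ℕ} (lam : Params N) (S : Finset (Component N))
    (c : Component N) {n : WithTop ℕ∞} : ContDiff ℝ n fun μ : S → ℝ => lam.replace S μ c := by
  by_cases h : c ∈ S
  · simp only [Params.replace, h, dite_true]; exact contDiff_apply _ _ _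
  · simp only [Params.replace, h, dite_false]; exact contDiff_const

section System

variable {α : ℝ} (hα : α ∈ Ioo (1 : ℝ) 2) (m : ℕ) {N : ℕ} {b : Fin N → ℝ}
  {lam : Params N} {S : Finset (Component N)}

theorem TotalSmall.injective {hα : α ∈ Ioo (1 : ℝ) 2} {m : ℕ} {ε : ℝ} {a : Fin N → Profile}
    {l : Params N} (h : TotalSmall hα m b ε a l) : Function.Injective l.pos := by
  intro i j hij
  by_contra hne
  exact ((h i).2 j (Ne.symm hne)).1 (sub_eq_zero.2 hij)

/-- The system for the profiles, the parameters and an auxiliary real unknown. -/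
def systemMap (b : Fin N → ℝ) (lam : Params N) (S : Finset (Component N)) (v : Fin N → ℂ)
    (q : ℝ × (Fin N → Profile) × (S → ℝ) × ℝ) : (Fin N → Profile) × (Fin N → ℂ) :=
  (fun i => highModes m (totalMap hα m b q.1 q.2.1 (lam.replace S q.2.2.1) i),
    fun i => firstMode m (totalMap hα m b q.1 q.2.1 (lam.replace S q.2.2.1) i) + q.2.2.2 • v i)

theorem contDiffAt_totalMap_replace {q : ℝ × (Fin N → Profile) × (S → ℝ) × ℝ}
    (hq : TotalSmall hα m b q.1 q.2.1 (lam.replace S q.2.2.1)) (i : Fin N) :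
    ContDiffAt ℝ 1 (fun q : ℝ × (Fin N → Profile) × (S → ℝ) × ℝ =>
      totalMap hα m b q.1 q.2.1 (lam.replace S q.2.2.1) i) q :=
  contDiffAt_totalMap hα m b (ε := fun q : ℝ × (Fin N → Profile) × (S → ℝ) × ℝ => q.1)
    (a := fun q => q.2.1) (l := fun q => lam.replace S q.2.2.1) contDiffAt_fst
    contDiffAt_snd.fst (fun c => (lam.contDiff_replace S c).contDiffAt.comp q
      contDiffAt_snd.snd.fst) hq i

theorem eventually_totalSmall_replace {q : ℝ × (Fin N → Profile) × (S → ℝ) × ℝ}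
    (hq : TotalSmall hα m b q.1 q.2.1 (lam.replace S q.2.2.1)) :
    ∀ᶠ q in 𝓝 q, TotalSmall hα m b q.1 q.2.1 (lam.replace S q.2.2.1) :=
  eventually_totalSmall hα m b (ε := fun q : ℝ × (Fin N → Profile) × (S → ℝ) × ℝ => q.1)
    (a := fun q => q.2.1) (l := fun q => lam.replace S q.2.2.1) contDiffAt_fst
    contDiffAt_snd.fst (fun c => (lam.contDiff_replace S c).contDiffAt.comp q
      contDiffAt_snd.snd.fst) hq

theorem contDiffAt_systemMap {v : Fin N → ℂ} {q : ℝ × (Fin N → Profile) × (S → ℝ) × ℝ}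
    (hq : TotalSmall hα m b q.1 q.2.1 (lam.replace S q.2.2.1)) :
    ContDiffAt ℝ 1 (systemMap hα m b lam S v) q := by
  have h := contDiffAt_totalMap_replace hα m hq
  refine ContDiffAt.prodMk (contDiffAt_pi.2 fun i => ?_) (contDiffAt_pi.2 fun i => ?_)
  · exact (highModes m).contDiff.contDiffAt.comp q (h i)
  · exact ((firstMode m).contDiff.contDiffAt.comp q (h i)).add
      (contDiffAt_snd.snd.snd.smul contDiffAt_const)

theorem kernelConst_pos (hα : α ∈ Ioo (1 : ℝ) 2) : 0 < kernelConst α := by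
  have h1 := Real.Gamma_pos_of_pos (s := α / 2) (by linarith [hα.1])
  have h2 := Real.Gamma_pos_of_pos (s := (2 - α) / 2) (by linarith [hα.2])
  unfold kernelConst; positivity

variable (b lam S) in
/-- The point on the trivial branch. -/
def basePoint : ℝ × (Fin N → Profile) × (S → ℝ) × ℝ := (0, 0, lam.first S, 0)

theorem totalSmall_basePoint (heq : IsVortexEquilibrium α lam) :
    TotalSmall hα m b (basePoint lam S).1 (basePoint lam S).2.1
      (lam.replace S (basePoint lam S).2.2.1) := by
  refine totalSmall_zero hα m b _ ?_
  rw [basePoint, lam.replace_first]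
  exact heq.pos_injective

/-- The derivative of the point vortex map at the equilibrium. -/
def vortexDeriv (α : ℝ) (lam : Params N) (S : Finset (Component N)) :
    (S → ℝ) →L[ℝ] (Fin N → ℂ) :=
  fderiv ℝ (fun μ : S → ℝ => pointVortexMap α (lam.replace S μ)) (lam.first S)

theorem eventually_injective (hα : α ∈ Ioo (1 : ℝ) 2) (heq : IsVortexEquilibrium α lam) :
    ∀ᶠ q in 𝓝 (basePoint lam S), Function.Injective (lam.replace S q.2.2.1).pos := by
  filter_upwards [eventually_totalSmall_replace hα 0
    (totalSmall_basePoint (b := fun _ => 1) hα 0 (S := S) heq)] with q hq using hq.injective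

theorem hasFDerivAt_pointVortexMap (hα : α ∈ Ioo (1 : ℝ) 2) (heq : IsVortexEquilibrium α lam) :
    HasFDerivAt (fun μ : S → ℝ => pointVortexMap α (lam.replace S μ)) (vortexDeriv α lam S)
      (lam.first S) := by
  refine DifferentiableAt.hasFDerivAt (differentiableAt_pi.2 fun i => ?_)
  have hc : Continuous fun μ : S → ℝ => ((0, 0, μ, 0) : ℝ × (Fin N → Profile) × (S → ℝ) × ℝ) := by
    fun_prop
  have hs := totalSmall_basePoint (b := fun _ => 1) hα 0 (S := S) heq
  have h1 := ((firstMode 0).contDiff.contDiffAt.comp _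
    (contDiffAt_totalMap_replace hα 0 hs i)).comp (f := fun μ : S → ℝ =>
      ((0, 0, μ, 0) : ℝ × (Fin N → Profile) × (S → ℝ) × ℝ)) (lam.first S)
      (contDiffAt_const.prodMk (contDiffAt_const.prodMk (contDiffAt_id.prodMk contDiffAt_const)))
  refine (h1.differentiableAt one_ne_zero).congr_of_eventuallyEq ?_
  have h2 := (hc.tendsto (lam.first S)).eventually (eventually_injective hα heq)
  filter_upwards [h2] with μ hμ
  exact (firstMode_totalMap_zero hα 0 (b := fun _ => 1) (fun _ => one_pos) 0 hμ i).symm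

/-- By rank and nullity: codimension one means rank `2 N - 1`, which is the number of free
parameters. -/
theorem ker_vortexDeriv (hnd : IsNondegenerate α lam S) :
    Function.Injective (vortexDeriv α lam S) := by
  have h1 := hnd.codim_range_eq_one
  have h2 := hnd.card_eq
  have h3 := Submodule.finrank_quotient_add_finrank (vortexDeriv α lam S).range
  have h4 := LinearMap.finrank_range_add_finrank_ker (vortexDeriv α lam S : (S → ℝ) →ₗ[ℝ] (Fin N → ℂ))
  change Module.finrank ℝ ((Fin N → ℂ) ⧸ (vortexDeriv α lam S).range) = 1 at h1
  have h5 : Module.finrank ℝ (Fin N → ℂ) = 2 * N := by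
    simp [Module.finrank_pi_fintype, Complex.finrank_real_complex, mul_comm]
  have h6 : Module.finrank ℝ (S → ℝ) = S.card := by simp
  rw [h1, h5] at h3
  rw [h6] at h4
  have h7 : Module.finrank ℝ (LinearMap.ker (vortexDeriv α lam S : (S → ℝ) →ₗ[ℝ] (Fin N → ℂ))) = 0 := by
    have : Module.finrank ℝ (vortexDeriv α lam S).range =
      Module.finrank ℝ (LinearMap.range (vortexDeriv α lam S : (S → ℝ) →ₗ[ℝ] (Fin N → ℂ))) := rfl
    omega
  exact LinearMap.ker_eq_bot.1 (Submodule.finrank_eq_zero.1 h7)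

/-- One direction outside a range of codimension one supplies the missing dimension. The augmented
map is injective between spaces of equal dimension. -/
theorem exists_equiv_param (hnd : IsNondegenerate α lam S) {v : Fin N → ℂ}
    (hv : v ∉ (vortexDeriv α lam S).range) :
    ∃ e : ((S → ℝ) × ℝ) ≃L[ℝ] (Fin N → ℂ), (e : ((S → ℝ) × ℝ) →L[ℝ] (Fin N → ℂ)) =
      (vortexDeriv α lam S).comp (.fst ℝ _ _) +
        (ContinuousLinearMap.snd ℝ (S → ℝ) ℝ).smulRight v := by
  set T := (vortexDeriv α lam S).comp (.fst ℝ _ _) +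
        (ContinuousLinearMap.snd ℝ (S → ℝ) ℝ).smulRight v with hT
  have hTa : ∀ p : (S → ℝ) × ℝ, T p = vortexDeriv α lam S p.1 + p.2 • v := fun p => rfl
  have hinj : Function.Injective (T : ((S → ℝ) × ℝ) →ₗ[ℝ] (Fin N → ℂ)) := by
    refine (injective_iff_map_eq_zero _).2 fun p hp => ?_
    have hp' : vortexDeriv α lam S p.1 + p.2 • v = 0 := hp
    have ht : p.2 = 0 := by
      by_contra hne
      refine hv ⟨-(p.2⁻¹ • p.1), ?_⟩
      have : p.2 • v = -vortexDeriv α lam S p.1 := eq_neg_of_add_eq_zero_right hp'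
      have h2 := congrArg (fun w => p.2⁻¹ • w) this
      simp only [smul_smul, inv_mul_cancel₀ hne, one_smul] at h2
      rw [h2]
      simp
    rw [ht, zero_smul, add_zero] at hp'
    exact Prod.ext (ker_vortexDeriv hnd (hp'.trans (map_zero _).symm)) ht
  have hdim : Module.finrank ℝ ((S → ℝ) × ℝ) = Module.finrank ℝ (Fin N → ℂ) := by
    have h2 := hnd.card_eq
    simp [Module.finrank_pi_fintype, Complex.finrank_real_complex]
    omega
  refine ⟨((T : ((S → ℝ) × ℝ) →ₗ[ℝ] (Fin N → ℂ)).linearEquivOfInjective hinj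
    hdim).toContinuousLinearEquiv, ?_⟩
  ext p <;> rfl

/-- The derivative in the unknowns is computed from the slice `ε = 0`, where the system is explicit.
It is block diagonal, with non-zero multiples of `diagLin` on the profiles and the augmented vortex
derivative on the parameters and `t`. -/
theorem isInvertible_systemMap (hb : ∀ i, 0 < b i) (heq : IsVortexEquilibrium α lam)
    (hnd : IsNondegenerate α lam S) {v : Fin N → ℂ} (hv : v ∉ (vortexDeriv α lam S).range) :
    (fderiv ℝ (systemMap hα m b lam S v) (basePoint lam S) ∘L .inr ℝ ℝ _).IsInvertible := by
  obtain ⟨e₂, he₂⟩ := exists_equiv_param hnd hv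
  obtain ⟨e₁, he₁⟩ := exists_equiv_diagLin hα m
  have hc : ∀ i, kernelConst α * lam.strength i ≠ 0 := fun i =>
    mul_ne_zero (kernelConst_pos hα).ne' (heq.strength_ne_zero i)
  have hs := totalSmall_basePoint (b := b) hα m (S := S) heq
  have hG := ((contDiffAt_systemMap hα m (v := v) hs).differentiableAt one_ne_zero).hasFDerivAt
  have h1 : HasFDerivAt (fun y => systemMap hα m b lam S v (0, y))
      (fderiv ℝ (systemMap hα m b lam S v) (basePoint lam S) ∘L .inr ℝ ℝ _)
      (basePoint lam S).2 :=
    HasFDerivAt.comp (f := fun y : (Fin N → Profile) × (S → ℝ) × ℝ => ((0 : ℝ), y))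
      (basePoint lam S).2 hG (hasFDerivAt_prodMk_right _ _)
  set T₁ : ((Fin N → Profile) × (S → ℝ) × ℝ) →L[ℝ] (Fin N → Profile) :=
    ContinuousLinearMap.pi fun i => (kernelConst α * lam.strength i) •
      (diagLin hα m).comp ((ContinuousLinearMap.proj i).comp (.fst ℝ _ _)) with hT₁
  set T₂ : ((Fin N → Profile) × (S → ℝ) × ℝ) →L[ℝ] (Fin N → ℂ) :=
    (e₂ : ((S → ℝ) × ℝ) →L[ℝ] (Fin N → ℂ)).comp (.snd ℝ _ _) with hT₂
  have h2 : HasFDerivAt (fun y => systemMap hα m b lam S v (0, y)) (T₁.prod T₂)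
      (basePoint lam S).2 := by
    have h3 : (fun y => systemMap hα m b lam S v (0, y)) =ᶠ[𝓝 (basePoint lam S).2]
        fun y => (fun i => (kernelConst α * (lam.replace S y.2.1).strength i) •
          diagLin hα m (y.1 i),
          pointVortexMap α (lam.replace S y.2.1) + y.2.2 • v) := by
      have hc : Continuous fun y : (Fin N → Profile) × (S → ℝ) × ℝ => ((0 : ℝ), y) := by fun_prop
      have h2 := (hc.tendsto (basePoint lam S).2).eventually
        (eventually_injective (S := S) hα heq)
      filter_upwards [h2] with y hy
      refine Prod.ext (funext fun i => ?_) (funext fun i => ?_)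
      · exact highModes_totalMap_zero hα m hb y.1 hy i
      · exact congrArg (· + y.2.2 • v i) (firstMode_totalMap_zero hα m hb y.1 hy i)
    refine HasFDerivAt.congr_of_eventuallyEq ?_ h3
    refine HasFDerivAt.prodMk (hasFDerivAt_pi.2 fun i => ?_) ?_
    · have hγ : ContDiff ℝ 1 fun y : (Fin N → Profile) × (S → ℝ) × ℝ =>
          kernelConst α * (lam.replace S y.2.1).strength i :=
        contDiff_const.mul ((lam.contDiff_replace S _).comp contDiff_snd.fst)
      have hγ' := (hγ.differentiable one_ne_zero (basePoint lam S).2).hasFDerivAt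
      have hL : HasFDerivAt (fun y : (Fin N → Profile) × (S → ℝ) × ℝ => diagLin hα m (y.1 i))
          ((diagLin hα m).comp ((ContinuousLinearMap.proj i).comp (.fst ℝ _ _)))
          (basePoint lam S).2 :=
        ((diagLin hα m).comp ((ContinuousLinearMap.proj i).comp
          (.fst ℝ (Fin N → Profile) ((S → ℝ) × ℝ)))).hasFDerivAt
      refine (hγ'.smul hL).congr_fderiv ?_
      have e1 : (lam.replace S (basePoint lam S).2.2.1) = lam := lam.replace_first S
      have e2 : (basePoint lam S).2.1 = 0 := rfl
      -- The variation of the strength is multiplied by the base profile, which is zero, so no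
      -- coupling term remains.
      rw [e1, e2, Pi.zero_apply, map_zero, ContinuousLinearMap.smulRight_zero, add_zero]
    · have hP : HasFDerivAt (fun y : (Fin N → Profile) × (S → ℝ) × ℝ =>
          pointVortexMap α (lam.replace S y.2.1))
          ((vortexDeriv α lam S).comp ((ContinuousLinearMap.fst ℝ (S → ℝ) ℝ).comp
            (.snd ℝ (Fin N → Profile) _))) (basePoint lam S).2 :=
        HasFDerivAt.comp (f := fun y : (Fin N → Profile) × (S → ℝ) × ℝ => y.2.1)
          (basePoint lam S).2 (hasFDerivAt_pointVortexMap hα heq)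
          ((ContinuousLinearMap.fst ℝ (S → ℝ) ℝ).comp
            (.snd ℝ (Fin N → Profile) _)).hasFDerivAt
      have ht : HasFDerivAt (fun y : (Fin N → Profile) × (S → ℝ) × ℝ => y.2.2 • v)
          (((ContinuousLinearMap.snd ℝ (S → ℝ) ℝ).comp
            (.snd ℝ (Fin N → Profile) _)).smulRight v) (basePoint lam S).2 :=
        (((ContinuousLinearMap.snd ℝ (S → ℝ) ℝ).comp
            (.snd ℝ (Fin N → Profile) _)).smulRight v).hasFDerivAt
      refine (hP.add ht).congr_fderiv ?_
      rw [hT₂, he₂]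
      rfl
  rw [h1.unique h2]
  refine ⟨(ContinuousLinearEquiv.piCongrRight fun i =>
    (e₁.trans (ContinuousLinearEquiv.smulLeft (Units.mk0 _ (hc i))))).prodCongr e₂, ?_⟩
  refine ContinuousLinearMap.ext fun y => Prod.ext (funext fun i => ?_) rfl
  change (kernelConst α * lam.strength i) • e₁ (y.1 i) =
    (kernelConst α * lam.strength i) • diagLin hα m (y.1 i)
  rw [← he₁]
  rfl

end System

end
end GSQG

namespace GSQG
noncomputable section

/-! ### Identities for double integrals over closed curves -/

theorem integral_integral_swap {f : ℝ → ℝ → ℝ} (hf : Continuous (Function.uncurry f)) :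
    ∫ x in (0 : ℝ)..(2 * Real.pi), ∫ y in (0 : ℝ)..(2 * Real.pi), f x y =
      ∫ y in (0 : ℝ)..(2 * Real.pi), ∫ x in (0 : ℝ)..(2 * Real.pi), f x y := by
  have hpi : (0 : ℝ) ≤ 2 * Real.pi := by positivity
  simp only [intervalIntegral.integral_of_le hpi]
  refine MeasureTheory.integral_integral_swap ?_
  rw [MeasureTheory.Measure.prod_restrict]
  exact (hf.continuousOn.integrableOn_compact (isCompact_Icc.prod isCompact_Icc)).mono_set
    (Set.prod_mono Ioc_subset_Icc_self Ioc_subset_Icc_self)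

/-- The double integral of a divergence of periodic functions vanishes. -/
theorem integral_divergence_eq_zero {A B Ax By : ℝ → ℝ → ℝ}
    (hAx : Continuous (Function.uncurry Ax)) (hBy : Continuous (Function.uncurry By))
    (hA : ∀ x y, HasDerivAt (fun x => A x y) (Ax x y) x)
    (hB : ∀ x y, HasDerivAt (fun y => B x y) (By x y) y)
    (pA : ∀ y, A (2 * Real.pi) y = A 0 y) (pB : ∀ x, B x (2 * Real.pi) = B x 0) :
    ∫ x in (0 : ℝ)..(2 * Real.pi), ∫ y in (0 : ℝ)..(2 * Real.pi), (Ax x y + By x y) = 0 := by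
  have h1 : ∀ x, ∫ y in (0 : ℝ)..(2 * Real.pi), (Ax x y + By x y) =
      ∫ y in (0 : ℝ)..(2 * Real.pi), Ax x y := by
    intro x
    have c1 : Continuous (Ax x) := hAx.uncurry_left x
    have c2 : Continuous (By x) := hBy.uncurry_left x
    rw [intervalIntegral.integral_add (c1.intervalIntegrable _ _) (c2.intervalIntegrable _ _),
      intervalIntegral.integral_eq_sub_of_hasDerivAt (fun y _ => hB x y)
        (c2.intervalIntegrable _ _), pB, sub_self, add_zero]
  simp only [h1]
  rw [integral_integral_swap hAx]
  have h2 : ∀ y, ∫ x in (0 : ℝ)..(2 * Real.pi), Ax x y = 0 := by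
    intro y
    have c1 : Continuous fun x => Ax x y := hAx.uncurry_right y
    rw [intervalIntegral.integral_eq_sub_of_hasDerivAt (fun x _ => hA x y)
      (c1.intervalIntegrable _ _), pA, sub_self]
  simp [h2]

/-- A closed `C¹` curve in the plane. -/
structure ClosedCurve (X Y X' Y' : ℝ → ℝ) : Prop where
  hasDerivAt_fst : ∀ x, HasDerivAt X (X' x) x
  hasDerivAt_snd : ∀ x, HasDerivAt Y (Y' x) x
  continuous_fst : Continuous X'
  continuous_snd : Continuous Y'
  closed_fst : X (2 * Real.pi) = X 0
  closed_snd : Y (2 * Real.pi) = Y 0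

section Exact

variable {X Y X' Y' P Q P' Q' : ℝ → ℝ}

/-- The squared distance of two points on two curves. -/
def distSq (X Y P Q : ℝ → ℝ) (x y : ℝ) : ℝ := (X x - P y) ^ 2 + (Y x - Q y) ^ 2

theorem ClosedCurve.continuous_X (h : ClosedCurve X Y X' Y') : Continuous X :=
  continuous_iff_continuousAt.2 fun x => (h.hasDerivAt_fst x).continuousAt

theorem ClosedCurve.continuous_Y (h : ClosedCurve X Y X' Y') : Continuous Y :=
  continuous_iff_continuousAt.2 fun x => (h.hasDerivAt_snd x).continuousAt

theorem continuous_distSq (h : ClosedCurve X Y X' Y') (h' : ClosedCurve P Q P' Q') :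
    Continuous (Function.uncurry (distSq X Y P Q)) := by
  have c1 := h.continuous_X
  have c2 := h.continuous_Y
  have c3 := h'.continuous_X
  have c4 := h'.continuous_Y
  unfold distSq Function.uncurry
  fun_prop

theorem hasDerivAt_distSq_left (h : ClosedCurve X Y X' Y') (x y : ℝ) :
    HasDerivAt (fun x => distSq X Y P Q x y)
      (2 * ((X x - P y) * X' x + (Y x - Q y) * Y' x)) x := by
  unfold distSq
  exact ((((h.hasDerivAt_fst x).sub_const (P y)).pow 2).add
    (((h.hasDerivAt_snd x).sub_const (Q y)).pow 2)).congr_deriv (by push_cast; ring)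

theorem hasDerivAt_distSq_right (h' : ClosedCurve P Q P' Q') (x y : ℝ) :
    HasDerivAt (fun y => distSq X Y P Q x y)
      (-(2 * ((X x - P y) * P' y + (Y x - Q y) * Q' y))) y := by
  unfold distSq
  exact ((((h'.hasDerivAt_fst y).const_sub (X x)).pow 2).add
    (((h'.hasDerivAt_snd y).const_sub (Y x)).pow 2)).congr_deriv (by push_cast; ring)

/-- The conservation law of a kernel, for the energy `E(z) = Ω |z|² / 2 + U · z`. -/
theorem integral_cross_energy (h : ClosedCurve X Y X' Y') (h' : ClosedCurve P Q P' Q')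
    (g k : ℝ → ℝ) (hg : ∀ x y, HasDerivAt g (k (distSq X Y P Q x y) / 2) (distSq X Y P Q x y))
    (hk : Continuous fun p : ℝ × ℝ => k (distSq X Y P Q p.1 p.2)) (Ω U₁ U₂ : ℝ) :
    ∫ x in (0 : ℝ)..(2 * Real.pi), ∫ y in (0 : ℝ)..(2 * Real.pi),
      k (distSq X Y P Q x y) * (X' x * Q' y - Y' x * P' y) *
        ((Ω * (X x ^ 2 + Y x ^ 2) / 2 + U₁ * X x + U₂ * Y x) -
          (Ω * (P y ^ 2 + Q y ^ 2) / 2 + U₁ * P y + U₂ * Q y)) = 0 := by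
  have c1 := h.continuous_X
  have c2 := h.continuous_Y
  have c3 := h'.continuous_X
  have c4 := h'.continuous_Y
  have c5 := h.continuous_fst
  have c6 := h.continuous_snd
  have c7 := h'.continuous_fst
  have c8 := h'.continuous_snd
  have cg : Continuous fun p : ℝ × ℝ => g (distSq X Y P Q p.1 p.2) := by
    rw [continuous_iff_continuousAt]
    intro p
    exact ContinuousAt.comp (hg p.1 p.2).continuousAt
      (continuous_distSq h h').continuousAt
  obtain ⟨G, hG⟩ : ∃ G : ℝ × ℝ → ℝ, G = fun p => g (distSq X Y P Q p.1 p.2) := ⟨_, rfl⟩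
  obtain ⟨K, hK⟩ : ∃ K : ℝ × ℝ → ℝ, K = fun p => k (distSq X Y P Q p.1 p.2) := ⟨_, rfl⟩
  rw [← hG] at cg
  rw [← hK] at hk
  -- Write `z`, `ζ` for the two points, `d = z - ζ` and `m = Ω (z + ζ) / 2 + U`, so that `E(z) -
  -- E(ζ) = d · m`. The integrand is `∂ₓ (g m × ζ') + ∂_y (g m × z')`: the derivatives of `g`
  -- combine by `(d · z')(m × ζ') - (d · ζ')(m × z') = (z' × ζ')(d · m)`, and those of `m` cancel.
  set Ax : ℝ → ℝ → ℝ := fun x y => k (distSq X Y P Q x y) *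
      ((X x - P y) * X' x + (Y x - Q y) * Y' x) *
      (P' y * -(Ω * (Y x + Q y) / 2 + U₂) + Q' y * (Ω * (X x + P y) / 2 + U₁)) +
    g (distSq X Y P Q x y) * (P' y * -(Ω * Y' x / 2) + Q' y * (Ω * X' x / 2)) with hAx
  set By : ℝ → ℝ → ℝ := fun x y => -(k (distSq X Y P Q x y) *
      ((X x - P y) * P' y + (Y x - Q y) * Q' y)) *
      (X' x * -(Ω * (Y x + Q y) / 2 + U₂) + Y' x * (Ω * (X x + P y) / 2 + U₁)) +
    g (distSq X Y P Q x y) * (X' x * -(Ω * Q' y / 2) + Y' x * (Ω * P' y / 2)) with hBy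
  have cAx : Continuous (Function.uncurry Ax) := by
    have e : Function.uncurry Ax = fun p => K p *
      ((X p.1 - P p.2) * X' p.1 + (Y p.1 - Q p.2) * Y' p.1) *
      (P' p.2 * -(Ω * (Y p.1 + Q p.2) / 2 + U₂) + Q' p.2 * (Ω * (X p.1 + P p.2) / 2 + U₁)) +
      G p * (P' p.2 * -(Ω * Y' p.1 / 2) + Q' p.2 * (Ω * X' p.1 / 2)) := by
      rw [hG, hK]; rfl
    rw [e]; fun_prop
  have cBy : Continuous (Function.uncurry By) := by
    have e : Function.uncurry By = fun p => -(K p *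
      ((X p.1 - P p.2) * P' p.2 + (Y p.1 - Q p.2) * Q' p.2)) *
      (X' p.1 * -(Ω * (Y p.1 + Q p.2) / 2 + U₂) + Y' p.1 * (Ω * (X p.1 + P p.2) / 2 + U₁)) +
      G p * (X' p.1 * -(Ω * Q' p.2 / 2) + Y' p.1 * (Ω * P' p.2 / 2)) := by
      rw [hG, hK]; rfl
    rw [e]; fun_prop
  have key := integral_divergence_eq_zero (Ax := Ax) (By := By)
    (A := fun x y => g (distSq X Y P Q x y) *
      (P' y * -(Ω * (Y x + Q y) / 2 + U₂) + Q' y * (Ω * (X x + P y) / 2 + U₁)))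
    (B := fun x y => g (distSq X Y P Q x y) *
      (X' x * -(Ω * (Y x + Q y) / 2 + U₂) + Y' x * (Ω * (X x + P y) / 2 + U₁)))
    cAx cBy
    (fun x y => by
      have hX := h.hasDerivAt_fst x
      have hY := h.hasDerivAt_snd x
      have h1 : HasDerivAt (fun x => g (distSq X Y P Q x y)) _ x :=
        (hg x y).comp x (hasDerivAt_distSq_left h x y)
      have h2 : HasDerivAt (fun x => P' y * -(Ω * (Y x + Q y) / 2 + U₂) +
          Q' y * (Ω * (X x + P y) / 2 + U₁)) (P' y * -(Ω * Y' x / 2) + Q' y * (Ω * X' x / 2)) x :=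
        (((((hY.add_const (Q y)).const_mul Ω).div_const 2).add_const U₂).neg.const_mul (P' y)).add
          (((((hX.add_const (P y)).const_mul Ω).div_const 2).add_const U₁).const_mul (Q' y))
      exact (h1.mul h2).congr_deriv (by simp only [hAx]; ring))
    (fun x y => by
      have hP := h'.hasDerivAt_fst y
      have hQ := h'.hasDerivAt_snd y
      have h1 : HasDerivAt (fun y => g (distSq X Y P Q x y)) _ y :=
        (hg x y).comp y (hasDerivAt_distSq_right h' x y)
      have h2 : HasDerivAt (fun y => X' x * -(Ω * (Y x + Q y) / 2 + U₂) +
          Y' x * (Ω * (X x + P y) / 2 + U₁)) (X' x * -(Ω * Q' y / 2) + Y' x * (Ω * P' y / 2)) y :=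
        (((((hQ.const_add (Y x)).const_mul Ω).div_const 2).add_const U₂).neg.const_mul (X' x)).add
          (((((hP.const_add (X x)).const_mul Ω).div_const 2).add_const U₁).const_mul (Y' x))
      exact (h1.mul h2).congr_deriv (by simp only [hBy]; ring))
    (fun y => by simp only [distSq, h.closed_fst, h.closed_snd])
    (fun x => by simp only [distSq, h'.closed_fst, h'.closed_snd])
  rw [← key]
  congr 1; funext x
  congr 1; funext y
  simp only [hAx, hBy]
  ring

/-- The double integral of a homogeneous kernel over two disjoint curves vanishes. -/
theorem integral_cross (h : ClosedCurve X Y X' Y') (h' : ClosedCurve P Q P' Q')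
    (g g' k : ℝ → ℝ) (hg : ∀ x y, HasDerivAt g (g' (distSq X Y P Q x y)) (distSq X Y P Q x y))
    (hg' : Continuous fun p : ℝ × ℝ => g' (distSq X Y P Q p.1 p.2))
    (hk : ∀ x y, k (distSq X Y P Q x y) =
      2 * (g (distSq X Y P Q x y) + distSq X Y P Q x y * g' (distSq X Y P Q x y))) :
    ∫ x in (0 : ℝ)..(2 * Real.pi), ∫ y in (0 : ℝ)..(2 * Real.pi),
      k (distSq X Y P Q x y) * (X' x * Q' y - Y' x * P' y) = 0 := by
  have c1 := h.continuous_X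
  have c2 := h.continuous_Y
  have c3 := h'.continuous_X
  have c4 := h'.continuous_Y
  have c5 := h.continuous_fst
  have c6 := h.continuous_snd
  have c7 := h'.continuous_fst
  have c8 := h'.continuous_snd
  have cg : Continuous fun p : ℝ × ℝ => g (distSq X Y P Q p.1 p.2) := by
    rw [continuous_iff_continuousAt]
    intro p
    exact ContinuousAt.comp (hg p.1 p.2).continuousAt
      (continuous_distSq h h').continuousAt
  obtain ⟨G, hG⟩ : ∃ G : ℝ × ℝ → ℝ, G = fun p => g (distSq X Y P Q p.1 p.2) := ⟨_, rfl⟩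
  obtain ⟨K, hK⟩ : ∃ K : ℝ × ℝ → ℝ, K = fun p => g' (distSq X Y P Q p.1 p.2) := ⟨_, rfl⟩
  rw [← hG] at cg
  rw [← hK] at hg'
  -- The same device with `d` in place of `m`: the divergence of `g d × ζ'` and `g d × z'` is `2 (g
  -- + |d|² g') z' × ζ'`, which is the combination required by `hk`.
  set Ax : ℝ → ℝ → ℝ := fun x y => g' (distSq X Y P Q x y) *
      (2 * ((X x - P y) * X' x + (Y x - Q y) * Y' x)) *
      ((X x - P y) * Q' y - (Y x - Q y) * P' y) +
    g (distSq X Y P Q x y) * (X' x * Q' y - Y' x * P' y) with hAx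
  set By : ℝ → ℝ → ℝ := fun x y => -(g' (distSq X Y P Q x y) *
      (2 * ((X x - P y) * P' y + (Y x - Q y) * Q' y))) *
      ((X x - P y) * Y' x - (Y x - Q y) * X' x) +
    g (distSq X Y P Q x y) * (-P' y * Y' x - -Q' y * X' x) with hBy
  have cAx : Continuous (Function.uncurry Ax) := by
    have e : Function.uncurry Ax = fun p => K p *
      (2 * ((X p.1 - P p.2) * X' p.1 + (Y p.1 - Q p.2) * Y' p.1)) *
      ((X p.1 - P p.2) * Q' p.2 - (Y p.1 - Q p.2) * P' p.2) +
      G p * (X' p.1 * Q' p.2 - Y' p.1 * P' p.2) := by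
      rw [hG, hK]; rfl
    rw [e]; fun_prop
  have cBy : Continuous (Function.uncurry By) := by
    have e : Function.uncurry By = fun p => -(K p *
      (2 * ((X p.1 - P p.2) * P' p.2 + (Y p.1 - Q p.2) * Q' p.2))) *
      ((X p.1 - P p.2) * Y' p.1 - (Y p.1 - Q p.2) * X' p.1) +
      G p * (-P' p.2 * Y' p.1 - -Q' p.2 * X' p.1) := by
      rw [hG, hK]; rfl
    rw [e]; fun_prop
  have key := integral_divergence_eq_zero (Ax := Ax) (By := By)
    (A := fun x y => g (distSq X Y P Q x y) * ((X x - P y) * Q' y - (Y x - Q y) * P' y))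
    (B := fun x y => g (distSq X Y P Q x y) * ((X x - P y) * Y' x - (Y x - Q y) * X' x))
    cAx cBy
    (fun x y => by
      have hX := h.hasDerivAt_fst x
      have hY := h.hasDerivAt_snd x
      have h1 : HasDerivAt (fun x => g (distSq X Y P Q x y)) _ x :=
        (hg x y).comp x (hasDerivAt_distSq_left h x y)
      have h2 : HasDerivAt (fun x => (X x - P y) * Q' y - (Y x - Q y) * P' y)
          (X' x * Q' y - Y' x * P' y) x :=
        ((hX.sub_const (P y)).mul_const (Q' y)).sub ((hY.sub_const (Q y)).mul_const (P' y))
      exact (h1.mul h2).congr_deriv (by simp only [hAx]))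
    (fun x y => by
      have hP := h'.hasDerivAt_fst y
      have hQ := h'.hasDerivAt_snd y
      have h1 : HasDerivAt (fun y => g (distSq X Y P Q x y)) _ y :=
        (hg x y).comp y (hasDerivAt_distSq_right h' x y)
      have h2 : HasDerivAt (fun y => (X x - P y) * Y' x - (Y x - Q y) * X' x)
          (-P' y * Y' x - -Q' y * X' x) y :=
        ((hP.const_sub (X x)).mul_const (Y' x)).sub ((hQ.const_sub (Y x)).mul_const (X' x))
      exact (h1.mul h2).congr_deriv (by simp only [hBy]; ring))
    (fun y => by simp only [distSq, h.closed_fst, h.closed_snd])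
    (fun x => by simp only [distSq, h'.closed_fst, h'.closed_snd])
  rw [← key]
  congr 1; funext x
  congr 1; funext y
  rw [hk]
  simp only [hAx, hBy]
  unfold distSq
  ring

end Exact

/-! ### Conservation laws for patches -/

/-- A `C¹` radius function. -/
structure PolarRadius (R : ℝ → ℝ) : Prop where
  hasDerivAt : ∀ x, HasDerivAt R (deriv R x) x
  continuous_deriv : Continuous (deriv R)
  periodic : Function.Periodic R (2 * Real.pi)
  periodic_deriv : Function.Periodic (deriv R) (2 * Real.pi)

theorem PolarRadius.continuous {R : ℝ → ℝ} (h : PolarRadius R) : Continuous R :=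
  continuous_iff_continuousAt.2 fun x => (h.hasDerivAt x).continuousAt

section Polar

variable {R S : ℝ → ℝ}

theorem closedCurve_polar (h : PolarRadius R) (w : ℂ) (c : ℝ) :
    ClosedCurve (fun x => w.re + c * (R x * Real.cos x)) (fun x => w.im + c * (R x * Real.sin x))
      (fun x => c * (deriv R x * Real.cos x - R x * Real.sin x))
      (fun x => c * (deriv R x * Real.sin x + R x * Real.cos x)) := by
  have hc := h.continuous
  have hc' := h.continuous_deriv
  have hp : R (2 * Real.pi) = R 0 := by simpa using h.periodic 0
  refine ⟨fun x => ?_, fun x => ?_, by fun_prop, by fun_prop, by simp [hp], by simp⟩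
  · exact ((((h.hasDerivAt x).mul (Real.hasDerivAt_cos x)).const_mul c).const_add w.re).congr_deriv
      (by ring)
  · exact ((((h.hasDerivAt x).mul (Real.hasDerivAt_sin x)).const_mul c).const_add w.im)

/-- The energy `Ω |z|² / 2 + U₁ z₁ + U₂ z₂` along a polar curve. -/
def curveEnergy (Ω U₁ U₂ : ℝ) (w : ℂ) (c : ℝ) (R : ℝ → ℝ) (x : ℝ) : ℝ :=
  Ω * ((w.re + c * (R x * Real.cos x)) ^ 2 + (w.im + c * (R x * Real.sin x)) ^ 2) / 2 +
    U₁ * (w.re + c * (R x * Real.cos x)) + U₂ * (w.im + c * (R x * Real.sin x))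

theorem continuous_curveEnergy (h : PolarRadius R) (Ω U₁ U₂ : ℝ) (w : ℂ) (c : ℝ) :
    Continuous (curveEnergy Ω U₁ U₂ w c R) := by
  have hc := h.continuous
  unfold curveEnergy
  fun_prop

theorem crossTerm_swap (x y : ℝ) : crossTerm S R y x = -crossTerm R S x y := by
  unfold crossTerm
  rw [← neg_sub x y, Real.sin_neg, Real.cos_neg]; ring

theorem continuous_crossTerm (hR : PolarRadius R) (hS : PolarRadius S) :
    Continuous (Function.uncurry (crossTerm R S)) := by
  have c1 := hR.continuous
  have c2 := hR.continuous_deriv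
  have c3 := hS.continuous
  have c4 := hS.continuous_deriv
  unfold crossTerm Function.uncurry
  fun_prop

section Pair

/-- The interaction kernel of two patches. -/
def pairKernel (α : ℝ) (w w' : ℂ) (c c' : ℝ) (R S : ℝ → ℝ) (x y : ℝ) : ℝ :=
  crossTerm R S x y / ‖(w + ((c * R x : ℝ) : ℂ) * unitVec x) -
    (w' + ((c' * S y : ℝ) : ℂ) * unitVec y)‖ ^ α

variable {α : ℝ} {w w' : ℂ} {c c' : ℝ}

theorem pairKernel_swap (x y : ℝ) :
    pairKernel α w' w c' c S R y x = -pairKernel α w w' c c' R S x y := by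
  rw [pairKernel, pairKernel, crossTerm_swap, norm_sub_rev, neg_div]

theorem normSq_sub_eq_distSq (x y : ℝ) : ‖(w + ((c * R x : ℝ) : ℂ) * unitVec x) -
    (w' + ((c' * S y : ℝ) : ℂ) * unitVec y)‖ ^ 2 =
    distSq (fun x => w.re + c * (R x * Real.cos x)) (fun x => w.im + c * (R x * Real.sin x))
      (fun x => w'.re + c' * (S x * Real.cos x)) (fun x => w'.im + c' * (S x * Real.sin x)) x y := by
  rw [← Complex.normSq_eq_norm_sq, Complex.normSq_apply, distSq]
  simp only [unitVec, Complex.sub_re, Complex.add_re, Complex.mul_re, Complex.ofReal_re,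
    Complex.ofReal_im, Complex.sub_im, Complex.add_im, Complex.mul_im, zero_mul, sub_zero, add_zero]
  ring

variable (hd : ∀ x y, w + ((c * R x : ℝ) : ℂ) * unitVec x ≠ w' + ((c' * S y : ℝ) : ℂ) * unitVec y)

theorem continuous_unitVec : Continuous unitVec := by
  have : unitVec = fun x : ℝ => ((Real.cos x : ℝ) : ℂ) + ((Real.sin x : ℝ) : ℂ) * Complex.I := by
    funext x; apply Complex.ext <;> simp [unitVec, Complex.cos_ofReal_re, Complex.sin_ofReal_re]
  rw [this]
  fun_prop

include hd in
theorem distSq_pos (x y : ℝ) : 0 < distSq (fun x => w.re + c * (R x * Real.cos x))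
    (fun x => w.im + c * (R x * Real.sin x)) (fun x => w'.re + c' * (S x * Real.cos x))
    (fun x => w'.im + c' * (S x * Real.sin x)) x y := by
  rw [← normSq_sub_eq_distSq]
  have := norm_pos_iff.2 (sub_ne_zero.2 (hd x y))
  positivity

include hd in
theorem continuous_pairKernel (hR : PolarRadius R) (hS : PolarRadius S) :
    Continuous (Function.uncurry (pairKernel α w w' c c' R S)) := by
  have c1 := hR.continuous
  have c3 := hS.continuous
  have c5 := continuous_unitVec
  refine (continuous_crossTerm hR hS).div ?_ fun p => ?_
  · refine Continuous.rpow_const (by fun_prop) fun p => Or.inl ?_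
    exact norm_ne_zero_iff.2 (sub_ne_zero.2 (hd p.1 p.2))
  · exact (Real.rpow_pos_of_pos (norm_pos_iff.2 (sub_ne_zero.2 (hd p.1 p.2))) _).ne'

theorem pairKernel_eq (hc : c ≠ 0) (hc' : c' ≠ 0) (x y : ℝ) :
    pairKernel α w w' c c' R S x y = -(c * c')⁻¹ * ((distSq (fun x => w.re + c * (R x * Real.cos x))
    (fun x => w.im + c * (R x * Real.sin x)) (fun x => w'.re + c' * (S x * Real.cos x))
    (fun x => w'.im + c' * (S x * Real.sin x)) x y) ^ (-α / 2) *
      (c * (deriv R x * Real.cos x - R x * Real.sin x) *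
        (c' * (deriv S y * Real.sin y + S y * Real.cos y)) -
      c * (deriv R x * Real.sin x + R x * Real.cos x) *
        (c' * (deriv S y * Real.cos y - S y * Real.sin y)))) := by
  rw [pairKernel, crossTerm_eq, ← normSq_sub_eq_distSq, div_eq_mul_inv]
  set n := ‖(w + ((c * R x : ℝ) : ℂ) * unitVec x) - (w' + ((c' * S y : ℝ) : ℂ) * unitVec y)‖ with hn
  have : (n ^ α)⁻¹ = (n ^ 2) ^ (-α / 2) := by
    rw [← Real.rpow_natCast, ← Real.rpow_mul (norm_nonneg _), ← Real.rpow_neg (norm_nonneg _)]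
    congr 1; push_cast; ring
  rw [this]
  field_simp
  ring

include hd in
-- `integral_cross_energy` with `g` a primitive of half the kernel as a function of the squared
-- distance. Disjointness of the curves keeps that distance positive.
theorem integral_pairKernel_energy (hα : α ∈ Ioo (1 : ℝ) 2) (hR : PolarRadius R)
    (hS : PolarRadius S) (hc : c ≠ 0) (hc' : c' ≠ 0) (Ω U₁ U₂ : ℝ) :
    ∫ x in (0 : ℝ)..(2 * Real.pi), ∫ y in (0 : ℝ)..(2 * Real.pi),
      pairKernel α w w' c c' R S x y *
        (curveEnergy Ω U₁ U₂ w c R x - curveEnergy Ω U₁ U₂ w' c' S y) = 0 := by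
  have h1 := closedCurve_polar hR w c
  have h2 := closedCurve_polar hS w' c'
  have hpos := distSq_pos hd
  have hα2 : 1 - α / 2 ≠ 0 := by linarith [hα.2]
  have key := integral_cross_energy h1 h2 (fun q => q ^ (1 - α / 2) / (2 - α))
    (fun q => q ^ (-α / 2)) (fun x y => by
      refine ((Real.hasDerivAt_rpow_const (p := 1 - α / 2) (Or.inl (hpos x y).ne')).div_const
        (2 - α)).congr_deriv ?_
      have : 2 - α ≠ 0 := by linarith [hα.2]
      rw [show 1 - α / 2 - 1 = -α / 2 by ring]
      field_simp) ((continuous_distSq h1 h2).rpow_const fun p => Or.inl (hpos p.1 p.2).ne') Ω U₁ U₂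
  have e : ∀ x y, pairKernel α w w' c c' R S x y *
      (curveEnergy Ω U₁ U₂ w c R x - curveEnergy Ω U₁ U₂ w' c' S y) = -(c * c')⁻¹ *
      (distSq (fun x => w.re + c * (R x * Real.cos x))
    (fun x => w.im + c * (R x * Real.sin x)) (fun x => w'.re + c' * (S x * Real.cos x))
    (fun x => w'.im + c' * (S x * Real.sin x)) x y ^ (-α / 2) *
      (c * (deriv R x * Real.cos x - R x * Real.sin x) *
        (c' * (deriv S y * Real.sin y + S y * Real.cos y)) -
      c * (deriv R x * Real.sin x + R x * Real.cos x) *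
        (c' * (deriv S y * Real.cos y - S y * Real.sin y))) *
      (curveEnergy Ω U₁ U₂ w c R x - curveEnergy Ω U₁ U₂ w' c' S y)) := by
    intro x y
    rw [pairKernel_eq hc hc']; ring
  simp only [e, intervalIntegral.integral_const_mul]
  exact mul_eq_zero_of_right _ key

include hd in
-- The power `q ^ (-α / 2)` is homogeneous, so `g = q ^ (-α / 2) / (2 - α)` solves `2 (g + q g') = q
-- ^ (-α / 2)`, as `integral_cross` asks.
theorem integral_pairKernel (hα : α ∈ Ioo (1 : ℝ) 2) (hR : PolarRadius R)
    (hS : PolarRadius S) (hc : c ≠ 0) (hc' : c' ≠ 0) :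
    ∫ x in (0 : ℝ)..(2 * Real.pi), ∫ y in (0 : ℝ)..(2 * Real.pi),
      pairKernel α w w' c c' R S x y = 0 := by
  have h1 := closedCurve_polar hR w c
  have h2 := closedCurve_polar hS w' c'
  have hpos := distSq_pos hd
  have hα2 : 2 - α ≠ 0 := by linarith [hα.2]
  have aux : ∀ q : ℝ, 0 < q → q ^ (-α / 2) = 2 * (q ^ (-α / 2) / (2 - α) +
      q * ((-α / 2 * q ^ (-α / 2 - 1)) / (2 - α))) := by
    intro q hq
    rw [Real.rpow_sub_one hq.ne']
    field_simp
    ring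
  have key := integral_cross h1 h2 (fun q => q ^ (-α / 2) / (2 - α))
    (fun q => (-α / 2 * q ^ (-α / 2 - 1)) / (2 - α)) (fun q => q ^ (-α / 2)) (fun x y =>
      (Real.hasDerivAt_rpow_const (p := -α / 2) (Or.inl (hpos x y).ne')).div_const (2 - α))
      ((((continuous_distSq h1 h2).rpow_const
        fun p => Or.inl (hpos p.1 p.2).ne').const_mul _).div_const _) (fun x y => aux _ (hpos x y))
  simp only [pairKernel_eq hc hc', intervalIntegral.integral_const_mul]
  exact mul_eq_zero_of_right _ key

include hd in
-- Action and reaction: the kernel is antisymmetric under exchange of the patches, and its integral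
-- against the difference of the energies vanishes. Fubini separates the two energies.
theorem integral_energy_mean_pairKernel (hα : α ∈ Ioo (1 : ℝ) 2) (hR : PolarRadius R)
    (hS : PolarRadius S) (hc : c ≠ 0) (hc' : c' ≠ 0) (Ω U₁ U₂ : ℝ) :
    ∫ x in (0 : ℝ)..(2 * Real.pi), curveEnergy Ω U₁ U₂ w c R x *
        mean (pairKernel α w w' c c' R S x) =
      -∫ y in (0 : ℝ)..(2 * Real.pi), curveEnergy Ω U₁ U₂ w' c' S y *
        mean (pairKernel α w' w c' c S R y) := by
  have hk := continuous_pairKernel (α := α) hd hR hS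
  have c1 := continuous_curveEnergy hR Ω U₁ U₂ w c
  have c2 := continuous_curveEnergy hS Ω U₁ U₂ w' c'
  have key := integral_pairKernel_energy hd hα hR hS hc hc' Ω U₁ U₂
  have f1 : Continuous (Function.uncurry fun x y => curveEnergy Ω U₁ U₂ w c R x *
      pairKernel α w w' c c' R S x y) := (c1.comp continuous_fst).mul hk
  have f2 : Continuous (Function.uncurry fun x y => curveEnergy Ω U₁ U₂ w' c' S y *
      pairKernel α w w' c c' R S x y) := (c2.comp continuous_snd).mul hk
  have e1 : ∀ x, ∫ y in (0 : ℝ)..(2 * Real.pi), pairKernel α w w' c c' R S x y *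
        (curveEnergy Ω U₁ U₂ w c R x - curveEnergy Ω U₁ U₂ w' c' S y) =
      (∫ y in (0 : ℝ)..(2 * Real.pi), curveEnergy Ω U₁ U₂ w c R x *
        pairKernel α w w' c c' R S x y) - ∫ y in (0 : ℝ)..(2 * Real.pi),
        curveEnergy Ω U₁ U₂ w' c' S y * pairKernel α w w' c c' R S x y := by
    intro x
    rw [← intervalIntegral.integral_sub ((f1.uncurry_left x).intervalIntegrable _ _)
      ((f2.uncurry_left x).intervalIntegrable _ _)]
    congr 1; funext y; ring
  simp only [e1] at key
  rw [intervalIntegral.integral_sub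
    ((intervalIntegral.continuous_parametric_intervalIntegral_of_continuous' f1 _ _).intervalIntegrable _ _)
    ((intervalIntegral.continuous_parametric_intervalIntegral_of_continuous' f2 _ _).intervalIntegrable _ _),
    integral_integral_swap f2] at key
  have e2 : ∀ x, curveEnergy Ω U₁ U₂ w c R x * mean (pairKernel α w w' c c' R S x) =
      (1 / (2 * Real.pi)) * ∫ y in (0 : ℝ)..(2 * Real.pi), curveEnergy Ω U₁ U₂ w c R x *
        pairKernel α w w' c c' R S x y := by
    intro x
    rw [mean, intervalIntegral.integral_const_mul]; ring
  have e3 : ∀ y, curveEnergy Ω U₁ U₂ w' c' S y * mean (pairKernel α w' w c' c S R y) =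
      -(1 / (2 * Real.pi)) * ∫ x in (0 : ℝ)..(2 * Real.pi), curveEnergy Ω U₁ U₂ w' c' S y *
        pairKernel α w w' c c' R S x y := by
    intro y
    rw [mean, intervalIntegral.integral_const_mul]
    rw [show pairKernel α w' w c' c S R y = fun x => -pairKernel α w w' c c' R S x y from
      funext fun x => pairKernel_swap x y, intervalIntegral.integral_neg]
    ring
  simp only [e2, e3]
  rw [intervalIntegral.integral_const_mul, intervalIntegral.integral_const_mul]
  linear_combination (1 / (2 * Real.pi)) * key

end Pair

/-! ### Conservation of energy under the self-interaction -/

section Self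

variable {α : ℝ}

/-- The squared distance of two points of a polar curve. -/
def chordSq (R : ℝ → ℝ) (x y : ℝ) : ℝ :=
  (R x - R y) ^ 2 + 4 * R x * R y * Real.sin ((x - y) / 2) ^ 2

theorem chordSq_eq (x y : ℝ) : chordSq R x y =
    distSq (fun x => (0 : ℂ).re + 1 * (R x * Real.cos x)) (fun x => (0 : ℂ).im + 1 * (R x * Real.sin x))
      (fun x => (0 : ℂ).re + 1 * (R x * Real.cos x)) (fun x => (0 : ℂ).im + 1 * (R x * Real.sin x))
      x y := by
  have h1 : Real.sin ((x - y) / 2) ^ 2 = (1 - Real.cos (x - y)) / 2 := by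
    have := Real.cos_sq' ((x - y) / 2)
    have h2 := Real.cos_two_mul ((x - y) / 2)
    rw [mul_div_cancel₀ _ (two_ne_zero)] at h2
    linarith
  rw [chordSq, h1, distSq, Real.cos_sub]
  simp only [Complex.zero_re, Complex.zero_im]
  linear_combination (-(R x ^ 2)) * Real.sin_sq_add_cos_sq x - R y ^ 2 * Real.sin_sq_add_cos_sq y

theorem chordSq_nonneg (x y : ℝ) : 0 ≤ chordSq R x y := by
  rw [chordSq_eq, distSq]; positivity

/-- The regularized self-interaction kernel. -/
def selfKernel (α : ℝ) (R : ℝ → ℝ) (η x y : ℝ) : ℝ :=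
  crossTerm R R x y / (chordSq R x y + η) ^ (α / 2)

theorem continuous_chordSq (hR : PolarRadius R) : Continuous (Function.uncurry (chordSq R)) := by
  have := hR.continuous
  unfold chordSq Function.uncurry
  fun_prop

theorem continuous_selfKernel (hR : PolarRadius R) {η : ℝ} (hη : 0 < η) :
    Continuous (Function.uncurry (selfKernel α R η)) := by
  have hpos : ∀ p : ℝ × ℝ, 0 < chordSq R p.1 p.2 + η := fun p =>
    add_pos_of_nonneg_of_pos (chordSq_nonneg _ _) hη
  refine (continuous_crossTerm hR hR).div ?_ fun p => (Real.rpow_pos_of_pos (hpos p) _).ne'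
  exact ((continuous_chordSq hR).add continuous_const).rpow_const fun p => Or.inl (hpos p).ne'

theorem selfKernel_swap (η x y : ℝ) : selfKernel α R η y x = -selfKernel α R η x y := by
  have : chordSq R y x = chordSq R x y := by
    unfold chordSq
    rw [show (y - x) / 2 = -((x - y) / 2) by ring, Real.sin_neg]; ring
  rw [selfKernel, selfKernel, crossTerm_swap, this, neg_div]

/-- Adding `η > 0` to the squared chord makes the kernel continuous, so the divergence identity
applies to a curve paired with itself. By antisymmetry the integral against the difference of
energies is twice the integral against one of them. The constant `A` is free, since only differences
occur. -/
theorem integral_energy_selfKernel_regularized (hα : α ∈ Ioo (1 : ℝ) 2) (hR : PolarRadius R)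
    {η : ℝ} (hη : 0 < η) (A Ω U₁ U₂ : ℝ) :
    ∫ x in (0 : ℝ)..(2 * Real.pi), (A + curveEnergy Ω U₁ U₂ 0 1 R x) *
      ∫ y in (0 : ℝ)..(2 * Real.pi), selfKernel α R η x y = 0 := by
  have hpos : ∀ x y, 0 < chordSq R x y + η := fun x y =>
    add_pos_of_nonneg_of_pos (chordSq_nonneg _ _) hη
  have h1 := closedCurve_polar hR 0 1
  have hk := continuous_selfKernel (α := α) hR hη
  have hne : 2 - α ≠ 0 := by linarith [hα.2]
  have aux : ∀ q : ℝ, 0 < q + η → HasDerivAt (fun q => (q + η) ^ (1 - α / 2) / (2 - α))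
      ((q + η) ^ (-α / 2) / 2) q := by
    intro q hq
    refine ((((hasDerivAt_id q).add_const η).rpow_const (p := 1 - α / 2)
      (Or.inl hq.ne')).div_const (2 - α)).congr_deriv ?_
    rw [show 1 - α / 2 - 1 = -α / 2 by ring]
    simp only [id]
    field_simp
  have key := integral_cross_energy h1 h1 (fun q => (q + η) ^ (1 - α / 2) / (2 - α))
    (fun q => (q + η) ^ (-α / 2)) (fun x y => by
      have hp := hpos x y
      rw [chordSq_eq] at hp
      exact aux _ hp) (((continuous_distSq h1 h1).add continuous_const).rpow_const
        fun p => Or.inl (by have := hpos p.1 p.2; rw [chordSq_eq] at this; exact this.ne')) Ω U₁ U₂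
  have e0 : ∀ x y, selfKernel α R η x y * ((A + curveEnergy Ω U₁ U₂ 0 1 R x) -
      (A + curveEnergy Ω U₁ U₂ 0 1 R y)) = -((distSq (fun x => (0 : ℂ).re + 1 * (R x * Real.cos x))
    (fun x => (0 : ℂ).im + 1 * (R x * Real.sin x)) (fun x => (0 : ℂ).re + 1 * (R x * Real.cos x))
    (fun x => (0 : ℂ).im + 1 * (R x * Real.sin x)) x y + η) ^ (-α / 2) *
      (1 * (deriv R x * Real.cos x - R x * Real.sin x) *
        (1 * (deriv R y * Real.sin y + R y * Real.cos y)) -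
      1 * (deriv R x * Real.sin x + R x * Real.cos x) *
        (1 * (deriv R y * Real.cos y - R y * Real.sin y))) *
      (curveEnergy Ω U₁ U₂ 0 1 R x - curveEnergy Ω U₁ U₂ 0 1 R y)) := by
    intro x y
    rw [selfKernel, crossTerm_eq, ← chordSq_eq, neg_div, Real.rpow_neg (hpos x y).le,
      div_eq_mul_inv]
    ring
  have key' : ∫ x in (0 : ℝ)..(2 * Real.pi), ∫ y in (0 : ℝ)..(2 * Real.pi),
      selfKernel α R η x y * ((A + curveEnergy Ω U₁ U₂ 0 1 R x) -
      (A + curveEnergy Ω U₁ U₂ 0 1 R y)) = 0 := by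
    simp only [e0, intervalIntegral.integral_neg]
    exact neg_eq_zero.2 key
  set φ : ℝ → ℝ := fun x => A + curveEnergy Ω U₁ U₂ 0 1 R x with hφ
  have cφ : Continuous φ := continuous_const.add (continuous_curveEnergy hR Ω U₁ U₂ 0 1)
  have f1 : Continuous (Function.uncurry fun x y => φ x * selfKernel α R η x y) :=
    (cφ.comp continuous_fst).mul hk
  have f2 : Continuous (Function.uncurry fun x y => φ y * selfKernel α R η x y) :=
    (cφ.comp continuous_snd).mul hk
  have e1 : ∀ x, ∫ y in (0 : ℝ)..(2 * Real.pi), selfKernel α R η x y * (φ x - φ y) =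
      (∫ y in (0 : ℝ)..(2 * Real.pi), φ x * selfKernel α R η x y) -
        ∫ y in (0 : ℝ)..(2 * Real.pi), φ y * selfKernel α R η x y := by
    intro x
    rw [← intervalIntegral.integral_sub ((f1.uncurry_left x).intervalIntegrable _ _)
      ((f2.uncurry_left x).intervalIntegrable _ _)]
    congr 1; funext y; ring
  replace key' : ∫ x in (0 : ℝ)..(2 * Real.pi), ∫ y in (0 : ℝ)..(2 * Real.pi),
      selfKernel α R η x y * (φ x - φ y) = 0 := key'
  simp only [e1] at key'
  rw [intervalIntegral.integral_sub
    ((intervalIntegral.continuous_parametric_intervalIntegral_of_continuous' f1 _ _).intervalIntegrable _ _)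
    ((intervalIntegral.continuous_parametric_intervalIntegral_of_continuous' f2 _ _).intervalIntegrable _ _),
    integral_integral_swap f2] at key'
  have e2 : ∀ y, ∫ x in (0 : ℝ)..(2 * Real.pi), φ y * selfKernel α R η x y =
      -∫ x in (0 : ℝ)..(2 * Real.pi), φ y * selfKernel α R η y x := by
    intro y
    rw [← intervalIntegral.integral_neg]
    congr 1; funext x
    rw [selfKernel_swap]; ring
  simp only [e2, intervalIntegral.integral_neg, intervalIntegral.integral_const_mul] at key'
  linarith

/-- The self-interaction conserves the energy. -/
theorem integral_energy_mean_selfKernel (hα : α ∈ Ioo (1 : ℝ) 2) (hR : PolarRadius R) {C c₀ : ℝ}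
    (hc₀ : 0 < c₀)
    (hC : ∀ x, ∀ τ ∈ Ioo 0 (2 * Real.pi), |crossTerm R R x (x - τ)| ≤ C * (2 * Real.sin (τ / 2)))
    (hlow : ∀ x, ∀ τ ∈ Ioo 0 (2 * Real.pi), c₀ * (4 * Real.sin (τ / 2) ^ 2) ≤ chordSq R x (x - τ))
    (A Ω U₁ U₂ : ℝ) :
    ∫ x in (0 : ℝ)..(2 * Real.pi), (A + curveEnergy Ω U₁ U₂ 0 1 R x) *
      mean (selfKernel α R 0 x) = 0 := by
  set φ : ℝ → ℝ := fun x => A + curveEnergy Ω U₁ U₂ 0 1 R x with hφ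
  have cφ : Continuous φ := continuous_const.add (continuous_curveEnergy hR Ω U₁ U₂ 0 1)
  -- A bound independent of `η` and `x`: the cross term vanishes like `2 sin (τ / 2)` and the
  -- squared chord is at least `c₀ (2 sin (τ / 2))²`, which leaves the integrable exponent `1 - α`.
  set B : ℝ → ℝ := fun τ => C * (c₀ ^ (-(α / 2))) * (2 * Real.sin (τ / 2)) ^ (1 - α) with hB
  have hBint : IntervalIntegrable B MeasureTheory.volume 0 (2 * Real.pi) :=
    (intervalIntegrable_two_sin_rpow (by linarith [hα.2]) (by linarith [hα.1])).const_mul _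
  have hper : ∀ η x, Function.Periodic (selfKernel α R η x) (2 * Real.pi) := by
    intro η x y
    have e : Real.sin ((x - (y + 2 * Real.pi)) / 2) ^ 2 = Real.sin ((x - y) / 2) ^ 2 := by
      rw [show (x - (y + 2 * Real.pi)) / 2 = (x - y) / 2 - Real.pi by ring, Real.sin_sub_pi, neg_sq]
    simp only [selfKernel, chordSq, crossTerm_periodic hR.periodic hR.periodic_deriv x y,
      hR.periodic y, e]
  have hsub : ∀ η x, ∫ y in (0 : ℝ)..(2 * Real.pi), selfKernel α R η x y =
      ∫ τ in (0 : ℝ)..(2 * Real.pi), selfKernel α R η x (x - τ) := by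
    intro η x
    have := mean_comp_sub (hper η x) x
    unfold mean at this
    have hpi : 1 / (2 * Real.pi) ≠ 0 := by positivity
    exact (mul_left_cancel₀ hpi this).symm
  have hbound : ∀ η, 0 ≤ η → ∀ x, ∀ τ ∈ Ioo 0 (2 * Real.pi),
      |selfKernel α R η x (x - τ)| ≤ B τ := by
    intro η hη x τ hτ
    have hs := sin_half_pos hτ
    have hD : 0 < c₀ * (4 * Real.sin (τ / 2) ^ 2) := by positivity
    have h1 : c₀ * (4 * Real.sin (τ / 2) ^ 2) ≤ chordSq R x (x - τ) + η := by
      linarith [hlow x τ hτ]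
    rw [selfKernel, abs_div, abs_of_pos (Real.rpow_pos_of_pos (hD.trans_le h1) _), div_eq_mul_inv]
    have h2 : ((chordSq R x (x - τ) + η) ^ (α / 2))⁻¹ ≤
        ((c₀ * (4 * Real.sin (τ / 2) ^ 2)) ^ (α / 2))⁻¹ :=
      inv_anti₀ (Real.rpow_pos_of_pos hD _)
        (Real.rpow_le_rpow hD.le h1 (by linarith [hα.1]))
    have h3 : ((c₀ * (4 * Real.sin (τ / 2) ^ 2)) ^ (α / 2))⁻¹ = c₀ ^ (-(α / 2)) * kern α τ := by
      rw [Real.mul_rpow hc₀.le (by positivity), mul_inv, Real.rpow_neg hc₀.le, kern]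
    have h4 := two_mul_sin_half_mul_kern (α := α) hτ
    have h5 := (abs_nonneg _).trans (hC x τ hτ)
    calc |crossTerm R R x (x - τ)| * ((chordSq R x (x - τ) + η) ^ (α / 2))⁻¹
        ≤ (C * (2 * Real.sin (τ / 2))) * (c₀ ^ (-(α / 2)) * kern α τ) := by
          rw [← h3]
          exact mul_le_mul (hC x τ hτ) h2
            (inv_nonneg.2 (Real.rpow_nonneg (hD.le.trans h1) _)) h5
      _ = B τ := by simp only [hB]; rw [← h4]; ring
  have hae : ∀ᵐ τ : ℝ, τ ∈ uIoc 0 (2 * Real.pi) → τ ∈ Ioo 0 (2 * Real.pi) := by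
    have h0 : ∀ᵐ τ : ℝ, τ ≠ 2 * Real.pi := by
      simp [MeasureTheory.ae_iff, MeasureTheory.measure_singleton]
    filter_upwards [h0] with τ hτ h
    rw [uIoc_of_le (by positivity)] at h
    exact ⟨h.1, lt_of_le_of_ne h.2 hτ⟩
  have hpos : ∀ᶠ η : ℝ in 𝓝[>] 0, 0 < η := eventually_mem_nhdsWithin
  have hinner : ∀ x, Tendsto (fun η => ∫ τ in (0 : ℝ)..(2 * Real.pi), selfKernel α R η x (x - τ))
      (𝓝[>] 0) (𝓝 (∫ τ in (0 : ℝ)..(2 * Real.pi), selfKernel α R 0 x (x - τ))) := by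
    intro x
    refine intervalIntegral.tendsto_integral_filter_of_dominated_convergence B ?_ ?_ hBint ?_
    · filter_upwards [hpos] with η hη
      exact (((continuous_selfKernel (α := α) hR hη).uncurry_left x).comp
        (by fun_prop : Continuous fun τ => x - τ)).aestronglyMeasurable
    · filter_upwards [hpos] with η hη
      filter_upwards [hae] with τ h hτ using hbound η hη.le x τ (h hτ)
    · filter_upwards [hae] with τ h hτ
      have hs := sin_half_pos (h hτ)
      have hD : 0 < chordSq R x (x - τ) :=
        lt_of_lt_of_le (by positivity) (hlow x τ (h hτ))
      have hcont : ContinuousAt (fun η => selfKernel α R η x (x - τ)) 0 := by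
        unfold selfKernel
        refine ContinuousAt.div continuousAt_const ?_ ?_
        · refine ContinuousAt.rpow_const (by fun_prop) (Or.inl ?_)
          rw [add_zero]; exact hD.ne'
        · rw [add_zero]; exact (Real.rpow_pos_of_pos hD _).ne'
      exact hcont.tendsto.mono_left nhdsWithin_le_nhds
  have hlim : Tendsto (fun η => ∫ x in (0 : ℝ)..(2 * Real.pi), φ x *
      ∫ y in (0 : ℝ)..(2 * Real.pi), selfKernel α R η x y) (𝓝[>] 0)
      (𝓝 (∫ x in (0 : ℝ)..(2 * Real.pi), φ x *
        ∫ y in (0 : ℝ)..(2 * Real.pi), selfKernel α R 0 x y)) := by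
    refine intervalIntegral.tendsto_integral_filter_of_dominated_convergence
      (fun x => |φ x| * ∫ τ in (0 : ℝ)..(2 * Real.pi), B τ) ?_ ?_
      ((cφ.abs.mul continuous_const).intervalIntegrable _ _) ?_
    · filter_upwards [hpos] with η hη
      exact (cφ.mul (intervalIntegral.continuous_parametric_intervalIntegral_of_continuous'
        (continuous_selfKernel hR hη) _ _)).aestronglyMeasurable
    · filter_upwards [hpos] with η hη
      refine Eventually.of_forall fun x _ => ?_
      rw [norm_mul, Real.norm_eq_abs, hsub]
      refine mul_le_mul_of_nonneg_left ?_ (abs_nonneg _)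
      refine intervalIntegral.norm_integral_le_of_norm_le (by positivity) ?_ hBint
      filter_upwards [hae] with τ h hτ
      rw [← uIoc_of_le (by positivity)] at hτ
      exact hbound η hη.le x τ (h hτ)
    · refine Eventually.of_forall fun x _ => ?_
      simp only [hsub]
      exact (hinner x).const_mul (φ x)
  have hzero : Tendsto (fun η => ∫ x in (0 : ℝ)..(2 * Real.pi), φ x *
      ∫ y in (0 : ℝ)..(2 * Real.pi), selfKernel α R η x y) (𝓝[>] 0) (𝓝 0) := by
    refine tendsto_const_nhds.congr' ?_
    filter_upwards [hpos] with η hη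
    exact (integral_energy_selfKernel_regularized hα hR hη A Ω U₁ U₂).symm
  have h0 := tendsto_nhds_unique hlim hzero
  have e : ∀ x, φ x * mean (selfKernel α R 0 x) = (1 / (2 * Real.pi)) * (φ x *
      ∫ y in (0 : ℝ)..(2 * Real.pi), selfKernel α R 0 x y) := by
    intro x; unfold mean; ring
  calc ∫ x in (0 : ℝ)..(2 * Real.pi), φ x * mean (selfKernel α R 0 x)
      = ∫ x in (0 : ℝ)..(2 * Real.pi), (1 / (2 * Real.pi)) * (φ x *
        ∫ y in (0 : ℝ)..(2 * Real.pi), selfKernel α R 0 x y) := by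
        congr 1; funext x; exact e x
    _ = 0 := by rw [intervalIntegral.integral_const_mul, h0, mul_zero]

end Self

end Polar

end
end GSQG

namespace GSQG
noncomputable section
open scoped BoundedContinuousFunction
open Wiener Profile

/-! ### Conservation laws of the functional -/

theorem norm_value_sub_shift_le {m m' : ℕ} {c : Wiener m} {d : Wiener m'}
    (h : ∀ n, d.coeff n = Complex.I * n * c.coeff n) (x : ℝ) {τ : ℝ}
    (hτ : τ ∈ Ioo 0 (2 * Real.pi)) :
    ‖c.value x - c.value (x - τ)‖ ≤ 2 * Real.sin (τ / 2) * ‖d‖ := by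
  have hs := sin_half_pos hτ
  have e : c.value x - c.value (x - τ) = ∑' n : ℤ, c.coeff n *
      Complex.exp (Complex.I * n * x) * (1 - Complex.exp (-(Complex.I * n * τ))) := by
    rw [value, value, ← (c.summable_value x).tsum_sub (c.summable_value (x - τ))]
    refine tsum_congr fun n => ?_
    rw [mul_sub, mul_one, mul_assoc _ _ (Complex.exp (-_)), ← Complex.exp_add]
    congr 3
    push_cast; ring
  have hle : ∀ n : ℤ, ‖c.coeff n * Complex.exp (Complex.I * n * x) *
      (1 - Complex.exp (-(Complex.I * n * τ)))‖ ≤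
      2 * Real.sin (τ / 2) * (wienerWeight m' n * ‖d.coeff n‖) := by
    intro n
    have h1 := abs_sin_nat_mul_le n.natAbs (τ / 2)
    rw [abs_of_pos hs, ← mul_div_assoc] at h1
    have hw := one_le_wienerWeight m' n
    rw [norm_mul, norm_mul, norm_exp_I, mul_one, norm_one_sub_exp, h, norm_mul, norm_I_mul_int]
    calc ‖c.coeff n‖ * (2 * |Real.sin (n.natAbs * τ / 2)|)
        ≤ ‖c.coeff n‖ * (2 * (n.natAbs * Real.sin (τ / 2))) := by gcongr
      _ = 1 * (2 * Real.sin (τ / 2) * (n.natAbs * ‖c.coeff n‖)) := by ring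
      _ ≤ wienerWeight m' n * (2 * Real.sin (τ / 2) * (n.natAbs * ‖c.coeff n‖)) := by gcongr
      _ = _ := by ring
  rw [e, norm_def, ← tsum_mul_left]
  have hsum := d.summable.mul_left (2 * Real.sin (τ / 2))
  have hsn := hsum.of_nonneg_of_le (fun n => norm_nonneg _) hle
  exact (norm_tsum_le_tsum_norm hsn).trans (hsn.tsum_le_tsum hle hsum)

section Rad

variable {α : ℝ} (hα : α ∈ Ioo (1 : ℝ) 2) {m : ℕ}

theorem polarRadius_radR (hα : α ∈ Ioo (1 : ℝ) 2) (m : ℕ) (s : ℝ) (a : Profile) :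
    PolarRadius (radR α m s a) where
  hasDerivAt x := by rw [deriv_radR hα]; exact hasDerivAt_radR hα m s a x
  continuous_deriv := by
    rw [show deriv (radR α m s a) = fun x => s * deriv (fnR α m a) x from
      funext (deriv_radR hα m s a)]
    exact continuous_const.mul (continuous_deriv_fnR hα.1.le a)
  periodic := radR_periodic hα m s a
  periodic_deriv x := by rw [deriv_radR hα, deriv_radR hα, deriv_fnR_periodic hα.1.le a x]

theorem abs_fnR_le (hα : α ∈ Ioo (1 : ℝ) 2) (m : ℕ) (a : Profile) (x : ℝ) :
    |fnR α m a x| ≤ ‖fn hα.1.le m a‖ := by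
  have := norm_value_le (fn hα.1.le m a) x
  rwa [value_fn, Complex.norm_real] at this

theorem abs_deriv_fnR_le (hα : α ∈ Ioo (1 : ℝ) 2) (m : ℕ) (a : Profile) (x : ℝ) :
    |deriv (fnR α m a) x| ≤ ‖dfn hα.1.le m a‖ := by
  have := norm_value_le (dfn hα.1.le m a) x
  rwa [value_dfn, Complex.norm_real] at this

theorem abs_fnR_sub_le (hα : α ∈ Ioo (1 : ℝ) 2) (m : ℕ) (a : Profile) (x : ℝ) {τ : ℝ}
    (hτ : τ ∈ Ioo 0 (2 * Real.pi)) : |fnR α m a x - fnR α m a (x - τ)| ≤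
      2 * Real.sin (τ / 2) * ‖dfn hα.1.le m a‖ := by
  have := norm_value_sub_shift_le (c := fn hα.1.le m a) (d := dfn hα.1.le m a)
    (fun n => by rw [coeff_dfn, coeff_fn]) x hτ
  rwa [value_fn, value_fn, ← Complex.ofReal_sub, Complex.norm_real] at this

theorem abs_deriv_fnR_sub_le (hα : α ∈ Ioo (1 : ℝ) 2) (hm : 1 ≤ m) (a : Profile) (x : ℝ) {τ : ℝ}
    (hτ : τ ∈ Ioo 0 (2 * Real.pi)) : |deriv (fnR α m a) x - deriv (fnR α m a) (x - τ)| ≤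
      2 * Real.sin (τ / 2) * ‖ddfn hα.1.le hm a‖ := by
  have := norm_value_sub_shift_le (c := dfn hα.1.le m a) (d := ddfn hα.1.le hm a)
    (fun n => by rw [coeff_ddfn, coeff_dfn]; ring) x hτ
  rwa [value_dfn, value_dfn, ← Complex.ofReal_sub, Complex.norm_real] at this

/-- The cross term of a curve with itself vanishes on the diagonal, and its Lipschitz constant
involves the second derivative of the radius. Hence `1 ≤ m`. -/
theorem exists_crossTerm_bound (hα : α ∈ Ioo (1 : ℝ) 2) (hm : 1 ≤ m) (s : ℝ) (a : Profile) :
    ∃ C, ∀ x, ∀ τ ∈ Ioo 0 (2 * Real.pi),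
      |crossTerm (radR α m s a) (radR α m s a) x (x - τ)| ≤ C * (2 * Real.sin (τ / 2)) := by
  set M₀ := 1 + |s| * ‖fn hα.1.le m a‖ with hM0
  set M₁ := |s| * ‖dfn hα.1.le m a‖ with hM1
  set M₂ := |s| * ‖ddfn hα.1.le hm a‖ with hM2
  have p0 : 0 ≤ M₀ := by positivity
  have p1 : 0 ≤ M₁ := by positivity
  refine ⟨M₀ * M₀ + M₁ * M₁ + (M₀ * M₂ + M₁ * M₁), fun x τ hτ => ?_⟩
  have hs := sin_half_pos hτ
  have b0 : ∀ y, |radR α m s a y| ≤ M₀ := by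
    intro y
    rw [radR]
    refine (abs_add_le _ _).trans ?_
    rw [abs_one, abs_mul]
    exact add_le_add_right (mul_le_mul_of_nonneg_left (abs_fnR_le hα m a y) (abs_nonneg _)) _
  have b1 : ∀ y, |deriv (radR α m s a) y| ≤ M₁ := by
    intro y
    rw [deriv_radR hα, abs_mul]
    exact mul_le_mul_of_nonneg_left (abs_deriv_fnR_le hα m a y) (abs_nonneg _)
  have d0 : |radR α m s a x - radR α m s a (x - τ)| ≤ M₁ * (2 * Real.sin (τ / 2)) := by
    rw [radR, radR, add_sub_add_left_eq_sub, ← mul_sub, abs_mul]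
    refine (mul_le_mul_of_nonneg_left (abs_fnR_sub_le hα m a x hτ) (abs_nonneg s)).trans_eq ?_
    rw [hM1]; ring
  have d1 : |deriv (radR α m s a) x - deriv (radR α m s a) (x - τ)| ≤
      M₂ * (2 * Real.sin (τ / 2)) := by
    rw [deriv_radR hα, deriv_radR hα, ← mul_sub, abs_mul]
    refine (mul_le_mul_of_nonneg_left (abs_deriv_fnR_sub_le hα hm a x hτ)
      (abs_nonneg s)).trans_eq ?_
    rw [hM2]; ring
  have hsin := abs_sin_le_two_mul_sin_half hτ
  have hcos := Real.abs_cos_le_one τ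
  set R := radR α m s a
  have e : crossTerm R R x (x - τ) = (R x * R (x - τ) + deriv R x * deriv R (x - τ)) * Real.sin τ +
      (R x * -(deriv R x - deriv R (x - τ)) + deriv R x * (R x - R (x - τ))) * Real.cos τ := by
    rw [crossTerm, sub_sub_cancel]; ring
  rw [e]
  have t1 : |(R x * R (x - τ) + deriv R x * deriv R (x - τ)) * Real.sin τ| ≤
      (M₀ * M₀ + M₁ * M₁) * (2 * Real.sin (τ / 2)) := by
    rw [abs_mul]
    refine mul_le_mul ?_ hsin (abs_nonneg _) (by positivity)
    refine (abs_add_le _ _).trans ?_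
    rw [abs_mul, abs_mul]
    exact add_le_add (mul_le_mul (b0 _) (b0 _) (abs_nonneg _) p0)
      (mul_le_mul (b1 _) (b1 _) (abs_nonneg _) p1)
  have t2 : |(R x * -(deriv R x - deriv R (x - τ)) + deriv R x * (R x - R (x - τ))) *
      Real.cos τ| ≤ (M₀ * (M₂ * (2 * Real.sin (τ / 2))) + M₁ * (M₁ * (2 * Real.sin (τ / 2)))) := by
    rw [abs_mul]
    refine (mul_le_of_le_one_right (abs_nonneg _) hcos).trans ((abs_add_le _ _).trans ?_)
    rw [abs_mul, abs_mul, abs_neg]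
    exact add_le_add (mul_le_mul (b0 _) d1 (abs_nonneg _) p0)
      (mul_le_mul (b1 _) d0 (abs_nonneg _) p1)
  refine (abs_add_le _ _).trans ((add_le_add t1 t2).trans_eq ?_)
  ring

theorem le_chordSq_radR {s : ℝ} {a : Profile} (x : ℝ) {τ : ℝ} (hτ : τ ∈ Ioo 0 (2 * Real.pi)) :
    (1 - ‖s • selfPert hα m s a‖) * (4 * Real.sin (τ / 2) ^ 2) ≤
      chordSq (radR α m s a) x (x - τ) := by
  have hsin := sin_half_pos hτ
  have hD : chordSq (radR α m s a) x (x - τ) =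
      (1 + s * selfPertR α m s a x τ) * (4 * Real.sin (τ / 2) ^ 2) := by
    have hs' := hsin.ne'
    rw [chordSq, sub_sub_cancel, radR, radR, selfPertR, mul_pow, inv_pow]
    field_simp
    ring
  have h := norm_evalFamily_le ⟨τ, hτ⟩ x (s • selfPert hα m s a)
  rw [eval_smul_selfPert, Complex.norm_real, Real.norm_eq_abs] at h
  rw [hD]
  have := (abs_le.1 h).1
  exact mul_le_mul_of_nonneg_right (by simp only at this; linarith) (by positivity)

/-- If the two points coincided, the relative perturbation of the squared distance of the centres
would be `-1`, whereas its modulus is less than one. The norm controls only `y ∈ (0, 2π)`;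
continuity and periodicity give all `y`, and keeping the bound by the norm preserves strictness in
the limit. -/
theorem PairSmall.ne {b b' ε : ℝ} {w w' : ℂ} {s s' : ℝ} {a a' : Profile}
    (hs : PairSmall b b' ε (w - w') (loop hα m s a) (loop hα m s' a')) (x y : ℝ) :
    w + ((ε * b * radR α m s a x : ℝ) : ℂ) * unitVec x ≠
      w' + ((ε * b' * radR α m s' a' y : ℝ) : ℂ) * unitVec y := by
  obtain ⟨hd, hlt⟩ := hs
  set d := w - w' with hdd
  set ρ := d.re ^ 2 + d.im ^ 2 with hρ
  have hρ0 : 0 < ρ := re_sq_add_im_sq_pos hd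
  set K := ‖(ε / ρ) • pairPert b b' ε d (loop hα m s a) (loop hα m s' a')‖ with hK
  have cS := (polarRadius_radR hα m s' a').continuous
  have hcont : Continuous fun y => |ε / ρ * pairPertR b b' ε d (radR α m s a) (radR α m s' a') x y| := by
    unfold pairPertR
    fun_prop
  have h1 : ∀ y ∈ Ioo 0 (2 * Real.pi),
      |ε / ρ * pairPertR b b' ε d (radR α m s a) (radR α m s' a') x y| ≤ K := by
    intro y hy
    have h := norm_evalFamily_le ⟨y, hy⟩ x ((ε / ρ) • pairPert b b' ε d (loop hα m s a)
      (loop hα m s' a'))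
    rw [map_smul, eval_pairPert hα, Complex.real_smul, ← Complex.ofReal_mul, Complex.norm_real] at h
    exact h
  have h2 : ∀ y ∈ Icc 0 (2 * Real.pi),
      |ε / ρ * pairPertR b b' ε d (radR α m s a) (radR α m s' a') x y| ≤ K := by
    intro y hy
    rw [← closure_Ioo (by positivity)] at hy
    exact closure_minimal h1 (isClosed_le hcont continuous_const) hy
  have hper : Function.Periodic
      (fun y => |ε / ρ * pairPertR b b' ε d (radR α m s a) (radR α m s' a') x y|)
      (2 * Real.pi) := by
    intro y
    simp only [pairPertR, radR_periodic hα m s' a' y, Real.cos_add_two_pi, Real.sin_add_two_pi]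
  obtain ⟨y', hy', e⟩ := hper.exists_mem_Ico₀ (by positivity) y
  have h3 : |ε / ρ * pairPertR b b' ε d (radR α m s a) (radR α m s' a') x y| < 1 := by
    rw [e]
    exact (h2 y' ⟨hy'.1, hy'.2.le⟩).trans_lt hlt
  intro heq
  have h4 := norm_sub_sq_eq b b' ε w w' (radR α m s a) (radR α m s' a') x y
  rw [heq, sub_self, norm_zero, ← hdd, ← hρ] at h4
  have h5 : ε / ρ * pairPertR b b' ε d (radR α m s a) (radR α m s' a') x y = -1 := by
    field_simp
    linarith
  rw [h5] at h3
  norm_num at h3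

end Rad

section Total

variable {α : ℝ} {m N : ℕ} {b : Fin N → ℝ}

/-- The rigid part of the functional is the derivative of the energy along the patch boundary. -/
theorem hasDerivAt_curveEnergy {R : ℝ → ℝ} (hR : PolarRadius R) (Ω U : ℝ) (w : ℂ) (c x : ℝ) :
    HasDerivAt (curveEnergy Ω U 0 w c R)
      (c * (Ω * (c * R x * deriv R x + inner ℝ w (((deriv R x : ℝ) : ℂ) * unitVec x +
        (R x : ℂ) * (Complex.I * unitVec x))) + inner ℝ (U : ℂ) (((deriv R x : ℝ) : ℂ) * unitVec x +
        (R x : ℂ) * (Complex.I * unitVec x)))) x := by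
  have h1 := (closedCurve_polar hR w c).hasDerivAt_fst x
  have h2 := (closedCurve_polar hR w c).hasDerivAt_snd x
  have h := (((((h1.pow 2).add (h2.pow 2)).const_mul Ω).div_const 2).add (h1.const_mul U)).add
    (h2.const_mul 0)
  refine h.congr_deriv ?_
  simp only [Complex.inner, unitVec, Complex.mul_re, Complex.mul_im, Complex.add_re, Complex.add_im,
    Complex.I_re, Complex.I_im, Complex.ofReal_re, Complex.ofReal_im, Complex.conj_re,
    Complex.conj_im]
  push_cast
  linear_combination (Ω * c ^ 2 * R x * deriv R x) * Real.sin_sq_add_cos_sq x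

variable (hα : α ∈ Ioo (1 : ℝ) 2)

theorem integral_mul_hasDerivAt {E E' : ℝ → ℝ} (h : ∀ x, HasDerivAt E (E' x) x)
    (hc : Continuous E') (hp : E (2 * Real.pi) = E 0) :
    ∫ x in (0 : ℝ)..(2 * Real.pi), E x * E' x = 0 := by
  have hE : Continuous E := continuous_iff_continuousAt.2 fun x => (h x).continuousAt
  have h2 : ∀ x, HasDerivAt (fun x => E x ^ 2 / 2) (E x * E' x) x := fun x =>
    (((h x).pow 2).div_const 2).congr_deriv (by push_cast; ring)
  rw [intervalIntegral.integral_eq_sub_of_hasDerivAt (fun x _ => h2 x)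
    ((hE.mul hc).intervalIntegrable _ _), hp, sub_self]

theorem continuous_of_value {c : Wiener m} {g : ℝ → ℝ} (h : ∀ x, c.value x = (g x : ℂ)) :
    Continuous g := by
  have : g = fun x => (c.value x).re := by funext x; rw [h, Complex.ofReal_re]
  rw [this]
  exact Complex.continuous_re.comp (continuous_value c)

variable (b) in
/-- The radius of a patch. -/
def patchRadius (α : ℝ) (m : ℕ) (ε : ℝ) (a : Fin N → Profile) (i : Fin N) : ℝ → ℝ :=
  radR α m (coreSize α (b i) ε) (a i)

variable (b) in
/-- The energy along the boundary of a patch. -/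
def patchEnergy (α : ℝ) (m : ℕ) (ε : ℝ) (a : Fin N → Profile) (l : Params N) (i : Fin N) : ℝ → ℝ :=
  curveEnergy l.angularVelocity l.speed 0 (l.pos i) (ε * b i) (patchRadius b α m ε a i)

variable (b) in
/-- The mean interaction of two patches. -/
def patchPair (α : ℝ) (m : ℕ) (ε : ℝ) (a : Fin N → Profile) (l : Params N) (i j : Fin N)
    (x : ℝ) : ℝ :=
  mean (pairKernel α (l.pos i) (l.pos j) (ε * b i) (ε * b j) (patchRadius b α m ε a i)
    (patchRadius b α m ε a j) x)

theorem polarRadius_patchRadius (hα : α ∈ Ioo (1 : ℝ) 2) (m : ℕ) (ε : ℝ) (a : Fin N → Profile)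
    (i : Fin N) : PolarRadius (patchRadius b α m ε a i) :=
  polarRadius_radR hα m _ _

variable {ε : ℝ} {a : Fin N → Profile} {l : Params N}

theorem continuous_patchPair (hs : TotalSmall hα m b ε a l) {i j : Fin N} (hij : j ≠ i) :
    Continuous (patchPair b α m ε a l i j) := by
  refine continuous_of_value (c := ε • pairMap α (b i) (b j) ε (l.pos i - l.pos j)
    (loop hα m (coreSize α (b i) ε) (a i)) (loop hα m (coreSize α (b j) ε) (a j))) fun x => ?_
  rw [value_smul, ← mean_interaction hα ((hs i).2 j hij) x]
  rfl

theorem selfKernel_zero (α : ℝ) (R : ℝ → ℝ) (x : ℝ) : selfKernel α R 0 x = fun y =>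
    crossTerm R R x y /
      ((R x - R y) ^ 2 + 4 * R x * R y * Real.sin ((x - y) / 2) ^ 2) ^ (α / 2) := by
  funext y
  rw [selfKernel, add_zero, chordSq]

theorem continuous_mean_selfKernel (hs : TotalSmall hα m b ε a l) (i : Fin N) :
    Continuous fun x => mean (selfKernel α (patchRadius b α m ε a i) 0 x) := by
  refine continuous_of_value (c := coreSize α (b i) ε • selfMap hα m (coreSize α (b i) ε) (a i))
    fun x => ?_
  rw [value_smul, ← mean_selfTerm hα m (hs i).1 x (R := radR α m (coreSize α (b i) ε) (a i))
      fun _ => rfl]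
  rw [selfKernel_zero]
  rfl

theorem exists_rigidTerm (hα : α ∈ Ioo (1 : ℝ) 2) (m : ℕ) (ε : ℝ) (a : Fin N → Profile)
    (l : Params N) (i : Fin N) :
    (∀ x, HasDerivAt (patchEnergy b α m ε a l i)
      (ε * b i * rigidTerm α b ε (fun j => fnR α m (a j)) l i x) x) ∧
    Continuous (rigidTerm α b ε (fun j => fnR α m (a j)) l i) := by
  refine ⟨fun x => hasDerivAt_curveEnergy (polarRadius_patchRadius hα m ε a i) _ _ _ _ x, ?_⟩
  refine continuous_of_value (c := rigidMap hα m (b i) ε (l.pos i) l.angularVelocity l.speed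
    (coreSize α (b i) ε) (a i)) fun x => ?_
  rw [value_rigidMap]
  rfl

theorem patchEnergy_closed (hα : α ∈ Ioo (1 : ℝ) 2) (m : ℕ) (ε : ℝ) (a : Fin N → Profile)
    (l : Params N) (i : Fin N) :
    patchEnergy b α m ε a l i (2 * Real.pi) = patchEnergy b α m ε a l i 0 := by
  have := (polarRadius_patchRadius (b := b) hα m ε a i).periodic 0
  rw [zero_add] at this
  simp [patchEnergy, curveEnergy, this]

theorem contourFunctional_eq (hε : ε ≠ 0) (i : Fin N) (x : ℝ) :
    contourFunctional α b ε (fun j => fnR α m (a j)) l i x =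
      rigidTerm α b ε (fun j => fnR α m (a j)) l i x +
      kernelConst α * l.strength i / coreSize α (b i) ε *
        mean (selfKernel α (patchRadius b α m ε a i) 0 x) +
      ∑ j ∈ Finset.univ.erase i, kernelConst α * l.strength j / (ε * b j) *
        patchPair b α m ε a l i j x := by
  rw [contourFunctional, if_neg hε]
  rw [selfKernel_zero]
  rfl

/-- Integrals of the functional against a continuous function. -/
theorem integral_mul_contourFunctional (hε : ε ≠ 0) (hs : TotalSmall hα m b ε a l) (i : Fin N)
    {φ : ℝ → ℝ} (hφ : Continuous φ) :
    ∫ x in (0 : ℝ)..(2 * Real.pi), φ x * contourFunctional α b ε (fun j => fnR α m (a j)) l i x =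
      (∫ x in (0 : ℝ)..(2 * Real.pi), φ x * rigidTerm α b ε (fun j => fnR α m (a j)) l i x) +
      kernelConst α * l.strength i / coreSize α (b i) ε *
        (∫ x in (0 : ℝ)..(2 * Real.pi), φ x * mean (selfKernel α (patchRadius b α m ε a i) 0 x)) +
      ∑ j ∈ Finset.univ.erase i, kernelConst α * l.strength j / (ε * b j) *
        ∫ x in (0 : ℝ)..(2 * Real.pi), φ x * patchPair b α m ε a l i j x := by
  have c1 : Continuous fun x => φ x * rigidTerm α b ε (fun j => fnR α m (a j)) l i x :=
    hφ.mul (exists_rigidTerm (b := b) hα m ε a l i).2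
  have c2 : Continuous fun x => φ x * mean (selfKernel α (patchRadius b α m ε a i) 0 x) :=
    hφ.mul (continuous_mean_selfKernel hα hs i)
  have c3 : ∀ j ∈ Finset.univ.erase i, Continuous fun x => φ x * patchPair b α m ε a l i j x :=
    fun j hj => hφ.mul (continuous_patchPair hα hs (Finset.ne_of_mem_erase hj))
  have e : ∀ x, φ x * contourFunctional α b ε (fun j => fnR α m (a j)) l i x =
      φ x * rigidTerm α b ε (fun j => fnR α m (a j)) l i x +
      kernelConst α * l.strength i / coreSize α (b i) ε *
        (φ x * mean (selfKernel α (patchRadius b α m ε a i) 0 x)) +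
      ∑ j ∈ Finset.univ.erase i, kernelConst α * l.strength j / (ε * b j) *
        (φ x * patchPair b α m ε a l i j x) := by
    intro x
    rw [contourFunctional_eq hε, mul_add, mul_add, Finset.mul_sum]
    congr 1
    · ring
    · exact Finset.sum_congr rfl fun j _ => by ring
  simp only [e]
  have i2 : Continuous fun x => kernelConst α * l.strength i / coreSize α (b i) ε *
      (φ x * mean (selfKernel α (patchRadius b α m ε a i) 0 x)) := continuous_const.mul c2
  have i12 : Continuous fun x => φ x * rigidTerm α b ε (fun j => fnR α m (a j)) l i x +
      kernelConst α * l.strength i / coreSize α (b i) ε *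
      (φ x * mean (selfKernel α (patchRadius b α m ε a i) 0 x)) := c1.add i2
  have i4 : Continuous fun x => ∑ j ∈ Finset.univ.erase i,
      kernelConst α * l.strength j / (ε * b j) * (φ x * patchPair b α m ε a l i j x) :=
    continuous_finsetSum _ fun j hj => continuous_const.mul (c3 j hj)
  have i3 : ∀ j ∈ Finset.univ.erase i, IntervalIntegrable (fun x =>
      kernelConst α * l.strength j / (ε * b j) * (φ x * patchPair b α m ε a l i j x))
      MeasureTheory.volume 0 (2 * Real.pi) := fun j hj =>
    (continuous_const.mul (c3 j hj)).intervalIntegrable _ _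
  rw [intervalIntegral.integral_add (i12.intervalIntegrable _ _)
    (i4.intervalIntegrable _ _),
    intervalIntegral.integral_add (c1.intervalIntegrable _ _) (i2.intervalIntegrable _ _),
    intervalIntegral.integral_const_mul, intervalIntegral.integral_finsetSum i3]
  simp only [intervalIntegral.integral_const_mul]

/-- The self-kernel refers to the curve centred at the origin and of size one. Expanding the energy
about the centre expresses it by an energy of that curve with other coefficients, plus a constant.
-/
theorem patchEnergy_eq (i : Fin N) (x : ℝ) :
    patchEnergy b α m ε a l i x =
      (l.angularVelocity * ((l.pos i).re ^ 2 + (l.pos i).im ^ 2) / 2 + l.speed * (l.pos i).re) +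
      curveEnergy (l.angularVelocity * (ε * b i) ^ 2)
        (ε * b i * (l.angularVelocity * (l.pos i).re + l.speed))
        (ε * b i * (l.angularVelocity * (l.pos i).im)) 0 1 (patchRadius b α m ε a i) x := by
  simp only [patchEnergy, curveEnergy, Complex.zero_re, Complex.zero_im]
  ring

theorem integral_energy_self (hm : 1 ≤ m) (hs : TotalSmall hα m b ε a l) (i : Fin N)
    (A Ω U₁ U₂ : ℝ) :
    ∫ x in (0 : ℝ)..(2 * Real.pi), (A + curveEnergy Ω U₁ U₂ 0 1 (patchRadius b α m ε a i) x) *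
      mean (selfKernel α (patchRadius b α m ε a i) 0 x) = 0 := by
  obtain ⟨C, hC⟩ := exists_crossTerm_bound hα hm (coreSize α (b i) ε) (a i)
  exact integral_energy_mean_selfKernel hα (polarRadius_patchRadius hα m ε a i)
    (sub_pos.2 (hs i).1) hC (fun x τ hτ => le_chordSq_radR hα x hτ) A Ω U₁ U₂

theorem patch_ne (hs : TotalSmall hα m b ε a l) {i j : Fin N} (hij : j ≠ i) (x y : ℝ) :
    l.pos i + ((ε * b i * patchRadius b α m ε a i x : ℝ) : ℂ) * unitVec x ≠
      l.pos j + ((ε * b j * patchRadius b α m ε a j y : ℝ) : ℂ) * unitVec y :=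
  ((hs i).2 j hij).ne hα x y

/-- The functional has mean value zero. -/
theorem integral_contourFunctional (hm : 1 ≤ m) (hb : ∀ i, 0 < b i) (hε : ε ≠ 0)
    (hs : TotalSmall hα m b ε a l) (i : Fin N) :
    ∫ x in (0 : ℝ)..(2 * Real.pi), contourFunctional α b ε (fun j => fnR α m (a j)) l i x = 0 := by
  have h := integral_mul_contourFunctional hα hε hs i (continuous_const (y := (1 : ℝ)))
  simp only [one_mul] at h
  have hR := polarRadius_patchRadius (b := b) hα m ε a
  have h1 : ∫ x in (0 : ℝ)..(2 * Real.pi), rigidTerm α b ε (fun j => fnR α m (a j)) l i x = 0 := by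
    obtain ⟨d, c⟩ := exists_rigidTerm (b := b) hα m ε a l i
    have := intervalIntegral.integral_eq_sub_of_hasDerivAt (a := 0) (b := 2 * Real.pi)
      (fun x _ => d x) ((continuous_const.mul c).intervalIntegrable _ _)
    rw [patchEnergy_closed hα, sub_self, intervalIntegral.integral_const_mul] at this
    exact (mul_eq_zero.1 this).resolve_left (mul_ne_zero hε (hb i).ne')
  have h2 : ∫ x in (0 : ℝ)..(2 * Real.pi), mean (selfKernel α (patchRadius b α m ε a i) 0 x) = 0 := by
    have := integral_energy_self hα hm hs i 1 0 0 0
    simpa [curveEnergy] using this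
  have h3 : ∀ j ∈ Finset.univ.erase i,
      ∫ x in (0 : ℝ)..(2 * Real.pi), patchPair b α m ε a l i j x = 0 := by
    intro j hj
    have := integral_pairKernel (patch_ne hα hs (Finset.ne_of_mem_erase hj)) hα (hR i) (hR j)
      (mul_ne_zero hε (hb i).ne') (mul_ne_zero hε (hb j).ne')
    simp only [patchPair, mean, intervalIntegral.integral_const_mul]
    rw [this, mul_zero]
  rw [h, h1, h2, Finset.sum_eq_zero fun j hj => by rw [h3 j hj, mul_zero]]
  simp

/-- The conservation of the total energy. -/
theorem sum_integral_energy_contourFunctional (hm : 1 ≤ m) (hb : ∀ i, 0 < b i) (hε : ε ≠ 0)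
    (hs : TotalSmall hα m b ε a l) :
    ∑ i, l.strength i / b i * ∫ x in (0 : ℝ)..(2 * Real.pi), patchEnergy b α m ε a l i x *
      contourFunctional α b ε (fun j => fnR α m (a j)) l i x = 0 := by
  have hR := polarRadius_patchRadius (b := b) hα m ε a
  have h : ∀ i, ∫ x in (0 : ℝ)..(2 * Real.pi), patchEnergy b α m ε a l i x *
      contourFunctional α b ε (fun j => fnR α m (a j)) l i x =
      ∑ j ∈ Finset.univ.erase i, kernelConst α * l.strength j / (ε * b j) *
        ∫ x in (0 : ℝ)..(2 * Real.pi), patchEnergy b α m ε a l i x *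
          patchPair b α m ε a l i j x := by
    intro i
    have cE : Continuous (patchEnergy b α m ε a l i) := continuous_curveEnergy (hR i) _ _ _ _ _
    rw [integral_mul_contourFunctional hα hε hs i cE]
    obtain ⟨d, c⟩ := exists_rigidTerm (b := b) hα m ε a l i
    -- Up to the factor `ε b_i` the rigid term is the derivative of the energy, so the integrand is
    -- a multiple of the derivative of its square.
    have h1 : ∫ x in (0 : ℝ)..(2 * Real.pi), patchEnergy b α m ε a l i x *
        rigidTerm α b ε (fun j => fnR α m (a j)) l i x = 0 := by
      have := integral_mul_hasDerivAt d (continuous_const.mul c) (patchEnergy_closed hα m ε a l i)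
      simp only [mul_left_comm _ (ε * b i), intervalIntegral.integral_const_mul] at this
      exact (mul_eq_zero.1 this).resolve_left (mul_ne_zero hε (hb i).ne')
    have h2 : ∫ x in (0 : ℝ)..(2 * Real.pi), patchEnergy b α m ε a l i x *
        mean (selfKernel α (patchRadius b α m ε a i) 0 x) = 0 := by
      simp only [patchEnergy_eq]
      exact integral_energy_self hα hm hs i _ _ _ _
    rw [h1, h2, mul_zero, zero_add, zero_add]
  have hanti : ∀ i j, i ≠ j → ∫ x in (0 : ℝ)..(2 * Real.pi), patchEnergy b α m ε a l i x *
      patchPair b α m ε a l i j x = -∫ x in (0 : ℝ)..(2 * Real.pi), patchEnergy b α m ε a l j x *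
      patchPair b α m ε a l j i x := fun i j hij =>
    integral_energy_mean_pairKernel (patch_ne hα hs hij.symm) hα (hR i) (hR j)
      (mul_ne_zero hε (hb i).ne') (mul_ne_zero hε (hb j).ne') _ _ _
  -- The weighted work of patch `j` on patch `i`. The weight `γ_i / b_i` makes the coefficient
  -- symmetric in `i` and `j`, so `T` is antisymmetric and its total vanishes.
  set T : Fin N → Fin N → ℝ := fun i j => if i = j then 0 else
    l.strength i / b i * (kernelConst α * l.strength j / (ε * b j) *
      ∫ x in (0 : ℝ)..(2 * Real.pi), patchEnergy b α m ε a l i x *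
        patchPair b α m ε a l i j x) with hT
  have hTs : ∀ i j, T i j = -T j i := by
    intro i j
    by_cases hij : i = j
    · simp [hT, hij]
    · simp only [hT, if_neg hij, if_neg (Ne.symm hij)]
      rw [hanti i j hij]
      ring
  have e : ∑ i, l.strength i / b i * ∫ x in (0 : ℝ)..(2 * Real.pi), patchEnergy b α m ε a l i x *
      contourFunctional α b ε (fun j => fnR α m (a j)) l i x = ∑ i, ∑ j, T i j := by
    refine Finset.sum_congr rfl fun i _ => ?_
    rw [h i, Finset.mul_sum, ← Finset.add_sum_erase _ _ (Finset.mem_univ i)]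
    rw [show T i i = 0 by simp [hT], zero_add]
    refine Finset.sum_congr rfl fun j hj => ?_
    simp only [hT, if_neg (Finset.ne_of_mem_erase hj).symm]
  rw [e]
  have h2 : ∑ i, ∑ j, T i j = -∑ i, ∑ j, T i j := by
    conv_lhs => rw [Finset.sum_comm]
    rw [← Finset.sum_neg_distrib]
    refine Finset.sum_congr rfl fun j _ => ?_
    rw [← Finset.sum_neg_distrib]
    exact Finset.sum_congr rfl fun i _ => hTs i j
  linarith

end Total

/-! ### The Lagrange multiplier -/

section Velocity

variable {α : ℝ} {N : ℕ}

/-- The velocity `Ω w_i + U`. -/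
def Params.velocity (l : Params N) (i : Fin N) : ℂ :=
  (l.angularVelocity : ℂ) * l.pos i + (l.speed : ℂ)

/-- The direction of the Lagrange multiplier. -/
def Params.multiplier (l : Params N) (i : Fin N) : ℂ :=
  l.strength i • (Complex.I * l.velocity i)

/-- The point vortex map is orthogonal to the infinitesimal motion. -/
theorem sum_inner_pointVortexMap (l : Params N) :
    ∑ i, inner ℝ (pointVortexMap α l i) (l.multiplier i) = 0 := by
  set κ := α * kernelConst α / 2 with hκ
  -- The sum `T i j + T j i` is a multiple of the inner product of `w_i - w_j` with `i` times the
  -- difference of the velocities. That difference is `Ω (w_i - w_j)`, so the product is zero.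
  set T : Fin N → Fin N → ℝ := fun i j => if i = j then 0 else
    -κ * l.strength i * (l.strength j / ‖l.pos i - l.pos j‖ ^ (α + 2)) *
      inner ℝ (l.pos i - l.pos j) (Complex.I * l.velocity i) with hT
  have hTs : ∑ i, ∑ j, T i j = -∑ i, ∑ j, T i j := by
    conv_lhs => rw [Finset.sum_comm]
    rw [← Finset.sum_neg_distrib]
    refine Finset.sum_congr rfl fun j _ => ?_
    rw [← Finset.sum_neg_distrib]
    refine Finset.sum_congr rfl fun i _ => ?_
    by_cases hij : i = j
    · simp [hT, hij]
    · simp only [hT, if_neg hij, if_neg (Ne.symm hij)]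
      rw [norm_sub_rev (l.pos j)]
      simp only [Complex.inner, Params.velocity, Complex.mul_re, Complex.mul_im, Complex.add_re,
        Complex.add_im, Complex.sub_re, Complex.sub_im, Complex.conj_re, Complex.conj_im,
        Complex.I_re, Complex.I_im, Complex.ofReal_re, Complex.ofReal_im]
      ring
  have e : ∀ i, inner ℝ (pointVortexMap α l i) (l.multiplier i) = ∑ j, T i j := by
    intro i
    have h0 : inner ℝ (l.velocity i) (Complex.I * l.velocity i) = 0 := by
      simp only [Complex.inner, Complex.mul_re, Complex.mul_im, Complex.conj_re, Complex.conj_im,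
        Complex.I_re, Complex.I_im]
      ring
    rw [← Finset.add_sum_erase _ _ (Finset.mem_univ i), show T i i = 0 by simp [hT], zero_add,
      show pointVortexMap α l i = l.velocity i - ∑ j ∈ Finset.univ.erase i,
        (κ * (l.strength j / ‖l.pos i - l.pos j‖ ^ (α + 2))) • (l.pos i - l.pos j) from ?_,
      Params.multiplier, inner_smul_right, inner_sub_left, h0, sum_inner, zero_sub, mul_neg,
      Finset.mul_sum, ← Finset.sum_neg_distrib]
    · refine Finset.sum_congr rfl fun j hj => ?_
      simp only [hT, if_neg (Finset.ne_of_mem_erase hj).symm]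
      rw [real_inner_smul_left]
      ring
    · rw [pointVortexMap, Params.velocity, Finset.mul_sum]
      congr 1
      refine Finset.sum_congr rfl fun j _ => ?_
      rw [Complex.real_smul, ← hκ]
      push_cast
      ring
  simp only [e]
  linarith

variable {lam : Params N} {S : Finset (Component N)}

theorem contDiff_multiplier_replace (lam : Params N) (S : Finset (Component N)) (i : Fin N) :
    ContDiff ℝ 1 fun μ : S → ℝ => (lam.replace S μ).multiplier i := by
  have h := fun c => (lam.contDiff_replace S c (n := 1))
  have hp : ContDiff ℝ 1 fun μ : S → ℝ => (lam.replace S μ).pos i :=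
    contDiff_iff_contDiffAt.2 fun μ => contDiffAt_pos (fun c => (h c).contDiffAt) i
  have hc : ∀ c, ContDiff ℝ 1 fun μ : S → ℝ => ((lam.replace S μ c : ℝ) : ℂ) := fun c =>
    Complex.ofRealCLM.contDiff.comp (h c)
  exact (h (Component.strength i)).smul (contDiff_const.mul
    (((hc Component.angularVelocity).mul hp).add (hc Component.speed)))

/-- The identity `sum_inner_pointVortexMap` is differentiated along a line of parameters. At an
equilibrium the derivative of the multiplier is paired with zero, so the range of `vortexDeriv` is
orthogonal to the multiplier. -/
theorem sum_inner_vortexDeriv (hα : α ∈ Ioo (1 : ℝ) 2) (heq : IsVortexEquilibrium α lam)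
    (h : S → ℝ) : ∑ i, inner ℝ (vortexDeriv α lam S h i) (lam.multiplier i) = 0 := by
  set γ : ℝ → S → ℝ := fun s => lam.first S + s • h with hγ
  have g1 : HasDerivAt γ h 0 := by
    have := ((hasDerivAt_id (0 : ℝ)).smul_const h).const_add (lam.first S)
    simpa [hγ] using this
  have e0 : γ 0 = lam.first S := by simp [hγ]
  have e1 : lam.replace S (γ 0) = lam := by rw [e0]; exact lam.replace_first S
  have hP : HasDerivAt (fun s => pointVortexMap α (lam.replace S (γ s))) (vortexDeriv α lam S h)
      0 := by
    have h1 := hasFDerivAt_pointVortexMap (S := S) hα heq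
    rw [← e0] at h1
    exact h1.comp_hasDerivAt (0 : ℝ) g1
  have hm : ∀ i, ∃ d, HasDerivAt (fun s => (lam.replace S (γ s)).multiplier i) d 0 := by
    intro i
    exact ⟨_, (((contDiff_multiplier_replace lam S i).differentiable one_ne_zero
      (γ 0)).hasFDerivAt.comp_hasDerivAt (0 : ℝ) g1)⟩
  choose d hd using hm
  have hsum : HasDerivAt (fun s => ∑ i, inner ℝ (pointVortexMap α (lam.replace S (γ s)) i)
      ((lam.replace S (γ s)).multiplier i))
      (∑ i, (inner ℝ (pointVortexMap α (lam.replace S (γ 0)) i) (d i) +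
        inner ℝ (vortexDeriv α lam S h i) ((lam.replace S (γ 0)).multiplier i))) 0 :=
    HasDerivAt.fun_sum fun i _ => (hasDerivAt_pi.1 hP i).inner ℝ (hd i)
  simp only [sum_inner_pointVortexMap, e1, heq.map_eq_zero, inner_zero_left, zero_add] at hsum
  exact hsum.unique (hasDerivAt_const _ _)

/-- A vector of the range is orthogonal to the multiplier; the multiplier cannot be orthogonal to
itself unless every velocity vanishes. -/
theorem multiplier_notMem_range (hα : α ∈ Ioo (1 : ℝ) 2) (heq : IsVortexEquilibrium α lam)
    (hv : ∃ i, lam.velocity i ≠ 0) : lam.multiplier ∉ (vortexDeriv α lam S).range := by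
  rintro ⟨h, hh⟩
  have h1 := sum_inner_vortexDeriv (S := S) hα heq h
  have h2 : ∀ i, vortexDeriv α lam S h i = lam.multiplier i := fun i => congrFun hh i
  simp only [h2, real_inner_self_eq_norm_sq] at h1
  obtain ⟨i, hi⟩ := hv
  have h3 := (Finset.sum_eq_zero_iff_of_nonneg fun i _ => by positivity).1 h1 i (Finset.mem_univ i)
  have h4 : lam.multiplier i ≠ 0 :=
    smul_ne_zero (heq.strength_ne_zero i) (mul_ne_zero Complex.I_ne_zero hi)
  exact h4 (norm_eq_zero.1 (pow_eq_zero_iff two_ne_zero |>.1 h3))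

end Velocity

section Multiplier

variable {α : ℝ} (hα : α ∈ Ioo (1 : ℝ) 2) (m : ℕ) {N : ℕ} (b : Fin N → ℝ)

/-- The energy along the boundary of a patch, up to a constant and a factor. -/
def energyElt (ε : ℝ) (a : Fin N → Profile) (l : Params N) (i : Fin N) : Wiener m :=
  (l.angularVelocity * ε * b i / 2) • ((1 + coreSize α (b i) ε • fn hα.1.le m (a i)) *
    (1 + coreSize α (b i) ε • fn hα.1.le m (a i))) +
  (l.angularVelocity * (l.pos i).re + l.speed) • (loop hα m (coreSize α (b i) ε) (a i)).1 +
  (l.angularVelocity * (l.pos i).im) • (loop hα m (coreSize α (b i) ε) (a i)).2.1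

/-- The constant part of the energy is dropped and the factor `ε b_i` divided out, so that
`energyElt` has a useful value at `ε = 0`. The pairing with the multiplier then depends continuously
on `ε` through zero. -/
theorem value_energyElt (ε : ℝ) (a : Fin N → Profile) (l : Params N) (i : Fin N) (x : ℝ) :
    ((ε * b i : ℝ) : ℂ) * (energyElt hα m b ε a l i).value x =
      ((patchEnergy b α m ε a l i x - (l.angularVelocity * ((l.pos i).re ^ 2 +
        (l.pos i).im ^ 2) / 2 + l.speed * (l.pos i).re) : ℝ) : ℂ) := by
  obtain ⟨h1, h2, -⟩ := value_loop hα m (coreSize α (b i) ε) (a i) x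
  have h3 : (1 + coreSize α (b i) ε • fn hα.1.le m (a i)).value x =
      ((patchRadius b α m ε a i x : ℝ) : ℂ) := by
    rw [value_add, value_one, value_smul, value_fn, patchRadius, radR]; push_cast; ring
  rw [energyElt, value_add, value_add, value_smul, value_smul, value_smul, value_mul, h1, h2, h3,
    patchEnergy_eq]
  simp only [curveEnergy, Complex.zero_re, Complex.zero_im, patchRadius]
  rw [← Complex.ofReal_mul, ← Complex.ofReal_mul, ← Complex.ofReal_mul, ← Complex.ofReal_mul,
    ← Complex.ofReal_add, ← Complex.ofReal_add, ← Complex.ofReal_mul]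
  congr 1
  linear_combination (-(l.angularVelocity * (ε * b i) ^ 2 *
    radR α m (coreSize α (b i) ε) (a i) x ^ 2 / 2)) * Real.sin_sq_add_cos_sq x

/-- The pairing of the energies with the multiplier. -/
def multiplierPairing (v : Fin N → ℂ) (ε : ℝ) (a : Fin N → Profile) (l : Params N) : ℝ :=
  ∑ i, l.strength i * ((energyElt hα m b ε a l i * perpElt m (v i)).coeff 0).re

variable {b}

/-- The coefficient of order zero of a product is its mean. The constant removed from the energy
does not matter because `⟨v_i, i e(x)⟩` has mean zero. -/
theorem two_pi_mul_multiplierPairing (hb : ∀ i, 0 < b i) (v : Fin N → ℂ) (ε : ℝ)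
    (a : Fin N → Profile) (l : Params N) :
    2 * Real.pi * (ε * multiplierPairing hα m b v ε a l) =
      ∑ i, l.strength i / b i * ∫ x in (0 : ℝ)..(2 * Real.pi), patchEnergy b α m ε a l i x *
        inner ℝ (v i) (Complex.I * unitVec x) := by
  rw [multiplierPairing, Finset.mul_sum, Finset.mul_sum]
  refine Finset.sum_congr rfl fun i _ => ?_
  set A := l.angularVelocity * ((l.pos i).re ^ 2 + (l.pos i).im ^ 2) / 2 +
    l.speed * (l.pos i).re with hA
  have hp : Continuous fun x => inner ℝ (v i) (Complex.I * unitVec x) :=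
    continuous_of_value (c := perpElt m (v i)) (value_perpElt (v i))
  have hE : Continuous (patchEnergy b α m ε a l i) :=
    continuous_curveEnergy (polarRadius_patchRadius hα m ε a i) _ _ _ _ _
  have h0 : ∫ x in (0 : ℝ)..(2 * Real.pi), inner ℝ (v i) (Complex.I * unitVec x) = 0 := by
    have h := integral_value_mul_exp (perpElt m (v i)) 0
    have hc := coeff_perpElt_nat (m := m) (v i) zero_ne_one
    rw [Nat.cast_zero] at hc
    rw [hc, mul_zero] at h
    simp only [value_perpElt, Int.cast_zero, mul_zero, zero_mul, neg_zero, Complex.exp_zero,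
      mul_one] at h
    rw [intervalIntegral.integral_ofReal] at h
    exact_mod_cast h
  have h1 := integral_value_mul_exp (energyElt hα m b ε a l i * perpElt m (v i)) 0
  simp only [Int.cast_zero, mul_zero, zero_mul, neg_zero, Complex.exp_zero, mul_one, value_mul] at h1
  have h2 : ((ε * b i : ℝ) : ℂ) * (2 * Real.pi *
      (energyElt hα m b ε a l i * perpElt m (v i)).coeff 0) =
      ((∫ x in (0 : ℝ)..(2 * Real.pi), patchEnergy b α m ε a l i x *
        inner ℝ (v i) (Complex.I * unitVec x) : ℝ) : ℂ) := by
    rw [← h1, ← intervalIntegral.integral_const_mul]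
    have h3 : ∀ x, ((ε * b i : ℝ) : ℂ) * ((energyElt hα m b ε a l i).value x *
        (perpElt m (v i)).value x) = ((patchEnergy b α m ε a l i x *
        inner ℝ (v i) (Complex.I * unitVec x) - A * inner ℝ (v i) (Complex.I * unitVec x) : ℝ) : ℂ) := by
      intro x
      rw [← mul_assoc, value_energyElt, value_perpElt, ← Complex.ofReal_mul, ← hA]
      congr 1; ring
    simp only [h3]
    have i1 : Continuous fun x => patchEnergy b α m ε a l i x *
        inner ℝ (v i) (Complex.I * unitVec x) := hE.mul hp
    have i2 : Continuous fun x => A * inner ℝ (v i) (Complex.I * unitVec x) :=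
      continuous_const.mul hp
    rw [intervalIntegral.integral_ofReal, intervalIntegral.integral_sub
      (i1.intervalIntegrable _ _) (i2.intervalIntegrable _ _),
      intervalIntegral.integral_const_mul, h0, mul_zero, sub_zero]
  have h4 := congrArg Complex.re h2
  rw [Complex.re_ofReal_mul, Complex.ofReal_re, show (2 * (Real.pi : ℂ)) = ((2 * Real.pi : ℝ) : ℂ) by
    push_cast; rfl, Complex.re_ofReal_mul] at h4
  rw [← h4]
  have := (hb i).ne'
  field_simp

/-- The multiplier of a solution of the projected equation vanishes. -/
theorem multiplier_mul_pairing_eq_zero (hm : 1 ≤ m) (hb : ∀ i, 0 < b i) {ε : ℝ} (hε : ε ≠ 0)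
    {a : Fin N → Profile} {l : Params N} (hs : TotalSmall hα m b ε a l) {v : Fin N → ℂ} {t : ℝ}
    (h1 : ∀ i, highModes m (totalMap hα m b ε a l i) = 0)
    (h2 : ∀ i, firstMode m (totalMap hα m b ε a l i) + t • v i = 0) :
    t * multiplierPairing hα m b v ε a l = 0 := by
  -- The mean vanishes by conservation and the modes of order at least two by assumption. Since the
  -- functional is real, its first mode determines it.
  have hF : ∀ i x, contourFunctional α b ε (fun j => fnR α m (a j)) l i x =
      -t * inner ℝ (v i) (Complex.I * unitVec x) := by
    intro i x
    have hval := value_totalMap hα m hb hε hs i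
    have h0 : (totalMap hα m b ε a l i).coeff 0 = 0 := by
      have h := integral_value_mul_exp (totalMap hα m b ε a l i) 0
      simp only [hval, Int.cast_zero, mul_zero, zero_mul, neg_zero, Complex.exp_zero, mul_one] at h
      rw [intervalIntegral.integral_ofReal, integral_contourFunctional hα hm hb hε hs] at h
      have hpi : (2 * (Real.pi : ℂ)) ≠ 0 := by
        exact_mod_cast (by positivity : 2 * Real.pi ≠ 0)
      simpa [hpi] using h.symm
    have h3 := eq_perpElt_of_highModes h0 (h1 i) (coeff_neg_of_value_conj fun x => by
      rw [hval, Complex.conj_ofReal])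
    have h4 : firstMode m (totalMap hα m b ε a l i) = -(t • v i) := eq_neg_of_add_eq_zero_left (h2 i)
    have h5 := hval x
    rw [h3, value_perpElt, h4] at h5
    have h6 := Complex.ofReal_injective h5
    rw [← h6, inner_neg_left, real_inner_smul_left]
    ring
  -- Energy conservation applied to this explicit functional leaves `t` times the pairing, up to the
  -- non-zero factor `2π ε`.
  have h := sum_integral_energy_contourFunctional hα hm hb hε hs
  simp only [hF, mul_left_comm _ (-t), intervalIntegral.integral_const_mul] at h
  rw [← Finset.mul_sum, ← two_pi_mul_multiplierPairing hα m hb] at h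
  have hpi := Real.pi_ne_zero
  have : t * multiplierPairing hα m b v ε a l * (ε * (2 * Real.pi)) = 0 := by linarith
  exact (mul_eq_zero.1 this).resolve_right (by positivity)

theorem energyElt_zero (a : Fin N → Profile) (l : Params N) (i : Fin N) :
    energyElt hα m b 0 a l i = perpElt m (Complex.I * l.velocity i) := by
  refine value_injective fun x => ?_
  obtain ⟨h1, h2, -⟩ := value_loop hα m 0 (a i) x
  rw [energyElt, coreSize_zero, value_add, value_add, value_smul, value_smul, value_smul, h1, h2,
    value_perpElt]
  simp only [radR, zero_mul, mul_zero, zero_div, add_zero, one_mul, Complex.inner, unitVec,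
    Params.velocity, Complex.mul_re, Complex.mul_im, Complex.add_re, Complex.add_im,
    Complex.conj_re, Complex.conj_im, Complex.I_re, Complex.I_im, Complex.ofReal_re,
    Complex.ofReal_im, Complex.ofReal_zero]
  push_cast
  ring

theorem perpElt_smul (m : ℕ) (r : ℝ) (q : ℂ) : perpElt m (r • q) = r • perpElt m q := by
  refine value_injective fun x => ?_
  rw [value_smul, value_perpElt, value_perpElt, real_inner_smul_left, Complex.ofReal_mul]

theorem coeff_zero_perpElt_sq (m : ℕ) (q : ℂ) :
    ((perpElt m q * perpElt m q).coeff 0) = ((q.re ^ 2 + q.im ^ 2) / 2 : ℝ) := by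
  have h1 := integral_value_mul_exp (perpElt m q * perpElt m q) 0
  have e : ∀ x, (perpElt m q * perpElt m q).value x = ((((q.re ^ 2 + q.im ^ 2) / 2) +
      0 * Real.cos x + 0 * Real.sin x + ((q.im ^ 2 - q.re ^ 2) / 2) * Real.cos (2 * x) +
      (-(q.re * q.im)) * Real.sin (2 * x) + 0 * Real.cos (3 * x) + 0 * Real.sin (3 * x) : ℝ) : ℂ) := by
    intro x
    rw [value_mul, value_perpElt, ← Complex.ofReal_mul]
    congr 1
    rw [Real.cos_two_mul, Real.sin_two_mul]
    simp only [Complex.inner, unitVec, Complex.mul_re, Complex.mul_im, Complex.conj_re,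
      Complex.conj_im, Complex.I_re, Complex.I_im]
    linear_combination q.re ^ 2 * Real.sin_sq_add_cos_sq x
  have h2 := mean_trig ((q.re ^ 2 + q.im ^ 2) / 2) 0 0 ((q.im ^ 2 - q.re ^ 2) / 2)
    (-(q.re * q.im)) 0 0
  simp only [e, Int.cast_zero, mul_zero, zero_mul, neg_zero, Complex.exp_zero, mul_one] at h1
  rw [intervalIntegral.integral_ofReal] at h1
  simp only [zero_mul] at h2
  rw [mean, one_div, inv_mul_eq_iff_eq_mul₀ (by positivity)] at h2
  rw [h2] at h1
  have hpi : (2 * (Real.pi : ℂ)) ≠ 0 := by exact_mod_cast (by positivity : 2 * Real.pi ≠ 0)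
  refine mul_left_cancel₀ hpi (h1.symm.trans ?_)
  push_cast; ring

/-- At `ε = 0` the energy of patch `i` is `⟨i v_i, i e(x)⟩` with `v_i` its velocity, and the
multiplier is `γ_i i v_i`. The pairing is therefore `∑ γ_i² |v_i|² / 2`, a sum of squares whatever
the signs of the strengths. -/
theorem multiplierPairing_zero (a : Fin N → Profile) {l : Params N}
    (hγ : ∀ i, l.strength i ≠ 0) (hv : ∃ i, l.velocity i ≠ 0) :
    0 < multiplierPairing hα m b l.multiplier 0 a l := by
  have e : ∀ i, l.strength i * ((energyElt hα m b 0 a l i *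
      perpElt m (l.multiplier i)).coeff 0).re =
      l.strength i ^ 2 * (‖l.velocity i‖ ^ 2 / 2) := by
    intro i
    rw [energyElt_zero, Params.multiplier, perpElt_smul, mul_smul_comm, ← coeffCLM_apply, map_smul,
      coeffCLM_apply, coeff_zero_perpElt_sq, Complex.smul_re, Complex.ofReal_re, smul_eq_mul,
      ← Complex.normSq_eq_norm_sq, Complex.normSq_apply]
    simp only [Complex.mul_re, Complex.mul_im, Complex.I_re, Complex.I_im]
    ring
  obtain ⟨i, hi⟩ := hv
  simp only [multiplierPairing, e]
  refine Finset.sum_pos' (fun i _ => by positivity) ⟨i, Finset.mem_univ i, ?_⟩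
  have := norm_pos_iff.2 hi
  have := hγ i
  positivity

variable {lam : Params N} {S : Finset (Component N)}

theorem continuous_multiplierPairing (v : Fin N → ℂ) :
    Continuous (fun q : ℝ × (Fin N → Profile) × (S → ℝ) × ℝ =>
      multiplierPairing hα m b v q.1 q.2.1 (lam.replace S q.2.2.1)) := by
  have hc : ∀ c, Continuous fun q : ℝ × (Fin N → Profile) × (S → ℝ) × ℝ =>
      lam.replace S q.2.2.1 c := fun c =>
    (lam.contDiff_replace S c (n := 0)).continuous.comp continuous_snd.snd.fst
  have hre : ∀ i, Continuous fun q : ℝ × (Fin N → Profile) × (S → ℝ) × ℝ =>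
      ((lam.replace S q.2.2.1).pos i).re := fun i => hc (Component.posX i)
  have him : ∀ i, Continuous fun q : ℝ × (Fin N → Profile) × (S → ℝ) × ℝ =>
      ((lam.replace S q.2.2.1).pos i).im := fun i => hc (Component.posY i)
  have hΩ : Continuous fun q : ℝ × (Fin N → Profile) × (S → ℝ) × ℝ =>
      (lam.replace S q.2.2.1).angularVelocity := hc Component.angularVelocity
  have hU : Continuous fun q : ℝ × (Fin N → Profile) × (S → ℝ) × ℝ =>
      (lam.replace S q.2.2.1).speed := hc Component.speed
  unfold multiplierPairing
  refine continuous_finsetSum _ fun i _ => (hc (Component.strength i)).mul ?_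
  have hp : Continuous fun q : ℝ × (Fin N → Profile) × (S → ℝ) × ℝ =>
      (coreSize α (b i) q.1, q.2.1 i) :=
    ((contDiff_coreSize hα (b i)).continuous.comp continuous_fst).prodMk
      ((continuous_apply i).comp continuous_snd.fst)
  have h1 := (contDiff_loop hα m (n := 0)).continuous.comp hp
  have h2 := (contDiff_radiusElt hα m (n := 0)).continuous.comp hp
  refine Complex.continuous_re.comp ((coeffCLM 0).continuous.comp (Continuous.mul ?_
    continuous_const))
  exact ((((hΩ.mul continuous_fst).mul continuous_const).div_const 2).smul (h2.mul h2)).add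
    (((hΩ.mul (hre i)).add hU).smul h1.fst) |>.add ((hΩ.mul (him i)).smul h1.snd.fst)

/-- Near the base point, solutions of the projected equation solve the full equation. -/
theorem eventually_multiplier_eq_zero (hm : 1 ≤ m) (hb : ∀ i, 0 < b i)
    (heq : IsVortexEquilibrium α lam) (hv : ∃ i, lam.velocity i ≠ 0) :
    ∀ᶠ q in 𝓝 (basePoint lam S), q.1 ≠ 0 → systemMap hα m b lam S lam.multiplier q = 0 →
      q.2.2.2 = 0 := by
  have h1 := eventually_totalSmall_replace hα m (b := b) (totalSmall_basePoint hα m (S := S) heq)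
  have h2 : ∀ᶠ q in 𝓝 (basePoint lam S),
      0 < multiplierPairing hα m b lam.multiplier q.1 q.2.1 (lam.replace S q.2.2.1) := by
    refine (continuous_multiplierPairing hα m lam.multiplier).continuousAt.eventually
      (lt_mem_nhds ?_)
    have := multiplierPairing_zero hα m (b := b) (0 : Fin N → Profile) heq.strength_ne_zero hv
    simpa only [basePoint, Params.replace_first] using this
  filter_upwards [h1, h2] with q hq1 hq2 hε hq
  have h3 := congrArg Prod.fst hq
  have h4 := congrArg Prod.snd hq
  exact (mul_eq_zero.1 (multiplier_mul_pairing_eq_zero hα m hm hb hε hq1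
    (fun i => congrFun h3 i) (fun i => congrFun h4 i))).resolve_right hq2.ne'

end Multiplier

/-! ### Embeddings of the function spaces -/

/-- The inclusion of `ℓ¹` in `ℓ²`: each term is at most the whole sum `M`, so `g n ^ 2 ≤ M * g n`.
-/
theorem sqrt_tsum_sq_le {u g : ℕ → ℝ} {C M : ℝ} (hC : 0 ≤ C) (hu : ∀ n, 0 ≤ u n)
    (hg : ∀ n, 0 ≤ g n) (hM : HasSum g M) (h : ∀ n, u n ≤ C * g n) :
    Summable (fun n => u n ^ 2) ∧ Real.sqrt (∑' n, u n ^ 2) ≤ C * M := by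
  have hM0 : 0 ≤ M := hM.nonneg hg
  have hle : ∀ n, u n ^ 2 ≤ C ^ 2 * M * g n := by
    intro n
    have h1 : g n ≤ M := le_hasSum hM n fun j _ => hg j
    calc u n ^ 2 ≤ (C * g n) ^ 2 := pow_le_pow_left₀ (hu n) (h n) 2
      _ = C ^ 2 * (g n * g n) := by ring
      _ ≤ C ^ 2 * (M * g n) := by
          have := hg n
          gcongr
      _ = _ := by ring
  have hs : Summable fun n => u n ^ 2 :=
    Summable.of_nonneg_of_le (fun n => sq_nonneg _) hle (hM.summable.mul_left _)
  refine ⟨hs, Real.sqrt_le_iff.2 ⟨by positivity, ?_⟩⟩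
  refine (hs.tsum_le_tsum hle (hM.summable.mul_left _)).trans_eq ?_
  rw [tsum_mul_left, hM.tsum_eq]
  ring

variable {α : ℝ} {k : ℕ}

theorem sobolevWeight_le (hα : 1 ≤ α) (k : ℕ) {n : ℕ} (hn : 2 ≤ n) :
    sobolevWeight k n ≤ profileWeight α k n := by
  have h1 : sobolevWeight k n ≤ (1 + (n : ℝ)) ^ k := by
    refine Real.sqrt_le_iff.2 ⟨by positivity, ?_⟩
    rw [← pow_mul, mul_comm k 2, pow_mul]
    refine pow_le_pow_left₀ (by positivity) ?_ k
    nlinarith [Nat.cast_nonneg (α := ℝ) n]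
  refine h1.trans (le_mul_of_one_le_left (by positivity) ?_)
  refine le_trans ?_ (natAbs_le_rpow hα n)
  exact_mod_cast (by omega : 1 ≤ n)

theorem singularSymbol_eq (n : ℕ) : singularSymbol α n = 2 ^ α * cosSymbol α n := by
  rw [singularSymbol, cosSymbol, ← intervalIntegral.integral_const_mul]
  congr 1
  funext y
  have h : (4 * Real.sin (y / 2) ^ 2) ^ (α / 2) = 2 ^ α * |Real.sin (y / 2)| ^ α := by
    rw [show 4 * Real.sin (y / 2) ^ 2 = (2 * |Real.sin (y / 2)|) ^ 2 by rw [mul_pow, sq_abs]; ring,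
      ← Real.rpow_natCast, ← Real.rpow_mul (by positivity), Nat.cast_two, mul_div_cancel₀ _ two_ne_zero,
      Real.mul_rpow (by norm_num) (abs_nonneg _)]
  rw [kern, h, mul_inv, div_eq_mul_inv]
  have : (2 : ℝ) ^ α ≠ 0 := by positivity
  field_simp

theorem singularSymbol_nonneg (n : ℕ) : 0 ≤ singularSymbol α n := by
  rw [singularSymbol_eq]
  exact mul_nonneg (by positivity) (cosSymbol_nonneg α n)

theorem singularWeight_le (hα : α ∈ Ioo (1 : ℝ) 2) (k : ℕ) : ∃ C, 0 ≤ C ∧ ∀ n : ℕ, 2 ≤ n →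
    singularWeight k α n ≤ C * profileWeight α k n := by
  obtain ⟨C, hC, h⟩ := cosSymbol_le hα
  refine ⟨2 ^ α * C, by positivity, fun n hn => ?_⟩
  have hn0 : (1 : ℝ) ≤ n := by exact_mod_cast (by omega : 1 ≤ n)
  have h1 : (n : ℝ) ^ (α - 1) ≤ (n : ℝ) ^ α := Real.rpow_le_rpow_of_exponent_le hn0 (by linarith)
  have h2 : (n : ℝ) ^ k ≤ (1 + (n : ℝ)) ^ k := pow_le_pow_left₀ (by positivity) (by linarith) k
  rw [singularWeight, singularSymbol_eq, profileWeight]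
  calc (n : ℝ) ^ k * (2 ^ α * cosSymbol α n)
      ≤ (1 + (n : ℝ)) ^ k * (2 ^ α * (C * (n : ℝ) ^ α)) := by
        refine mul_le_mul h2 ?_ (mul_nonneg (by positivity) (cosSymbol_nonneg α n)) (by positivity)
        refine mul_le_mul_of_nonneg_left ((h n (by omega)).trans ?_) (by positivity)
        exact mul_le_mul_of_nonneg_left h1 hC
    _ = _ := by ring

theorem norm_smul_realCoeff_le {w : ℕ → ℝ} {C : ℝ}
    (h : ∀ n, 2 ≤ n → w n ≤ C * profileWeight α k n) (a : Profile) (n : ℕ) :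
    w n * ‖realCoeff α k a n‖ ≤ C * (profileWeight α k n * ‖realCoeff α k a n‖) := by
  by_cases hn : n < 2
  · simp [realCoeff, hn]
  · rw [← mul_assoc]
    exact mul_le_mul_of_nonneg_right (h n (by omega)) (norm_nonneg _)

theorem memℓp_two {c : ℕ → ℂ} {w : ℕ → ℝ} (hw : ∀ n, 0 ≤ w n)
    (h : Summable fun n => (w n * ‖c n‖) ^ 2) : Memℓp (fun n => w n • c n) 2 := by
  refine memℓp_gen ?_
  refine h.congr fun n => ?_
  rw [norm_smul, Real.norm_of_nonneg (hw n), ENNReal.toReal_ofNat, Real.rpow_two]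

theorem singularWeight_nonneg (k n : ℕ) : 0 ≤ singularWeight k α n :=
  mul_nonneg (by positivity) (singularSymbol_nonneg n)

/-- A bound for the weights of `X^{k+α-1}`. -/
def embedConst (hα : α ∈ Ioo (1 : ℝ) 2) (k : ℕ) : ℝ := (singularWeight_le hα k).choose

theorem embedConst_spec (hα : α ∈ Ioo (1 : ℝ) 2) (k : ℕ) : 0 ≤ embedConst hα k ∧
    ∀ n : ℕ, 2 ≤ n → singularWeight k α n ≤ embedConst hα k * profileWeight α k n :=
  (singularWeight_le hα k).choose_spec

theorem sqrt_weight_le (hα : α ∈ Ioo (1 : ℝ) 2) (a : Profile) :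
    (Summable (fun n => (sobolevWeight k n * ‖realCoeff α k a n‖) ^ 2) ∧
      Real.sqrt (∑' n, (sobolevWeight k n * ‖realCoeff α k a n‖) ^ 2) ≤ 1 * ‖a‖) ∧
    Summable (fun n => (singularWeight k α n * ‖realCoeff α k a n‖) ^ 2) ∧
      Real.sqrt (∑' n, (singularWeight k α n * ‖realCoeff α k a n‖) ^ 2) ≤
        embedConst hα k * ‖a‖ := by
  have hs : ∀ n, 0 ≤ sobolevWeight k n := fun n => Real.sqrt_nonneg _
  have hg : ∀ n, 0 ≤ profileWeight α k n * ‖realCoeff α k a n‖ := fun n =>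
    mul_nonneg (profileWeight_nonneg α k n) (norm_nonneg _)
  refine ⟨sqrt_tsum_sq_le zero_le_one (fun n => mul_nonneg (hs n) (norm_nonneg _)) hg
    (hasSum_realCoeff a) (norm_smul_realCoeff_le (fun n hn => ?_) a),
    sqrt_tsum_sq_le (embedConst_spec hα k).1
    (fun n => mul_nonneg (singularWeight_nonneg k n) (norm_nonneg _)) hg
    (hasSum_realCoeff a) (norm_smul_realCoeff_le (embedConst_spec hα k).2 a)⟩
  rw [one_mul]; exact sobolevWeight_le hα.1.le k hn

/-- The embedding of the profiles into `X^{k+α-1}`. -/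
def toX (hα : α ∈ Ioo (1 : ℝ) 2) (k : ℕ) : Profile →L[ℝ] XSpace k α :=
  LinearMap.mkContinuous
    (⟨⟨fun a => (⟨realCoeff α k a, by simp [realCoeff], by simp [realCoeff],
        memℓp_two (fun n => Real.sqrt_nonneg _) (sqrt_weight_le hα a).1.1,
        memℓp_two (singularWeight_nonneg k) (sqrt_weight_le hα a).2.1⟩ :
          coeffSubmodule k α),
      fun a b => Subtype.ext (funext fun n => realCoeff_add a b n)⟩,
      fun r a => Subtype.ext (funext fun n => realCoeff_smul r a n)⟩ : Profile →ₗ[ℝ] XSpace k α)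
    (1 + embedConst hα k) fun a => by
      rw [XSpace.norm_eq, add_mul]
      refine add_le_add (le_trans (le_of_eq ?_) (sqrt_weight_le (k := k) hα a).1.2)
        (le_trans (le_of_eq ?_) (sqrt_weight_le (k := k) hα a).2.2)
      · congr 1
        refine tsum_congr fun n => ?_
        rw [mul_pow, sobolevWeight, Real.sq_sqrt (by positivity)]
        rfl
      · congr 1
        refine tsum_congr fun n => ?_
        exact (mul_pow (singularWeight k α n) _ 2).symm

/-- The seminorm of order `k` bounds the sequence of weighted coefficients. -/
theorem XSpace.hasSum_sobolev (f : XSpace k α) :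
    ∃ M, HasSum (fun n => (sobolevWeight k n * ‖f.coeff n‖) ^ 2) M ∧ M ≤ ‖f‖ ^ 2 := by
  have h1 := f.2.2.2.1.summable (by norm_num)
  have e : ∀ n, ‖sobolevWeight k n • f.coeff n‖ ^ (2 : ENNReal).toReal =
      (sobolevWeight k n * ‖f.coeff n‖) ^ 2 := fun n => by
    rw [norm_smul, Real.norm_of_nonneg (show 0 ≤ sobolevWeight k n from Real.sqrt_nonneg _),
      ENNReal.toReal_ofNat, Real.rpow_two]
  have h2 : Summable fun n => (sobolevWeight k n * ‖f.coeff n‖) ^ 2 := h1.congr e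
  refine ⟨_, h2.hasSum, ?_⟩
  have h3 : Real.sqrt (∑' n, (sobolevWeight k n * ‖f.coeff n‖) ^ 2) ≤ ‖f‖ := by
    rw [XSpace.norm_eq]
    refine le_trans (le_of_eq ?_) (le_add_of_nonneg_right (Real.sqrt_nonneg _))
    congr 1
    refine tsum_congr fun n => ?_
    rw [mul_pow, sobolevWeight, Real.sq_sqrt (by positivity)]
  have h4 : 0 ≤ ∑' n, (sobolevWeight k n * ‖f.coeff n‖) ^ 2 := tsum_nonneg fun n => sq_nonneg _
  exact (Real.sqrt_le_left (norm_nonneg f)).1 h3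

/-- Since `α < 2` and `3 ≤ k`, one has `n ^ α * n ≤ n ^ 3 ≤ n ^ k`. The spare factor `1 / n` is
square summable, which pays for the passage from `ℓ²` to `ℓ¹`. -/
theorem profileWeight_mul_le (hα : α ∈ Ioo (1 : ℝ) 2) (hk : 3 ≤ k) {n : ℕ} (hn : 2 ≤ n) :
    profileWeight α 0 n * n ≤ sobolevWeight k n := by
  have hn0 : (1 : ℝ) ≤ n := by exact_mod_cast (by omega : 1 ≤ n)
  have h1 : (n : ℝ) ^ α ≤ (n : ℝ) ^ 2 := by
    rw [← Real.rpow_two]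
    exact Real.rpow_le_rpow_of_exponent_le hn0 hα.2.le
  rw [profileWeight, pow_zero, mul_one]
  calc (n : ℝ) ^ α * n ≤ (n : ℝ) ^ 2 * n := by gcongr
    _ = (n : ℝ) ^ 3 := by ring
    _ ≤ (n : ℝ) ^ k := pow_le_pow_right₀ hn0 hk
    _ ≤ sobolevWeight k n := by
      refine Real.le_sqrt_of_sq_le ?_
      rw [← pow_mul, mul_comm k 2, pow_mul]
      exact pow_le_pow_left₀ (by positivity) (by linarith) k

/-- A Cauchy-Schwarz estimate against `1 / n`, carried out termwise by the inequality between the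
arithmetic and geometric means, with the norm of `f` as balancing parameter. -/
theorem XSpace.profile_bound (hα : α ∈ Ioo (1 : ℝ) 2) (hk : 3 ≤ k) :
    ∃ C, 0 ≤ C ∧ ∀ f : XSpace k α,
      Summable (fun n : ℕ => profileWeight α 0 (n + 2) * ‖f.coeff (n + 2)‖) ∧
      ∑' n : ℕ, profileWeight α 0 (n + 2) * ‖f.coeff (n + 2)‖ ≤ C * ‖f‖ := by
  have hA : Summable fun n : ℕ => 1 / (((n + 2 : ℕ) : ℝ)) ^ 2 :=
    (summable_nat_add_iff 2).2 (Real.summable_one_div_nat_pow.2 one_lt_two)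
  set A := ∑' n : ℕ, 1 / (((n + 2 : ℕ) : ℝ)) ^ 2 with hAdef
  have hA0 : 0 ≤ A := tsum_nonneg fun n => by positivity
  -- With `r = ‖f‖` the two halves of the inequality sum to at most `r A / 2` and `r² / (2 r) = r /
  -- 2`.
  refine ⟨(A + 1) / 2, by positivity, fun f => ?_⟩
  obtain ⟨M, hM, hMle⟩ := f.hasSum_sobolev
  rcases (norm_nonneg f).eq_or_lt with h0 | h0
  · have hf : f = 0 := norm_eq_zero.1 h0.symm
    have hz : ∀ n : ℕ, profileWeight α 0 (n + 2) * ‖f.coeff (n + 2)‖ = 0 := fun n => by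
      rw [hf, show (0 : XSpace k α).coeff (n + 2) = 0 from rfl, norm_zero, mul_zero]
    simp only [hz, tsum_zero]
    exact ⟨summable_zero, by positivity⟩
  · set r := ‖f‖
    have hS : Summable fun n : ℕ => (sobolevWeight k (n + 2) * ‖f.coeff (n + 2)‖) ^ 2 :=
      (summable_nat_add_iff 2).2 hM.summable
    have hSle : ∑' n : ℕ, (sobolevWeight k (n + 2) * ‖f.coeff (n + 2)‖) ^ 2 ≤ r ^ 2 := by
      refine le_trans ?_ (hM.tsum_eq.le.trans hMle)
      have := hM.summable.sum_add_tsum_nat_add 2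
      have h2 : 0 ≤ ∑ i ∈ Finset.range 2, (sobolevWeight k i * ‖f.coeff i‖) ^ 2 :=
        Finset.sum_nonneg fun i _ => sq_nonneg _
      linarith
    have hle : ∀ n : ℕ, profileWeight α 0 (n + 2) * ‖f.coeff (n + 2)‖ ≤
        r / 2 * (1 / (((n + 2 : ℕ) : ℝ)) ^ 2) +
        1 / (2 * r) * (sobolevWeight k (n + 2) * ‖f.coeff (n + 2)‖) ^ 2 := by
      intro n
      have hn : (0 : ℝ) < ((n + 2 : ℕ) : ℝ) := by positivity
      set X := sobolevWeight k (n + 2) * ‖f.coeff (n + 2)‖ with hX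
      have h1 : profileWeight α 0 (n + 2) * ‖f.coeff (n + 2)‖ ≤ X / ((n + 2 : ℕ) : ℝ) := by
        rw [le_div_iff₀ hn, hX]
        calc _ = (profileWeight α 0 (n + 2) * ((n + 2 : ℕ) : ℝ)) * ‖f.coeff (n + 2)‖ := by ring
          _ ≤ _ := mul_le_mul_of_nonneg_right (profileWeight_mul_le hα hk (by omega))
            (norm_nonneg _)
      refine h1.trans ?_
      have h2 := sq_nonneg (r / ((n + 2 : ℕ) : ℝ) - X)
      have h3 : r / 2 * (1 / (((n + 2 : ℕ) : ℝ)) ^ 2) + 1 / (2 * r) * X ^ 2 -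
          X / ((n + 2 : ℕ) : ℝ) = 1 / (2 * r) * (r / ((n + 2 : ℕ) : ℝ) - X) ^ 2 := by
        field_simp
        ring
      have h4 : 0 ≤ 1 / (2 * r) * (r / ((n + 2 : ℕ) : ℝ) - X) ^ 2 := by positivity
      linarith
    have hsum := (hA.mul_left (r / 2)).add (hS.mul_left (1 / (2 * r)))
    have hs : Summable fun n : ℕ => profileWeight α 0 (n + 2) * ‖f.coeff (n + 2)‖ :=
      Summable.of_nonneg_of_le (fun n => mul_nonneg (profileWeight_nonneg _ _ _) (norm_nonneg _))
        hle hsum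
    refine ⟨hs, (hs.tsum_le_tsum hle hsum).trans ?_⟩
    rw [(hA.mul_left (r / 2)).tsum_add (hS.mul_left (1 / (2 * r))), tsum_mul_left, tsum_mul_left,
      ← hAdef]
    have h5 : 1 / (2 * r) * ∑' n : ℕ, (sobolevWeight k (n + 2) * ‖f.coeff (n + 2)‖) ^ 2 ≤
        1 / (2 * r) * r ^ 2 := mul_le_mul_of_nonneg_left hSle (by positivity)
    have h6 : 1 / (2 * r) * r ^ 2 = r / 2 := by field_simp
    linarith

/-- The element of `X^{k+α-1}`, as a profile of regularity zero. -/
def XSpace.toProfile (hα : α ∈ Ioo (1 : ℝ) 2) (hk : 3 ≤ k) (f : XSpace k α) : Profile :=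
  ⟨fun n => profileWeight α 0 (n + 2) • f.coeff (n + 2), memℓp_gen (by
    obtain ⟨C, -, h⟩ := XSpace.profile_bound hα hk
    refine (h f).1.congr fun n => ?_
    rw [norm_smul, Real.norm_of_nonneg (profileWeight_nonneg _ _ _), ENNReal.toReal_one,
      Real.rpow_one])⟩

theorem XSpace.toProfile_apply (hα : α ∈ Ioo (1 : ℝ) 2) (hk : 3 ≤ k) (f : XSpace k α) (n : ℕ) :
    f.toProfile hα hk n = profileWeight α 0 (n + 2) • f.coeff (n + 2) := rfl

/-- The embedding of `X^{k+α-1}` into the profiles of regularity zero. -/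
def ofX (hα : α ∈ Ioo (1 : ℝ) 2) (hk : 3 ≤ k) : XSpace k α →L[ℝ] Profile :=
  LinearMap.mkContinuous
    (⟨⟨XSpace.toProfile hα hk, fun f g => lp.ext (funext fun n =>
        smul_add (profileWeight α 0 (n + 2)) (f.coeff (n + 2)) (g.coeff (n + 2)))⟩,
      fun r f => lp.ext (funext fun n =>
        smul_comm (profileWeight α 0 (n + 2)) r (f.coeff (n + 2)))⟩ :
        XSpace k α →ₗ[ℝ] Profile) (XSpace.profile_bound hα hk).choose fun f => by
      refine le_trans (le_of_eq ?_) ((XSpace.profile_bound hα hk).choose_spec.2 f).2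
      rw [lp.norm_eq_tsum_rpow (by norm_num)]
      simp only [ENNReal.toReal_one, Real.rpow_one, ne_eq, one_ne_zero, not_false_eq_true, div_self]
      refine tsum_congr fun n => ?_
      change ‖profileWeight α 0 (n + 2) • f.coeff (n + 2)‖ = _
      rw [norm_smul, Real.norm_of_nonneg (profileWeight_nonneg _ _ _)]

theorem realCoeff_ofX (hα : α ∈ Ioo (1 : ℝ) 2) (hk : 3 ≤ k) (f : XSpace k α) (n : ℕ) :
    realCoeff α 0 (ofX hα hk f) n = f.coeff n := by
  rw [realCoeff]
  split_ifs with h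
  · interval_cases n
    · exact f.2.1.symm
    · exact f.2.2.1.symm
  · obtain ⟨j, rfl⟩ := Nat.exists_eq_add_of_le' (not_lt.1 h)
    rw [Nat.add_sub_cancel, show ofX hα hk f j = profileWeight α 0 (j + 2) • f.coeff (j + 2)
      from f.toProfile_apply hα hk j, inv_smul_smul₀ (profileWeight_pos α 0 (by omega)).ne']

theorem fnR_ofX (hα : α ∈ Ioo (1 : ℝ) 2) (hk : 3 ≤ k) (f : XSpace k α) :
    fnR α 0 (ofX hα hk f) = f := by
  funext x
  simp only [fnR, realCoeff_ofX]
  rfl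

theorem ofX_injective (hα : α ∈ Ioo (1 : ℝ) 2) (hk : 3 ≤ k) :
    Function.Injective (ofX hα hk) := by
  intro f g h
  refine Subtype.ext (funext fun n => ?_)
  have h1 := realCoeff_ofX hα hk f n
  rw [h, realCoeff_ofX] at h1
  exact h1.symm

/-! ### The solution curve -/

section ZeroProfile

variable {α : ℝ} (hα : α ∈ Ioo (1 : ℝ) 2) (m : ℕ)

theorem selfPert_profile_zero (s : ℝ) : selfPert hα m s 0 = 0 := by
  simp [selfPert]

theorem selfMap_profile_zero (s : ℝ) : selfMap hα m s 0 = 0 := by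
  simp [selfMap, selfPert_profile_zero]

theorem loop_profile_zero (s : ℝ) : loop hα m s 0 =
    (cosElt m, sinElt m, -sinElt m, cosElt m) := by
  simp [loop]

variable {N : ℕ} {b : Fin N → ℝ}

/-- The functional at discs. -/
theorem totalMap_profile_zero (ε : ℝ) (l : Params N) (i : Fin N) :
    totalMap hα m b ε 0 l i = perpElt m (l.velocity i) +
      ∑ j ∈ Finset.univ.erase i, (kernelConst α * l.strength j / b j) •
        pairMap α (b i) (b j) ε (l.pos i - l.pos j) (cosElt m, sinElt m, -sinElt m, cosElt m)
          (cosElt m, sinElt m, -sinElt m, cosElt m) := by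
  simp only [totalMap, Pi.zero_apply, loop_profile_zero, selfMap_profile_zero, smul_zero, add_zero,
    rigidMap, map_zero, mul_zero, zero_add]
  congr 1
  rw [perpElt, Params.velocity]
  simp only [Complex.add_re, Complex.add_im, Complex.mul_re, Complex.mul_im, Complex.ofReal_re,
    Complex.ofReal_im, zero_mul, sub_zero, add_zero, smul_neg, neg_smul]

end ZeroProfile

variable {α : ℝ} (hα : α ∈ Ioo (1 : ℝ) 2) (m : ℕ) {N : ℕ} {b : Fin N → ℝ}
  {lam : Params N} {S : Finset (Component N)}

theorem exists_notMem_range (hnd : IsNondegenerate α lam S) :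
    ∃ v : Fin N → ℂ, v ∉ (vortexDeriv α lam S).range := by
  by_contra! h
  have h1 : (vortexDeriv α lam S).range = ⊤ := eq_top_iff.2 fun v _ => h v
  have h2 := hnd.codim_range_eq_one
  change Module.finrank ℝ ((Fin N → ℂ) ⧸ (vortexDeriv α lam S).range) = 1 at h2
  rw [h1] at h2
  have : Subsingleton ((Fin N → ℂ) ⧸ (⊤ : Submodule ℝ (Fin N → ℂ))) :=
    Submodule.Quotient.subsingleton_iff.2 rfl
  rw [Module.finrank_zero_of_subsingleton] at h2
  exact zero_ne_one h2

theorem systemMap_basePoint (hb : ∀ i, 0 < b i) (heq : IsVortexEquilibrium α lam)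
    (v : Fin N → ℂ) : systemMap hα m b lam S v (basePoint lam S) = 0 := by
  have e : lam.replace S (lam.first S) = lam := lam.replace_first S
  refine Prod.ext (funext fun i => ?_) (funext fun i => ?_)
  · simp only [systemMap, basePoint, e]
    rw [highModes_totalMap_zero hα m hb 0 heq.pos_injective]
    simp
  · simp only [systemMap, basePoint, e]
    rw [firstMode_totalMap_zero hα m hb 0 heq.pos_injective, heq.map_eq_zero]
    simp

/-- Local uniqueness of the solutions of the equation. -/
theorem exists_unique_solution (hb : ∀ i, 0 < b i) (heq : IsVortexEquilibrium α lam)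
    (hnd : IsNondegenerate α lam S) :
    ∃ ψ : ℝ → (Fin N → Profile) × (S → ℝ),
      ∀ᶠ q : ℝ × (Fin N → Profile) × (S → ℝ) in 𝓝 (0, 0, lam.first S),
        TotalSmall hα m b q.1 q.2.1 (lam.replace S q.2.2) ∧
          ((∀ i, totalMap hα m b q.1 q.2.1 (lam.replace S q.2.2) i = 0) → q.2 = ψ q.1) := by
  -- For uniqueness any complementary direction will do; the conservation laws play no part here.
  obtain ⟨v, hv⟩ := exists_notMem_range hnd
  have hs := totalSmall_basePoint (b := b) hα m (S := S) heq
  have cdf := contDiffAt_systemMap hα m (v := v) hs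
  have hinv := isInvertible_systemMap hα m hb heq hnd hv
  have h1 := cdf.eventually_apply_eq_iff_implicitFunction one_ne_zero hinv
  have h2 := eventually_totalSmall_replace hα m hs
  have hc : Continuous fun q : ℝ × (Fin N → Profile) × (S → ℝ) =>
      ((q.1, q.2.1, q.2.2, 0) : ℝ × (Fin N → Profile) × (S → ℝ) × ℝ) := by fun_prop
  refine ⟨fun ε => ((cdf.implicitFunction one_ne_zero hinv ε).1,
    (cdf.implicitFunction one_ne_zero hinv ε).2.1), ?_⟩
  filter_upwards [(hc.tendsto (0, 0, lam.first S)).eventually h1,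
    (hc.tendsto (0, 0, lam.first S)).eventually h2] with q hq1 hq2
  refine ⟨hq2, fun h => ?_⟩
  -- A solution of the full equation solves the augmented system with `t = 0`, so it lies on the
  -- graph of the implicit function.
  have h3 := hq1.1 (by
    rw [systemMap_basePoint hα m hb heq]
    refine Prod.ext (funext fun i => ?_) (funext fun i => ?_)
    · simp only [systemMap, h i, map_zero]; rfl
    · simp only [systemMap, h i, map_zero, zero_smul, add_zero]; rfl)
  simp only [h3]

/-- The projections used in `systemMap` omit the mean and the negative modes. The mean vanishes by
conservation, and the negative modes are conjugates of the positive ones. -/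
theorem totalMap_eq_zero (hm : 1 ≤ m) (hb : ∀ i, 0 < b i) {ε : ℝ} (hε : ε ≠ 0)
    {a : Fin N → Profile} {l : Params N} (hs : TotalSmall hα m b ε a l) (i : Fin N)
    (h1 : highModes m (totalMap hα m b ε a l i) = 0)
    (h2 : firstMode m (totalMap hα m b ε a l i) = 0) : totalMap hα m b ε a l i = 0 := by
  have hval := value_totalMap hα m hb hε hs i
  have h0 : (totalMap hα m b ε a l i).coeff 0 = 0 := by
    have h := integral_value_mul_exp (totalMap hα m b ε a l i) 0
    simp only [hval, Int.cast_zero, mul_zero, zero_mul, neg_zero, Complex.exp_zero, mul_one] at h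
    rw [intervalIntegral.integral_ofReal, integral_contourFunctional hα hm hb hε hs] at h
    have hpi : (2 * (Real.pi : ℂ)) ≠ 0 := by
      exact_mod_cast (by positivity : 2 * Real.pi ≠ 0)
    simpa [hpi] using h.symm
  rw [eq_perpElt_of_highModes h0 h1 (coeff_neg_of_value_conj fun x => by
      rw [hval, Complex.conj_ofReal]), h2]
  simp [perpElt]

/-- If `Ω = 0` the velocity is `U`, which is then non-zero. Otherwise every position equals `-U /
Ω`, and distinctness leaves at most one vortex. -/
theorem velocity_eq_zero_imp (hmove : lam.angularVelocity ≠ 0 ∨ lam.speed ≠ 0)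
    (heq : IsVortexEquilibrium α lam) (h : ∀ i, lam.velocity i = 0) : Subsingleton (Fin N) := by
  refine ⟨fun i j => heq.pos_injective ?_⟩
  have hi := h i
  have hj := h j
  rw [Params.velocity] at hi hj
  by_cases hΩ : lam.angularVelocity = 0
  · rw [hΩ] at hi
    have : lam.speed = 0 := by simpa using hi
    exact absurd this (hmove.resolve_left (not_not.2 hΩ))
  · have h1 : (lam.angularVelocity : ℂ) ≠ 0 := by exact_mod_cast hΩ
    exact mul_left_cancel₀ h1 (add_right_cancel (hi.trans hj.symm))

/-- Existence of a curve of solutions. -/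
theorem exists_profileCurve (hm : 1 ≤ m) (hb : ∀ i, 0 < b i) (heq : IsVortexEquilibrium α lam)
    (hmove : lam.angularVelocity ≠ 0 ∨ lam.speed ≠ 0) (hnd : IsNondegenerate α lam S) :
    ∃ (A : ℝ → Fin N → Profile) (μ : ℝ → S → ℝ), ContDiffAt ℝ 1 (fun ε => (A ε, μ ε)) 0 ∧
      A 0 = 0 ∧ μ 0 = lam.first S ∧
      ∀ᶠ ε in 𝓝 0, TotalSmall hα m b ε (A ε) (lam.replace S (μ ε)) ∧
        ∀ i, totalMap hα m b ε (A ε) (lam.replace S (μ ε)) i = 0 := by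
  have hs := totalSmall_basePoint (b := b) hα m (S := S) heq
  have e : lam.replace S (lam.first S) = lam := lam.replace_first S
  have hbase : ∀ i, totalMap hα m b 0 0 lam i = 0 := by
    intro i
    rw [totalMap_zero hα m hb 0 heq.pos_injective, heq.map_eq_zero]
    simp [perpElt]
  by_cases hv : ∃ i, lam.velocity i ≠ 0
  · have hrange := multiplier_notMem_range (S := S) hα heq hv
    have cdf := contDiffAt_systemMap hα m (v := lam.multiplier) hs
    have hinv := isInvertible_systemMap hα m hb heq hnd hrange
    set ψ := cdf.implicitFunction one_ne_zero hinv with hψ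
    have hψ0 : ψ 0 = (basePoint lam S).2 := cdf.implicitFunction_apply_self one_ne_zero hinv
    have hψc : ContDiffAt ℝ 1 ψ 0 := cdf.contDiffAt_implicitFunction one_ne_zero hinv
    have h1 : ∀ᶠ ε in 𝓝 0, systemMap hα m b lam S lam.multiplier (ε, ψ ε) =
        systemMap hα m b lam S lam.multiplier (basePoint lam S) :=
      cdf.eventually_apply_implicitFunction one_ne_zero hinv
    have hcont : Tendsto (fun ε => (ε, ψ ε)) (𝓝 0) (𝓝 (basePoint lam S)) := by
      have : ContinuousAt (fun ε => (ε, ψ ε)) 0 := continuousAt_id.prodMk hψc.continuousAt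
      have h := this.tendsto
      rw [hψ0] at h
      exact h
    have h2 := hcont.eventually (eventually_totalSmall_replace hα m hs)
    have h3 := hcont.eventually (eventually_multiplier_eq_zero hα m (b := b) hm hb (S := S) heq hv)
    refine ⟨fun ε => (ψ ε).1, fun ε => (ψ ε).2.1, hψc.fst.prodMk hψc.snd.fst, by simp [hψ0, basePoint],
      by simp [hψ0, basePoint], ?_⟩
    filter_upwards [h1, h2, h3] with ε g1 g2 g3
    refine ⟨g2, fun i => ?_⟩
    -- The multiplier is shown to vanish only for `ε ≠ 0`. At `ε = 0` the curve is at the base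
    -- point, where the equation holds by the equilibrium condition.
    by_cases hε : ε = 0
    · subst hε
      simp only [hψ0, basePoint, e]
      exact hbase i
    · rw [systemMap_basePoint hα m hb heq] at g1
      have h4 : (ψ ε).2.2 = 0 := g3 hε g1
      have h5 := congrFun (congrArg Prod.fst g1) i
      have h6 := congrFun (congrArg Prod.snd g1) i
      simp only [systemMap, h4, zero_smul, add_zero] at h6
      exact totalMap_eq_zero hα m hm hb hε g2 i h5 h6
  -- All velocities vanish, so there is at most one vortex and no interaction. The multiplier
  -- degenerates, but the undisturbed disc with unchanged parameters is an exact solution for every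
  -- `ε`.
  · push Not at hv
    have := velocity_eq_zero_imp hmove heq hv
    refine ⟨fun _ => 0, fun _ => lam.first S, contDiffAt_const, rfl, rfl,
      Eventually.of_forall fun ε => ?_⟩
    rw [e]
    refine ⟨fun i => ⟨?_, fun j hj => absurd (Subsingleton.elim j i) hj⟩, fun i => ?_⟩
    · change ‖coreSize α (b i) ε • selfPert hα m (coreSize α (b i) ε) 0‖ < 1
      rw [selfPert_profile_zero, smul_zero, norm_zero]
      exact one_pos
    · rw [totalMap_profile_zero, hv, Finset.sum_eq_zero fun j hj =>
        absurd (Subsingleton.elim j i) (Finset.ne_of_mem_erase hj)]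
      simp [perpElt]

/-! ### First order expansion -/

/-- The unit circle. -/
def circle (m : ℕ) : Loop m := (cosElt m, sinElt m, -sinElt m, cosElt m)

/-- `K Im (d² exp (-2 i x))` as an element of the Wiener algebra. -/
def secondMode (m : ℕ) (K : ℝ) (d : ℂ) : Wiener m :=
  single (-2) (-Complex.I * K * d ^ 2 / 2) + single 2 (Complex.I * K * starRingEnd ℂ (d ^ 2) / 2)

theorem value_secondMode (m : ℕ) (K : ℝ) (d : ℂ) (x : ℝ) : (secondMode m K d).value x =
    ((2 * K * (d.re * Real.cos x + d.im * Real.sin x) *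
      (d.im * Real.cos x - d.re * Real.sin x) : ℝ) : ℂ) := by
  rw [secondMode, value_add, value_single, value_single]
  have e1 : Complex.exp (Complex.I * (-2 : ℤ) * x) =
      ((Real.cos x : ℝ) - (Real.sin x : ℝ) * Complex.I) ^ 2 := by
    rw [Complex.ofReal_cos, Complex.ofReal_sin, ← Complex.cos_neg, ← neg_neg (Complex.sin x),
      ← Complex.sin_neg, neg_mul, sub_neg_eq_add, ← Complex.exp_mul_I, ← Complex.exp_nat_mul]
    congr 1; push_cast; ring
  have e2 : Complex.exp (Complex.I * (2 : ℤ) * x) =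
      ((Real.cos x : ℝ) + (Real.sin x : ℝ) * Complex.I) ^ 2 := by
    rw [Complex.ofReal_cos, Complex.ofReal_sin, ← Complex.exp_mul_I, ← Complex.exp_nat_mul]
    congr 1; push_cast; ring
  rw [e1, e2, map_pow]
  apply Complex.ext
  · simp only [sq, Complex.add_re, Complex.mul_re, Complex.mul_im, Complex.sub_re, Complex.sub_im,
      Complex.add_im, Complex.neg_re, Complex.neg_im, Complex.I_re, Complex.I_im, Complex.ofReal_re,
      Complex.ofReal_im, Complex.conj_re, Complex.conj_im, Complex.div_ofNat_re,
      Complex.div_ofNat_im]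
    ring
  · simp only [sq, Complex.add_re, Complex.mul_re, Complex.mul_im, Complex.sub_re, Complex.sub_im,
      Complex.add_im, Complex.neg_re, Complex.neg_im, Complex.I_re, Complex.I_im, Complex.ofReal_re,
      Complex.ofReal_im, Complex.conj_re, Complex.conj_im, Complex.div_ofNat_re,
      Complex.div_ofNat_im]
    ring

/-- Only the index zero of a profile, that is the mode `n = 2`, is hit. The factor `3 ^ m` is the
weight `(1 + n) ^ m` there. -/
theorem highModes_secondMode (m : ℕ) (K : ℝ) (d : ℂ) :
    highModes m (secondMode m K d) = lp.single 1 0 (((-(3 ^ m * K) : ℝ) : ℂ) * d ^ 2) := by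
  refine lp.ext (funext fun k => ?_)
  rw [highModes_apply, secondMode, coeff_add, coeff_single, coeff_single, lp.coeFn_single]
  rcases k with _ | k
  · norm_num [Complex.conj_ofNat]
    linear_combination (-(3 ^ m * K * d ^ 2) : ℂ) * Complex.I_sq
  · rw [if_neg (by push_cast; omega), if_neg (by push_cast; omega), Pi.single_eq_of_ne (by omega)]
    simp

/-- The derivative of the interaction of two discs with respect to their size. -/
theorem hasDerivAt_pairMap_circle (m : ℕ) (α b b' : ℝ) {d : ℂ} (hd : d ≠ 0) :
    HasDerivAt (fun ε => pairMap α b b' ε d (circle m) (circle m))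
      (secondMode m (α * (α + 2) / 4 * b * b' * (d.re ^ 2 + d.im ^ 2) ^ (-α / 2 - 2)) d) 0 := by
  set ρ := d.re ^ 2 + d.im ^ 2 with hρ
  have hρ0 : 0 < ρ := re_sq_add_im_sq_pos hd
  set β := -α / 2 with hβ
  set X : Family m := b • constFamily m (cosElt m) - b' • valueFamily m (cosElt m) with hX
  set Y : Family m := b • constFamily m (sinElt m) - b' • valueFamily m (sinElt m) with hY
  set P₀ : Family m := (2 * d.re) • X + (2 * d.im) • Y with hP₀
  set P₁ : Family m := X ^ 2 + Y ^ 2 with hP₁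
  have hpert : HasDerivAt (fun ε => pairPert b b' ε d (circle m) (circle m)) P₁ 0 := by
    have : HasDerivAt (fun ε : ℝ => P₀ + ε • P₁) ((1 : ℝ) • P₁) 0 :=
      ((hasDerivAt_id (0 : ℝ)).smul_const P₁).const_add P₀
    rw [one_smul] at this
    exact this
  have hpert0 : pairPert b b' 0 d (circle m) (circle m) = P₀ := by
    change P₀ + (0 : ℝ) • P₁ = P₀
    rw [zero_smul, add_zero]
  have hu : HasDerivAt (fun ε => (ε / ρ) • pairPert b b' ε d (circle m) (circle m))
      ((1 / ρ) • P₀) 0 := by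
    have h := ((hasDerivAt_id (0 : ℝ)).div_const ρ).smul hpert
    simp only [id, zero_div, zero_smul, zero_add, hpert0] at h
    exact h
  have hu0 : ((0 : ℝ) / ρ) • pairPert b b' 0 d (circle m) (circle m) = 0 := by
    rw [zero_div, zero_smul]
  have hq : HasDerivAt (fun ε => powQuot β ((ε / ρ) • pairPert b b' ε d (circle m) (circle m)))
      ((β * (β - 1) / 2) • ((1 / ρ) • P₀)) 0 := by
    have h1 := hasFDerivAt_powQuot_zero (𝔸 := Family m) β
    rw [← hu0] at h1
    exact h1.comp_hasDerivAt (0 : ℝ) hu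
  have hprod := hpert.mul hq
  rw [hpert0, zero_div, zero_smul, powQuot_zero] at hprod
  set M := meanFamily m (fun _ => 1) intervalIntegrable_one with hM
  have hfin : HasDerivAt (fun ε => pairMap α b b' ε d (circle m) (circle m))
      (ρ ^ (β - 1) • M (pairCross (circle m) (circle m) * (P₁ * β • 1 +
        P₀ * (β * (β - 1) / 2) • (1 / ρ) • P₀))) 0 :=
    (M.hasFDerivAt.comp_hasDerivAt (0 : ℝ) (hprod.const_mul _)).const_smul (ρ ^ (β - 1))
  refine hfin.congr_deriv (value_injective fun x => ?_)
  set c := Real.cos x with hc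
  set s := Real.sin x with hs
  set κ := β * (β - 1) / 2 / ρ with hκ
  have hX' : ∀ τ : Angle, evalFamily τ x X = ((b * c - b' * Real.cos τ : ℝ) : ℂ) := fun τ => by
    simp only [hX, map_sub, map_smul, eval_constFamily, eval_valueFamily, value_cosElt,
      Complex.real_smul, Complex.ofReal_re, hc, Complex.ofReal_sub, Complex.ofReal_mul]
  have hY' : ∀ τ : Angle, evalFamily τ x Y = ((b * s - b' * Real.sin τ : ℝ) : ℂ) := fun τ => by
    simp only [hY, map_sub, map_smul, eval_constFamily, eval_valueFamily, value_sinElt,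
      Complex.real_smul, Complex.ofReal_re, hs, Complex.ofReal_sub, Complex.ofReal_mul]
  have hC' : ∀ τ : Angle, evalFamily τ x (pairCross (circle m) (circle m)) =
      ((s * Real.cos τ - c * Real.sin τ : ℝ) : ℂ) := fun τ => by
    simp only [pairCross, circle, map_sub, map_mul, map_neg, eval_constFamily, eval_valueFamily,
      value_cosElt, value_sinElt, Complex.ofReal_re, hc, hs, Complex.ofReal_sub, Complex.ofReal_mul]
    ring
  set g : ℝ → ℝ := fun y => (s * Real.cos y - c * Real.sin y) *
    (((b * c - b' * Real.cos y) ^ 2 + (b * s - b' * Real.sin y) ^ 2) * β +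
      κ * (2 * d.re * (b * c - b' * Real.cos y) + 2 * d.im * (b * s - b' * Real.sin y)) ^ 2) with hg
  have he : ∀ τ : Angle, evalFamily τ x (pairCross (circle m) (circle m) * (P₁ * β • 1 +
        P₀ * (β * (β - 1) / 2) • (1 / ρ) • P₀)) = ((g τ : ℝ) : ℂ) := fun τ => by
    simp only [hP₁, hP₀, map_add, map_mul, map_smul, map_pow, map_one, hX', hY', hC',
      Complex.real_smul, hg, hκ]
    push_cast; ring
  simp only [evalFamily_apply] at he
  rw [value_smul, value_meanFamily _ _ x g he, value_secondMode, ← Complex.ofReal_mul]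
  congr 1
  set A := b * (d.re * c + d.im * s) with hA
  set K₁ := β * (b ^ 2 + b' ^ 2) + 4 * κ * A ^ 2 with hK₁
  set k₂ := -2 * β * b * b' with hk₂
  set k₃ := -8 * κ * A * b' with hk₃
  set k₄ := 4 * κ * b' ^ 2 with hk₄
  -- The coefficients of the integrand as a trigonometric polynomial of degree three in `y`. Only
  -- the cross term `k₃` of the squared linear part contributes to the mean.
  have hmean := mean_trig (k₃ * (s * d.re - c * d.im) / 2)
    (s * K₁ + k₄ * (3 * (s * d.re ^ 2) + (s * d.im ^ 2 - 2 * c * d.re * d.im)) / 4)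
    (-(c * K₁) + k₄ * ((2 * s * d.re * d.im - c * d.re ^ 2) + 3 * (-(c * d.im ^ 2))) / 4)
    ((k₂ * (s * c + c * s) + k₃ * (s * d.re + c * d.im)) / 2)
    ((k₂ * (s * s - c * c) + k₃ * (s * d.im - c * d.re)) / 2)
    (k₄ * ((s * d.re ^ 2) - (s * d.im ^ 2 - 2 * c * d.re * d.im)) / 4)
    (k₄ * ((2 * s * d.re * d.im - c * d.re ^ 2) + c * d.im ^ 2) / 4)
  have hgm : mean (fun τ => 1 * g τ) = k₃ * (s * d.re - c * d.im) / 2 := by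
    rw [← hmean]
    refine mean_congr fun y _ => ?_
    have h1 := Real.sin_sq_add_cos_sq y
    have h2 := Real.sin_sq_add_cos_sq x
    rw [← hs, ← hc] at h2
    rw [Real.cos_two_mul, Real.sin_two_mul, Real.cos_three_mul, Real.sin_three_mul]
    simp only [hg, hK₁, hk₂, hk₃, hk₄, hA]
    linear_combination (β * b ^ 2 * (s * Real.cos y - c * Real.sin y)) * h2 +
      (β * b' ^ 2 * (s * Real.cos y - c * Real.sin y) + k₂ * (-(c * s)) + k₃ * (-(c * d.im)) +
        k₄ * ((2 * s * d.re * d.im - c * d.re ^ 2) * Real.sin y +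
          (s * d.im ^ 2 - 2 * c * d.re * d.im) * Real.cos y)) * h1
  rw [hgm, hk₃, hκ, hA, show -α / 2 - 2 = β - 1 - 1 by rw [hβ]; ring,
    Real.rpow_sub_one hρ0.ne' (β - 1), hβ]
  field_simp
  ring

section FirstOrder

variable {α : ℝ} (hα : α ∈ Ioo (1 : ℝ) 2) (m : ℕ) {N : ℕ} {b : Fin N → ℝ} {lam : Params N}
  {S : Finset (Component N)}

theorem hasDerivAt_totalMap_profile_zero (hl : Function.Injective lam.pos) (i : Fin N) :
    HasDerivAt (fun ε => totalMap hα m b ε 0 lam i)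
      (∑ j ∈ Finset.univ.erase i, (kernelConst α * lam.strength j / b j) •
        secondMode m (α * (α + 2) / 4 * b i * b j *
          ((lam.pos i - lam.pos j).re ^ 2 + (lam.pos i - lam.pos j).im ^ 2) ^ (-α / 2 - 2))
          (lam.pos i - lam.pos j)) 0 := by
  simp only [totalMap_profile_zero]
  refine HasDerivAt.const_add _ (HasDerivAt.fun_sum fun j hj => HasDerivAt.fun_const_smul _ ?_)
  exact hasDerivAt_pairMap_circle m α (b i) (b j)
    (sub_ne_zero.2 fun h => (Finset.ne_of_mem_erase hj) (hl h).symm)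

/-- At `ε = 0` the high modes are the strength times a linear function of the profile. Along a ray
from the base point the variation of the parameters thus enters only at second order. -/
theorem hasDerivAt_highModes_totalMap_zero (hb : ∀ i, 0 < b i) (heq : IsVortexEquilibrium α lam)
    (a : Fin N → Profile) (ν : S → ℝ) (i : Fin N) :
    HasDerivAt (fun s : ℝ =>
        highModes m (totalMap hα m b 0 (s • a) (lam.replace S (lam.first S + s • ν)) i))
      ((kernelConst α * lam.strength i) • diagLin hα m (a i)) 0 := by
  set γ : ℝ → ℝ := fun s => (lam.replace S (lam.first S + s • ν)).strength i with hγ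
  have hγ0 : γ 0 = lam.strength i := by
    simp only [hγ, zero_smul, add_zero, lam.replace_first]
  have hcurve : ContDiff ℝ 1 fun s : ℝ => lam.first S + s • ν :=
    contDiff_const.add (contDiff_id.smul contDiff_const)
  have hγd : HasDerivAt γ (deriv γ 0) 0 :=
    ((((lam.contDiff_replace S (Component.strength i)).comp hcurve).differentiable
      one_ne_zero).differentiableAt).hasDerivAt
  have h1 : HasDerivAt (fun s : ℝ => (kernelConst α * (γ s * s)) • diagLin hα m (a i))
      ((kernelConst α * lam.strength i) • diagLin hα m (a i)) 0 := by
    have h := (((hγd.mul (hasDerivAt_id (0 : ℝ))).const_mul (kernelConst α)).smul_const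
      (diagLin hα m (a i)))
    simp only [id, mul_zero, zero_add, mul_one, hγ0] at h
    exact h
  refine h1.congr_of_eventuallyEq ?_
  have hc : Tendsto (fun s : ℝ => ((0 : ℝ), s • a, lam.first S + s • ν, (0 : ℝ))) (𝓝 0)
      (𝓝 (basePoint lam S)) := by
    have : Continuous fun s : ℝ => ((0 : ℝ), s • a, lam.first S + s • ν, (0 : ℝ)) := by fun_prop
    have h := this.tendsto 0
    simpa only [zero_smul, add_zero, basePoint] using h
  filter_upwards [hc.eventually (eventually_injective hα heq)] with s hs
  rw [highModes_totalMap_zero hα m hb _ hs, Pi.smul_apply, map_smul, smul_smul]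
  congr 1
  simp only [hγ]; ring

/-- The equation is differentiated along the curve at `ε = 0`. The high modes of the result relate
`diagLin` of the derivative of the profile to the first order interaction of undisturbed discs; the
derivative of the parameters drops out. -/
theorem diagLin_deriv_profile (hb : ∀ i, 0 < b i) (heq : IsVortexEquilibrium α lam)
    {A : ℝ → Fin N → Profile} {μ : ℝ → S → ℝ} {A' : Fin N → Profile} {μ' : S → ℝ}
    (hA : HasDerivAt A A' 0) (hμ : HasDerivAt μ μ' 0) (hA0 : A 0 = 0) (hμ0 : μ 0 = lam.first S)
    (hsol : ∀ᶠ ε in 𝓝 0, ∀ i, totalMap hα m b ε (A ε) (lam.replace S (μ ε)) i = 0) (i : Fin N) :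
    (kernelConst α * lam.strength i) • diagLin hα m (A' i) =
      lp.single 1 0 (∑ j ∈ Finset.univ.erase i, ((kernelConst α * lam.strength j / b j *
        (3 ^ m * (α * (α + 2) / 4 * b i * b j *
          ((lam.pos i - lam.pos j).re ^ 2 + (lam.pos i - lam.pos j).im ^ 2) ^ (-α / 2 - 2))) : ℝ)
          : ℂ) * (lam.pos i - lam.pos j) ^ 2) := by
  have e : lam.replace S (lam.first S) = lam := lam.replace_first S
  set G : ℝ × (Fin N → Profile) × (S → ℝ) × ℝ → Wiener m := fun q =>
    totalMap hα m b q.1 q.2.1 (lam.replace S q.2.2.1) i with hG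
  have hGd : HasFDerivAt G (fderiv ℝ G (basePoint lam S)) (basePoint lam S) :=
    ((contDiffAt_totalMap_replace hα m (totalSmall_basePoint hα m heq) i).differentiableAt
      one_ne_zero).hasFDerivAt
  set D := fderiv ℝ G (basePoint lam S) with hD
  have h1 : D (1, A', μ', 0) = 0 := by
    have hc : HasDerivAt (fun ε : ℝ => (ε, A ε, μ ε, (0 : ℝ))) (1, A', μ', 0) 0 :=
      (hasDerivAt_id 0).prodMk (hA.prodMk (hμ.prodMk (hasDerivAt_const _ _)))
    have hp : basePoint lam S = (fun ε : ℝ => (ε, A ε, μ ε, (0 : ℝ))) 0 := by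
      simp only [basePoint, hA0, hμ0]
    rw [hp] at hGd
    have h := hGd.comp_hasDerivAt (0 : ℝ) hc
    refine h.unique ((hasDerivAt_const (0 : ℝ) (0 : Wiener m)).congr_of_eventuallyEq ?_)
    filter_upwards [hsol] with ε hε using hε i
  have h2 : HasDerivAt (fun ε => totalMap hα m b ε 0 lam i) (D (1, 0, 0, 0)) 0 := by
    have hc : HasDerivAt (fun ε : ℝ => (ε, (0 : Fin N → Profile), lam.first S, (0 : ℝ)))
        (1, 0, 0, 0) 0 :=
      (hasDerivAt_id 0).prodMk ((hasDerivAt_const _ _).prodMk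
        ((hasDerivAt_const _ _).prodMk (hasDerivAt_const _ _)))
    have h := HasFDerivAt.comp_hasDerivAt (f := fun ε : ℝ =>
      (ε, (0 : Fin N → Profile), lam.first S, (0 : ℝ))) (0 : ℝ) hGd hc
    have e' : G ∘ (fun ε : ℝ => (ε, (0 : Fin N → Profile), lam.first S, (0 : ℝ))) =
        fun ε => totalMap hα m b ε 0 lam i := by
      funext ε
      simp only [hG, Function.comp_apply, e]
    rwa [e'] at h
  have h3 : highModes m (D (0, A', μ', 0)) =
      (kernelConst α * lam.strength i) • diagLin hα m (A' i) := by
    have hc : HasDerivAt (fun s : ℝ => ((0 : ℝ), s • A', lam.first S + s • μ', (0 : ℝ)))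
        (0, A', μ', 0) 0 := by
      refine (hasDerivAt_const _ _).prodMk (HasDerivAt.prodMk ?_ (HasDerivAt.prodMk ?_
        (hasDerivAt_const _ _)))
      · simpa using (hasDerivAt_id (0 : ℝ)).smul_const A'
      · simpa using ((hasDerivAt_id (0 : ℝ)).smul_const μ').const_add (lam.first S)
    have hp : basePoint lam S = (fun s : ℝ => ((0 : ℝ), s • A', lam.first S + s • μ', (0 : ℝ))) 0 := by
      simp only [basePoint, zero_smul, add_zero]
    rw [hp] at hGd
    have h := (highModes m).hasFDerivAt.comp_hasDerivAt (0 : ℝ) (hGd.comp_hasDerivAt (0 : ℝ) hc)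
    exact h.unique (hasDerivAt_highModes_totalMap_zero hα m hb heq A' μ' i)
  -- The tangent vector is split into the direction of `ε` alone, with discs and fixed parameters,
  -- and the directions inside the slice `ε = 0`.
  have hsplit : ((1 : ℝ), A', μ', (0 : ℝ)) = (1, 0, 0, 0) + (0, A', μ', 0) := by simp
  rw [hsplit, map_add] at h1
  have h4 := congrArg (highModes m) h1
  rw [map_add, h3, map_zero] at h4
  rw [eq_neg_of_add_eq_zero_right h4,
    h2.unique (hasDerivAt_totalMap_profile_zero (b := b) hα m heq.pos_injective i), map_sum, ← Finset.sum_neg_distrib,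
    ← lp.singleAddMonoidHom_apply, map_sum]
  refine Finset.sum_congr rfl fun j _ => ?_
  rw [map_smul, highModes_secondMode, lp.singleAddMonoidHom_apply, ← lp.single_smul, ← lp.single_neg,
    Complex.real_smul]
  congr 1
  push_cast; ring

/-- The first order term of the solution curve. -/
theorem fnR_deriv_profile (hb : ∀ i, 0 < b i) (heq : IsVortexEquilibrium α lam)
    {A : ℝ → Fin N → Profile} {μ : ℝ → S → ℝ} {A' : Fin N → Profile} {μ' : S → ℝ}
    (hA : HasDerivAt A A' 0) (hμ : HasDerivAt μ μ' 0) (hA0 : A 0 = 0) (hμ0 : μ 0 = lam.first S)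
    (hsol : ∀ᶠ ε in 𝓝 0, ∀ i, totalMap hα m b ε (A ε) (lam.replace S (μ ε)) i = 0) (i : Fin N)
    (x : ℝ) : fnR α m (A' i) x = firstOrderProfile α b lam i x := by
  have h := diagLin_deriv_profile hα m hb heq hA hμ hA0 hμ0 hsol i
  have hC := (kernelConst_pos hα).ne'
  have hγ := heq.strength_ne_zero i
  have hL := (linSymbol_pos hα 0).ne'
  have hLk := fun k => (linSymbol_pos hα k).ne'
  have hΞ := linSymbol_two hα
  have hcoeff : ∀ k, (kernelConst α * lam.strength i * (linSymbol α (k + 2) *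
      (((k + 2 : ℕ) : ℝ) ^ α)⁻¹)) • A' i k = _ := fun k => by
    have h' := congrArg (fun v : Profile => v k) h
    simp only [lp.coeFn_smul, Pi.smul_apply, diagLin_apply, smul_smul, lp.coeFn_single] at h'
    exact h'
  set c : ℂ := ((profileConst α / 4 * b i : ℝ) : ℂ) * ∑ j ∈ Finset.univ.erase i,
    ((lam.strength j / lam.strength i / ‖lam.pos j - lam.pos i‖ ^ (α + 4) : ℝ) : ℂ) *
      (lam.pos j - lam.pos i) ^ 2 with hc
  have h2 : realCoeff α m (A' i) 2 = c := by
    have h0 := hcoeff 0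
    rw [Pi.single_eq_same] at h0
    rw [realCoeff, if_neg (by norm_num), profileWeight, Nat.sub_self]
    have hpow : ((2 : ℕ) : ℝ) ^ α ≠ 0 := by positivity
    have hfac : kernelConst α * lam.strength i * (linSymbol α (0 + 2) *
        (((0 + 2 : ℕ) : ℝ) ^ α)⁻¹) ≠ 0 := by
      have : ((0 + 2 : ℕ) : ℝ) ^ α ≠ 0 := by positivity
      positivity
    have h0' := congrArg (fun z : ℂ => (kernelConst α * lam.strength i * (linSymbol α (0 + 2) *
        (((0 + 2 : ℕ) : ℝ) ^ α)⁻¹))⁻¹ • z) h0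
    simp only [inv_smul_smul₀ hfac] at h0'
    rw [h0', hc, smul_smul, Finset.smul_sum, Finset.mul_sum]
    refine Finset.sum_congr rfl fun j hj => ?_
    have hne : lam.pos i - lam.pos j ≠ 0 :=
      sub_ne_zero.2 fun h => (Finset.ne_of_mem_erase hj) (heq.pos_injective h).symm
    rw [re_sq_add_im_sq_rpow, norm_sub_rev (lam.pos j), ← neg_sub (lam.pos i), neg_sq,
      show 2 * (-α / 2 - 2) = -(α + 4) by ring, Real.rpow_neg (norm_nonneg _), Complex.real_smul,
      ← mul_assoc (Complex.ofReal _), ← mul_assoc (Complex.ofReal _), ← Complex.ofReal_mul,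
      ← Complex.ofReal_mul]
    congr 2
    have hbj := (hb j).ne'
    have hn : ‖lam.pos i - lam.pos j‖ ^ (α + 4) ≠ 0 :=
      (Real.rpow_pos_of_pos (norm_pos_iff.2 hne) _).ne'
    rw [zero_add, ← hΞ]
    push_cast
    push_cast at hpow
    rw [zero_add] at hL
    field_simp
    norm_num
    exact Or.inl (Or.inl (mul_comm _ _))
  have hk : ∀ n, n ≠ 2 → realCoeff α m (A' i) n = 0 := by
    intro n hn
    rw [realCoeff]
    split_ifs with hlt
    · rfl
    · obtain ⟨k, rfl⟩ := Nat.exists_eq_add_of_le' (not_lt.1 hlt)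
      have h0 := hcoeff k
      rw [Pi.single_eq_of_ne (by omega)] at h0
      have : ((k + 2 : ℕ) : ℝ) ^ α ≠ 0 := by positivity
      rw [Nat.add_sub_cancel, (smul_eq_zero.1 h0).resolve_left ?_, smul_zero]
      exact mul_ne_zero (mul_ne_zero hC hγ) (mul_ne_zero (hLk k) (inv_ne_zero this))
  rw [fnR, tsum_eq_single 2 fun n hn => by rw [hk n hn]; simp, h2]
  have hu : unitVec x ^ 2 = ⟨Real.cos (2 * x), Real.sin (2 * x)⟩ := by
    apply Complex.ext
    · simp only [unitVec, sq, Complex.mul_re]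
      rw [Real.cos_two_mul]; nlinarith [Real.sin_sq_add_cos_sq x]
    · simp only [unitVec, sq, Complex.mul_im]
      rw [Real.sin_two_mul]; ring
  rw [firstOrderProfile, hu, hc, Complex.re_ofReal_mul, Complex.im_ofReal_mul, Complex.re_sum,
    Complex.im_sum, Finset.mul_sum, Finset.mul_sum, Finset.sum_mul, Finset.sum_mul, Finset.mul_sum,
    ← Finset.sum_add_distrib]
  refine Finset.sum_congr rfl fun j _ => ?_
  rw [Complex.re_ofReal_mul, Complex.im_ofReal_mul, Complex.mul_re, Complex.conj_re,
    Complex.conj_im]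
  push_cast
  ring

end FirstOrder

/-! ### Convexity and disjointness of the patches -/

section Convexity

/-- A solution of `D'' + D > 0` with vanishing Cauchy data is positive on `(0, π]`. -/
theorem pos_of_add_deriv_pos {D D' D'' : ℝ → ℝ} (h1 : ∀ x, HasDerivAt D (D' x) x)
    (h2 : ∀ x, HasDerivAt D' (D'' x) x) (h : ∀ x, 0 < D x + D'' x) (h0 : D 0 = 0) (h0' : D' 0 = 0)
    {t : ℝ} (ht : t ∈ Ioc 0 Real.pi) : 0 < D t := by
  -- The Wronskian of `D` with `s ↦ sin (t - s)`. It vanishes at `s = 0`, equals `D t` at `s = t`,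
  -- and increases because `sin (t - s) > 0` for `0 < s < t ≤ π`.
  have hW : ∀ s, HasDerivAt (fun s => D' s * Real.sin (t - s) + D s * Real.cos (t - s))
      ((D s + D'' s) * Real.sin (t - s)) s := by
    intro s
    have hs : HasDerivAt (fun s => t - s) (-1) s := by simpa using (hasDerivAt_id s).const_sub t
    refine (((h2 s).mul hs.sin).add ((h1 s).mul hs.cos)).congr_deriv ?_
    ring
  have hmono : StrictMonoOn (fun s => D' s * Real.sin (t - s) + D s * Real.cos (t - s))
      (Icc 0 t) := by
    refine strictMonoOn_of_deriv_pos (convex_Icc 0 t)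
      (fun s _ => (hW s).continuousAt.continuousWithinAt) fun s hs => ?_
    rw [interior_Icc] at hs
    rw [(hW s).deriv]
    exact mul_pos (h s) (Real.sin_pos_of_pos_of_lt_pi (by linarith [hs.2])
      (by linarith [hs.1, ht.2]))
  have := hmono (left_mem_Icc.2 ht.1.le) (right_mem_Icc.2 ht.1.le) ht.1
  simpa [h0, h0'] using this

variable {v v' v'' : ℝ → ℝ}

/-- The difference of `v` and the solution of `u'' + u = 0` with the same value and slope at `θ` has
vanishing Cauchy data. For `v = 1 / R` that solution is the tangent line in polar form, so the curve
stays strictly on one side of it. -/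
theorem tangent_lt_of_mem_Ioc (h1 : ∀ x, HasDerivAt v (v' x) x)
    (h2 : ∀ x, HasDerivAt v' (v'' x) x) (h : ∀ x, 0 < v x + v'' x) (θ : ℝ) {t : ℝ}
    (ht : t ∈ Ioc 0 Real.pi) : v θ * Real.cos t + v' θ * Real.sin t < v (θ + t) := by
  have key := pos_of_add_deriv_pos
    (D := fun t => v (θ + t) - v θ * Real.cos t - v' θ * Real.sin t)
    (D' := fun t => v' (θ + t) + v θ * Real.sin t - v' θ * Real.cos t)
    (D'' := fun t => v'' (θ + t) + v θ * Real.cos t + v' θ * Real.sin t)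
    (fun x => ?_) (fun x => ?_) (fun x => ?_) (by simp) (by simp) ht
  · linarith
  · have hs : HasDerivAt (fun s => θ + s) 1 x := by simpa using (hasDerivAt_id x).const_add θ
    refine ((((h1 (θ + x)).comp x hs).sub ((Real.hasDerivAt_cos x).const_mul (v θ))).sub
      ((Real.hasDerivAt_sin x).const_mul (v' θ))).congr_deriv ?_
    ring
  · have hs : HasDerivAt (fun s => θ + s) 1 x := by simpa using (hasDerivAt_id x).const_add θ
    refine ((((h2 (θ + x)).comp x hs).add ((Real.hasDerivAt_sin x).const_mul (v θ))).sub
      ((Real.hasDerivAt_cos x).const_mul (v' θ))).congr_deriv ?_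
    ring
  · have := h (θ + x)
    linarith

theorem tangent_lt (h1 : ∀ x, HasDerivAt v (v' x) x)
    (h2 : ∀ x, HasDerivAt v' (v'' x) x) (h : ∀ x, 0 < v x + v'' x) (θ : ℝ) {t : ℝ}
    (ht : t ∈ Ioc (-Real.pi) Real.pi) (ht0 : t ≠ 0) :
    v θ * Real.cos t + v' θ * Real.sin t < v (θ + t) := by
  rcases lt_or_gt_of_ne ht0 with h0 | h0
  · have hn : ∀ x : ℝ, HasDerivAt (fun s => -s) (-1) x := fun x => hasDerivAt_neg x
    have key := tangent_lt_of_mem_Ioc (v := fun x => v (-x)) (v' := fun x => -v' (-x))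
      (v'' := fun x => v'' (-x)) (fun x => ?_) (fun x => ?_) (fun x => h (-x)) (-θ)
      (t := -t) ⟨by linarith, by linarith [ht.1]⟩
    · simp only [neg_neg, Real.cos_neg, Real.sin_neg, neg_add] at key
      linarith
    · exact ((h1 (-x)).comp x (hn x)).congr_deriv (by ring)
    · exact ((h2 (-x)).comp x (hn x)).neg.congr_deriv (by ring)
  · exact tangent_lt_of_mem_Ioc h1 h2 h θ ⟨h0, ht.2⟩

theorem unitVec_periodic (θ : ℝ) (n : ℤ) : unitVec (θ + n * (2 * Real.pi)) = unitVec θ := by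
  simp only [unitVec, Real.cos_add_int_mul_two_pi, Real.sin_add_int_mul_two_pi]

/-- The angle difference is reduced to its representative in `(-π, π]`. The second alternative is
the contact point itself, reached modulo `2π`. -/
theorem tangent_le (h1 : ∀ x, HasDerivAt v (v' x) x)
    (h2 : ∀ x, HasDerivAt v' (v'' x) x) (h : ∀ x, 0 < v x + v'' x)
    (hper : Function.Periodic v (2 * Real.pi)) (θ φ : ℝ) :
    v θ * Real.cos (φ - θ) + v' θ * Real.sin (φ - θ) < v φ ∨
      v θ * Real.cos (φ - θ) + v' θ * Real.sin (φ - θ) = v φ ∧ unitVec φ = unitVec θ ∧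
        v φ = v θ := by
  set t := toIocMod Real.two_pi_pos (-Real.pi) (φ - θ) with ht
  have hmem : t ∈ Ioc (-Real.pi) Real.pi := by
    have := toIocMod_mem_Ioc Real.two_pi_pos (-Real.pi) (φ - θ)
    rwa [show -Real.pi + 2 * Real.pi = Real.pi by ring] at this
  set n := toIocDiv Real.two_pi_pos (-Real.pi) (φ - θ) with hn
  have e : φ - θ = t + n * (2 * Real.pi) := by
    rw [← zsmul_eq_mul, ht, hn, toIocMod_add_toIocDiv_zsmul]
  have e' : φ = θ + t + n * (2 * Real.pi) := by linarith
  have hv : v φ = v (θ + t) := by rw [e']; exact hper.int_mul n _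
  rw [hv, e, Real.cos_add_int_mul_two_pi, Real.sin_add_int_mul_two_pi]
  by_cases ht0 : t = 0
  · right
    refine ⟨by simp [ht0], ?_, by rw [ht0, add_zero]⟩
    rw [e', unitVec_periodic, ht0, add_zero]
  · exact Or.inl (tangent_lt h1 h2 h θ hmem ht0)

end Convexity

/-! ### Strict convexity of polar regions and disjointness of patches -/

section Region

variable {R R' R'' : ℝ → ℝ}

theorem eq_norm_mul_unitVec_arg (z : ℂ) : z = (‖z‖ : ℂ) * unitVec z.arg := by
  apply Complex.ext
  · simp [unitVec, Complex.norm_mul_cos_arg]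
  · simp [unitVec, Complex.norm_mul_sin_arg]

theorem norm_unitVec (x : ℝ) : ‖unitVec x‖ = 1 := by
  have : unitVec x = Complex.exp (x * Complex.I) := by
    rw [Complex.exp_mul_I]
    apply Complex.ext
    · simp [unitVec, ← Complex.ofReal_cos, ← Complex.ofReal_sin]
    · simp [unitVec, ← Complex.ofReal_cos, ← Complex.ofReal_sin]
  rw [this, Complex.norm_exp_ofReal_mul_I]

theorem mem_polarRegion {z : ℂ} (h : ‖z‖ ≤ R z.arg) : z ∈ polarRegion R :=
  ⟨z.arg, ‖z‖, norm_nonneg z, h, eq_norm_mul_unitVec_arg z⟩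

/-- The argument jumps across the negative axis and is continuous only modulo `2π`; periodicity lets
`R` factor through `Real.Angle`. -/
theorem continuousAt_comp_arg (hc : Continuous R) (hper : Function.Periodic R (2 * Real.pi))
    {z : ℂ} (hz : z ≠ 0) : ContinuousAt (fun z : ℂ => R z.arg) z := by
  have hl : Continuous (hper.lift : Real.Angle → ℝ) := hc.quotient_lift _
  have e : (fun z : ℂ => R z.arg) = fun z : ℂ => hper.lift (z.arg : Real.Angle) := rfl
  rw [e]
  exact hl.continuousAt.comp (Complex.continuousAt_arg_coe_angle hz)

theorem mem_interior_polarRegion (hc : Continuous R) (hper : Function.Periodic R (2 * Real.pi))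
    {r : ℝ} (hr : 0 < r) (hR : ∀ x, r ≤ R x) {z : ℂ} (hz : z ≠ 0 → ‖z‖ < R z.arg) :
    z ∈ interior (polarRegion R) := by
  rw [mem_interior_iff_mem_nhds]
  by_cases h0 : z = 0
  · subst h0
    filter_upwards [Metric.ball_mem_nhds (0 : ℂ) hr] with y hy
    exact mem_polarRegion ((mem_ball_zero_iff.1 hy).le.trans (hR _))
  · filter_upwards [continuous_norm.continuousAt.eventually_lt (continuousAt_comp_arg hc hper h0)
      (hz h0)] with y hy
    exact mem_polarRegion hy.le

/-- A polar region with positive curvature is strictly convex. -/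
theorem strictConvex_polarRegion (h1 : ∀ x, HasDerivAt R (R' x) x)
    (h2 : ∀ x, HasDerivAt R' (R'' x) x) (hper : Function.Periodic R (2 * Real.pi)) {r₀ : ℝ}
    (hr₀ : 0 < r₀) (hR : ∀ x, r₀ ≤ R x) (hcurv : ∀ x, 0 < R x ^ 2 + 2 * R' x ^ 2 - R x * R'' x) :
    StrictConvex ℝ (polarRegion R) := by
  have hpos : ∀ x, 0 < R x := fun x => hr₀.trans_le (hR x)
  -- For the reciprocal radius the curvature condition takes the simple form `v + v'' > 0`, because
  -- `v + v''` is the curvature expression divided by `R³`.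
  set v : ℝ → ℝ := fun x => (R x)⁻¹ with hv
  set v' : ℝ → ℝ := fun x => -R' x / R x ^ 2 with hv'
  set v'' : ℝ → ℝ := fun x => (-R'' x * R x ^ 2 - -R' x * (2 * R x * R' x)) / (R x ^ 2) ^ 2 with hv''
  have d1 : ∀ x, HasDerivAt v (v' x) x := fun x => (h1 x).inv (hpos x).ne'
  have d2 : ∀ x, HasDerivAt v' (v'' x) x := fun x =>
    ((h2 x).neg.div ((h1 x).pow 2) (pow_pos (hpos x) 2).ne').congr_deriv (by simp [hv''])
  have hvv : ∀ x, 0 < v x + v'' x := by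
    intro x
    have hx := hpos x
    have : v x + v'' x = (R x ^ 2 + 2 * R' x ^ 2 - R x * R'' x) / R x ^ 3 := by
      simp only [hv, hv'']; field_simp; ring
    rw [this]
    exact div_pos (hcurv x) (by positivity)
  have hvper : Function.Periodic v (2 * Real.pi) := fun x => by simp only [hv, hper x]
  have hcont : Continuous R := continuous_iff_continuousAt.2 fun x => (h1 x).continuousAt
  -- The supporting functional at the angle `θ`: it equals one on the tangent line, is at most one
  -- on the region, and attains one there only at the boundary point of angle `θ`.
  set L : ℝ → ℂ →ₗ[ℝ] ℝ := fun θ => (v θ * Real.cos θ - v' θ * Real.sin θ) • Complex.reLm +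
    (v θ * Real.sin θ + v' θ * Real.cos θ) • Complex.imLm with hL
  have hLe : ∀ θ r φ : ℝ, L θ ((r : ℂ) * unitVec φ) =
      r * (v θ * Real.cos (φ - θ) + v' θ * Real.sin (φ - θ)) := by
    intro θ r φ
    simp only [hL, LinearMap.add_apply, LinearMap.smul_apply, Complex.reLm_coe, Complex.imLm_coe,
      Complex.re_ofReal_mul, Complex.im_ofReal_mul, unitVec, smul_eq_mul, Real.cos_sub, Real.sin_sub]
    ring
  have hmem : ∀ θ, ∀ w ∈ polarRegion R, L θ w ≤ 1 ∧ (L θ w = 1 → w = (R θ : ℂ) * unitVec θ) := by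
    rintro θ w ⟨φ, r, hr, hrR, rfl⟩
    rw [hLe]
    have hrv : r * v φ ≤ 1 := by
      rw [hv]; exact (mul_inv_le_iff₀ (hpos φ)).2 (by rwa [one_mul])
    rcases tangent_le d1 d2 hvv hvper θ φ with hlt | ⟨heq, hu, hvφ⟩
    · rcases hr.eq_or_lt with rfl | hr
      · simp
      · have := (mul_lt_mul_of_pos_left hlt hr).trans_le hrv
        exact ⟨this.le, fun h => absurd h this.ne⟩
    · rw [heq]
      refine ⟨hrv, fun h => ?_⟩
      rw [hu]
      have : r = R θ := by
        rw [hvφ, hv] at h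
        field_simp [(hpos θ).ne'] at h
        exact h
      rw [this]
  intro P hP Q hQ hPQ a b ha hb hab
  refine mem_interior_polarRegion hcont hper hr₀ hR fun hM => ?_
  set M := a • P + b • Q with hMdef
  have e1 : L M.arg M = ‖M‖ * v M.arg := by
    have h := hLe M.arg ‖M‖ M.arg
    rwa [← eq_norm_mul_unitVec_arg M, sub_self, Real.cos_zero, Real.sin_zero, mul_one, mul_zero,
      add_zero] at h
  -- The two endpoints cannot both be the single contact point, so an interior point of the segment
  -- lies strictly below the supporting line. In the direction of `M` the functional is `‖M‖ / R`,
  -- so `M` is interior.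
  have e2 : L M.arg M < 1 := by
    have hP' := hmem M.arg P hP
    have hQ' := hmem M.arg Q hQ
    rw [hMdef, map_add, map_smul, map_smul, smul_eq_mul, smul_eq_mul, ← hMdef]
    by_contra hge
    have hp : L M.arg P = 1 := by nlinarith [hP'.1, hQ'.1]
    have hq : L M.arg Q = 1 := by nlinarith [hP'.1, hQ'.1]
    exact hPQ ((hP'.2 hp).trans (hQ'.2 hq).symm)
  rw [e1, hv] at e2
  exact (mul_inv_lt_iff₀ (hpos _)).1 e2 |>.trans_eq (one_mul _)

theorem norm_le_of_mem_polarRegion {r : ℝ} (hR : ∀ x, R x ≤ r) {z : ℂ} (hz : z ∈ polarRegion R) :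
    ‖z‖ ≤ r := by
  obtain ⟨x, s, hs, hsR, rfl⟩ := hz
  rw [norm_mul, norm_unitVec, mul_one, Complex.norm_real, Real.norm_of_nonneg hs]
  exact hsR.trans (hR x)

theorem disjoint_patch {b b' ε r : ℝ} {w w' : ℂ} {O O' : Set ℂ} (hO : ∀ z ∈ O, ‖z‖ ≤ r)
    (hO' : ∀ z ∈ O', ‖z‖ ≤ r) (h : |ε * b| * r + |ε * b'| * r < ‖w - w'‖) :
    Disjoint (patch b ε w O) (patch b' ε w' O') := by
  rw [Set.disjoint_left]
  rintro _ ⟨z, hz, rfl⟩ ⟨z', hz', h'⟩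
  have e : w - w' = ((ε * b' : ℝ) : ℂ) * z' - ((ε * b : ℝ) : ℂ) * z := by
    simp only at h'
    linear_combination -h'
  refine absurd h (not_lt.2 ?_)
  rw [e]
  refine (norm_sub_le _ _).trans ?_
  rw [norm_mul, norm_mul, Complex.norm_real, Complex.norm_real, Real.norm_eq_abs, Real.norm_eq_abs,
    add_comm]
  exact add_le_add (mul_le_mul_of_nonneg_left (hO z hz) (abs_nonneg _))
    (mul_le_mul_of_nonneg_left (hO' z' hz') (abs_nonneg _))

end Region

section Small

variable {α : ℝ} (hα : α ∈ Ioo (1 : ℝ) 2) {m : ℕ}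

/-- The profile `a` scaled by `s` is small in `C²`. -/
def ProfileSmall (hm : 1 ≤ m) (s : ℝ) (a : Profile) : Prop :=
  ‖s • fn hα.1.le m a‖ ≤ 1 / 4 ∧ ‖s • ddfn hα.1.le hm a‖ ≤ 1 / 4

variable {hα} {hm : 1 ≤ m} {s : ℝ} {a : Profile}

theorem ProfileSmall.abs_radR_sub_one_le (h : ProfileSmall hα hm s a) (x : ℝ) :
    |radR α m s a x - 1| ≤ 1 / 4 := by
  have h1 := norm_value_le (s • fn hα.1.le m a) x
  rw [value_smul, value_fn, ← Complex.ofReal_mul, Complex.norm_real, Real.norm_eq_abs] at h1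
  rw [radR, add_sub_cancel_left]
  exact h1.trans h.1

/-- With `R ≥ 3 / 4` and `|R''| ≤ 1 / 4` one has `R (R - R'') > 0`, and the term with `R'` only
helps. -/
theorem ProfileSmall.strictConvex (h : ProfileSmall hα hm s a) :
    StrictConvex ℝ (polarRegion (radR α m s a)) := by
  refine strictConvex_polarRegion (hasDerivAt_radR hα m s a)
    (fun x => (hasDerivAt_deriv_fnR hα.1.le hm a x).const_mul s) (radR_periodic hα m s a)
    (r₀ := 3 / 4) (by norm_num) (fun x => ?_) (fun x => ?_)
  · linarith [(abs_le.1 (h.abs_radR_sub_one_le x)).1]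
  · have h1 := abs_le.1 (h.abs_radR_sub_one_le x)
    have h2 := ((Complex.abs_re_le_norm _).trans (norm_value_le (s • ddfn hα.1.le hm a) x)).trans h.2
    rw [value_smul, Complex.re_ofReal_mul] at h2
    have h3 := abs_le.1 h2
    nlinarith [sq_nonneg (s * deriv (fnR α m a) x)]

theorem eventually_profileSmall (hα : α ∈ Ioo (1 : ℝ) 2) (hm : 1 ≤ m) {N : ℕ} {b : Fin N → ℝ}
    {A : ℝ → Fin N → Profile} (hA : ContinuousAt A 0) :
    ∀ᶠ ε in 𝓝 0, ∀ i, ProfileSmall hα hm (coreSize α (b i) ε) (A ε i) := by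
  have hs : ∀ i, ContinuousAt (fun ε => coreSize α (b i) ε) 0 := fun i =>
    (contDiff_coreSize hα (b i)).continuous.continuousAt
  have hAi : ∀ i, ContinuousAt (fun ε => A ε i) 0 := fun i =>
    (continuous_apply i).continuousAt.comp hA
  refine eventually_all.2 fun i => Eventually.and ?_ ?_
  · have hc : ContinuousAt (fun ε => ‖coreSize α (b i) ε • fn hα.1.le m (A ε i)‖) 0 :=
      ((hs i).smul ((fn hα.1.le m).continuous.continuousAt.comp (hAi i))).norm
    refine (hc.eventually_lt continuousAt_const (?_ : _ < (1 / 4 : ℝ))).mono fun _ h => h.le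
    simp [coreSize_zero]
  · have hc : ContinuousAt (fun ε => ‖coreSize α (b i) ε • ddfn hα.1.le hm (A ε i)‖) 0 :=
      ((hs i).smul ((ddfn hα.1.le hm).continuous.continuousAt.comp (hAi i))).norm
    refine (hc.eventually_lt continuousAt_const (?_ : _ < (1 / 4 : ℝ))).mono fun _ h => h.le
    simp [coreSize_zero]

theorem eventually_disjoint_patch {N : ℕ} (b : Fin N → ℝ) (r : ℝ) {l : ℝ → Params N}
    (hl : ∀ i, ContinuousAt (fun ε => (l ε).pos i) 0) (h0 : Function.Injective (l 0).pos) :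
    ∀ᶠ ε in 𝓝 0, ∀ i j, i ≠ j → |ε * b i| * r + |ε * b j| * r < ‖(l ε).pos i - (l ε).pos j‖ := by
  refine eventually_all.2 fun i => eventually_all.2 fun j => ?_
  by_cases hij : i = j
  · exact Eventually.of_forall fun _ h => absurd hij h
  have h1 : ContinuousAt (fun ε : ℝ => |ε * b i| * r + |ε * b j| * r) 0 := by fun_prop
  have h2 : ContinuousAt (fun ε : ℝ => ‖(l ε).pos i - (l ε).pos j‖) 0 := ((hl i).sub (hl j)).norm
  refine (h1.eventually_lt h2 ?_).mono fun _ h _ => h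
  simpa [sub_eq_zero] using fun h => hij (h0 h)

end Small

/-! ### Uniqueness of the branch -/

/-- Two curves which agree wherever the second one is close to the first one are equal. -/
theorem eqOn_of_eq_of_mem_isOpen {Y : Type*} [TopologicalSpace Y] [T2Space Y] {I : Set ℝ}
    (hI : IsOpen I) (hpre : IsPreconnected I) {F G : ℝ → Y} (hF : ContinuousOn F I)
    (hG : ContinuousOn G I) {x₀ : ℝ} (hx₀ : x₀ ∈ I) (h0 : G x₀ = F x₀) {O : Set (ℝ × Y)}
    (hO : IsOpen O) (hFO : ∀ x ∈ I, (x, F x) ∈ O)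
    (h : ∀ x ∈ I, (x, G x) ∈ O → G x = F x) : ∀ x ∈ I, G x = F x := by
  -- The set of agreement is open in `I`, since near such a point the second curve remains in `O`,
  -- and closed in `I` because the target is Hausdorff.
  have hsub : I ⊆ {x | x ∈ I ∧ G x = F x} := by
    refine hpre.subset_of_closure_inter_subset ?_ ⟨x₀, hx₀, hx₀, h0⟩ ?_
    · rw [isOpen_iff_mem_nhds]
      rintro x ⟨hx, hxe⟩
      have hc : ContinuousAt (fun x => (x, G x)) x :=
        continuousAt_id.prodMk (hG.continuousAt (hI.mem_nhds hx))
      have hmem : (x, G x) ∈ O := by rw [hxe]; exact hFO x hx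
      filter_upwards [hI.mem_nhds hx, hc.eventually_mem (hO.mem_nhds hmem)] with y hy hyO
      exact ⟨hy, h y hy hyO⟩
    · rintro x ⟨hx, hxI⟩
      refine ⟨hxI, ?_⟩
      have hc : Tendsto (fun x => (G x, F x)) (𝓝 x) (𝓝 (G x, F x)) :=
        (hG.continuousAt (hI.mem_nhds hxI)).prodMk (hF.continuousAt (hI.mem_nhds hxI))
      exact isClosed_diagonal.mem_of_frequently_of_tendsto
        ((mem_closure_iff_frequently.1 hx).mono fun y hy => hy.2) hc
  exact fun x hx => (hsub hx).2

section Equations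

variable {α : ℝ} (hα : α ∈ Ioo (1 : ℝ) 2) (m : ℕ) {N : ℕ} {b : Fin N → ℝ}

theorem value_totalMap_eq_contourFunctional (hb : ∀ i, 0 < b i) {ε : ℝ} {a : Fin N → Profile}
    {l : Params N} (hs : TotalSmall hα m b ε a l) (i : Fin N) (x : ℝ) :
    (totalMap hα m b ε a l i).value x =
      ((contourFunctional α b ε (fun j => fnR α m (a j)) l i x : ℝ) : ℂ) := by
  by_cases hε : ε = 0
  · subst hε
    exact value_totalMap_zero' hα m hb a hs.injective i x
  · exact value_totalMap hα m hb hε hs i x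

end Equations

/-! ### Transfer between the profiles and `X^{k+α-1}` -/

section Branch

variable {α : ℝ} (hα : α ∈ Ioo (1 : ℝ) 2) {k : ℕ} (hk : 3 ≤ k) {N : ℕ} {b : Fin N → ℝ}
  {lam : Params N} {S : Finset (Component N)}

/-- The embedding of the profiles into `(X^{k+α-1})^N`. -/
def toXs (k N : ℕ) : (Fin N → Profile) →L[ℝ] (Fin N → XSpace k α) :=
  ContinuousLinearMap.pi fun i => (toX hα k).comp (ContinuousLinearMap.proj i)

/-- The embedding of `(X^{k+α-1})^N` into the profiles. -/
def ofXs (N : ℕ) : (Fin N → XSpace k α) →L[ℝ] (Fin N → Profile) :=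
  ContinuousLinearMap.pi fun i => (ofX hα hk).comp (ContinuousLinearMap.proj i)

theorem ofXs_injective : Function.Injective (ofXs hα hk N) := fun _ _ h =>
  funext fun i => ofX_injective hα hk (congrFun h i)

/-- A solution of the functional equation solves the lifted equation. -/
theorem totalMap_ofXs_eq_zero (hb : ∀ i, 0 < b i) {ε : ℝ} {g : Fin N → XSpace k α}
    {l : Params N} (hs : TotalSmall hα 0 b ε (ofXs hα hk N g) l)
    (h : ∀ i x, contourFunctional α b ε (fun j => g j) l i x = 0) (i : Fin N) :
    totalMap hα 0 b ε (ofXs hα hk N g) l i = 0 := by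
  refine value_injective fun x => ?_
  have e : (fun j => fnR α 0 (ofXs hα hk N g j)) = fun j => ⇑(g j) :=
    funext fun j => fnR_ofX hα hk (g j)
  rw [value_totalMap_eq_contourFunctional hα 0 hb hs, e, h, Complex.ofReal_zero, value_zero]

theorem contourFunctional_toXs_eq_zero (hb : ∀ i, 0 < b i) {ε : ℝ} {a : Fin N → Profile}
    {l : Params N} (hs : TotalSmall hα k b ε a l) (h : ∀ i, totalMap hα k b ε a l i = 0)
    (i : Fin N) (x : ℝ) : contourFunctional α b ε (fun j => toXs hα k N a j) l i x = 0 := by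
  have h1 := value_totalMap_eq_contourFunctional hα k hb hs i x
  rw [h, value_zero] at h1
  exact_mod_cast h1.symm

/-- Solutions near the trivial one are determined by `ε`. -/
theorem exists_isOpen_unique (hα : α ∈ Ioo (1 : ℝ) 2) (hk : 3 ≤ k) (hb : ∀ i, 0 < b i) (heq : IsVortexEquilibrium α lam)
    (hnd : IsNondegenerate α lam S) :
    ∃ O : Set (ℝ × (Fin N → XSpace k α) × (S → ℝ)), IsOpen O ∧ (0, 0, lam.first S) ∈ O ∧
      ∀ ε y y', (ε, y) ∈ O → (ε, y') ∈ O →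
        (∀ i x, contourFunctional α b ε (fun j => y.1 j) (lam.replace S y.2) i x = 0) →
        (∀ i x, contourFunctional α b ε (fun j => y'.1 j) (lam.replace S y'.2) i x = 0) →
        y = y' := by
  -- Regularity zero is used because all of `X^{k+α-1}` embeds there, whereas it need not embed into
  -- the profiles on which the branch is constructed.
  obtain ⟨ψ, hψ⟩ := exists_unique_solution hα 0 hb heq hnd
  obtain ⟨O, hO, hOo, hO0⟩ := eventually_nhds_iff.1 hψ
  have hc : Continuous fun q : ℝ × (Fin N → XSpace k α) × (S → ℝ) =>
      (q.1, ofXs hα hk N q.2.1, q.2.2) :=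
    continuous_fst.prodMk (((ofXs hα hk N).continuous.comp continuous_snd.fst).prodMk
      continuous_snd.snd)
  refine ⟨_, hOo.preimage hc, ?_, ?_⟩
  · simpa using hO0
  · intro ε y y' hy hy' h h'
    have h1 := hO _ hy
    have h2 := hO _ hy'
    have e := (h1.2 (totalMap_ofXs_eq_zero hα hk hb h1.1 h)).trans
      (h2.2 (totalMap_ofXs_eq_zero hα hk hb h2.1 h')).symm
    rw [Prod.ext_iff] at e
    exact Prod.ext (ofXs_injective hα hk e.1) e.2

end Branch

end
end GSQG

/-! ### The branch of solutions and its properties -/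

theorem theorem4p3 (α : ℝ) (hα : α ∈ Ioo (1 : ℝ) 2) (k : ℕ) (hk : 3 ≤ k) (N : ℕ)
    (b : Fin N → ℝ) (hb : ∀ i, 0 < b i)
    (lam : GSQG.Params N) (S : Finset (GSQG.Component N))
    (heq : GSQG.IsVortexEquilibrium α lam)
    (hmove : lam.angularVelocity ≠ 0 ∨ lam.speed ≠ 0)
    (hnondeg : GSQG.IsNondegenerate α lam S) :
    ∃ ε₁ : ℝ, 0 < ε₁ ∧ ∃ (f : ℝ → Fin N → GSQG.XSpace k α) (μ : ℝ → S → ℝ),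
      GSQG.IsSolutionBranch α b lam S ε₁ f μ ∧
      (∀ δ ∈ Ioc 0 ε₁, ∀ (g : ℝ → Fin N → GSQG.XSpace k α) (ν : ℝ → S → ℝ),
        GSQG.IsSolutionBranch α b lam S δ g ν →
          ∀ ε ∈ Ioo (-δ) δ, g ε = f ε ∧ ν ε = μ ε) ∧
      ((fun ε => μ ε - lam.first S) =O[𝓝 0] fun ε : ℝ => ε) ∧
      (∃ p : Fin N → GSQG.XSpace k α,
        (∀ i x, p i x = GSQG.firstOrderProfile α b lam i x) ∧
        (fun ε => f ε - ε • p) =o[𝓝 0] fun ε : ℝ => ε) ∧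
      ∀ ε ∈ Ioo (-ε₁) ε₁, ε ≠ 0 →
        (∀ i x, 0 < GSQG.radius α (b i) ε (f ε i) x) ∧
        (∀ i, StrictConvex ℝ (GSQG.polarRegion (GSQG.radius α (b i) ε (f ε i)))) ∧
        Pairwise fun i j => Disjoint
          (GSQG.patch (b i) ε ((lam.replace S (μ ε)).pos i)
            (GSQG.polarRegion (GSQG.radius α (b i) ε (f ε i))))
          (GSQG.patch (b j) ε ((lam.replace S (μ ε)).pos j)
            (GSQG.polarRegion (GSQG.radius α (b j) ε (f ε j)))) := by
  have hk1 : 1 ≤ k := by omega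
  -- Existence is taken at regularity `m = k`, so that the profiles land in `X^{k+α-1}`.
  obtain ⟨A, μ, hcd, hA0, hμ0, hsol⟩ := GSQG.exists_profileCurve hα k hk1 hb heq hmove hnondeg
  obtain ⟨O, hOo, hO0, hO⟩ := GSQG.exists_isOpen_unique hα hk hb heq hnondeg
  set f : ℝ → Fin N → GSQG.XSpace k α := fun ε => GSQG.toXs hα k N (A ε) with hf
  have hAcd : ContDiffAt ℝ 1 A 0 := hcd.fst
  have hμcd : ContDiffAt ℝ 1 μ 0 := hcd.snd
  have hAd := (hAcd.differentiableAt one_ne_zero).hasDerivAt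
  have hμd := (hμcd.differentiableAt one_ne_zero).hasDerivAt
  have hfd : HasDerivAt f (GSQG.toXs hα k N (deriv A 0)) 0 :=
    (GSQG.toXs hα k N).hasFDerivAt.comp_hasDerivAt 0 hAd
  have hf0 : f 0 = 0 := by simp only [hf, hA0, map_zero]
  have hball : ∀ᶠ ε in 𝓝 0, ‖f ε‖ < 1 :=
    hfd.continuousAt.norm.eventually_lt continuousAt_const (by simp [hf0])
  have hmemO : ∀ᶠ ε in 𝓝 0, (ε, f ε, μ ε) ∈ O := by
    have hc : ContinuousAt (fun ε => (ε, f ε, μ ε)) 0 :=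
      continuousAt_id.prodMk (hfd.continuousAt.prodMk hμd.continuousAt)
    refine hc.eventually_mem (hOo.mem_nhds ?_)
    simpa only [hf0, hμ0] using hO0
  have hpos : ∀ i, ContinuousAt (fun ε => (lam.replace S (μ ε)).pos i) 0 := by
    intro i
    have hc : ∀ c, ContinuousAt (fun ε => lam.replace S (μ ε) c) 0 := fun c =>
      ((lam.contDiff_replace S c (n := 0)).continuous.continuousAt).comp hμd.continuousAt
    exact (Complex.equivRealProdCLM.symm.continuous.continuousAt).comp
      ((hc (GSQG.Component.posX i)).prodMk (hc (GSQG.Component.posY i)))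
  have hinj : Function.Injective (lam.replace S (μ 0)).pos := by
    rw [hμ0, lam.replace_first]; exact heq.pos_injective
  have hdiff := hcd.eventually (by simp)
  -- One radius for all local conditions at once. It includes membership in `O`, which the
  -- uniqueness argument needs along the whole branch. The radius bound `5 / 4` matches `|R - 1| ≤ 1
  -- / 4`.
  obtain ⟨ε₁, hε₁, hall⟩ := Metric.eventually_nhds_iff.1 (hdiff.and (hsol.and (hball.and (hmemO.and
    ((GSQG.eventually_profileSmall (b := b) hα hk1 hAd.continuousAt).and
      (GSQG.eventually_disjoint_patch b (5 / 4) hpos hinj))))))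
  have hall' : ∀ ε ∈ Ioo (-ε₁) ε₁, _ := fun ε hε =>
    hall (y := ε) (by rw [dist_zero_right, Real.norm_eq_abs]; exact abs_lt.2 hε)
  have hbranch : GSQG.IsSolutionBranch α b lam S ε₁ f μ := {
    contDiffOn := fun ε hε => by
      have h := (hall' ε hε).1
      exact (((GSQG.toXs hα k N).contDiff.contDiffAt.comp ε h.fst).prodMk h.snd).contDiffWithinAt
    mem_ball := fun ε hε => (hall' ε hε).2.2.1
    profile_zero := hf0
    param_zero := hμ0
    functional_eq_zero := fun ε hε =>
      GSQG.contourFunctional_toXs_eq_zero hα hb (hall' ε hε).2.1.1 (hall' ε hε).2.1.2 }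
  refine ⟨ε₁, hε₁, f, μ, hbranch, ?_, ?_, ?_, ?_⟩
  · intro δ hδ g ν hg
    have hsub : Ioo (-δ) δ ⊆ Ioo (-ε₁) ε₁ := Ioo_subset_Ioo (neg_le_neg hδ.2) hδ.2
    -- The competing branch is not assumed to stay in `O`; that it does is part of the continuation
    -- argument.
    have key := GSQG.eqOn_of_eq_of_mem_isOpen isOpen_Ioo isPreconnected_Ioo
      (F := fun ε => (f ε, μ ε)) (G := fun ε => (g ε, ν ε))
      (hbranch.contDiffOn.continuousOn.mono hsub) hg.contDiffOn.continuousOn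
      (x₀ := 0) ⟨neg_lt_zero.2 hδ.1, hδ.1⟩
      (by simp only [hf0, hμ0, hg.profile_zero, hg.param_zero]) hOo
      (fun ε hε => (hall' ε (hsub hε)).2.2.2.1)
      (fun ε hε hmem => hO ε _ _ hmem (hall' ε (hsub hε)).2.2.2.1
        (hg.functional_eq_zero ε hε) (hbranch.functional_eq_zero ε (hsub hε)))
    exact fun ε hε => Prod.ext_iff.1 (key ε hε)
  · have h := hμd.differentiableAt.isBigO_sub
    simpa only [hμ0, sub_zero] using h
  · refine ⟨GSQG.toXs hα k N (deriv A 0), fun i x => ?_, ?_⟩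
    -- The embedding `toX` keeps the Fourier coefficients, so the values of the derivative of the
    -- branch are those of `fnR`.
    · exact GSQG.fnR_deriv_profile hα k hb heq hAd hμd hA0 hμ0 (hsol.mono fun _ h => h.2) i x
    · have h := hasDerivAt_iff_isLittleO.1 hfd
      simpa only [hf0, sub_zero] using h
  · intro ε hε _
    have hsm := (hall' ε hε).2.2.2.2.1
    have hdj := (hall' ε hε).2.2.2.2.2
    have hle : ∀ i x, |GSQG.radius α (b i) ε (f ε i) x - 1| ≤ 1 / 4 := fun i x =>
      (hsm i).abs_radR_sub_one_le x
    refine ⟨fun i x => by linarith [(abs_le.1 (hle i x)).1], fun i => (hsm i).strictConvex,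
      fun i j hij => GSQG.disjoint_patch (r := 5 / 4) (fun z => ?_) (fun z => ?_) (hdj i j hij)⟩
    · exact GSQG.norm_le_of_mem_polarRegion fun x => by linarith [(abs_le.1 (hle i x)).2]
    · exact GSQG.norm_le_of_mem_polarRegion fun x => by linarith [(abs_le.1 (hle j x)).2]
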